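/- **Notation.** Put $\Delta(x_1,\dots,x_r)=\prod_{1\le i<j\le r}(x_j-x_i)$ and let $[\,\cdot\,]$ denote the integer part. Let $\zeta$ be a complex parameter and $$\xi_0=2\zeta+1,\qquad \xi_1=\frac{\zeta}{\zeta+2},\qquad \xi_2=\frac{\zeta(2\zeta+1)}{\zeta+2},\qquad \xi_3=1,$$ $$G(x,y)=(\zeta+2)xy(x+y)-\zeta(x^2+y^2)-2(\zeta^2+3\zeta+1)xy+\zeta(2\zeta+1)(x+y),$$ $$e_0(x)=\big((\zeta+2)x-\zeta\big)(2\zeta+1-3x),\qquad e_1(x)=(x-2\zeta-1)\big((\zeta+2)x-3\zeta\big).$$ For an integer $N\ge 0$ and $1\le j\le 2N$ let $$P_j(x)=x^{j-1}(x-2\zeta-1)^{[(j-1)/2]}\big((\zeta+2)x-\zeta\big)^{N-[(j+1)/2]},$$ and let $\hat\sigma P_j=e_0P_j$ if $j$ is odd, $\hat\sigma P_j=e_1P_j$ if $j$ is even. For $0\le K\le 2N$ define the polynomial $$T(x_1,\dots,x_K;x_{K+1},\dots,x_{2N})=\frac{\det_{1\le i,j\le 2N}(A_{ij})}{\Delta(x_1,\dots,x_K)\,\Delta(x_{K+1},\dots,x_{2N})},\qquad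 A_{ij}=\begin{cases}P_j(x_i),&i\le K,\\(\hat\sigma P_j)(x_i),&i>K\end{cases}$$ (with $T=1$ if $N=0$). Let $n\in\mathbb Z$ and $\mathbf k=(k_0,k_1,k_2,k_3)\in\mathbb Z^4$ be such that $m=2n-|\mathbf k|\ge 0$, where $|\mathbf k|=\sum_jk_j$. Write $k_j^+=\max(k_j,0)$, $k_j^-=\max(-k_j,0)$, and, for $\mathbf a\in\mathbb Z_{\ge0}^4$, let $\boldsymbol\xi^{\mathbf a}$ be the vector in which each $\xi_i$ is repeated $a_i$ times. Define $$T_n^{(\mathbf k)}(x_1,\dots,x_m)=\frac{(-1)^{\binom{|\mathbf k^-|}2}\,T(x_1,\dots,x_m,\boldsymbol\xi^{\mathbf k^+};\boldsymbol\xi^{\mathbf k^-})}{2^{|\mathbf k^-|}\prod_{i,j=0}^3G(\xi_i,\xi_j)^{k_i^-k_j^+}\prod_{j=1}^m\prod_{i=0}^3G(x_j,\xi_i)^{k_i^-}},$$ where the polynomial $T$ is taken with $N=n+|\mathbf k^-|$. The parameters $(n,\mathbf k)$ are said to be in regime A, B or C if, respectively, $$\text{(A)}\ \ |k_1+k_2+1|\le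 m+|k_0+k_3+1|,\qquad \text{(B)}\ \ k_1+k_2+1\le-(m+|k_0+k_3+1|),\qquad \text{(C)}\ \ k_1+k_2+1\ge m+|k_0+k_3+1|.$$ Every $(n,\mathbf k)$ is in at least one regime. Let $$L=\begin{cases}(k_1+k_2)(2n-k_1-k_2-1)&\text{in regime A},\\(k_1+k_2)(2n-k_1-k_2-1)+(n+1)(n-k_0-k_3)&\text{in regime B},\\(k_1+k_2)(2n-k_1-k_2-1)+(n+1-m)(k_1+k_2-n)&\text{in regime C}\end{cases}$$ (these expressions agree where regimes overlap). Let $J(N;a,b,c,d)$ be the subset of $\{0,1,\dots,N\}$ consisting of the $a$ smallest and $b$ largest odd elements together with the $c$ smallest and $d$ largest even elements. Let $U$ be the set of all $x\in\mathbb C^m$ such that, for every $j$, $x_j\ne0$ if $k_0<0$ or $k_3<0$, and $x_j\ne\frac12$ if $k_2<0$. Finally, $f\sim g$ means that $f=cg$ for some non-zero constant $c$ independent of the variables $x_j$ (it may depend on $n$ and $\mathbf k$). **Theorem.** The function $T_n^{(\mathbf k)}$ is exactly of order $\zeta^L$ as $\zeta\to0$: the limit $$C_n^{(\mathbf k)}(x)=\lim_{\zeta\to0}\zeta^{-L}\,T_n^{(\mathbf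 k)}(x)$$ exists for every $x\in U$, and $C_n^{(\mathbf k)}$ does not vanish identically on $U$. Moreover: * In regime A with $k_0+k_3+1\ge0$, let $N=2(n+k_1^-+k_2^-)$. Then $$C_n^{(\mathbf k)}\sim\frac1{\Delta(\mathbf x)}\prod_{j=1}^m\frac{x_j^{n-k_1-k_2-1}}{(1-x_j)^{k_0+k_3+1}(1-2x_j)^{2k_2^-}}\sum_{\lambda_1,\dots,\lambda_m=0}^N\Delta(\boldsymbol\lambda)\prod_{j=1}^m\Bigg(\binom N{\lambda_j}(1-2x_j)^{\lambda_j}\prod_{\mu\in J(N;k_2^+,k_1^+,k_2^-,k_1^-)}(\lambda_j-\mu)\Bigg).$$ * In regime A with $k_0+k_3+1\le0$, let $N=2(n+k_1^-+k_2^--k_0-k_3-1)$. Then $$C_n^{(\mathbf k)}\sim\frac1{\Delta(\mathbf x)}\prod_{j=1}^m\frac{x_j^{n+k_0+k_3-k_1-k_2}}{(1-2x_j)^{2k_2^-}}\sum_{\lambda_1,\dots,\lambda_m=0}^N\Delta(\boldsymbol\lambda)\prod_{j=1}^m\Bigg(\binom N{\lambda_j}(1-2x_j)^{\lambda_j}\big(1+2(-1)^{\lambda_j}\big)\prod_{\mu\in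 J(N;k_2^+,k_1^+,k_2^-,k_1^-)}(\lambda_j-\mu)\Bigg).$$ * In regime B, $$C_n^{(\mathbf k)}\sim\prod_{j=1}^m\frac{x_j^{k_0+k_3-k_1-k_2-1}(1-2x_j)^{2k_2+1}}{(1-x_j)^{n+1}}\prod_{1\le i<j\le m}(x_i+x_j-1).$$ * In regime C, $$C_n^{(\mathbf k)}\sim\prod_{j=1}^mx_j^{k_0+k_3}(1-x_j)^{k_1+k_2-n}\prod_{1\le i<j\le m}(x_i+x_j-1).$$ In regimes B and C the relation holds at all points of $U$; in regime A it holds at all points of $U$ whose coordinates are pairwise distinct and different from $0$ and $1$. -/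

import Mathlib

open Filter Topology

noncomputable section

namespace HyperbolicCusp

/-! ### The symmetric polynomials `T` in two groups of variables -/

/-- The polynomial `P_j` of index `N` with `1 ≤ j ≤ 2N`. It is indexed here by `i = j - 1`, so that
`[(j-1)/2] = i / 2` and `N - [(j+1)/2] = N - 1 - i / 2`. -/
def basisPoly (N : ℕ) (ζ : ℂ) (i : ℕ) : Polynomial ℂ :=
  Polynomial.X ^ i * (Polynomial.X - Polynomial.C (2 * ζ + 1)) ^ (i / 2) *
    (Polynomial.C (ζ + 2) * Polynomial.X - Polynomial.C ζ) ^ (N - 1 - i / 2)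

/-- `e_0(x) = ((ζ+2)x - ζ)(2ζ + 1 - 3x)`. -/
def e0 (ζ : ℂ) : Polynomial ℂ :=
  (Polynomial.C (ζ + 2) * Polynomial.X - Polynomial.C ζ) *
    (Polynomial.C (2 * ζ + 1) - Polynomial.C 3 * Polynomial.X)

/-- `e_1(x) = (x - 2ζ - 1)((ζ+2)x - 3ζ)`. -/
def e1 (ζ : ℂ) : Polynomial ℂ :=
  (Polynomial.X - Polynomial.C (2 * ζ + 1)) *
    (Polynomial.C (ζ + 2) * Polynomial.X - Polynomial.C (3 * ζ))

/-- The image of `P_j` under the operator `σ̂`, again indexed by `i = j - 1`: it is `e_0 P_j` for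
odd `j` and `e_1 P_j` for even `j`. -/
def sigmaBasisPoly (N : ℕ) (ζ : ℂ) (i : ℕ) : Polynomial ℂ :=
  if Even i then e0 ζ * basisPoly N ζ i else e1 ζ * basisPoly N ζ i

/-- The matrix whose first `K` rows are `P_j(x_i)` and whose other rows are `(σ̂ P_j)(x_i)`. -/
def alternantMatrix (N K : ℕ) (ζ : ℂ) :
    Matrix (Fin (2 * N)) (Fin (2 * N)) (MvPolynomial (Fin (2 * N)) ℂ) :=
  Matrix.of fun i j =>
    Polynomial.aeval (MvPolynomial.X i)
      (if (i : ℕ) < K then basisPoly N ζ j else sigmaBasisPoly N ζ j)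

/-- The pairs `i < j` of indices that lie in the same group of variables, the two groups being
the first `K` variables and the remaining ones. -/
def groupPairs (N K : ℕ) : Finset (Fin (2 * N) × Fin (2 * N)) :=
  Finset.univ.filter fun q => q.1 < q.2 ∧ ((q.1 : ℕ) < K ↔ (q.2 : ℕ) < K)

/-- `Δ(x_1, …, x_K) Δ(x_{K+1}, …, x_{2N})`, where `Δ(x) = ∏_{i<j} (x_j - x_i)`. -/
def groupDelta (N K : ℕ) : MvPolynomial (Fin (2 * N)) ℂ :=
  ∏ q ∈ groupPairs N K, (MvPolynomial.X q.2 - MvPolynomial.X q.1)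

section Divisibility

variable {σ : Type*} [DecidableEq σ]

lemma X_sub_X_dvd_iff (i j : σ) (f : MvPolynomial σ ℂ) :
    (MvPolynomial.X j - MvPolynomial.X i) ∣ f ↔
      MvPolynomial.aeval (Function.update (MvPolynomial.X : σ → MvPolynomial σ ℂ) j
        (MvPolynomial.X i)) f = 0 := by
  constructor
  · rintro ⟨g, rfl⟩
    rw [map_mul, map_sub, MvPolynomial.aeval_X, MvPolynomial.aeval_X, Function.update_self]
    by_cases h : i = j
    · subst h; simp
    · simp [Function.update_of_ne h]
  · intro h
    set I : Ideal (MvPolynomial σ ℂ) :=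
      Ideal.span {(MvPolynomial.X j - MvPolynomial.X i : MvPolynomial σ ℂ)} with hI
    have key : (Ideal.Quotient.mkₐ ℂ I).comp
        (MvPolynomial.aeval (Function.update (MvPolynomial.X : σ → MvPolynomial σ ℂ) j
          (MvPolynomial.X i))) = Ideal.Quotient.mkₐ ℂ I := by
      ext a
      simp only [AlgHom.comp_apply, MvPolynomial.aeval_X]
      by_cases ha : a = j
      · subst ha
        rw [Function.update_self]
        refine ((Ideal.Quotient.mk_eq_mk_iff_sub_mem _ _).2 ?_).symm
        exact Ideal.mem_span_singleton_self _
      · rw [Function.update_of_ne ha]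
    have h2 := DFunLike.congr_fun key f
    rw [AlgHom.comp_apply, h, map_zero] at h2
    exact Ideal.mem_span_singleton.1 (Ideal.Quotient.eq_zero_iff_mem.1 h2.symm)

lemma prime_X_sub_X {i j : σ} (hij : i ≠ j) :
    Prime (MvPolynomial.X j - MvPolynomial.X i : MvPolynomial σ ℂ) := by
  refine ⟨?_, ?_, ?_⟩
  · rw [sub_ne_zero]
    exact fun h => hij (MvPolynomial.X_injective h).symm
  · intro h
    have h1 := (X_sub_X_dvd_iff i j (1 : MvPolynomial σ ℂ)).1 h.dvd
    rw [map_one] at h1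
    exact one_ne_zero h1
  · intro a b h
    rw [X_sub_X_dvd_iff, map_mul, mul_eq_zero] at h
    rwa [X_sub_X_dvd_iff, X_sub_X_dvd_iff]

end Divisibility

/-- The determinant is divisible by the product of the two Vandermonde determinants. -/
theorem groupDelta_dvd (N K : ℕ) (ζ : ℂ) : groupDelta N K ∣ (alternantMatrix N K ζ).det := by
  unfold groupDelta
  refine Finset.prod_dvd_of_isRelPrime ?_ ?_
  · rintro ⟨i, j⟩ hp ⟨i', j'⟩ hq hne
    simp only [groupPairs, Finset.coe_filter, Finset.mem_univ, true_and, Set.mem_ofPred_eq] at hp hq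
    have hirr := (prime_X_sub_X (σ := Fin (2 * N)) hp.1.ne).irreducible
    refine (hirr.isRelPrime_iff_not_dvd).2 ?_
    intro h
    rw [X_sub_X_dvd_iff, map_sub, MvPolynomial.aeval_X, MvPolynomial.aeval_X, sub_eq_zero] at h
    simp only [Function.update_apply] at h
    apply hne
    have h1 := hp.1
    have h2 := hq.1
    split_ifs at h with ha hb hb
    · exact absurd (hb.trans ha.symm) h2.ne
    · rw [ha, MvPolynomial.X_injective h]
    · have := MvPolynomial.X_injective h
      rw [this, hb] at h2
      exact absurd h2 (not_lt.2 h1.le)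
    · exact absurd (MvPolynomial.X_injective h).symm h2.ne
  · rintro ⟨i, j⟩ hp
    simp only [groupPairs, Finset.mem_filter, Finset.mem_univ, true_and] at hp
    rw [X_sub_X_dvd_iff, AlgHom.map_det]
    refine Matrix.det_zero_of_row_eq hp.1.ne ?_
    funext l
    simp only [AlgHom.mapMatrix_apply, Matrix.map_apply, alternantMatrix, Matrix.of_apply,
      ← Polynomial.aeval_algHom_apply, MvPolynomial.aeval_X, Function.update_self,
      Function.update_of_ne hp.1.ne, hp.2]

/-- The polynomial `T(x_1, …, x_K; x_{K+1}, …, x_{2N})`: the quotient of the determinant by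
`Δ(x_1, …, x_K) Δ(x_{K+1}, …, x_{2N})`. -/
def polyT (N K : ℕ) (ζ : ℂ) : MvPolynomial (Fin (2 * N)) ℂ :=
  (groupDelta_dvd N K ζ).choose

theorem groupDelta_mul_polyT (N K : ℕ) (ζ : ℂ) :
    groupDelta N K * polyT N K ζ = (alternantMatrix N K ζ).det :=
  (groupDelta_dvd N K ζ).choose_spec.symm

/-! ### The functions `T_n^{(k)}` -/

/-- `k_i^+ = max(k_i, 0)`. -/
def posPart (k : Fin 4 → ℤ) (i : Fin 4) : ℕ := (k i).toNat

/-- `k_i^- = max(-k_i, 0)`. -/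
def negPart (k : Fin 4 → ℤ) (i : Fin 4) : ℕ := (-k i).toNat

/-- The points `ξ_0, ξ_1, ξ_2, ξ_3`. -/
def xi (ζ : ℂ) : Fin 4 → ℂ :=
  ![2 * ζ + 1, ζ / (ζ + 2), ζ * (2 * ζ + 1) / (ζ + 2), 1]

/-- The symmetric polynomial `G(x, y)`. -/
def G (ζ x y : ℂ) : ℂ :=
  (ζ + 2) * x * y * (x + y) - ζ * (x ^ 2 + y ^ 2) - 2 * (ζ ^ 2 + 3 * ζ + 1) * x * y
    + ζ * (2 * ζ + 1) * (x + y)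

/-- The list in which `ξ_i` is repeated `a_i` times, for `i = 0, 1, 2, 3`. -/
def xiList (ζ : ℂ) (a : Fin 4 → ℕ) : List ℂ :=
  List.replicate (a 0) (xi ζ 0) ++ List.replicate (a 1) (xi ζ 1) ++
    List.replicate (a 2) (xi ζ 2) ++ List.replicate (a 3) (xi ζ 3)

/-- The value `T_n^{(k)}(x_1, …, x_m)` at the parameter `ζ`, where `m = 2n - |k|`. The polynomial
`T` in the numerator has `m + |k^+|` variables in its first group and `|k^-|` variables in its
second group, hence `2(n + |k^-|)` variables in all. -/
def tnk (n : ℤ) (k : Fin 4 → ℤ) {m : ℕ} (ζ : ℂ) (x : Fin m → ℂ) : ℂ :=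
  (-1) ^ (Nat.choose (∑ i, negPart k i) 2) *
    MvPolynomial.eval
      (fun i : Fin _ => (List.ofFn x ++ xiList ζ (posPart k) ++ xiList ζ (negPart k)).getD (i : ℕ) 0)
      (polyT (n + ∑ i, (negPart k i : ℤ)).toNat (m + ∑ i, posPart k i) ζ) /
    (2 ^ (∑ i, negPart k i) *
      (∏ i, ∏ j, G ζ (xi ζ i) (xi ζ j) ^ (negPart k i * posPart k j)) *
      ∏ j, ∏ i, G ζ (x j) (xi ζ i) ^ negPart k i)

/-- The points `x` none of whose coordinates is a limit, as `ζ → 0`, of a pole of `T_n^{(k)}`. In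
each variable the poles are `η_0 = 0` if `k_0 < 0`, `η_2 = (2ζ+1)/(ζ+2) → 1/2` if `k_2 < 0`, and
`η_3 = ζ → 0` if `k_3 < 0`. -/
def regularPoints (k : Fin 4 → ℤ) (m : ℕ) : Set (Fin m → ℂ) :=
  {x | ∀ j, (k 0 < 0 ∨ k 3 < 0 → x j ≠ 0) ∧ (k 2 < 0 → x j ≠ 1 / 2)}

/-! ### The three regimes and the exponent `L` -/

def RegimeA (k : Fin 4 → ℤ) (m : ℕ) : Prop := |k 1 + k 2 + 1| ≤ m + |k 0 + k 3 + 1|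

def RegimeB (k : Fin 4 → ℤ) (m : ℕ) : Prop := k 1 + k 2 + 1 ≤ -(m + |k 0 + k 3 + 1|)

def RegimeC (k : Fin 4 → ℤ) (m : ℕ) : Prop := m + |k 0 + k 3 + 1| ≤ k 1 + k 2 + 1

open scoped Classical in
/-- The exponent `L`. Every parameter belongs to a regime, and where regimes overlap
the corresponding expressions agree, see `leadingExponent_of_regimeB` and
`leadingExponent_of_regimeC`. -/
def leadingExponent (n : ℤ) (k : Fin 4 → ℤ) (m : ℕ) : ℤ :=
  if RegimeA k m then (k 1 + k 2) * (2 * n - k 1 - k 2 - 1)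
  else if RegimeB k m then
    (k 1 + k 2) * (2 * n - k 1 - k 2 - 1) + (n + 1) * (n - k 0 - k 3)
  else (k 1 + k 2) * (2 * n - k 1 - k 2 - 1) + (n + 1 - m) * (k 1 + k 2 - n)

lemma leadingExponent_of_regimeA {n : ℤ} {k : Fin 4 → ℤ} {m : ℕ} (h : RegimeA k m) :
    leadingExponent n k m = (k 1 + k 2) * (2 * n - k 1 - k 2 - 1) := by
  simp [leadingExponent, h]

lemma leadingExponent_of_regimeB {n : ℤ} {k : Fin 4 → ℤ} {m : ℕ}
    (hm : (m : ℤ) = 2 * n - ∑ i, k i) (h : RegimeB k m) :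
    leadingExponent n k m =
      (k 1 + k 2) * (2 * n - k 1 - k 2 - 1) + (n + 1) * (n - k 0 - k 3) := by
  rw [Fin.sum_univ_four] at hm
  by_cases hA : RegimeA k m
  · rw [leadingExponent_of_regimeA hA]
    unfold RegimeA at hA
    unfold RegimeB at h
    have h0 : n + 1 = 0 ∨ n - k 0 - k 3 = 0 := by
      have := abs_le.1 hA
      rcases abs_cases (k 0 + k 3 + 1) with h' | h' <;> omega
    rcases h0 with h0 | h0 <;> rw [h0] <;> ring
  · simp [leadingExponent, hA, h]

lemma leadingExponent_of_regimeC {n : ℤ} {k : Fin 4 → ℤ} {m : ℕ}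
    (hm : (m : ℤ) = 2 * n - ∑ i, k i) (h : RegimeC k m) :
    leadingExponent n k m =
      (k 1 + k 2) * (2 * n - k 1 - k 2 - 1) + (n + 1 - m) * (k 1 + k 2 - n) := by
  have hm' := hm
  rw [Fin.sum_univ_four] at hm'
  by_cases hA : RegimeA k m
  · rw [leadingExponent_of_regimeA hA]
    unfold RegimeA at hA
    unfold RegimeC at h
    have h0 : n + 1 - m = 0 ∨ k 1 + k 2 - n = 0 := by
      have := abs_le.1 hA
      rcases abs_cases (k 0 + k 3 + 1) with h' | h' <;> omega
    rcases h0 with h0 | h0 <;> rw [h0] <;> ring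
  · have hB : ¬ RegimeB k m := by
      intro hB
      apply hA
      unfold RegimeA
      unfold RegimeB at hB
      unfold RegimeC at h
      rw [abs_le]
      have := abs_nonneg (k 0 + k 3 + 1)
      omega
    simp [leadingExponent, hA, hB]

/-! ### The expressions for the leading coefficient -/

/-- The `a` smallest and the `b` largest elements of `S`. -/
def extremes (S : Finset ℕ) (a b : ℕ) : Finset ℕ :=
  S.filter fun μ => (S.filter (· < μ)).card < a ∨ (S.filter (μ < ·)).card < b

/-- `J(N; a, b, c, d)`: the `a` smallest and `b` largest odd elements together with the `c`
smallest and `d` largest even elements of `{0, 1, …, N}`. -/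
def indexSetJ (N a b c d : ℕ) : Finset ℕ :=
  extremes ((Finset.range (N + 1)).filter Odd) a b ∪
    extremes ((Finset.range (N + 1)).filter Even) c d

/-- `Δ(x) = ∏_{i<j} (x_j - x_i)`. -/
def delta {m : ℕ} (x : Fin m → ℂ) : ℂ :=
  ∏ i, ∏ j ∈ Finset.Ioi i, (x j - x i)

/-- The value of `N` in regime A when `k_0 + k_3 + 1 ≥ 0`. -/
def upperA₁ (n : ℤ) (k : Fin 4 → ℤ) : ℕ :=
  (2 * (n + negPart k 1 + negPart k 2)).toNat

/-- The value of `N` in regime A when `k_0 + k_3 + 1 ≤ 0`. -/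
def upperA₂ (n : ℤ) (k : Fin 4 → ℤ) : ℕ :=
  (2 * (n + negPart k 1 + negPart k 2 - k 0 - k 3 - 1)).toNat

/-- The expression in regime A when `k_0 + k_3 + 1 ≥ 0`. -/
def formA₁ (n : ℤ) (k : Fin 4 → ℤ) {m : ℕ} (x : Fin m → ℂ) : ℂ :=
  1 / delta x *
    (∏ j, x j ^ (n - k 1 - k 2 - 1) /
      ((1 - x j) ^ (k 0 + k 3 + 1) * (1 - 2 * x j) ^ (2 * negPart k 2))) *
    ∑ l : Fin m → Fin (upperA₁ n k + 1),
      delta (fun j => ((l j : ℕ) : ℂ)) *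
        ∏ j, (((upperA₁ n k).choose (l j) : ℂ) * (1 - 2 * x j) ^ (l j : ℕ) *
          ∏ μ ∈ indexSetJ (upperA₁ n k) (posPart k 2) (posPart k 1) (negPart k 2) (negPart k 1),
            (((l j : ℕ) : ℂ) - (μ : ℂ)))

/-- The expression in regime A when `k_0 + k_3 + 1 ≤ 0`. -/
def formA₂ (n : ℤ) (k : Fin 4 → ℤ) {m : ℕ} (x : Fin m → ℂ) : ℂ :=
  1 / delta x *
    (∏ j, x j ^ (n + k 0 + k 3 - k 1 - k 2) / (1 - 2 * x j) ^ (2 * negPart k 2)) *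
    ∑ l : Fin m → Fin (upperA₂ n k + 1),
      delta (fun j => ((l j : ℕ) : ℂ)) *
        ∏ j, (((upperA₂ n k).choose (l j) : ℂ) * (1 - 2 * x j) ^ (l j : ℕ) *
          (1 + 2 * (-1) ^ (l j : ℕ)) *
          ∏ μ ∈ indexSetJ (upperA₂ n k) (posPart k 2) (posPart k 1) (negPart k 2) (negPart k 1),
            (((l j : ℕ) : ℂ) - (μ : ℂ)))

/-- The expression in regime B. -/
def formB (n : ℤ) (k : Fin 4 → ℤ) {m : ℕ} (x : Fin m → ℂ) : ℂ :=
  (∏ j, x j ^ (k 0 + k 3 - k 1 - k 2 - 1) * (1 - 2 * x j) ^ (2 * k 2 + 1) /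
      (1 - x j) ^ (n + 1)) *
    ∏ i, ∏ j ∈ Finset.Ioi i, (x i + x j - 1)

/-- The expression in regime C. -/
def formC (n : ℤ) (k : Fin 4 → ℤ) {m : ℕ} (x : Fin m → ℂ) : ℂ :=
  (∏ j, x j ^ (k 0 + k 3) * (1 - x j) ^ (k 1 + k 2 - n)) *
    ∏ i, ∏ j ∈ Finset.Ioi i, (x i + x j - 1)

end HyperbolicCusp

end

open HyperbolicCusp

/-!
Write `D = (ζ + 2) x - ζ` and `w = x² (x - 2 ζ - 1) / D`. Up to the common factor `D ^ (N - 1)` the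
basis polynomials are `w ^ i` and `x w ^ i` with `0 ≤ i < N`. As `ζ → 0` the points `ξ_0, ξ_3`
collide at `x = 1` and `ξ_1, ξ_2` collide at `x = 0`, so the repeated variables form two clusters in
each of the two groups of variables. The coordinates `x = 1 + ζ y` and `x = ζ (1 + ζ s) / (ζ + 2)`
separate the points: `ξ_0, ξ_3` are `y = 2, 0` and `ξ_1, ξ_2` are `s = 0, 2`. Near `x = 1` one has
`w ≈ ζ (y - 2) / 2`, near `x = 0` one has `w ≈ -1 / (4 s)`, and elsewhere `w → x (x - 1) / 2`.

*From `T` to a determinant of residues.* Evaluating an alternant at confluent points amounts to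
replacing the rows of a cluster by the coefficients of the residues of the columns modulo the
polynomial with the points of the cluster as roots, and dividing by the Vandermonde determinants
between clusters; see `exists_polyT_eval_eq_det`. The order of those Vandermonde determinants and of
the factors `G (ξ_i, ξ_j)`, `G (x_j, ξ_i)` is explicit, so everything reduces to the order and the
leading coefficient of the determinant of residues.

*Limits of entries suffice.* Suppose that after multiplying rows and columns by powers of `ζ` all
entries converge. Then the limit of the determinant has `m` rows `ev (x_i)` and further constant
rows. If the common zeros of the constant rows give functions in the span of `φ_1, …, φ_m` and are
determined by these functions, then the limit is a nonzero multiple of `det (φ_j (x_i))`, by a count of dimensions that requires no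
existence statement for such zeros; see `exists_det_eq_const_mul` and `detAsymptotics_of_limits`.
What remains is a uniqueness problem for polynomials in each regime.

*Regime A.* The columns carry no weights. With `t = 1 - 2 x`, a common zero is a polynomial
`(1 + t) (A (w) + x B (w))` with prescribed zeros at `t = ±1`; after division by a power of
`1 - t ^ 2` its coefficients vanish at the places of `J`. A polynomial of degree at most `M` with a
zero of order `q` at `-1` has coefficients `binom M λ` times a polynomial in `λ` of degree less than
`M + 1 - q`, and the conditions from `J` divide out the factors `λ - μ`. This produces the sums over `λ`, see
`exists_eq_sum_regimeAFun`. The factor `1 + 2 (-1) ^ λ` comes from the operator `σ̂`, which combines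
the values at `t` and `-t`.

*Regimes B and C.* Here the unscaled limit of the determinant vanishes in general, because one of
the clusters near `x = 0` contains too many points: it imposes conditions also on low coefficients, which meet
the conditions from `x = 1`. After scaling the columns with index `i` by powers that saturate at
`i = P`, the low coefficients solve a two-point Padé problem. In the coordinate `v` with
`σ = (1 - v) / (1 + v)` its solution becomes a polynomial with at most `K` terms and a zero of order
`K` at `v = 1`, hence is zero (`pade_eq_zero`). The surviving coefficients span
`s ^ j`, `0 ≤ j < m`, in the coordinate `s = 1 / (2 x (1 - x))`, up to a common factor, and the
determinant of these functions is a Vandermonde determinant, which gives `∏ (x_i + x_j - 1)`. In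
regime B the large cluster belongs to the second group of variables; there the leading terms of
consecutive columns at the cluster are proportional, and one combines them first (`gluedFamily`).
The two regimes share `exists_limits_saturated`, `glue_kernel` and `detAsymptotics_glue`.

*Special points.* The argument so far needs distinct `x_j` different from `0` and `1`. Since `T` is
a polynomial of degree bounded independently of `ζ`, interpolation on a generic line through a given
point extends the convergence to all points (`exists_tnkNum_limit`). Where two regimes overlap, the
limits agree by uniqueness.
-/

noncomputable section

namespace HyperbolicCusp

/-! ### Reduction of the alternant to residues modulo the confluent points -/

/-- The index set of the rows of the alternant: `m` free variables, then the variables of the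
first group near `1` and near `0`, then those of the second group near `1` and near `0`. -/
abbrev Rows (m a κ b δ : ℕ) := Fin m ⊕ ((Fin a ⊕ Fin κ) ⊕ (Fin b ⊕ Fin δ))

/-- A family on `Rows` given by its five parts. -/
def rowFun {m a κ b δ : ℕ} {M : Type*} (f₀ : Fin m → M) (f₁ : Fin a → M) (f₂ : Fin κ → M)
    (f₃ : Fin b → M) (f₄ : Fin δ → M) : Rows m a κ b δ → M :=
  Sum.elim f₀ (Sum.elim (Sum.elim f₁ f₂) (Sum.elim f₃ f₄))

/-- The monic polynomial with roots `y i`. -/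
def nodal {R : Type*} [CommRing R] {n : ℕ} (y : Fin n → R) : Polynomial R :=
  ∏ i, (Polynomial.X - Polynomial.C (y i))

lemma nodal_monic {R : Type*} [CommRing R] {n : ℕ} (y : Fin n → R) : (nodal y).Monic :=
  Polynomial.monic_prod_of_monic _ _ fun i _ => Polynomial.monic_X_sub_C (y i)

lemma natDegree_nodal {R : Type*} [CommRing R] [Nontrivial R] {n : ℕ} (y : Fin n → R) :
    (nodal y).natDegree = n := by
  unfold nodal
  rw [Polynomial.natDegree_prod_of_monic _ _ fun i _ => Polynomial.monic_X_sub_C (y i)]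
  simp

lemma eval_eq_sum_residue {R : Type*} [CommRing R] [Nontrivial R] {n : ℕ} (y : Fin n → R)
    (F : Polynomial R) (i : Fin n) :
    F.eval (y i) = ∑ l : Fin n, Matrix.vandermonde y i l * (F %ₘ nodal y).coeff l := by
  have hn : 0 < n := i.pos
  have h1 : (F %ₘ nodal y).eval (y i) = F.eval (y i) := by
    have hroot : (nodal y).eval (y i) = 0 := by
      unfold nodal
      rw [Polynomial.eval_prod]
      exact Finset.prod_eq_zero (Finset.mem_univ i) (by simp)
    conv_rhs => rw [← Polynomial.modByMonic_add_div F (nodal y)]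
    simp [hroot]
  have h2 : (F %ₘ nodal y).natDegree < n := by
    have h3 := Polynomial.natDegree_modByMonic_lt F (nodal_monic y) (by
      intro h
      have := natDegree_nodal y
      rw [h, Polynomial.natDegree_one] at this
      omega)
    rwa [natDegree_nodal] at h3
  rw [← h1, Polynomial.eval_eq_sum_range' h2, Finset.sum_range]
  refine Finset.sum_congr rfl fun l _ => ?_
  rw [Matrix.vandermonde_apply, mul_comm]

/-- A matrix of values of polynomials at the points of four clusters is a matrix of residues
multiplied by Vandermonde matrices, one for each cluster. -/
lemma det_rowFun_eval {R : Type*} [CommRing R] [Nontrivial R] {m a κ b δ : ℕ}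
    (F₀ : Fin m → Rows m a κ b δ → R) (F₁ F₂ F₃ F₄ : Rows m a κ b δ → Polynomial R)
    (y₁ : Fin a → R) (y₂ : Fin κ → R) (y₃ : Fin b → R) (y₄ : Fin δ → R) :
    (Matrix.of (rowFun F₀ (fun i j => (F₁ j).eval (y₁ i)) (fun i j => (F₂ j).eval (y₂ i))
      (fun i j => (F₃ j).eval (y₃ i)) (fun i j => (F₄ j).eval (y₄ i)))).det =
    ((Matrix.vandermonde y₁).det * (Matrix.vandermonde y₂).det) *
      ((Matrix.vandermonde y₃).det * (Matrix.vandermonde y₄).det) *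
    (Matrix.of (rowFun F₀ (fun l j => (F₁ j %ₘ nodal y₁).coeff l)
      (fun l j => (F₂ j %ₘ nodal y₂).coeff l) (fun l j => (F₃ j %ₘ nodal y₃).coeff l)
      (fun l j => (F₄ j %ₘ nodal y₄).coeff l))).det := by
  have hV : (Matrix.fromBlocks (1 : Matrix (Fin m) (Fin m) R) 0 0
      (Matrix.fromBlocks (Matrix.fromBlocks (Matrix.vandermonde y₁) 0 0 (Matrix.vandermonde y₂)) 0 0
        (Matrix.fromBlocks (Matrix.vandermonde y₃) 0 0 (Matrix.vandermonde y₄)))).det =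
      ((Matrix.vandermonde y₁).det * (Matrix.vandermonde y₂).det) *
      ((Matrix.vandermonde y₃).det * (Matrix.vandermonde y₄).det) := by
    simp [Matrix.det_fromBlocks_zero₂₁]
  rw [← hV, ← Matrix.det_mul]
  congr 1
  ext t j
  rcases t with i | (i | i) | (i | i)
  · simp [Matrix.mul_apply, rowFun, Matrix.one_apply]
  all_goals
    simp [Matrix.mul_apply, rowFun, eval_eq_sum_residue]

/-- Two ways of choosing an order within each pair of variables change the product of the
differences by a sign only. -/
lemma prod_sub_tournament {τ R : Type*} [DecidableEq τ] [CommRing R]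
    (S₁ S₂ : Finset (τ × τ)) (h₁ : ∀ q ∈ S₁, q.swap ∉ S₁) (h₂ : ∀ q ∈ S₂, q.swap ∉ S₂)
    (h₁₂ : ∀ q ∈ S₁, q ∈ S₂ ∨ q.swap ∈ S₂) (h₂₁ : ∀ q ∈ S₂, q ∈ S₁ ∨ q.swap ∈ S₁) :
    ∃ ε : ℤ, (ε = 1 ∨ ε = -1) ∧ ∀ z : τ → R,
      ∏ q ∈ S₁, (z q.2 - z q.1) = ε * ∏ q ∈ S₂, (z q.2 - z q.1) := by
  classical
  refine ⟨∏ q ∈ S₂, (if q ∈ S₁ then 1 else -1), ?_, ?_⟩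
  · refine Finset.prod_induction _ (fun x : ℤ => x = 1 ∨ x = -1) ?_ (Or.inl rfl) ?_
    · rintro a b (rfl | rfl) (rfl | rfl) <;> simp
    · intro q _
      by_cases h : q ∈ S₁ <;> simp [h]
  · intro z
    rw [Int.cast_prod, ← Finset.prod_mul_distrib]
    refine (Finset.prod_bij (fun q _ => if q ∈ S₁ then q else q.swap) ?_ ?_ ?_ ?_).symm
    · intro q hq
      by_cases h : q ∈ S₁
      · simp [h]
      · simpa [h] using (h₂₁ q hq).resolve_left h
    · intro q hq q' hq' heq
      by_cases h : q ∈ S₁ <;> by_cases h' : q' ∈ S₁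
      · simpa [h, h'] using heq
      · simp only [h, h', if_true, if_false] at heq
        exact absurd (heq ▸ hq) (h₂ q' hq')
      · simp only [h, h', if_true, if_false] at heq
        exact absurd (heq ▸ hq') (h₂ q hq)
      · simp only [h, h', if_false] at heq
        exact Prod.swap_injective heq
    · intro q hq
      by_cases h : q ∈ S₂
      · exact ⟨q, h, by simp [hq]⟩
      · refine ⟨q.swap, (h₁₂ q hq).resolve_left h, ?_⟩
        simp [h₁ q hq]
    · intro q _
      by_cases h : q ∈ S₁ <;> simp [h]

/-- The pairs of rows in the same group of variables, ordered as the five parts of `Rows` are. -/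
def rowLT {m a κ b δ : ℕ} : Rows m a κ b δ → Rows m a κ b δ → Bool
  | .inl i, .inl j => i < j
  | .inl _, .inr (.inl _) => true
  | .inr (.inl (.inl i)), .inr (.inl (.inl j)) => i < j
  | .inr (.inl (.inl _)), .inr (.inl (.inr _)) => true
  | .inr (.inl (.inr i)), .inr (.inl (.inr j)) => i < j
  | .inr (.inr (.inl i)), .inr (.inr (.inl j)) => i < j
  | .inr (.inr (.inl _)), .inr (.inr (.inr _)) => true
  | .inr (.inr (.inr i)), .inr (.inr (.inr j)) => i < j
  | _, _ => false

/-- Whether a row belongs to the first group of variables. -/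
def isFirst {m a κ b δ : ℕ} : Rows m a κ b δ → Bool
  | .inr (.inr _) => false
  | _ => true

/-- `∏_{i,j} (y_j - x_i)`. -/
def crossProd {R : Type*} [CommRing R] {p q : ℕ} (x : Fin p → R) (y : Fin q → R) : R :=
  ∏ i, ∏ j, (y j - x i)

lemma prod_Ioi_eq {R : Type*} [CommRing R] {n : ℕ} (z : Fin n → R) :
    (∏ i, ∏ j, if i < j then z j - z i else 1) = (Matrix.vandermonde z).det := by
  rw [Matrix.det_vandermonde]
  refine Finset.prod_congr rfl fun i _ => ?_
  rw [← Finset.prod_filter]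
  congr 1
  ext j; simp

lemma prod_rowLT {R : Type*} [CommRing R] {m a κ b δ : ℕ} (z₀ : Fin m → R) (z₁ : Fin a → R)
    (z₂ : Fin κ → R) (z₃ : Fin b → R) (z₄ : Fin δ → R) :
    (∏ q ∈ Finset.univ.filter (fun q : Rows m a κ b δ × Rows m a κ b δ => rowLT q.1 q.2),
      (rowFun z₀ z₁ z₂ z₃ z₄ q.2 - rowFun z₀ z₁ z₂ z₃ z₄ q.1)) =
    (Matrix.vandermonde z₀).det * (Matrix.vandermonde z₁).det * (Matrix.vandermonde z₂).det *
      (Matrix.vandermonde z₃).det * (Matrix.vandermonde z₄).det *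
      (crossProd z₀ z₁ * crossProd z₀ z₂ * crossProd z₁ z₂ * crossProd z₃ z₄) := by
  rw [Finset.prod_filter, Fintype.prod_prod_type]
  simp only [Fintype.prod_sum_type, rowLT, rowFun, Sum.elim_inl, Sum.elim_inr, if_true,
    Bool.false_eq_true, if_false, Finset.prod_const_one, mul_one, one_mul, decide_eq_true_eq,
    Finset.prod_mul_distrib, prod_Ioi_eq]
  unfold crossProd
  ring

/-- The product of the Vandermonde determinants of the two groups of variables does not depend, up to
sign, on how the variables of each group are ordered. -/
lemma exists_sign {R : Type*} [CommRing R] {m a κ b δ : ℕ} (N K : ℕ)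
    (e : Rows m a κ b δ ≃ Fin (2 * N)) (he : ∀ t, ((e t : ℕ) < K ↔ isFirst t = true)) :
    ∃ ε : ℤ, (ε = 1 ∨ ε = -1) ∧ ∀ z : Rows m a κ b δ → R,
      ∏ q ∈ groupPairs N K, (z (e.symm q.2) - z (e.symm q.1)) =
        ε * ∏ q ∈ Finset.univ.filter
          (fun q : Rows m a κ b δ × Rows m a κ b δ => rowLT q.1 q.2), (z q.2 - z q.1) := by
  classical
  have hmem : ∀ t t', (t, t') ∈ (groupPairs N K).image (Prod.map e.symm e.symm) ↔
      (e t < e t' ∧ (isFirst t = isFirst t')) := by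
    intro t t'
    have : (isFirst t = isFirst t') ↔ ((e t : ℕ) < K ↔ (e t' : ℕ) < K) := by
      rw [he, he]
      cases isFirst t <;> cases isFirst t' <;> simp
    rw [this]
    simp only [Finset.mem_image, groupPairs, Finset.mem_filter, Finset.mem_univ, true_and,
      Prod.exists, Prod.map_apply, Prod.mk.injEq]
    constructor
    · rintro ⟨i, j, h, rfl, rfl⟩
      simpa using h
    · intro h
      exact ⟨e t, e t', h, by simp, by simp⟩
  have hne : ∀ t t', t ≠ t' → (e t < e t' ∨ e t' < e t) := fun t t' h =>
    lt_or_gt_of_ne (fun h' => h (e.injective h'))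
  obtain ⟨ε, hε, h⟩ := prod_sub_tournament (R := R)
    ((groupPairs N K).image (Prod.map e.symm e.symm))
    (Finset.univ.filter (fun q : Rows m a κ b δ × Rows m a κ b δ => rowLT q.1 q.2))
    (by
      rintro ⟨t, t'⟩ h h'
      simp only [Prod.swap_prod_mk] at h'
      rw [hmem] at h h'
      exact absurd h.1 (not_lt.2 h'.1.le))
    (by
      rintro ⟨t, t'⟩ h h'
      simp only [Prod.swap_prod_mk, Finset.mem_filter, Finset.mem_univ, true_and] at h h'
      rcases t with i | (i | i) | (i | i) <;> rcases t' with j | (j | j) | (j | j) <;>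
        simp [rowLT] at h h' <;> omega)
    (by
      rintro ⟨t, t'⟩ h
      rw [hmem] at h
      have htt : t ≠ t' := by
        rintro rfl
        exact lt_irrefl _ h.1
      have h2 := h.2
      simp only [Prod.swap_prod_mk, Finset.mem_filter, Finset.mem_univ, true_and]
      rcases t with i | (i | i) | (i | i) <;> rcases t' with j | (j | j) | (j | j) <;>
        simp [rowLT, isFirst] at h2 htt ⊢ <;> omega)
    (by
      rintro ⟨t, t'⟩ h
      simp only [Finset.mem_filter, Finset.mem_univ, true_and] at h
      simp only [Prod.swap_prod_mk, hmem]
      have h2 : isFirst t = isFirst t' := by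
        rcases t with i | (i | i) | (i | i) <;> rcases t' with j | (j | j) | (j | j) <;>
          simp [rowLT, isFirst] at h ⊢
      have htt : t ≠ t' := by
        rintro rfl
        rcases t with i | (i | i) | (i | i) <;> simp [rowLT] at h
      rcases hne t t' htt with h3 | h3
      · exact Or.inl ⟨h3, h2⟩
      · exact Or.inr ⟨h3, h2.symm⟩)
  refine ⟨ε, hε, fun z => ?_⟩
  rw [← h z, Finset.prod_image]
  · rfl
  · intro q _ q' _ hq
    exact (e.symm.injective.prodMap e.symm.injective) hq

/-- The matrix obtained from the alternant with column polynomials `f` (first group) and `g`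
(second group): evaluations at the free points `x`, and coefficients of the residues modulo
`nodal y₁`, …, `nodal y₄` after the affine substitutions `u₁ + l₁ X` and `u₂ + l₂ X`. -/
def residueMatrix {m a κ b δ : ℕ} {γ : Type*} (f g : γ → Polynomial ℂ) (u₁ l₁ u₂ l₂ : ℂ)
    (x : Fin m → ℂ) (y₁ : Fin a → ℂ) (y₂ : Fin κ → ℂ) (y₃ : Fin b → ℂ) (y₄ : Fin δ → ℂ) :
    Matrix (Rows m a κ b δ) γ ℂ :=
  Matrix.of (rowFun (fun i j => (f j).eval (x i))
    (fun l j => ((f j).comp (Polynomial.C u₁ + Polynomial.C l₁ * Polynomial.X) %ₘ nodal y₁).coeff l)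
    (fun l j => ((f j).comp (Polynomial.C u₂ + Polynomial.C l₂ * Polynomial.X) %ₘ nodal y₂).coeff l)
    (fun l j => ((g j).comp (Polynomial.C u₁ + Polynomial.C l₁ * Polynomial.X) %ₘ nodal y₃).coeff l)
    (fun l j => ((g j).comp (Polynomial.C u₂ + Polynomial.C l₂ * Polynomial.X) %ₘ nodal y₄).coeff l))

lemma map_nodal {R S : Type*} [CommRing R] [CommRing S] (φ : R →+* S) {n : ℕ} (y : Fin n → R) :
    (nodal y).map φ = nodal (fun i => φ (y i)) := by
  unfold nodal
  rw [Polynomial.map_prod]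
  simp

lemma map_residue {R S : Type*} [CommRing R] [CommRing S] (φ : R →+* S) {n : ℕ} (y : Fin n → R)
    (F : Polynomial R) (l : ℕ) :
    φ ((F %ₘ nodal y).coeff l) = ((F.map φ) %ₘ nodal (fun i => φ (y i))).coeff l := by
  rw [← map_nodal, ← Polynomial.map_modByMonic φ (nodal_monic y), Polynomial.coeff_map]

lemma det_vandermonde_affine {R : Type*} [CommRing R] {n : ℕ} (u l : R) (y : Fin n → R) :
    (Matrix.vandermonde (fun i => u + l * y i)).det =
      l ^ (n.choose 2) * (Matrix.vandermonde y).det := by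
  have h : (n.choose 2) = ∑ i : Fin n, (Finset.Ioi i).card := by
    simp only [Fin.card_Ioi]
    rw [Fin.sum_univ_eq_sum_range (fun i => n - 1 - i) n, Finset.sum_range_reflect (fun i => i) n,
      Finset.sum_range_id, Nat.choose_two_right]
  rw [Matrix.det_vandermonde, Matrix.det_vandermonde, h, ← Finset.prod_pow_eq_pow_sum,
    ← Finset.prod_mul_distrib]
  refine Finset.prod_congr rfl fun i _ => ?_
  rw [Finset.prod_congr rfl fun j _ => show (u + l * y j) - (u + l * y i) = l * (y j - y i) by ring,
    Finset.prod_mul_distrib, Finset.prod_const]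

lemma det_vandermonde_X_ne_zero {σ : Type*} {n : ℕ} (v : Fin n → σ) (hv : Function.Injective v) :
    (Matrix.vandermonde (fun i => (MvPolynomial.X (v i) : MvPolynomial σ ℂ))).det ≠ 0 :=
  Matrix.det_vandermonde_ne_zero_iff.2 fun _ _ h => hv (MvPolynomial.X_injective h)

/-- The polynomial `T` at arbitrary, possibly coinciding points, as a determinant of residues. The
Vandermonde factors of the four clusters are cancelled over the ring of polynomials in generic
points. -/
theorem exists_polyT_eval_eq_det {m a κ b δ : ℕ} (N K : ℕ) (e : Rows m a κ b δ ≃ Fin (2 * N))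
    (he : ∀ t, ((e t : ℕ) < K ↔ isFirst t = true)) :
    ∃ ε : ℂ, ε ≠ 0 ∧ ∀ (ζ : ℂ) (U : Matrix (Fin (2 * N)) (Fin (2 * N)) ℂ)
      (f g : Fin (2 * N) → Polynomial ℂ) (_ : ∀ j, f j = ∑ j', U j' j • basisPoly N ζ j')
      (_ : ∀ j, g j = ∑ j', U j' j • sigmaBasisPoly N ζ j') (u₁ l₁ u₂ l₂ : ℂ)
      (x : Fin m → ℂ) (y₁ : Fin a → ℂ) (y₂ : Fin κ → ℂ) (y₃ : Fin b → ℂ) (y₄ : Fin δ → ℂ),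
      ε * U.det * MvPolynomial.eval (fun i => rowFun x (fun i => u₁ + l₁ * y₁ i)
          (fun i => u₂ + l₂ * y₂ i) (fun i => u₁ + l₁ * y₃ i) (fun i => u₂ + l₂ * y₄ i) (e.symm i))
          (polyT N K ζ) *
        ((Matrix.vandermonde x).det * l₁ ^ (a.choose 2) * l₂ ^ (κ.choose 2) * l₁ ^ (b.choose 2) *
          l₂ ^ (δ.choose 2)) *
        (crossProd x (fun i => u₁ + l₁ * y₁ i) * crossProd x (fun i => u₂ + l₂ * y₂ i) *
          crossProd (fun i => u₁ + l₁ * y₁ i) (fun i => u₂ + l₂ * y₂ i) *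
          crossProd (fun i => u₁ + l₁ * y₃ i) (fun i => u₂ + l₂ * y₄ i)) =
      ((residueMatrix f g u₁ l₁ u₂ l₂ x y₁ y₂ y₃ y₄).submatrix id e).det := by
  classical
  obtain ⟨ε, hε, hsign⟩ := exists_sign (R := MvPolynomial (Rows m a κ b δ) ℂ) N K e he
  refine ⟨(ε : ℂ), by rcases hε with rfl | rfl <;> simp, ?_⟩
  intro ζ U f g hf hg u₁ l₁ u₂ l₂ x y₁ y₂ y₃ y₄
  let R := MvPolynomial (Rows m a κ b δ) ℂ
  let cst : ℂ →+* R := MvPolynomial.C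
  let X₀ : Fin m → R := fun i => MvPolynomial.X (.inl i)
  let X₁ : Fin a → R := fun i => MvPolynomial.X (.inr (.inl (.inl i)))
  let X₂ : Fin κ → R := fun i => MvPolynomial.X (.inr (.inl (.inr i)))
  let X₃ : Fin b → R := fun i => MvPolynomial.X (.inr (.inr (.inl i)))
  let X₄ : Fin δ → R := fun i => MvPolynomial.X (.inr (.inr (.inr i)))
  let z : Rows m a κ b δ → R := rowFun X₀ (fun i => cst u₁ + cst l₁ * X₁ i)
    (fun i => cst u₂ + cst l₂ * X₂ i) (fun i => cst u₁ + cst l₁ * X₃ i)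
    (fun i => cst u₂ + cst l₂ * X₄ i)
  let A₁ : Polynomial ℂ := Polynomial.C u₁ + Polynomial.C l₁ * Polynomial.X
  let A₂ : Polynomial ℂ := Polynomial.C u₂ + Polynomial.C l₂ * Polynomial.X
  have haff₁ : ∀ (p : Polynomial ℂ) (r : R), Polynomial.aeval (cst u₁ + cst l₁ * r) p =
      ((p.comp A₁).map cst).eval r := by
    intro p r
    have h : (A₁.map cst).eval r = cst u₁ + cst l₁ * r := by simp [A₁]
    rw [Polynomial.map_comp, Polynomial.eval_comp, Polynomial.eval_map, h]
    rfl
  have haff₂ : ∀ (p : Polynomial ℂ) (r : R), Polynomial.aeval (cst u₂ + cst l₂ * r) p =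
      ((p.comp A₂).map cst).eval r := by
    intro p r
    have h : (A₂.map cst).eval r = cst u₂ + cst l₂ * r := by simp [A₂]
    rw [Polynomial.map_comp, Polynomial.eval_comp, Polynomial.eval_map, h]
    rfl
  -- the defining identity of `T` at the generic point of the clusters
  have h1 : (MvPolynomial.aeval (fun i => z (e.symm i)) (polyT N K ζ)) *
      ∏ q ∈ groupPairs N K, (z (e.symm q.2) - z (e.symm q.1)) =
      (Matrix.of fun i j : Fin (2 * N) => Polynomial.aeval (z (e.symm i))
        (if (i : ℕ) < K then basisPoly N ζ j else sigmaBasisPoly N ζ j)).det := by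
    have := congrArg (MvPolynomial.aeval (fun i => z (e.symm i))) (groupDelta_mul_polyT N K ζ)
    rw [map_mul, AlgHom.map_det, groupDelta, map_prod] at this
    simp only [map_sub, MvPolynomial.aeval_X] at this
    rw [mul_comm, this]
    congr 1
    ext i j
    simp only [AlgHom.mapMatrix_apply, Matrix.map_apply, alternantMatrix, Matrix.of_apply,
      ← Polynomial.aeval_algHom_apply, MvPolynomial.aeval_X]
  have h2 : (Matrix.of fun i j : Fin (2 * N) => Polynomial.aeval (z (e.symm i))
        (if (i : ℕ) < K then basisPoly N ζ j else sigmaBasisPoly N ζ j)).det * cst U.det =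
      (Matrix.of fun i j : Fin (2 * N) => Polynomial.aeval (z (e.symm i))
        (if (i : ℕ) < K then f j else g j)).det := by
    rw [RingHom.map_det, ← Matrix.det_mul]
    congr 1
    ext i j
    simp only [Matrix.mul_apply, Matrix.of_apply, RingHom.mapMatrix_apply, Matrix.map_apply]
    congr 1
    by_cases h : (i : ℕ) < K
    · simp only [h, if_true, hf, map_sum, map_smul]
      refine Finset.sum_congr rfl fun j' _ => ?_
      rw [mul_comm, MvPolynomial.smul_eq_C_mul]
    · simp only [h, if_false, hg, map_sum, map_smul]
      refine Finset.sum_congr rfl fun j' _ => ?_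
      rw [mul_comm, MvPolynomial.smul_eq_C_mul]
  have h3 : (Matrix.of fun i j : Fin (2 * N) => Polynomial.aeval (z (e.symm i))
        (if (i : ℕ) < K then f j else g j)).det =
      (Matrix.of (rowFun (fun i j => Polynomial.aeval (X₀ i) (f (e j)))
        (fun i j => (((f (e j)).comp A₁).map cst).eval (X₁ i))
        (fun i j => (((f (e j)).comp A₂).map cst).eval (X₂ i))
        (fun i j => (((g (e j)).comp A₁).map cst).eval (X₃ i))
        (fun i j => (((g (e j)).comp A₂).map cst).eval (X₄ i)))).det := by
    rw [← Matrix.det_submatrix_equiv_self e]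
    congr 1
    ext t j
    simp only [Matrix.submatrix_apply, Matrix.of_apply, Equiv.symm_apply_apply, he]
    rcases t with i | (i | i) | (i | i) <;>
      simp [isFirst, z, rowFun, haff₁, haff₂]
  rw [det_rowFun_eval] at h3
  rw [hsign, prod_rowLT, det_vandermonde_affine, det_vandermonde_affine, det_vandermonde_affine,
    det_vandermonde_affine] at h1
  have hX₁ := det_vandermonde_X_ne_zero (fun i => (.inr (.inl (.inl i)) : Rows m a κ b δ))
    (fun i j h => by simpa using h)
  have hX₂ := det_vandermonde_X_ne_zero (fun i => (.inr (.inl (.inr i)) : Rows m a κ b δ))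
    (fun i j h => by simpa using h)
  have hX₃ := det_vandermonde_X_ne_zero (fun i => (.inr (.inr (.inl i)) : Rows m a κ b δ))
    (fun i j h => by simpa using h)
  have hX₄ := det_vandermonde_X_ne_zero (fun i => (.inr (.inr (.inr i)) : Rows m a κ b δ))
    (fun i j h => by simpa using h)
  have hX := mul_ne_zero (mul_ne_zero hX₁ hX₂) (mul_ne_zero hX₃ hX₄)
  have h4 := mul_left_cancel₀ hX (a := _)
    (b := (ε : R) * cst U.det * (MvPolynomial.aeval (fun i => z (e.symm i)) (polyT N K ζ)) *
      ((Matrix.vandermonde X₀).det * cst l₁ ^ (a.choose 2) * cst l₂ ^ (κ.choose 2) *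
        cst l₁ ^ (b.choose 2) * cst l₂ ^ (δ.choose 2)) *
      (crossProd X₀ (fun i => cst u₁ + cst l₁ * X₁ i) *
        crossProd X₀ (fun i => cst u₂ + cst l₂ * X₂ i) *
        crossProd (fun i => cst u₁ + cst l₁ * X₁ i) (fun i => cst u₂ + cst l₂ * X₂ i) *
        crossProd (fun i => cst u₁ + cst l₁ * X₃ i) (fun i => cst u₂ + cst l₂ * X₄ i)))
    ((by rw [← h3, ← h2, ← h1]; ring))
  -- specialization of the generic points
  let v : Rows m a κ b δ → ℂ := rowFun x y₁ y₂ y₃ y₄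
  have hc : ∀ c : ℂ, MvPolynomial.eval v (cst c) = c := fun c => MvPolynomial.eval_C c
  have hv₀ : ∀ i, MvPolynomial.eval v (X₀ i) = x i := fun i => MvPolynomial.eval_X _
  have hv₁ : ∀ i, MvPolynomial.eval v (X₁ i) = y₁ i := fun i => MvPolynomial.eval_X _
  have hv₂ : ∀ i, MvPolynomial.eval v (X₂ i) = y₂ i := fun i => MvPolynomial.eval_X _
  have hv₃ : ∀ i, MvPolynomial.eval v (X₃ i) = y₃ i := fun i => MvPolynomial.eval_X _
  have hv₄ : ∀ i, MvPolynomial.eval v (X₄ i) = y₄ i := fun i => MvPolynomial.eval_X _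
  have hvan : MvPolynomial.eval v (Matrix.vandermonde X₀).det = (Matrix.vandermonde x).det := by
    rw [Matrix.det_vandermonde, Matrix.det_vandermonde, map_prod]
    simp only [map_prod, map_sub, hv₀]
  have hmapC : ∀ p : Polynomial ℂ, (p.map cst).map (MvPolynomial.eval v) = p := by
    intro p
    rw [Polynomial.map_map]
    rw [show (MvPolynomial.eval v).comp cst = RingHom.id ℂ from RingHom.ext hc, Polynomial.map_id]
  have h5 := congrArg (MvPolynomial.eval v) h4
  simp only [map_mul, map_pow, hc, hvan, map_intCast] at h5
  have hT : MvPolynomial.eval v (MvPolynomial.aeval (fun i => z (e.symm i)) (polyT N K ζ)) =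
      MvPolynomial.eval (fun i => rowFun x (fun i => u₁ + l₁ * y₁ i)
          (fun i => u₂ + l₂ * y₂ i) (fun i => u₁ + l₁ * y₃ i) (fun i => u₂ + l₂ * y₄ i) (e.symm i))
          (polyT N K ζ) := by
    rw [← MvPolynomial.coe_aeval_eq_eval, ← MvPolynomial.coe_aeval_eq_eval]
    simp only [RingHom.coe_coe]
    rw [← AlgHom.comp_apply, MvPolynomial.comp_aeval]
    congr 1
    congr 1
    funext i
    change MvPolynomial.eval v (z (e.symm i)) = _
    rcases e.symm i with i | (i | i) | (i | i) <;>
      simp only [z, rowFun, Sum.elim_inl, Sum.elim_inr, map_add, map_mul, hc, hv₀, hv₁, hv₂, hv₃, hv₄]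
  have hcr : ∀ {p q : ℕ} (s : Fin p → R) (r : Fin q → R), MvPolynomial.eval v (crossProd s r) =
      crossProd (fun i => MvPolynomial.eval v (s i)) (fun i => MvPolynomial.eval v (r i)) := by
    intro p q s r
    simp only [crossProd, map_prod, map_sub]
  rw [hT] at h5
  simp only [hcr, map_add, map_mul, hc, hv₀, hv₁, hv₂, hv₃, hv₄] at h5
  refine h5.trans ?_
  rw [RingHom.map_det]
  congr 1
  ext t j
  simp only [RingHom.mapMatrix_apply, Matrix.map_apply, Matrix.of_apply, residueMatrix,
    Matrix.submatrix_apply, id]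
  rcases t with i | (i | i) | (i | i)
  · have : MvPolynomial.eval v (Polynomial.aeval (X₀ i) (f (e j))) = (f (e j)).eval (x i) := by
      rw [← MvPolynomial.coe_aeval_eq_eval, RingHom.coe_coe, ← Polynomial.aeval_algHom_apply,
        Polynomial.coe_aeval_eq_eval]
      congr 1
      exact hv₀ i
    simpa [rowFun] using this
  all_goals
    simp only [rowFun, Sum.elim_inl, Sum.elim_inr, map_residue, hmapC, hv₁, hv₂, hv₃, hv₄, A₁, A₂]

/-! ### Determinants with constant rows -/

/-- Linearly independent functions have a nonvanishing alternant. -/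
lemma exists_det_ne_zero {m : ℕ} {X : Type*} (φ : Fin m → X → ℂ) (hφ : LinearIndependent ℂ φ) :
    ∃ x : Fin m → X, (Matrix.of fun i j => φ j (x i)).det ≠ 0 := by
  set s : Set (Fin m → ℂ) := Set.range fun (x : X) (j : Fin m) => φ j x with hs
  have htop : Submodule.span ℂ s = ⊤ := by
    by_contra h
    obtain ⟨f, hf0, hf⟩ := Submodule.exists_le_ker_of_lt_top _ (lt_top_iff_ne_top.2 h)
    apply hf0
    have hsum : ∑ j, f (Pi.single j 1) • φ j = 0 := by
      funext x
      have hx : f (fun j => φ j x) = 0 := hf (Submodule.subset_span ⟨x, rfl⟩)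
      rw [LinearMap.pi_apply_eq_sum_univ f] at hx
      simp only [Finset.sum_apply, Pi.smul_apply, smul_eq_mul, Pi.zero_apply]
      rw [← hx]
      refine Finset.sum_congr rfl fun j _ => ?_
      rw [smul_eq_mul, mul_comm]
      congr 2
      funext i
      simp [Pi.single_apply, eq_comm]
    have hz := Fintype.linearIndependent_iff.1 hφ _ hsum
    refine LinearMap.pi_ext' fun j => ?_
    ext
    simpa using hz j
  have hrank : Module.finrank ℂ (Submodule.span ℂ s) = m := by
    rw [htop]; simp
  obtain ⟨f, hfs, -, hf⟩ := Submodule.exists_fun_fin_finrank_span_eq ℂ s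
  have hfs' : ∀ i, ∃ x : X, (fun j => φ j x) = f i := fun i => by
    obtain ⟨x, hx⟩ := hfs i
    exact ⟨x, hx⟩
  choose x hx using hfs'
  refine ⟨fun i => x (Fin.cast hrank.symm i), ?_⟩
  have hli : LinearIndependent ℂ (fun i : Fin m => f (Fin.cast hrank.symm i)) :=
    hf.comp _ (Fin.cast_injective _)
  have hM : (Matrix.of fun i j => φ j (x (Fin.cast hrank.symm i))) =
      Matrix.of fun i : Fin m => f (Fin.cast hrank.symm i) := by
    ext i j
    simp [← hx]
  rw [hM]
  have := Matrix.linearIndependent_rows_iff_isUnit.1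
    (show LinearIndependent ℂ (Matrix.of fun i : Fin m => f (Fin.cast hrank.symm i)).row from hli)
  exact ((Matrix.isUnit_iff_isUnit_det _).1 this).ne_zero

/-- If all common zeros `u` of the constant rows `Y` give functions `x ↦ ev x ⬝ᵥ u` in the span of
`g_1, …, g_m`, and these functions determine `u`, then a determinant with `m` rows `ev (x_i)` and the
constant rows `Y` is a nonzero multiple of `det (g_j (x_i))`. By counting dimensions no lower bound
for the space of common zeros is needed. -/
theorem exists_det_eq_const_mul {m : ℕ} {ρ n : Type*} [Fintype ρ] [DecidableEq ρ] [Fintype n]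
    [DecidableEq n] (e : Fin m ⊕ ρ ≃ n) (Y : Matrix ρ n ℂ) (S S' : Set ℂ) (hS : S' ⊆ S)
    (ev : ℂ → n → ℂ) (g : Fin m → ℂ → ℂ)
    (hg : ∀ u, Y.mulVec u = 0 → ∃ c : Fin m → ℂ, ∀ x ∈ S, ev x ⬝ᵥ u = ∑ j, c j * g j x)
    (hsep : ∀ u, Y.mulVec u = 0 → (∀ x ∈ S', ev x ⬝ᵥ u = 0) → u = 0) :
    ∃ C : ℂ, C ≠ 0 ∧
      (∀ x : Fin m → ℂ, (∀ i, x i ∈ S) →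
        ((Matrix.of (Sum.elim (fun i => ev (x i)) Y)).submatrix id e).det =
          C * (Matrix.of fun i j => g j (x i)).det) ∧
      ∃ x : Fin m → ℂ, (∀ i, x i ∈ S') ∧ (Matrix.of fun i j => g j (x i)).det ≠ 0 := by
  classical
  set K : Submodule ℂ (n → ℂ) := LinearMap.ker Y.mulVecLin with hK
  have hcard : Fintype.card n = m + Fintype.card ρ := by
    rw [← Fintype.card_congr e]; simp
  have hmem : ∀ u, u ∈ K ↔ Y.mulVec u = 0 := fun u => by
    rw [hK, LinearMap.mem_ker, Matrix.mulVecLin_apply]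
  -- the restriction of the functions to `S'`
  let Φ : (n → ℂ) →ₗ[ℂ] (S' → ℂ) :=
    { toFun := fun u x => ev x ⬝ᵥ u
      map_add' := fun u v => by funext x; simp [dotProduct_add]
      map_smul' := fun r u => by funext x; simp [dotProduct_smul] }
  have hΦ : ∀ u (x : S'), Φ u x = ev x ⬝ᵥ u := fun _ _ => rfl
  have hinj : Function.Injective (Φ.domRestrict K) := by
    rw [← LinearMap.ker_eq_bot, LinearMap.ker_eq_bot']
    rintro ⟨u, hu⟩ h
    have := hsep u ((hmem u).1 hu) (fun x hx => congrFun h ⟨x, hx⟩)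
    exact Subtype.ext this
  -- `K` embeds into the span of the `g_j`, and rank-nullity gives the opposite inequality.
  have hle : Module.finrank ℂ K ≤ m := by
    let V : Submodule ℂ (S' → ℂ) := Submodule.span ℂ (Set.range fun j (x : S') => g j x)
    have hrange : LinearMap.range (Φ.domRestrict K) ≤ V := by
      rintro _ ⟨⟨u, hu⟩, rfl⟩
      obtain ⟨c, hc⟩ := hg u ((hmem u).1 hu)
      have : Φ.domRestrict K ⟨u, hu⟩ = ∑ j, c j • (fun (x : S') => g j x) := by
        funext x
        rw [LinearMap.domRestrict_apply, hΦ, hc x (hS x.2)]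
        simp
      rw [this]
      exact Submodule.sum_mem _ fun j _ => Submodule.smul_mem _ _ (Submodule.subset_span ⟨j, rfl⟩)
    have hV : Module.finrank ℂ V ≤ m := by
      refine (finrank_range_le_card (R := ℂ) (fun j (x : S') => g j x)).trans ?_
      simp
    have : FiniteDimensional ℂ V := FiniteDimensional.span_of_finite ℂ (Set.finite_range _)
    rw [← LinearMap.finrank_range_of_inj hinj]
    exact (Submodule.finrank_mono hrange).trans hV
  have hrn := LinearMap.finrank_range_add_finrank_ker Y.mulVecLin
  have hr : Module.finrank ℂ (LinearMap.range Y.mulVecLin) ≤ Fintype.card ρ := by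
    refine (Submodule.finrank_le _).trans ?_
    simp
  have hfr : Module.finrank ℂ K = m := by
    simp only [Module.finrank_fintype_fun_eq_card] at hrn
    rw [← hK] at hrn
    omega
  -- In a basis adapted to a decomposition `K ⊕ K'` the matrix is block triangular.
  obtain ⟨K', hK'⟩ := Submodule.exists_isCompl K
  have hfr' : Module.finrank ℂ K' = Fintype.card ρ := by
    have := Submodule.finrank_add_eq_of_isCompl hK'
    simp only [Module.finrank_fintype_fun_eq_card] at this
    omega
  let w := Module.finBasisOfFinrankEq ℂ K hfr
  let w' := (Module.finBasisOfFinrankEq ℂ K' hfr').reindex (Fintype.equivFin ρ).symm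
  let B : Module.Basis (Fin m ⊕ ρ) ℂ (n → ℂ) :=
    (w.prod w').map (Submodule.prodEquivOfIsCompl K K' hK')
  have hBl : ∀ i, B (.inl i) = w i := fun i => by simp [B]
  have hBr : ∀ s, B (.inr s) = w' s := fun s => by simp [B]
  let Q : Matrix n (Fin m ⊕ ρ) ℂ := Matrix.of fun t s => B s t
  have hQ : (Q.submatrix e id).det ≠ 0 := by
    have hli : LinearIndependent ℂ (fun s => (B s) ∘ e) := by
      have h1 := B.linearIndependent.map' (LinearMap.funLeft ℂ ℂ e)
        (LinearMap.ker_eq_bot.2 (LinearMap.funLeft_injective_of_surjective ℂ ℂ e e.surjective))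
      exact h1
    have := Matrix.linearIndependent_cols_iff_isUnit.1
      (show LinearIndependent ℂ (Q.submatrix e id).col from hli)
    exact ((Matrix.isUnit_iff_isUnit_det _).1 this).ne_zero
  have hYB : (Y * Matrix.of fun t s => B (.inr s) t).det ≠ 0 := by
    intro h0
    obtain ⟨d, hd, hd0⟩ := Matrix.exists_mulVec_eq_zero_iff.2 h0
    apply hd
    set u : n → ℂ := (Matrix.of fun t s => B (.inr s) t).mulVec d with hu
    have hu' : u = ∑ s, d s • (w' s : n → ℂ) := by
      funext t
      simp [hu, Matrix.mulVec, dotProduct, hBr, mul_comm]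
    have h1 : u ∈ K := by
      rw [hmem, hu, Matrix.mulVec_mulVec, hd0]
    have h2 : u ∈ K' := by
      rw [hu']
      exact Submodule.sum_mem _ fun s _ => Submodule.smul_mem _ _ (w' s).2
    have h3 : u = 0 := Submodule.disjoint_def.1 hK'.disjoint u h1 h2
    have h4 : ∑ s, d s • w' s = 0 := by
      apply Subtype.ext
      simpa [hu'] using h3
    funext s
    exact Fintype.linearIndependent_iff.1 w'.linearIndependent d h4 s
  have hwK : ∀ i, Y.mulVec (w i : n → ℂ) = 0 := fun i => (hmem _).1 (w i).2
  choose c hc using fun i => hg (w i) (hwK i)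
  -- The coefficients of a basis of `K` with respect to the `g_j` form an invertible matrix.
  have hcdet : (Matrix.of c).det ≠ 0 := by
    intro h0
    obtain ⟨d, hd, hd0⟩ := Matrix.exists_vecMul_eq_zero_iff.2 h0
    apply hd
    have h1 : ∑ i, d i • (w i : n → ℂ) = 0 := by
      refine hsep _ ?_ fun x hx => ?_
      · rw [← hmem]
        exact Submodule.sum_mem _ fun s _ => Submodule.smul_mem _ _ (w s).2
      · rw [dotProduct_sum]
        simp only [dotProduct_smul, hc _ x (hS hx), smul_eq_mul, Finset.mul_sum]
        rw [Finset.sum_comm]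
        refine Finset.sum_eq_zero fun j _ => ?_
        have := congrFun hd0 j
        simp only [Matrix.vecMul, dotProduct, Matrix.of_apply, Pi.zero_apply] at this
        rw [← zero_mul (g j x), ← this, Finset.sum_mul]
        refine Finset.sum_congr rfl fun i _ => by ring
    have h4 : ∑ s, d s • w s = 0 := by
      apply Subtype.ext
      simpa using h1
    funext s
    exact Fintype.linearIndependent_iff.1 w.linearIndependent d h4 s
  have hevw : ∀ x : Fin m → ℂ, (∀ i, x i ∈ S) →
      (Matrix.of fun i k => ev (x i) ⬝ᵥ (w k : n → ℂ)) =
        (Matrix.of fun i j => g j (x i)) * (Matrix.of c).transpose := by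
    intro x hx
    ext i k
    simp only [Matrix.of_apply, Matrix.mul_apply, Matrix.transpose_apply, hc k _ (hx i)]
    exact Finset.sum_congr rfl fun j _ => mul_comm _ _
  refine ⟨(Matrix.of c).det * (Y * Matrix.of fun t s => B (.inr s) t).det /
    (Q.submatrix e id).det, div_ne_zero (mul_ne_zero hcdet hYB) hQ, ?_, ?_⟩
  · intro x hx
    have hprod : ((Matrix.of (Sum.elim (fun i => ev (x i)) Y)).submatrix id e) *
        (Q.submatrix e id) = Matrix.fromBlocks (Matrix.of fun i k => ev (x i) ⬝ᵥ (w k : n → ℂ))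
          (Matrix.of fun i s => ev (x i) ⬝ᵥ B (.inr s)) 0
          (Y * Matrix.of fun t s => B (.inr s) t) := by
      rw [← Matrix.submatrix_mul _ _ id e id e.bijective]
      ext t s
      rcases t with i | r <;> rcases s with k | s
      · simp [Matrix.mul_apply, dotProduct, Q, hBl]
        rfl
      · simp [Matrix.mul_apply, dotProduct, Q]
        rfl
      · have := congrFun (hwK k) r
        simp only [Matrix.mulVec, dotProduct, Pi.zero_apply] at this
        simp [Matrix.mul_apply, Q, hBl]
        exact this
      · simp [Matrix.mul_apply, Q]
        rfl
    have hdet := congrArg Matrix.det hprod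
    rw [Matrix.det_mul, Matrix.det_fromBlocks_zero₂₁, hevw x hx, Matrix.det_mul,
      Matrix.det_transpose] at hdet
    field_simp
    rw [hdet]
    ring
  · have hli : LinearIndependent ℂ (fun k (x : S') => ev x ⬝ᵥ (w k : n → ℂ)) := by
      have h1 := w.linearIndependent.map' (Φ.domRestrict K) (LinearMap.ker_eq_bot.2 hinj)
      exact h1
    obtain ⟨x, hx⟩ := exists_det_ne_zero _ hli
    refine ⟨fun i => x i, fun i => (x i).2, ?_⟩
    rw [hevw (fun i => x i) fun i => hS (x i).2, Matrix.det_mul] at hx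
    exact left_ne_zero_of_mul hx

/-! ### Families of polynomials with a limit -/

/-- A family of polynomials of bounded degree converges coefficientwise as `ζ → 0`. -/
def PolyTendsto (H : ℂ → Polynomial ℂ) (H₀ : Polynomial ℂ) : Prop :=
  (∃ d, ∀ ζ, (H ζ).natDegree ≤ d) ∧
    ∀ e, Tendsto (fun ζ => (H ζ).coeff e) (𝓝[≠] 0) (𝓝 (H₀.coeff e))

namespace PolyTendsto

variable {H K : ℂ → Polynomial ℂ} {H₀ K₀ : Polynomial ℂ}

lemma const (p : Polynomial ℂ) : PolyTendsto (fun _ => p) p :=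
  ⟨⟨_, fun _ => le_rfl⟩, fun _ => tendsto_const_nhds⟩

lemma C {f : ℂ → ℂ} {l : ℂ} (h : Tendsto f (𝓝[≠] 0) (𝓝 l)) :
    PolyTendsto (fun ζ => Polynomial.C (f ζ)) (Polynomial.C l) := by
  refine ⟨⟨0, fun ζ => by simp⟩, fun e => ?_⟩
  simp only [Polynomial.coeff_C]
  split_ifs
  · exact h
  · exact tendsto_const_nhds

lemma add (h : PolyTendsto H H₀) (k : PolyTendsto K K₀) :
    PolyTendsto (fun ζ => H ζ + K ζ) (H₀ + K₀) := by
  obtain ⟨⟨d, hd⟩, h⟩ := h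
  obtain ⟨⟨d', hd'⟩, k⟩ := k
  refine ⟨⟨max d d', fun ζ => ?_⟩, fun e => ?_⟩
  · exact (Polynomial.natDegree_add_le _ _).trans (max_le_max (hd ζ) (hd' ζ))
  · simp only [Polynomial.coeff_add]
    exact (h e).add (k e)

lemma mul (h : PolyTendsto H H₀) (k : PolyTendsto K K₀) :
    PolyTendsto (fun ζ => H ζ * K ζ) (H₀ * K₀) := by
  obtain ⟨⟨d, hd⟩, h⟩ := h
  obtain ⟨⟨d', hd'⟩, k⟩ := k
  refine ⟨⟨d + d', fun ζ => ?_⟩, fun e => ?_⟩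
  · exact Polynomial.natDegree_mul_le.trans (add_le_add (hd ζ) (hd' ζ))
  · simp only [Polynomial.coeff_mul]
    exact tendsto_finsetSum _ fun q _ => (h _).mul (k _)

lemma sub (h : PolyTendsto H H₀) (k : PolyTendsto K K₀) :
    PolyTendsto (fun ζ => H ζ - K ζ) (H₀ - K₀) := by
  obtain ⟨⟨d, hd⟩, h⟩ := h
  obtain ⟨⟨d', hd'⟩, k⟩ := k
  refine ⟨⟨max d d', fun ζ => ?_⟩, fun e => ?_⟩
  · exact (Polynomial.natDegree_sub_le _ _).trans (max_le_max (hd ζ) (hd' ζ))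
  · simp only [Polynomial.coeff_sub]
    exact (h e).sub (k e)

lemma pow (h : PolyTendsto H H₀) (n : ℕ) : PolyTendsto (fun ζ => H ζ ^ n) (H₀ ^ n) := by
  induction n with
  | zero => simpa using PolyTendsto.const 1
  | succ n ih => simpa only [pow_succ] using ih.mul h

lemma exists_natDegree_le (h : PolyTendsto H H₀) :
    ∃ d, (∀ ζ, (H ζ).natDegree ≤ d) ∧ H₀.natDegree ≤ d := by
  obtain ⟨⟨d, hd⟩, h⟩ := h
  refine ⟨d, hd, ?_⟩
  rw [Polynomial.natDegree_le_iff_coeff_eq_zero]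
  intro e he
  refine tendsto_nhds_unique (h e) ?_
  have : ∀ ζ, (H ζ).coeff e = 0 := fun ζ =>
    Polynomial.coeff_eq_zero_of_natDegree_lt (lt_of_le_of_lt (hd ζ) he)
  simp only [this]
  exact tendsto_const_nhds

/-- Linear functionals are compatible with coefficientwise limits. -/
lemma linear (h : PolyTendsto H H₀) (φ : Polynomial ℂ →ₗ[ℂ] ℂ) :
    Tendsto (fun ζ => φ (H ζ)) (𝓝[≠] 0) (𝓝 (φ H₀)) := by
  obtain ⟨d, hd, hd₀⟩ := h.exists_natDegree_le
  have key : ∀ p : Polynomial ℂ, p.natDegree ≤ d →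
      φ p = ∑ e ∈ Finset.range (d + 1), p.coeff e * φ (Polynomial.X ^ e) := by
    intro p hp
    conv_lhs => rw [p.as_sum_range_C_mul_X_pow' (Nat.lt_succ_of_le hp), map_sum]
    refine Finset.sum_congr rfl fun e _ => ?_
    rw [← Polynomial.smul_eq_C_mul, map_smul, smul_eq_mul]
  rw [key _ hd₀]
  simp only [fun ζ => key _ (hd ζ)]
  exact tendsto_finsetSum _ fun e _ => (h.2 e).mul_const _

lemma eval (h : PolyTendsto H H₀) (x : ℂ) :
    Tendsto (fun ζ => (H ζ).eval x) (𝓝[≠] 0) (𝓝 (H₀.eval x)) :=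
  h.linear (Polynomial.leval x)

lemma comp (h : PolyTendsto H H₀) (p : Polynomial ℂ) :
    PolyTendsto (fun ζ => (H ζ).comp p) (H₀.comp p) := by
  obtain ⟨d, hd, -⟩ := h.exists_natDegree_le
  refine ⟨⟨d * p.natDegree, fun ζ => ?_⟩, fun e => ?_⟩
  · exact Polynomial.natDegree_comp_le.trans (Nat.mul_le_mul_right _ (hd ζ))
  · simp only [Polynomial.comp_eq_aeval]
    exact h.linear ((Polynomial.lcoeff ℂ e).comp (Polynomial.aeval p).toLinearMap)

end PolyTendsto

/-- The linear functional `F ↦ coeff_j (F mod q)`. -/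
def residueCoeff (q : Polynomial ℂ) (j : ℕ) : Polynomial ℂ →ₗ[ℂ] ℂ :=
  (Polynomial.lcoeff ℂ j).comp (Polynomial.modByMonicHom q)

lemma residueCoeff_apply (q : Polynomial ℂ) (j : ℕ) (F : Polynomial ℂ) :
    residueCoeff q j F = (F %ₘ q).coeff j := rfl

lemma residueCoeff_X_pow {q : Polynomial ℂ} (hq : q.Monic) {j i : ℕ} (hi : i < q.natDegree) :
    residueCoeff q j (Polynomial.X ^ i) = if i = j then 1 else 0 := by
  rw [residueCoeff_apply, (Polynomial.modByMonic_eq_self_iff hq).2]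
  · rw [Polynomial.coeff_X_pow]
    simp [eq_comm]
  · rw [Polynomial.degree_X_pow, Polynomial.degree_eq_natDegree hq.ne_zero]
    exact_mod_cast hi

/-- The leading behaviour of a coefficient of the residue of `X ^ e₀ * H ζ (ζ X)`: the first power
of `X` that contributes to this coefficient determines it. -/
lemma PolyTendsto.residueCoeff_scaled {H : ℂ → Polynomial ℂ} {H₀ : Polynomial ℂ}
    (h : PolyTendsto H H₀) (φ : Polynomial ℂ →ₗ[ℂ] ℂ) (e₀ k : ℕ)
    (hk : ∀ i < k, φ (Polynomial.X ^ (e₀ + i)) = 0) :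
    Tendsto (fun ζ => φ (Polynomial.X ^ e₀ * (H ζ).comp (Polynomial.C ζ * Polynomial.X)) / ζ ^ k)
      (𝓝[≠] 0) (𝓝 (H₀.coeff k * φ (Polynomial.X ^ (e₀ + k)))) := by
  obtain ⟨d, hd, hd₀⟩ := h.exists_natDegree_le
  have key : ∀ ζ, φ (Polynomial.X ^ e₀ * (H ζ).comp (Polynomial.C ζ * Polynomial.X)) =
      ∑ i ∈ Finset.range (d + k + 1), (H ζ).coeff i * ζ ^ i * φ (Polynomial.X ^ (e₀ + i)) := by
    intro ζ
    conv_lhs => rw [(H ζ).as_sum_range_C_mul_X_pow'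
      (show (H ζ).natDegree < d + k + 1 by have := hd ζ; omega)]
    rw [Polynomial.sum_comp, Finset.mul_sum, map_sum]
    refine Finset.sum_congr rfl fun i _ => ?_
    have : Polynomial.X ^ e₀ * (Polynomial.C ((H ζ).coeff i) * Polynomial.X ^ i).comp
        (Polynomial.C ζ * Polynomial.X) =
        ((H ζ).coeff i * ζ ^ i) • (Polynomial.X ^ (e₀ + i) : Polynomial ℂ) := by
      rw [Polynomial.smul_eq_C_mul]
      simp only [Polynomial.mul_comp, Polynomial.C_comp, Polynomial.pow_comp, Polynomial.X_comp,
        mul_pow, map_mul, map_pow, pow_add]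
      ring
    rw [this, map_smul, smul_eq_mul]
  have hlim : ∀ i ∈ Finset.range (d + k + 1), Tendsto
      (fun ζ => (H ζ).coeff i * ζ ^ i * φ (Polynomial.X ^ (e₀ + i)) / ζ ^ k) (𝓝[≠] 0)
      (𝓝 (if i = k then H₀.coeff k * φ (Polynomial.X ^ (e₀ + k)) else 0)) := by
    intro i _
    rcases lt_trichotomy i k with hik | rfl | hik
    · simp only [hk i hik, mul_zero, zero_div, hik.ne, if_false]
      exact tendsto_const_nhds
    · simp only [if_true]
      refine ((h.2 i).mul_const _).congr' ?_
      filter_upwards [self_mem_nhdsWithin] with ζ hζ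
      have : ζ ^ i ≠ 0 := pow_ne_zero _ hζ
      field_simp
    · simp only [hik.ne', if_false]
      have h0 : Tendsto (fun ζ : ℂ => ζ ^ (i - k)) (𝓝[≠] 0) (𝓝 0) := by
        have : Tendsto (fun ζ : ℂ => ζ ^ (i - k)) (𝓝 0) (𝓝 (0 ^ (i - k))) :=
          (continuous_pow (i - k)).tendsto 0
        rw [zero_pow (by omega)] at this
        exact this.mono_left nhdsWithin_le_nhds
      have h1 := ((h.2 i).mul h0).mul_const (φ (Polynomial.X ^ (e₀ + i)))
      simp only [mul_zero, zero_mul] at h1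
      refine h1.congr' ?_
      filter_upwards [self_mem_nhdsWithin] with ζ hζ
      have hk0 : ζ ^ k ≠ 0 := pow_ne_zero _ hζ
      have hsplit : ζ ^ i = ζ ^ (i - k) * ζ ^ k := by rw [← pow_add, Nat.sub_add_cancel hik.le]
      rw [eq_div_iff hk0, hsplit]
      ring
  have := tendsto_finsetSum _ hlim
  rw [Finset.sum_ite_eq' (Finset.range (d + k + 1)) k, if_pos (by simp)] at this
  refine this.congr fun ζ => ?_
  rw [key, Finset.sum_div]

/-! ### Orders of vanishing -/

/-- `f(ζ) ~ l ζ^e` as `ζ → 0`; the constant `l` may vanish. -/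
def HasOrder (f : ℂ → ℂ) (e : ℤ) (l : ℂ) : Prop :=
  Tendsto (fun ζ => f ζ / ζ ^ e) (𝓝[≠] 0) (𝓝 l)

namespace HasOrder

variable {f g : ℂ → ℂ} {e e' : ℤ} {l l' : ℂ}

lemma of_tendsto (h : Tendsto f (𝓝[≠] 0) (𝓝 l)) : HasOrder f 0 l := by
  simpa [HasOrder] using h

lemma of_continuousAt (h : ContinuousAt f 0) : HasOrder f 0 (f 0) :=
  of_tendsto (h.tendsto.mono_left nhdsWithin_le_nhds)

lemma congr' (h : HasOrder f e l) (hfg : ∀ᶠ ζ in 𝓝[≠] 0, f ζ = g ζ) : HasOrder g e l :=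
  Tendsto.congr' (hfg.mono fun ζ hζ => by rw [hζ]) h

lemma mul (h : HasOrder f e l) (h' : HasOrder g e' l') :
    HasOrder (fun ζ => f ζ * g ζ) (e + e') (l * l') := by
  refine (Tendsto.mul h h').congr' ?_
  filter_upwards [self_mem_nhdsWithin] with ζ hζ
  rw [zpow_add₀ hζ]
  field_simp

lemma div (h : HasOrder f e l) (h' : HasOrder g e' l') (hl : l' ≠ 0) :
    HasOrder (fun ζ => f ζ / g ζ) (e - e') (l / l') := by
  refine (Tendsto.div h h' hl).congr' ?_
  filter_upwards [self_mem_nhdsWithin] with ζ hζ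
  have := zpow_ne_zero e hζ
  have := zpow_ne_zero e' hζ
  rw [zpow_sub₀ hζ, Pi.div_apply]
  field_simp

lemma const (c : ℂ) : HasOrder (fun _ => c) 0 c := of_tendsto tendsto_const_nhds

lemma zpow_self (n : ℤ) : HasOrder (fun ζ => ζ ^ n) n 1 := by
  refine tendsto_const_nhds.congr' ?_
  filter_upwards [self_mem_nhdsWithin] with ζ hζ
  rw [div_self (zpow_ne_zero n hζ)]

lemma pow (h : HasOrder f e l) (n : ℕ) : HasOrder (fun ζ => f ζ ^ n) (n * e) (l ^ n) := by
  induction n with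
  | zero => simpa using const 1
  | succ n ih =>
    have := ih.mul h
    simp only [pow_succ]
    convert this using 1
    push_cast; ring

lemma prod {ι : Type*} (s : Finset ι) {f : ι → ℂ → ℂ} {e : ι → ℤ} {l : ι → ℂ}
    (h : ∀ i ∈ s, HasOrder (f i) (e i) (l i)) :
    HasOrder (fun ζ => ∏ i ∈ s, f i ζ) (∑ i ∈ s, e i) (∏ i ∈ s, l i) := by
  classical
  induction s using Finset.induction_on with
  | empty => simpa using const 1
  | insert i s hi ih =>
    simp only [Finset.prod_insert hi, Finset.sum_insert hi]
    exact (h i (by simp)).mul (ih fun j hj => h j (by simp [hj]))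

end HasOrder

/-- Determinants of matrices whose entries have orders of the form (row weight) + (column
weight). -/
lemma HasOrder.det {τ : Type*} [Fintype τ] [DecidableEq τ] {M : ℂ → Matrix τ τ ℂ}
    {M₀ : Matrix τ τ ℂ} (rw cw : τ → ℤ)
    (h : ∀ t j, HasOrder (fun ζ => M ζ t j) (rw t + cw j) (M₀ t j)) :
    HasOrder (fun ζ => (M ζ).det) (∑ t, rw t + ∑ j, cw j) M₀.det := by
  simp only [Matrix.det_apply]
  have hterm : ∀ σ : Equiv.Perm τ, Tendsto
      (fun ζ : ℂ => (Equiv.Perm.sign σ • ∏ t, M ζ (σ t) t) / ζ ^ (∑ t, rw t + ∑ j, cw j)) (𝓝[≠] 0)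
      (𝓝 (Equiv.Perm.sign σ • ∏ t, M₀ (σ t) t)) := by
    intro σ
    have h1 := HasOrder.prod Finset.univ fun t _ => h (σ t) t
    have h2 := (HasOrder.const ((Equiv.Perm.sign σ : ℤ) : ℂ)).mul h1
    rw [Finset.sum_add_distrib, Equiv.sum_comp σ rw, zero_add] at h2
    simpa only [HasOrder, Units.smul_def, zsmul_eq_mul] using h2
  refine (tendsto_finsetSum _ fun σ _ => hterm σ).congr fun ζ => ?_
  rw [Finset.sum_div]

/-! ### Sparse polynomials and homogenization -/

/-- A nonzero polynomial with a zero of order `k` at `1` has more than `k` terms. -/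
lemma lt_card_support_of_dvd (k : ℕ) (p : Polynomial ℂ) (hp : p ≠ 0)
    (h : (Polynomial.X - 1) ^ k ∣ p) : k < p.support.card := by
  induction k generalizing p with
  | zero => exact Finset.card_pos.2 (Polynomial.support_nonempty.2 hp)
  | succ k ih =>
    obtain ⟨n, hn⟩ := Polynomial.support_nonempty.2 hp
    -- the operator `X d/dX - n` removes the term of degree `n`
    set q : Polynomial ℂ := Polynomial.X * p.derivative - Polynomial.C (n : ℂ) * p with hq
    have hcoeff : ∀ i, q.coeff i = ((i : ℂ) - n) * p.coeff i := by
      intro i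
      rw [hq, Polynomial.coeff_sub, Polynomial.coeff_C_mul]
      rcases i with _ | i
      · simp
      · rw [Polynomial.coeff_X_mul, Polynomial.coeff_derivative]
        push_cast; ring
    have hsub : q.support ⊆ p.support.erase n := by
      intro i hi
      rw [Polynomial.mem_support_iff, hcoeff] at hi
      rw [Finset.mem_erase, Polynomial.mem_support_iff]
      refine ⟨?_, right_ne_zero_of_mul hi⟩
      rintro rfl
      simp at hi
    have hdvd : (Polynomial.X - 1) ^ k ∣ q := by
      refine dvd_sub (Dvd.dvd.mul_left ?_ _) (Dvd.dvd.mul_left ?_ _)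
      · obtain ⟨r, hr⟩ := h
        have hd : p.derivative = (Polynomial.X - 1) ^ k * (Polynomial.C ((k + 1 : ℕ) : ℂ) * r +
            (Polynomial.X - 1) * r.derivative) := by
          rw [hr, Polynomial.derivative_mul, Polynomial.derivative_pow, Nat.add_sub_cancel,
            Polynomial.derivative_sub, Polynomial.derivative_X, Polynomial.derivative_one]
          ring
        exact ⟨_, hd⟩
      · exact (pow_dvd_pow _ (Nat.le_succ k)).trans h
    have hq0 : q ≠ 0 := by
      intro h0
      have hp' : p = Polynomial.C (p.coeff n) * Polynomial.X ^ n := by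
        ext i
        rw [Polynomial.coeff_C_mul_X_pow]
        split_ifs with hin
        · rw [hin]
        · have := hcoeff i
          rw [h0, Polynomial.coeff_zero] at this
          rcases mul_eq_zero.1 this.symm with h1 | h1
          · exact absurd (by exact_mod_cast sub_eq_zero.1 h1) hin
          · exact h1
      have h1 : p.eval 1 = 0 := by
        obtain ⟨r, hr⟩ := h
        rw [hr]; simp
      rw [hp'] at h1
      simp at h1
      exact (Polynomial.mem_support_iff.1 hn) h1
    have := ih q hq0 hdvd
    have hcard := Finset.card_le_card hsub
    rw [Finset.card_erase_of_mem hn] at hcard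
    omega

/-- The homogenization `L₂ ^ D * F (L₁ / L₂)` of `F`. -/
def homog (D : ℕ) (F L₁ L₂ : Polynomial ℂ) : Polynomial ℂ :=
  ∑ i ∈ Finset.range (D + 1), Polynomial.C (F.coeff i) * L₁ ^ i * L₂ ^ (D - i)

lemma eval_homog {D : ℕ} {F L₁ L₂ : Polynomial ℂ} (hF : F.natDegree ≤ D) {v : ℂ}
    (hv : L₂.eval v ≠ 0) :
    (homog D F L₁ L₂).eval v = L₂.eval v ^ D * F.eval (L₁.eval v / L₂.eval v) := by
  rw [Polynomial.eval_eq_sum_range' (Nat.lt_succ_of_le hF), homog, Polynomial.eval_finsetSum,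
    Finset.mul_sum]
  refine Finset.sum_congr rfl fun i hi => ?_
  have hi' : i ≤ D := by simpa [Nat.lt_succ_iff] using hi
  have hsplit : L₂.eval v ^ D = L₂.eval v ^ (D - i) * L₂.eval v ^ i := by
    rw [← pow_add, Nat.sub_add_cancel hi']
  simp only [Polynomial.eval_mul, Polynomial.eval_C, Polynomial.eval_pow]
  rw [hsplit, div_pow]
  have := pow_ne_zero i hv
  field_simp

lemma natDegree_homog_le {D : ℕ} {F L₁ L₂ : Polynomial ℂ} {k₁ k₂ k : ℕ} (h₁ : L₁.natDegree ≤ k₁)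
    (h₂ : L₂.natDegree ≤ k₂) (hk₁ : k₁ ≤ k) (hk₂ : k₂ ≤ k) :
    (homog D F L₁ L₂).natDegree ≤ D * k := by
  refine Polynomial.natDegree_sum_le_of_forall_le _ _ fun i hi => ?_
  have hi' : i ≤ D := by simpa [Nat.lt_succ_iff] using hi
  refine Polynomial.natDegree_mul_le.trans ?_
  refine (add_le_add ((Polynomial.natDegree_C_mul_le _ _).trans Polynomial.natDegree_pow_le)
    Polynomial.natDegree_pow_le).trans ?_
  calc i * L₁.natDegree + (D - i) * L₂.natDegree ≤ i * k + (D - i) * k :=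
        add_le_add (Nat.mul_le_mul_left _ (h₁.trans hk₁)) (Nat.mul_le_mul_left _ (h₂.trans hk₂))
    _ = D * k := by rw [← add_mul, Nat.add_sub_cancel' hi']

/-- Polynomials that agree outside a finite set are equal. -/
lemma eq_of_eval_eq_off (s : Finset ℂ) {p q : Polynomial ℂ}
    (h : ∀ v, v ∉ s → p.eval v = q.eval v) : p = q :=
  Polynomial.eq_of_infinite_eval_eq p q
    ((s.finite_toSet.infinite_compl).mono fun v hv => h v (by simpa using hv))

lemma homog_one_X_sub_one {D p q : ℕ} {G : Polynomial ℂ} (hG : G.natDegree ≤ D) :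
    homog (D + p + q) (Polynomial.X ^ p * (Polynomial.X + 1) ^ q * G) 1 (Polynomial.X - 1) =
      Polynomial.X ^ q * homog D G 1 (Polynomial.X - 1) := by
  refine eq_of_eval_eq_off {1} fun v hv => ?_
  have hv1 : v - 1 ≠ 0 := by simpa [sub_eq_zero] using hv
  have hd : (Polynomial.X ^ p * (Polynomial.X + 1) ^ q * G).natDegree ≤ D + p + q := by
    refine Polynomial.natDegree_mul_le.trans ?_
    have h1 : (Polynomial.X ^ p * (Polynomial.X + 1) ^ q : Polynomial ℂ).natDegree ≤ p + q := by
      refine Polynomial.natDegree_mul_le.trans (add_le_add (by simp) ?_)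
      refine Polynomial.natDegree_pow_le.trans ?_
      rw [show (Polynomial.X + 1 : Polynomial ℂ) = Polynomial.X + Polynomial.C 1 by simp,
        Polynomial.natDegree_X_add_C, mul_one]
    omega
  have hR : (Polynomial.X ^ q * homog D G 1 (Polynomial.X - 1)).eval v =
      v ^ q * ((v - 1) ^ D * G.eval (1 / (v - 1))) := by
    rw [Polynomial.eval_mul, eval_homog hG (by simpa using hv1)]
    simp
  rw [eval_homog hd (by simpa using hv1), hR]
  simp only [Polynomial.eval_mul, Polynomial.eval_pow, Polynomial.eval_X, Polynomial.eval_add,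
    Polynomial.eval_one, Polynomial.eval_sub]
  have : 1 / (v - 1) + 1 = v / (v - 1) := by field_simp; ring
  rw [this, div_pow, div_pow, one_pow, pow_add, pow_add]
  field_simp

lemma eq_zero_of_homog_eq_zero {D : ℕ} {F : Polynomial ℂ} (hF : F.natDegree ≤ D)
    (h : homog D F 1 (Polynomial.X - 1) = 0) : F = 0 := by
  refine eq_of_eval_eq_off {0} fun v hv => ?_
  have hv0 : v ≠ 0 := by simpa using hv
  have h1 : (Polynomial.X - 1 : Polynomial ℂ).eval (1 / v + 1) = 1 / v := by simp
  have h2 := eval_homog (L₁ := 1) (L₂ := Polynomial.X - 1) (v := 1 / v + 1) hF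
    (by rw [h1]; exact one_div_ne_zero hv0)
  rw [h, h1] at h2
  simp only [Polynomial.eval_zero, Polynomial.eval_one, one_div_one_div] at h2
  simpa [hv0] using h2.symm

lemma homog_mul {D₁ D₂ : ℕ} {F G L₁ L₂ : Polynomial ℂ} (hL : L₂ ≠ 0) (hF : F.natDegree ≤ D₁)
    (hG : G.natDegree ≤ D₂) :
    homog (D₁ + D₂) (F * G) L₁ L₂ = homog D₁ F L₁ L₂ * homog D₂ G L₁ L₂ := by
  classical
  refine eq_of_eval_eq_off L₂.roots.toFinset fun v hv => ?_
  have hv' : L₂.eval v ≠ 0 := by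
    intro h
    exact hv (by simp [hL, h])
  rw [eval_homog (Polynomial.natDegree_mul_le.trans (add_le_add hF hG)) hv', Polynomial.eval_mul,
    Polynomial.eval_mul, eval_homog hF hv', eval_homog hG hv', pow_add]
  ring

lemma pow_dvd_homog {D K : ℕ} {F : Polynomial ℂ} (L₁ L₂ : Polynomial ℂ)
    (h : Polynomial.X ^ K ∣ F) : L₁ ^ K ∣ homog D F L₁ L₂ := by
  rw [Polynomial.X_pow_dvd_iff] at h
  refine Finset.dvd_sum fun i _ => ?_
  rcases lt_or_ge i K with hi | hi
  · simp [h i hi]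
  · exact ((pow_dvd_pow L₁ hi).mul_left _).mul_right _

/-- The number of terms drops by one for every zero of `F` at `0` or `-1`. -/
lemma card_support_homog_le {D p q : ℕ} {F : Polynomial ℂ} (hF : F.natDegree ≤ D)
    (h : Polynomial.X ^ p * (Polynomial.X + 1) ^ q ∣ F) :
    (homog D F 1 (Polynomial.X - 1)).support.card ≤ D + 1 - p - q := by
  obtain ⟨G, rfl⟩ := h
  rcases eq_or_ne G 0 with rfl | hG
  · simp [homog]
  have hX1 : (Polynomial.X + 1 : Polynomial ℂ) = Polynomial.X + Polynomial.C 1 := by simp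
  have hm : (Polynomial.X ^ p * (Polynomial.X + 1) ^ q : Polynomial ℂ).Monic := by
    rw [hX1]
    exact (Polynomial.monic_X_pow p).mul ((Polynomial.monic_X_add_C 1).pow q)
  have hdeg : (Polynomial.X ^ p * (Polynomial.X + 1) ^ q : Polynomial ℂ).natDegree = p + q := by
    rw [hX1, (Polynomial.monic_X_pow p).natDegree_mul ((Polynomial.monic_X_add_C 1).pow q),
      (Polynomial.monic_X_add_C 1).natDegree_pow,
      Polynomial.natDegree_X_pow, Polynomial.natDegree_X_add_C, mul_one]
  rw [hm.natDegree_mul' hG, hdeg] at hF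
  obtain ⟨D', rfl⟩ : ∃ D', D = D' + p + q := ⟨D - p - q, by omega⟩
  have hG' : G.natDegree ≤ D' := by omega
  rw [homog_one_X_sub_one hG']
  have hh : (homog D' G 1 (Polynomial.X - 1)).natDegree ≤ D' := by
    have := natDegree_homog_le (D := D') (F := G) (L₁ := (1 : Polynomial ℂ))
      (L₂ := Polynomial.X - 1) (k₁ := 0) (k₂ := 1) (k := 1) (by simp)
      (by rw [← Polynomial.C_1, Polynomial.natDegree_X_sub_C]) (by simp) le_rfl
    simpa using this
  have hsub : (Polynomial.X ^ q * homog D' G 1 (Polynomial.X - 1)).support ⊆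
      (Finset.range (D' + 1)).image (· + q) := by
    intro i hi
    rw [Polynomial.mem_support_iff, Polynomial.coeff_X_pow_mul'] at hi
    split_ifs at hi with hqi
    · have := (Polynomial.le_natDegree_of_ne_zero hi).trans hh
      exact Finset.mem_image.2 ⟨i - q, Finset.mem_range.2 (by omega), Nat.sub_add_cancel hqi⟩
    · exact absurd rfl hi
  have := (Finset.card_le_card hsub).trans Finset.card_image_le
  rw [Finset.card_range] at this
  omega

lemma card_support_expand_two (Q : Polynomial ℂ) :
    (Polynomial.expand ℂ 2 Q).support.card ≤ Q.support.card := by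
  refine (Finset.card_le_card (t := Q.support.image (· * 2)) ?_).trans Finset.card_image_le
  intro i hi
  rw [Polynomial.mem_support_iff, Polynomial.coeff_expand two_pos] at hi
  split_ifs at hi with h
  · exact Finset.mem_image.2 ⟨i / 2, Polynomial.mem_support_iff.2 hi, Nat.div_mul_cancel h⟩
  · exact absurd rfl hi

lemma card_support_X_mul (Q : Polynomial ℂ) :
    (Polynomial.X * Q).support.card ≤ Q.support.card := by
  refine (Finset.card_le_card (t := Q.support.image (· + 1)) ?_).trans Finset.card_image_le
  intro i hi
  rw [Polynomial.mem_support_iff] at hi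
  rcases i with _ | i
  · simp at hi
  · rw [Polynomial.coeff_X_mul] at hi
    exact Finset.mem_image.2 ⟨i, Polynomial.mem_support_iff.2 hi, rfl⟩

lemma expand_two_add_X_mul_eq_zero {Q R : Polynomial ℂ}
    (h : Polynomial.expand ℂ 2 Q + Polynomial.X * Polynomial.expand ℂ 2 R = 0) :
    Q = 0 ∧ R = 0 := by
  constructor
  · ext i
    have := congrArg (fun p => p.coeff (2 * i)) h
    simp only [Polynomial.coeff_add, Polynomial.coeff_zero] at this
    rw [Polynomial.coeff_expand two_pos, if_pos (Dvd.intro _ rfl),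
      Nat.mul_div_cancel_left _ two_pos] at this
    rcases i with _ | i
    · simpa using this
    · rw [show 2 * (i + 1) = 2 * i + 1 + 1 by ring, Polynomial.coeff_X_mul,
        Polynomial.coeff_expand two_pos, if_neg (by omega), add_zero] at this
      simpa using this
  · ext i
    have := congrArg (fun p => p.coeff (2 * i + 1)) h
    simp only [Polynomial.coeff_add, Polynomial.coeff_zero] at this
    rw [Polynomial.coeff_X_mul, Polynomial.coeff_expand two_pos, if_neg (by omega), zero_add,
      Polynomial.coeff_expand two_pos, if_pos (Dvd.intro _ rfl),
      Nat.mul_div_cancel_left _ two_pos] at this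
    simpa using this

/-- A two-point Padé problem without nonzero solutions. With `σ = (1 - v) / (1 + v)` the
combination that vanishes at `σ = 0` becomes, up to a power of `1 + v`, the polynomial
`Q (v ^ 2) + v * R (v ^ 2)`; this polynomial has a zero of high order at `v = 1`, while the
zeros prescribed for `β` and `α - X β` leave it with too few terms. -/
theorem pade_eq_zero {P c0 c3 d0 d3 K : ℕ} {α β : Polynomial ℂ} (hα : α.natDegree ≤ P)
    (hβ : β.degree < P)
    (hβd : Polynomial.X ^ c0 * (Polynomial.X + 1) ^ c3 ∣ β)
    (hαd : Polynomial.X ^ d0 * (Polynomial.X + 1) ^ d3 ∣ α - Polynomial.X * β)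
    (hc : c0 + c3 ≤ P) (hd : d0 + d3 ≤ P + 1) (hK : K + (c0 + c3) + (d0 + d3) = 2 * P + 1)
    (hΨ : Polynomial.X ^ K ∣
      homog P α (Polynomial.C (-1 / 4) * (1 + Polynomial.X) ^ 2) Polynomial.X +
        Polynomial.C (1 / 2) * (1 + Polynomial.X) *
          homog P β (Polynomial.C (-1 / 4) * (1 + Polynomial.X) ^ 2) Polynomial.X) :
    α = 0 ∧ β = 0 := by
  classical
  set q : Polynomial ℂ := Polynomial.C (-1 / 4) * (1 + Polynomial.X) ^ 2 with hq
  set Ψ := homog P α q Polynomial.X +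
    Polynomial.C (1 / 2) * (1 + Polynomial.X) * homog P β q Polynomial.X with hΨdef
  set Q := homog P (α - Polynomial.X * β) 1 (Polynomial.X - 1) with hQ
  set R := homog (P - 1) β 1 (Polynomial.X - 1) with hR
  have hβn : β = 0 ∨ β.natDegree + 1 ≤ P := by
    rcases eq_or_ne β 0 with h | h
    · exact Or.inl h
    · exact Or.inr (by rw [Polynomial.degree_eq_natDegree h] at hβ; exact_mod_cast hβ)
  have hβ1 : β.natDegree ≤ P - 1 := by
    rcases hβn with h | h
    · simp [h]
    · omega
  have hβP : β.natDegree ≤ P := hβ1.trans (Nat.sub_le _ _)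
  have hαβ : (α - Polynomial.X * β).natDegree ≤ P := by
    refine (Polynomial.natDegree_sub_le _ _).trans (max_le hα ?_)
    rcases hβn with h | h
    · simp [h]
    · exact Polynomial.natDegree_mul_le.trans (by rw [Polynomial.natDegree_X]; omega)
  have hqdeg : q.natDegree ≤ 2 := by
    refine (Polynomial.natDegree_C_mul_le _ _).trans (Polynomial.natDegree_pow_le.trans ?_)
    have : (1 + Polynomial.X : Polynomial ℂ).natDegree ≤ 1 := by
      rw [add_comm, ← Polynomial.C_1, Polynomial.natDegree_X_add_C]
    omega
  have hΨdeg : Ψ.natDegree ≤ 2 * P := by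
    refine (Polynomial.natDegree_add_le _ _).trans (max_le ?_ ?_)
    · have := natDegree_homog_le (D := P) (F := α) (k := 2) hqdeg
        (Polynomial.natDegree_X (R := ℂ)).le le_rfl (by norm_num)
      omega
    · rcases hβn with h | h
      · simp [h, homog]
      · rw [show P = (P - 1) + 1 by omega]
        have h1 : homog (P - 1 + 1) β q Polynomial.X =
            homog (P - 1) β q Polynomial.X * Polynomial.X := by
          have := homog_mul (L₁ := q) Polynomial.X_ne_zero hβ1
            (G := 1) (D₂ := 1) (by simp)
          rw [mul_one] at this
          rw [this]
          congr 1
          simp [homog, Polynomial.coeff_one]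
        have h2 := natDegree_homog_le (D := P - 1) (F := β) (k := 2) hqdeg
          (Polynomial.natDegree_X (R := ℂ)).le le_rfl (by norm_num)
        rw [h1]
        have h3 : (1 + Polynomial.X : Polynomial ℂ).natDegree ≤ 1 := by
          rw [add_comm, ← Polynomial.C_1, Polynomial.natDegree_X_add_C]
        refine Polynomial.natDegree_mul_le.trans ((add_le_add
          ((Polynomial.natDegree_C_mul_le _ _).trans h3) Polynomial.natDegree_mul_le).trans ?_)
        rw [Polynomial.natDegree_X]
        omega
  -- At `σ = (1 - v) / (1 + v)` one has `q (σ) / σ = 1 / (v ^ 2 - 1)`.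
  set Θ := Polynomial.expand ℂ 2 Q + Polynomial.X * Polynomial.expand ℂ 2 R with hΘ
  have key : homog (2 * P) Ψ (1 - Polynomial.X) (1 + Polynomial.X) =
      Polynomial.C ((-1) ^ P) * Θ := by
    refine eq_of_eval_eq_off {1, -1} fun v hv => ?_
    simp only [Finset.mem_insert, Finset.mem_singleton, not_or] at hv
    have hv1 : v - 1 ≠ 0 := sub_ne_zero.2 hv.1
    have hv2 : 1 + v ≠ 0 := by
      intro h
      exact hv.2 (by linear_combination h)
    have hv3 : v ^ 2 - 1 ≠ 0 := by
      rw [show v ^ 2 - 1 = (v - 1) * (1 + v) by ring]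
      exact mul_ne_zero hv1 hv2
    have hσ : (1 - v) / (1 + v) ≠ 0 := by
      refine div_ne_zero ?_ hv2
      intro h
      exact hv1 (by linear_combination -h)
    have hσX : (Polynomial.X : Polynomial ℂ).eval ((1 - v) / (1 + v)) ≠ 0 := by simpa using hσ
    rw [eval_homog hΨdeg (by simpa using hv2)]
    simp only [Polynomial.eval_add, Polynomial.eval_sub, Polynomial.eval_one, Polynomial.eval_X]
    rw [hΨdef, Polynomial.eval_add, Polynomial.eval_mul, eval_homog hα hσX, eval_homog hβP hσX]
    have hω : q.eval ((1 - v) / (1 + v)) / (Polynomial.X : Polynomial ℂ).eval ((1 - v) / (1 + v)) =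
        1 / (v ^ 2 - 1) := by
      rw [hq]
      simp only [Polynomial.eval_mul, Polynomial.eval_C, Polynomial.eval_pow, Polynomial.eval_add,
        Polynomial.eval_one, Polynomial.eval_X]
      have hv4 : (1 : ℂ) - v ≠ 0 := by
        intro h
        exact hv1 (by linear_combination -h)
      field_simp
      ring
    have hΘe : Θ.eval v = (v ^ 2 - 1) ^ P * (α - Polynomial.X * β).eval (1 / (v ^ 2 - 1)) +
        v * ((v ^ 2 - 1) ^ (P - 1) * β.eval (1 / (v ^ 2 - 1))) := by
      rw [hΘ, Polynomial.eval_add, Polynomial.eval_mul, Polynomial.expand_eval,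
        Polynomial.expand_eval, hQ, hR, eval_homog hαβ (by simpa using hv3),
        eval_homog hβ1 (by simpa using hv3)]
      simp
    rw [hω, Polynomial.eval_mul (p := Polynomial.C ((-1) ^ P)), hΘe]
    simp only [Polynomial.eval_mul, Polynomial.eval_C, Polynomial.eval_add,
        Polynomial.eval_one, Polynomial.eval_X, Polynomial.eval_sub]
    have hP : (1 + v) ^ (2 * P) * ((1 - v) / (1 + v)) ^ P = (-1) ^ P * (v ^ 2 - 1) ^ P := by
      rw [pow_mul, ← mul_pow, ← mul_pow]
      congr 1
      field_simp
      ring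
    rcases hβn with h | h
    · subst h
      simp only [Polynomial.eval_zero, mul_zero, add_zero, sub_zero]
      rw [← mul_assoc, hP]
      ring
    · have hP1 : (v ^ 2 - 1) ^ P = (v ^ 2 - 1) ^ (P - 1) * (v ^ 2 - 1) := by
        rw [← pow_succ, Nat.sub_add_cancel (by omega)]
      calc _ = (1 + v) ^ (2 * P) * ((1 - v) / (1 + v)) ^ P * (α.eval (1 / (v ^ 2 - 1)) +
            1 / 2 * (1 + (1 - v) / (1 + v)) * β.eval (1 / (v ^ 2 - 1))) := by ring
        _ = _ := by
          rw [hP, hP1]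
          have : 1 / 2 * (1 + (1 - v) / (1 + v)) = (v - 1) / (v ^ 2 - 1) := by
            rw [show v ^ 2 - 1 = (v - 1) * (1 + v) by ring]
            field_simp
            ring
          rw [this]
          field_simp
          ring
  have hdvd : (Polynomial.X - 1) ^ K ∣ Θ := by
    have h1 := pow_dvd_homog (D := 2 * P) (1 - Polynomial.X) (1 + Polynomial.X) hΨ
    rw [key] at h1
    have h2 : (1 - Polynomial.X : Polynomial ℂ) ^ K = (-1) ^ K * (Polynomial.X - 1) ^ K := by
      rw [← mul_pow]; ring
    rw [h2] at h1
    have h3 := (Dvd.intro_left _ rfl).trans h1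
    have hu : IsUnit (Polynomial.C ((-1 : ℂ) ^ P)) := by
      rw [Polynomial.isUnit_C]
      exact (IsUnit.mk0 _ (pow_ne_zero _ (by norm_num)))
    exact (hu.dvd_mul_left).1 h3
  -- `Q` and `R` have at most `P + 1 - (d0 + d3)` and `P - (c0 + c3)` terms.
  have hcard : Θ.support.card ≤ K := by
    have h1 := card_support_homog_le hαβ hαd
    have h2 : R.support.card ≤ P - c0 - c3 := by
      rcases hβn with h | h
      · simp [hR, h, homog]
      · have := card_support_homog_le hβ1 hβd
        rw [← hR] at this
        omega
    have h3 : Θ.support.card ≤ Q.support.card + R.support.card :=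
      (Finset.card_le_card Polynomial.support_add).trans ((Finset.card_union_le _ _).trans
        (add_le_add (card_support_expand_two _)
          ((card_support_X_mul _).trans (card_support_expand_two _))))
    rw [← hQ] at h1
    omega
  have hΘ0 : Θ = 0 := by
    by_contra h
    exact absurd (lt_card_support_of_dvd K Θ h hdvd) (not_lt.2 hcard)
  obtain ⟨h1, h2⟩ := expand_two_add_X_mul_eq_zero hΘ0
  have hβ0 := eq_zero_of_homog_eq_zero hβ1 h2
  have hα0 := eq_zero_of_homog_eq_zero hαβ h1
  rw [hβ0, mul_zero, sub_zero] at hα0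
  exact ⟨hα0, hβ0⟩

/-- Passing from the coordinate `s` to `T` with `s = 2 / (1 - T)`, zeros at `s = 0` lower the
degree in `T` and zeros at `s = 2` become zeros at `T = 0`. -/
lemma coeff_comp_eq_zero_of_dvd_homog {D p q : ℕ} {F : Polynomial ℂ} (hF : F.natDegree ≤ D)
    (h : Polynomial.X ^ p * (Polynomial.X - Polynomial.C 2) ^ q ∣
      homog D F (Polynomial.C (-1 / 4)) Polynomial.X) {i : ℕ} (hi : i < q ∨ D < i + p) :
    (F.comp (Polynomial.C (1 / 8) * (Polynomial.X - 1))).coeff i = 0 := by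
  obtain ⟨R, hR⟩ := h
  have hFe : ∀ t : ℂ, t ≠ 1 → (F.comp (Polynomial.C (1 / 8) * (Polynomial.X - 1))).eval t =
      ((1 - t) / 2) ^ D *
        (homog D F (Polynomial.C (-1 / 4)) Polynomial.X).eval (2 / (1 - t)) := by
    intro t ht
    have ht' : 1 - t ≠ 0 := sub_ne_zero.2 (Ne.symm ht)
    rw [eval_homog hF (by simpa using ht'), ← mul_assoc, ← mul_pow, Polynomial.eval_comp]
    simp only [Polynomial.eval_mul, Polynomial.eval_C, Polynomial.eval_sub, Polynomial.eval_X,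
      Polynomial.eval_one]
    rw [show (1 - t) / 2 * (2 / (1 - t)) = 1 by field_simp, one_pow, one_mul]
    congr 1
    field_simp
    ring
  rcases eq_or_ne R 0 with rfl | hR0
  · rw [mul_zero] at hR
    have : F.comp (Polynomial.C (1 / 8) * (Polynomial.X - 1)) = 0 := by
      refine eq_of_eval_eq_off {1} fun t ht => ?_
      rw [hFe t (by simpa using ht), hR]
      simp
    rw [this, Polynomial.coeff_zero]
  have hm : (Polynomial.X ^ p * (Polynomial.X - Polynomial.C 2) ^ q : Polynomial ℂ).Monic :=
    (Polynomial.monic_X_pow p).mul ((Polynomial.monic_X_sub_C 2).pow q)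
  have hdeg : (Polynomial.X ^ p * (Polynomial.X - Polynomial.C 2) ^ q : Polynomial ℂ).natDegree =
      p + q := by
    rw [(Polynomial.monic_X_pow p).natDegree_mul ((Polynomial.monic_X_sub_C 2).pow q),
      (Polynomial.monic_X_sub_C 2).natDegree_pow, Polynomial.natDegree_X_pow,
      Polynomial.natDegree_X_sub_C, mul_one]
  have hHD := natDegree_homog_le (D := D) (F := F) (L₁ := Polynomial.C (-1 / 4))
    (Polynomial.natDegree_C _).le (Polynomial.natDegree_X (R := ℂ)).le zero_le_one le_rfl
  rw [hR, hm.natDegree_mul' hR0, hdeg, mul_one] at hHD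
  obtain ⟨D', rfl⟩ : ∃ D', D = D' + p + q := ⟨D - p - q, by omega⟩
  have hR' : R.natDegree ≤ D' := by omega
  have hX1 : (1 - Polynomial.X : Polynomial ℂ).natDegree ≤ 1 := by
    rw [← Polynomial.C_1, ← Polynomial.natDegree_neg, neg_sub, Polynomial.natDegree_X_sub_C]
  have key : F.comp (Polynomial.C (1 / 8) * (Polynomial.X - 1)) =
      Polynomial.C ((1 / 2) ^ D') *
        (homog D' R (Polynomial.C 2) (1 - Polynomial.X) * Polynomial.X ^ q) := by
    refine eq_of_eval_eq_off {1} fun t ht => ?_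
    have ht1 : t ≠ 1 := by simpa using ht
    have ht' : 1 - t ≠ 0 := sub_ne_zero.2 (Ne.symm ht1)
    rw [hFe t ht1, hR]
    have hRe : (homog D' R (Polynomial.C 2) (1 - Polynomial.X)).eval t =
        (1 - t) ^ D' * R.eval (2 / (1 - t)) := by
      rw [eval_homog hR' (by simpa using ht')]
      simp
    simp only [Polynomial.eval_mul, Polynomial.eval_C, Polynomial.eval_pow, Polynomial.eval_X,
      Polynomial.eval_sub, hRe]
    rw [show (2 : ℂ) / (1 - t) - 2 = 2 * t / (1 - t) by field_simp; ring]
    rw [pow_add, pow_add]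
    simp only [div_pow, mul_pow, one_pow]
    field_simp
  rw [key, Polynomial.coeff_C_mul]
  refine mul_eq_zero_of_right _ ?_
  rw [Polynomial.coeff_mul_X_pow']
  split_ifs with hqi
  · refine Polynomial.coeff_eq_zero_of_natDegree_lt ?_
    have := natDegree_homog_le (D := D') (F := R) (L₁ := Polynomial.C 2)
      (Polynomial.natDegree_C _).le hX1 zero_le_one le_rfl
    omega
  · rfl

lemma homog_X_one_add {R : ℕ} {h : Polynomial ℂ} (hh : h.natDegree ≤ R) :
    homog R (homog R h Polynomial.X (1 - Polynomial.X)) Polynomial.X (1 + Polynomial.X) = h := by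
  have hX1 : (1 - Polynomial.X : Polynomial ℂ).natDegree ≤ 1 := by
    rw [← Polynomial.C_1, ← Polynomial.natDegree_neg, neg_sub, Polynomial.natDegree_X_sub_C]
  have hd := natDegree_homog_le (D := R) (F := h)
    (Polynomial.natDegree_X (R := ℂ)).le hX1 le_rfl le_rfl
  rw [mul_one] at hd
  refine eq_of_eval_eq_off {-1} fun t ht => ?_
  have ht' : 1 + t ≠ 0 := by
    intro h0
    exact ht (by simp; linear_combination h0)
  have h1 : 1 - t / (1 + t) = 1 / (1 + t) := by field_simp; ring
  have h2 : (1 - Polynomial.X : Polynomial ℂ).eval (t / (1 + t)) = 1 / (1 + t) := by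
    simpa using h1
  rw [eval_homog hd (by simpa using ht')]
  simp only [Polynomial.eval_add, Polynomial.eval_one, Polynomial.eval_X]
  rw [eval_homog hh (by rw [h2]; exact one_div_ne_zero ht'), h2, ← mul_assoc, ← mul_pow]
  rw [show (1 + t) * (1 / (1 + t)) = 1 by field_simp, one_pow, one_mul, Polynomial.eval_X]
  congr 1
  field_simp

/-- The coefficients of a polynomial of degree at most `M` with a zero of order `q` at `-1` are
`p(λ) * binom(M, λ)` for a polynomial `p` of degree at most `M - q`. -/
lemma exists_coeff_eq_choose_mul {M q : ℕ} (hq : q ≤ M) {h : Polynomial ℂ} (hh : h.natDegree ≤ M)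
    (hd : (Polynomial.X + 1) ^ q ∣ h) :
    ∃ p : Polynomial ℂ, p.natDegree ≤ M - q ∧
      ∀ l : ℕ, l ≤ M → h.coeff l = p.eval (l : ℂ) * (M.choose l : ℂ) := by
  obtain ⟨h₁, rfl⟩ := hd
  have hX1 : (Polynomial.X + 1 : Polynomial ℂ) = Polynomial.X + Polynomial.C 1 := by simp
  have hh₁ : h₁.natDegree ≤ M - q := by
    rcases eq_or_ne h₁ 0 with h0 | h0
    · simp [h0]
    · have hm : ((Polynomial.X + 1) ^ q : Polynomial ℂ).Monic := by
        rw [hX1]; exact (Polynomial.monic_X_add_C 1).pow q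
      rw [hm.natDegree_mul' h0, hX1, (Polynomial.monic_X_add_C 1).natDegree_pow,
        Polynomial.natDegree_X_add_C] at hh
      omega
  set a := homog (M - q) h₁ Polynomial.X (1 - Polynomial.X) with ha
  have hexp := homog_X_one_add hh₁
  rw [← ha] at hexp
  refine ⟨∑ k ∈ Finset.range (M - q + 1),
    Polynomial.C (a.coeff k / (M.choose k * k.factorial : ℂ)) * descPochhammer ℂ k, ?_, ?_⟩
  · refine Polynomial.natDegree_sum_le_of_forall_le _ _ fun k hk => ?_
    refine (Polynomial.natDegree_C_mul_le _ _).trans ?_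
    rw [descPochhammer_natDegree]
    simpa [Nat.lt_succ_iff] using hk
  · intro l hl
    rw [← hexp, homog, Finset.mul_sum, Polynomial.finsetSum_coeff, Polynomial.eval_finsetSum,
      Finset.sum_mul]
    refine Finset.sum_congr rfl fun k hk => ?_
    have hk' : k ≤ M - q := by simpa [Nat.lt_succ_iff] using hk
    have hpow : (Polynomial.X + 1 : Polynomial ℂ) ^ q *
        (Polynomial.C (a.coeff k) * Polynomial.X ^ k * (1 + Polynomial.X) ^ (M - q - k)) =
        Polynomial.C (a.coeff k) * ((1 + Polynomial.X) ^ (M - k) * Polynomial.X ^ k) := by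
      rw [show M - k = q + (M - q - k) by omega, pow_add, add_comm (1 : Polynomial ℂ)]
      ring
    rw [hpow, Polynomial.coeff_C_mul, Polynomial.coeff_mul_X_pow', Polynomial.eval_mul,
      Polynomial.eval_C, descPochhammer_eval_eq_descFactorial, Nat.descFactorial_eq_factorial_mul_choose]
    have hMk : (M.choose k : ℂ) ≠ 0 := by
      exact_mod_cast (Nat.choose_pos (by omega)).ne'
    have hkf : (k.factorial : ℂ) ≠ 0 := by exact_mod_cast k.factorial_ne_zero
    split_ifs with hkl
    · rw [Polynomial.coeff_one_add_X_pow]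
      have hc : (M.choose l : ℂ) * l.choose k = M.choose k * (M - k).choose (l - k) := by
        exact_mod_cast Nat.choose_mul hkl
      push_cast
      field_simp
      linear_combination -(a.coeff k) * hc
    · rw [Nat.choose_eq_zero_of_lt (show l < k by omega)]
      simp

/-- If moreover the coefficients with index in `J` vanish, then `p` is divisible by
`∏_{μ ∈ J} (λ - μ)`. -/
theorem exists_coeff_eq_sum_pow {M q m : ℕ} {h : Polynomial ℂ} (hh : h.natDegree ≤ M)
    (hd : (Polynomial.X + 1) ^ q ∣ h) (J : Finset ℕ) (hJ : ∀ μ ∈ J, μ ≤ M ∧ h.coeff μ = 0)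
    (hcard : M + 1 ≤ q + m + J.card) :
    ∃ c : Fin m → ℂ, ∀ l : ℕ, l ≤ M → h.coeff l =
      (∑ j, c j * (l : ℂ) ^ (j : ℕ)) * ((M.choose l : ℂ) * ∏ μ ∈ J, ((l : ℂ) - μ)) := by
  by_cases hz : h = 0
  · exact ⟨0, fun l _ => by simp [hz]⟩
  have hX1 : (Polynomial.X + 1 : Polynomial ℂ) = Polynomial.X + Polynomial.C 1 := by simp
  have hq : q ≤ M := by
    have := Polynomial.natDegree_le_of_dvd hd hz
    rw [hX1, (Polynomial.monic_X_add_C 1).natDegree_pow, Polynomial.natDegree_X_add_C] at this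
    omega
  obtain ⟨p, hp, hpc⟩ := exists_coeff_eq_choose_mul hq hh hd
  have hdvd : ∏ μ ∈ J, (Polynomial.X - Polynomial.C (μ : ℂ)) ∣ p := by
    refine Finset.prod_dvd_of_coprime ?_ ?_
    · intro i _ j _ hij
      exact Polynomial.isCoprime_X_sub_C_of_isUnit_sub
        (sub_ne_zero.2 (by exact_mod_cast hij)).isUnit
    · intro μ hμ
      rw [Polynomial.dvd_iff_isRoot, Polynomial.IsRoot.def]
      have h1 := hpc μ (hJ μ hμ).1
      rw [(hJ μ hμ).2] at h1
      have : (M.choose μ : ℂ) ≠ 0 := by exact_mod_cast (Nat.choose_pos (hJ μ hμ).1).ne'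
      exact (mul_eq_zero.1 h1.symm).resolve_right this
  obtain ⟨r, hr⟩ := hdvd
  have hp0 : p ≠ 0 := by
    rintro rfl
    refine hz (Polynomial.ext fun l => ?_)
    rcases le_or_gt l M with hl | hl
    · rw [hpc l hl]; simp
    · rw [Polynomial.coeff_eq_zero_of_natDegree_lt (by omega), Polynomial.coeff_zero]
  have hr0 : r ≠ 0 := by
    rintro rfl
    exact hp0 (by rw [hr, mul_zero])
  have hm : (∏ μ ∈ J, (Polynomial.X - Polynomial.C (μ : ℂ))).Monic :=
    Polynomial.monic_prod_of_monic _ _ fun μ _ => Polynomial.monic_X_sub_C _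
  have hdeg : r.natDegree < m := by
    rw [hr, hm.natDegree_mul' hr0, Polynomial.natDegree_prod_of_monic _ _
      fun μ _ => Polynomial.monic_X_sub_C _] at hp
    simp only [Polynomial.natDegree_X_sub_C, Finset.sum_const, smul_eq_mul, mul_one] at hp
    omega
  refine ⟨fun j => r.coeff j, fun l hl => ?_⟩
  rw [hpc l hl, hr, Polynomial.eval_mul, Polynomial.eval_prod, Fin.sum_univ_eq_sum_range
    (fun j => r.coeff j * (l : ℂ) ^ j), ← Polynomial.eval_eq_sum_range' hdeg]
  simp only [Polynomial.eval_sub, Polynomial.eval_X, Polynomial.eval_C]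
  ring

lemma extremes_image {f : ℕ → ℕ} (hf : StrictMono f) (L a b : ℕ) :
    extremes ((Finset.range L).image f) a b =
      ((Finset.range L).filter fun i => i < a ∨ L ≤ i + b).image f := by
  unfold extremes
  rw [Finset.filter_image]
  congr 1
  refine Finset.filter_congr fun i hi => ?_
  rw [Finset.mem_range] at hi
  have h1 : (((Finset.range L).image f).filter (· < f i)).card = i := by
    rw [Finset.filter_image, Finset.card_image_of_injective _ hf.injective]
    have : (Finset.range L).filter (fun j => f j < f i) = Finset.range i := by
      ext j
      simp only [Finset.mem_filter, Finset.mem_range, hf.lt_iff_lt]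
      omega
    rw [this, Finset.card_range]
  have h2 : (((Finset.range L).image f).filter (f i < ·)).card = L - 1 - i := by
    rw [Finset.filter_image, Finset.card_image_of_injective _ hf.injective]
    have : (Finset.range L).filter (fun j => f i < f j) = Finset.Ioo i L := by
      ext j
      simp only [Finset.mem_filter, Finset.mem_range, hf.lt_iff_lt, Finset.mem_Ioo]
      omega
    rw [this, Nat.card_Ioo]
    omega
  rw [h1, h2]
  omega

lemma le_card_extremes {f : ℕ → ℕ} (hf : StrictMono f) {L a b : ℕ} (h : a + b ≤ L) :
    a + b ≤ (extremes ((Finset.range L).image f) a b).card := by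
  rw [extremes_image hf, Finset.card_image_of_injective _ hf.injective]
  calc a + b = (Finset.range a ∪ Finset.Ico (L - b) L).card := by
        rw [Finset.card_union_of_disjoint, Finset.card_range, Nat.card_Ico]
        · omega
        · rw [Finset.disjoint_left]
          intro i hi hj
          rw [Finset.mem_range] at hi
          rw [Finset.mem_Ico] at hj
          omega
    _ ≤ _ := by
        refine Finset.card_le_card fun i hi => ?_
        simp only [Finset.mem_union, Finset.mem_range, Finset.mem_Ico, Finset.mem_filter] at hi ⊢
        omega

lemma odd_range_eq (M : ℕ) :
    (Finset.range (2 * M + 1)).filter Odd = (Finset.range M).image fun i => 2 * i + 1 := by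
  ext μ
  simp only [Finset.mem_filter, Finset.mem_range, Finset.mem_image]
  constructor
  · rintro ⟨h1, i, rfl⟩
    exact ⟨i, by omega, rfl⟩
  · rintro ⟨i, hi, rfl⟩
    exact ⟨by omega, i, rfl⟩

lemma even_range_eq (M : ℕ) :
    (Finset.range (2 * M + 1)).filter Even = (Finset.range (M + 1)).image fun i => 2 * i := by
  ext μ
  simp only [Finset.mem_filter, Finset.mem_range, Finset.mem_image]
  constructor
  · rintro ⟨h1, i, rfl⟩
    exact ⟨i, by omega, by omega⟩
  · rintro ⟨i, hi, rfl⟩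
    exact ⟨by omega, i, by omega⟩

lemma strictMono_odd : StrictMono fun i : ℕ => 2 * i + 1 := fun i j h => by simp; omega
lemma strictMono_even : StrictMono fun i : ℕ => 2 * i := fun i j h => by simp; omega

lemma mem_indexSetJ {M a b c d μ : ℕ} :
    μ ∈ indexSetJ (2 * M) a b c d ↔
      (∃ i < M, μ = 2 * i + 1 ∧ (i < a ∨ M ≤ i + b)) ∨
        ∃ i ≤ M, μ = 2 * i ∧ (i < c ∨ M + 1 ≤ i + d) := by
  rw [indexSetJ, Finset.mem_union, odd_range_eq, even_range_eq, extremes_image strictMono_odd,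
    extremes_image strictMono_even]
  simp only [Finset.mem_image, Finset.mem_filter, Finset.mem_range]
  constructor
  · rintro (⟨i, ⟨h1, h2⟩, rfl⟩ | ⟨i, ⟨h1, h2⟩, rfl⟩)
    · exact Or.inl ⟨i, h1, rfl, h2⟩
    · exact Or.inr ⟨i, by omega, rfl, h2⟩
  · rintro (⟨i, h1, rfl, h2⟩ | ⟨i, h1, rfl, h2⟩)
    · exact Or.inl ⟨i, ⟨h1, h2⟩, rfl⟩
    · exact Or.inr ⟨i, ⟨by omega, h2⟩, rfl⟩

lemma le_card_indexSetJ {M a b c d : ℕ} (h : a + b ≤ M) (h' : c + d ≤ M + 1) :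
    a + b + (c + d) ≤ (indexSetJ (2 * M) a b c d).card := by
  have hdisj : Disjoint (extremes ((Finset.range (2 * M + 1)).filter Odd) a b)
      (extremes ((Finset.range (2 * M + 1)).filter Even) c d) := by
    rw [Finset.disjoint_left]
    intro μ h1 h2
    have h3 := (Finset.mem_filter.1 (Finset.mem_filter.1 h1).1).2
    have h4 := (Finset.mem_filter.1 (Finset.mem_filter.1 h2).1).2
    exact (Nat.not_even_iff_odd.2 h3) h4
  rw [indexSetJ, Finset.card_union_of_disjoint hdisj, odd_range_eq, even_range_eq]
  exact add_le_add (le_card_extremes strictMono_odd h) (le_card_extremes strictMono_even h')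

lemma dvd_of_expand_two_dvd {P E : Polynomial ℂ} (hP : P.Monic)
    (h : Polynomial.expand ℂ 2 P ∣ Polynomial.expand ℂ 2 E) : P ∣ E := by
  rw [← Polynomial.modByMonic_eq_zero_iff_dvd hP]
  have h1 : Polynomial.expand ℂ 2 P ∣ Polynomial.expand ℂ 2 (E %ₘ P) := by
    have h2 := congrArg (Polynomial.expand ℂ 2) (Polynomial.modByMonic_add_div E P)
    rw [map_add, map_mul] at h2
    exact (dvd_add_left (Dvd.intro _ rfl)).1 (h2 ▸ h)
  by_contra h0
  have h3 := Polynomial.natDegree_le_of_dvd h1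
    ((Polynomial.expand_ne_zero two_pos).2 h0)
  rw [Polynomial.natDegree_expand, Polynomial.natDegree_expand] at h3
  have h4 := Polynomial.natDegree_lt_natDegree h0 (Polynomial.degree_modByMonic_lt E hP)
  omega

lemma isCoprime_one_add_one_sub :
    IsCoprime (1 + Polynomial.X : Polynomial ℂ) (1 - Polynomial.X) := by
  refine ⟨Polynomial.C (1 / 2), Polynomial.C (1 / 2), ?_⟩
  rw [← mul_add, show (1 + Polynomial.X + (1 - Polynomial.X) : Polynomial ℂ) = Polynomial.C 2 by
    rw [show (2 : ℂ) = 1 + 1 by norm_num, Polynomial.C_add, Polynomial.C_1]; ring,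
    ← Polynomial.C_mul]
  norm_num

lemma isCoprime_X_one_sub : IsCoprime (Polynomial.X : Polynomial ℂ) (1 - Polynomial.X) :=
  ⟨1, 1, by ring⟩

lemma expand_one_sub_pow (e : ℕ) : Polynomial.expand ℂ 2 ((1 - Polynomial.X) ^ e) =
    (1 + Polynomial.X) ^ e * (1 - Polynomial.X) ^ e := by
  rw [map_pow, map_sub, map_one, Polynomial.expand_X, ← mul_pow]
  congr 1
  ring

/-- The even and the odd part of a polynomial `g` inherit the common zeros of `g (t)` and
`g (-t)`. -/
lemma exists_eq_one_sub_pow_mul {e : ℕ} {E A : Polynomial ℂ}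
    (h₁ : (1 + Polynomial.X) ^ e ∣
      Polynomial.expand ℂ 2 E + Polynomial.X * Polynomial.expand ℂ 2 A)
    (h₂ : (1 + Polynomial.X) ^ e ∣
      Polynomial.expand ℂ 2 E - Polynomial.X * Polynomial.expand ℂ 2 A) :
    ∃ E₁ A₁, E = (1 - Polynomial.X) ^ e * E₁ ∧ A = (1 - Polynomial.X) ^ e * A₁ := by
  have hcomp : ∀ Q : Polynomial ℂ, (Polynomial.expand ℂ 2 Q).comp (-Polynomial.X) =
      Polynomial.expand ℂ 2 Q := by
    intro Q
    rw [Polynomial.expand_eq_comp_X_pow, Polynomial.comp_assoc]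
    simp
  have hneg : ∀ {Q : Polynomial ℂ}, (1 + Polynomial.X) ^ e ∣ Q →
      (1 - Polynomial.X) ^ e ∣ Q.comp (-Polynomial.X) := by
    rintro Q ⟨R, rfl⟩
    refine ⟨R.comp (-Polynomial.X), ?_⟩
    simp [sub_eq_add_neg]
  have h₃ := hneg h₁
  have h₄ := hneg h₂
  simp only [Polynomial.add_comp, Polynomial.sub_comp, Polynomial.mul_comp, hcomp,
    Polynomial.X_comp, neg_mul, sub_neg_eq_add] at h₃ h₄
  rw [← sub_eq_add_neg] at h₃
  have hcop := (isCoprime_one_add_one_sub.pow (m := e) (n := e))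
  have hu : IsUnit (Polynomial.C (2 : ℂ)) := Polynomial.isUnit_C.2 (IsUnit.mk0 _ two_ne_zero)
  have hC2 : (Polynomial.C (2 : ℂ)) = 1 + 1 := by
    rw [show (2 : ℂ) = 1 + 1 by norm_num, Polynomial.C_add, Polynomial.C_1]
  have hE : (1 + Polynomial.X) ^ e * (1 - Polynomial.X) ^ e ∣ Polynomial.expand ℂ 2 E := by
    refine hu.dvd_mul_left.1 (hcop.mul_dvd ?_ ?_)
    · convert dvd_add h₁ h₂ using 1
      rw [hC2]; ring
    · convert dvd_add h₃ h₄ using 1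
      rw [hC2]; ring
  have hA : (1 + Polynomial.X) ^ e * (1 - Polynomial.X) ^ e ∣ Polynomial.expand ℂ 2 A := by
    have hXA : (1 + Polynomial.X) ^ e * (1 - Polynomial.X) ^ e ∣
        Polynomial.X * Polynomial.expand ℂ 2 A := by
      refine hu.dvd_mul_left.1 (hcop.mul_dvd ?_ ?_)
      · convert dvd_sub h₁ h₂ using 1
        rw [hC2]; ring
      · convert dvd_sub h₄ h₃ using 1
        rw [hC2]; ring
    refine IsCoprime.dvd_of_dvd_mul_left (IsCoprime.mul_left ?_ ?_) hXA
    · exact (show IsCoprime (1 + Polynomial.X : Polynomial ℂ) Polynomial.X from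
        ⟨1, -1, by ring⟩).pow_left
    · exact isCoprime_X_one_sub.symm.pow_left
  have hmon : ((Polynomial.X - 1) ^ e : Polynomial ℂ).Monic := by
    rw [← Polynomial.C_1]; exact (Polynomial.monic_X_sub_C 1).pow e
  have hsign : (1 - Polynomial.X : Polynomial ℂ) ^ e = (-1) ^ e * (Polynomial.X - 1) ^ e := by
    rw [← mul_pow]; ring
  have hdvd : ∀ Q : Polynomial ℂ, (1 + Polynomial.X) ^ e * (1 - Polynomial.X) ^ e ∣
      Polynomial.expand ℂ 2 Q → (1 - Polynomial.X) ^ e ∣ Q := by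
    intro Q hQ
    have h5 : ((Polynomial.X - 1) ^ e : Polynomial ℂ) ∣ Q := by
      refine dvd_of_expand_two_dvd hmon ?_
      refine Dvd.dvd.trans ⟨(-1) ^ e, ?_⟩ hQ
      rw [← expand_one_sub_pow, hsign, map_mul, map_pow, map_neg, map_one, mul_comm]
    obtain ⟨R, hR⟩ := h5
    refine ⟨(-1) ^ e * R, ?_⟩
    have hsq : ((-1) ^ e : Polynomial ℂ) * (-1) ^ e = 1 := by
      rw [← mul_pow]; simp
    rw [hsign, hR]
    linear_combination -(Polynomial.X - 1) ^ e * R * hsq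
  exact ⟨_, _, (hdvd E hE).choose_spec, (hdvd A hA).choose_spec⟩

lemma coeff_eq_zero_of_one_sub_pow_mul {e D p q : ℕ} {Q : Polynomial ℂ}
    (h : ∀ i, i < q ∨ D < i + p → ((1 - Polynomial.X) ^ e * Q).coeff i = 0) {i : ℕ}
    (hi : i < q ∨ D < i + p + e) : Q.coeff i = 0 := by
  rcases eq_or_ne Q 0 with rfl | hQ
  · simp
  have h1X : (1 - Polynomial.X : Polynomial ℂ) ≠ 0 := by
    intro h0
    have := congrArg (Polynomial.eval 0) h0
    simp at this
  rcases hi with hi | hi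
  · have h1 : Polynomial.X ^ q ∣ (1 - Polynomial.X) ^ e * Q :=
      Polynomial.X_pow_dvd_iff.2 fun j hj => h j (Or.inl hj)
    exact Polynomial.X_pow_dvd_iff.1 ((isCoprime_X_one_sub.pow).dvd_of_dvd_mul_left h1) i hi
  · by_contra h0
    have h2 := Polynomial.le_natDegree_of_ne_zero h0
    have h3 : ((1 - Polynomial.X) ^ e * Q).natDegree = e + Q.natDegree := by
      rw [Polynomial.natDegree_mul (pow_ne_zero _ h1X) hQ, Polynomial.natDegree_pow,
        ← Polynomial.natDegree_neg (1 - Polynomial.X), neg_sub, ← Polynomial.C_1,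
        Polynomial.natDegree_X_sub_C, mul_one]
    have h4 : ((1 - Polynomial.X) ^ e * Q).coeff (e + Q.natDegree) = 0 := h _ (Or.inr (by omega))
    rw [← h3, Polynomial.coeff_natDegree] at h4
    exact mul_ne_zero (pow_ne_zero _ h1X) hQ (Polynomial.leadingCoeff_eq_zero.1 h4)

/-- The limiting functions in regime A, with `t = 1 - 2 x`. -/
def regimeAFun (N e M : ℕ) (θ : ℕ → ℂ) (J : Finset ℕ) (j : ℕ) (x : ℂ) : ℂ :=
  ((2 * x) ^ (N - 1) * (1 - (1 - 2 * x) ^ 2) ^ e / (2 * (1 - x))) *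
    ∑ l ∈ Finset.range (M + 1), (l : ℂ) ^ j *
      ((M.choose l : ℂ) * (1 - 2 * x) ^ l * θ l * ∏ μ ∈ J, ((l : ℂ) - μ))

/-- The polynomial `g (t) = (1 + t) (A (w) + x B (w))` with `x = (1 - t) / 2` and
`w = (t ^ 2 - 1) / 8`, where `E = A - 4 w B`. -/
lemma eval_expand_add {A B : Polynomial ℂ} (t : ℂ) :
    (Polynomial.expand ℂ 2 ((A - Polynomial.C 4 * Polynomial.X * B).comp
        (Polynomial.C (1 / 8) * (Polynomial.X - 1))) +
      Polynomial.X * Polynomial.expand ℂ 2 (A.comp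
        (Polynomial.C (1 / 8) * (Polynomial.X - 1)))).eval t =
      (1 + t) * (A.eval ((t ^ 2 - 1) / 8) + (1 - t) / 2 * B.eval ((t ^ 2 - 1) / 8)) := by
  simp only [Polynomial.eval_add, Polynomial.expand_eval, Polynomial.eval_mul, Polynomial.eval_X,
    Polynomial.eval_comp, Polynomial.eval_sub, Polynomial.eval_C, Polynomial.eval_one]
  rw [show (1 : ℂ) / 8 * (t ^ 2 - 1) = (t ^ 2 - 1) / 8 by ring]
  ring

lemma eval_expand_sub {A B : Polynomial ℂ} (t : ℂ) :
    (Polynomial.expand ℂ 2 ((A - Polynomial.C 4 * Polynomial.X * B).comp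
        (Polynomial.C (1 / 8) * (Polynomial.X - 1))) -
      Polynomial.X * Polynomial.expand ℂ 2 (A.comp
        (Polynomial.C (1 / 8) * (Polynomial.X - 1)))).eval t =
      (1 - t) * (A.eval ((t ^ 2 - 1) / 8) + (1 + t) / 2 * B.eval ((t ^ 2 - 1) / 8)) := by
  simp only [Polynomial.eval_sub, Polynomial.expand_eval, Polynomial.eval_mul, Polynomial.eval_X,
    Polynomial.eval_comp, Polynomial.eval_C, Polynomial.eval_one]
  rw [show (1 : ℂ) / 8 * (t ^ 2 - 1) = (t ^ 2 - 1) / 8 by ring]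
  ring

/-- Zeros at `x = 1` are zeros at `t = 1 - 2 x = -1`. -/
lemma one_add_pow_dvd_comp {c : ℕ} {F : Polynomial ℂ} (h : (Polynomial.X - 1) ^ c ∣ F) :
    (1 + Polynomial.X) ^ c ∣ F.comp (Polynomial.C (1 / 2) * (1 - Polynomial.X)) := by
  obtain ⟨R, rfl⟩ := h
  have : (Polynomial.X - 1 : Polynomial ℂ).comp (Polynomial.C (1 / 2) * (1 - Polynomial.X)) =
      Polynomial.C (-1 / 2) * (1 + Polynomial.X) := by
    refine Polynomial.funext fun v => ?_
    simp only [Polynomial.eval_comp, Polynomial.eval_sub, Polynomial.eval_add, Polynomial.eval_mul,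
      Polynomial.eval_C, Polynomial.eval_X, Polynomial.eval_one]
    ring
  rw [Polynomial.mul_comp, Polynomial.pow_comp, this, mul_pow]
  exact (Dvd.intro_left _ rfl).mul_right _

/-- The common zeros of the limiting rows in regime A. Here `A` and `B` are the generating polynomials
of the coefficients, `F` is the function represented by them and `S` its image under `σ̂`.

Put `g (t) = (1 + t) (A (w) + x B (w))` with `t = 1 - 2 x`. The zeros of `F` and `S` at `x = 1` say
that `(1 + t) ^ (a + 1)` divides `g (t)` and `(1 + t) ^ b` divides `g (t) - 2 g (-t)`. With
`e = min (a + 1, b)` it follows that `g = (1 - t ^ 2) ^ e g₁`. If `e = b`, then `h = g₁` has the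
remaining zero of order `q` at `t = -1`; if `e = a + 1`, then it is `g₁ (t) - 2 g₁ (-t)` that has it,
and `h` is this polynomial divided by `-3`, so that `g₁ (t) = h (t) + 2 h (-t)`. The conditions at
`ξ_1` and `ξ_2` say that the coefficients of `h` with index in `J` vanish. -/
theorem exists_eq_sum_regimeAFun {N a b c1 c2 d1 d2 m M e q : ℕ} {A B F S : Polynomial ℂ}
    {θ : ℕ → ℂ}
    (hA : A.degree < N) (hB : B.degree < N)
    (hF : ∀ x, F.eval x = (2 * x) ^ (N - 1) *
      (A.eval (x * (x - 1) / 2) + x * B.eval (x * (x - 1) / 2)))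
    (hS : ∀ x, S.eval x = (2 * x) ^ N *
      ((1 - 3 * x) * A.eval (x * (x - 1) / 2) + x * (x - 1) * B.eval (x * (x - 1) / 2)))
    (hFd : (Polynomial.X - 1) ^ a ∣ F) (hSd : (Polynomial.X - 1) ^ b ∣ S)
    (hA' : Polynomial.X ^ c1 * (Polynomial.X - Polynomial.C 2) ^ c2 ∣
      homog (N - 1) A (Polynomial.C (-1 / 4)) Polynomial.X)
    (hE' : Polynomial.X ^ d1 * (Polynomial.X - Polynomial.C 2) ^ d2 ∣
      Polynomial.X * homog (N - 1) A (Polynomial.C (-1 / 4)) Polynomial.X +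
        homog (N - 1) B (Polynomial.C (-1 / 4)) Polynomial.X)
    (hM : N = M + e) (hc : c1 + c2 ≤ M) (hd : d1 + d2 ≤ M + 1)
    (hcard : 2 * M + 1 = q + m + (c1 + c2) + (d1 + d2))
    (hθ : (e = b ∧ a + 1 = b + q ∧ θ = fun _ => 1) ∨
      (e = a + 1 ∧ b = a + 1 + q ∧ θ = fun l => 1 + 2 * (-1) ^ l)) :
    ∃ c : Fin m → ℂ, ∀ x, x ≠ 1 → F.eval x =
      ∑ j, c j * regimeAFun N e (2 * M) θ (indexSetJ (2 * M) c2 c1 d2 d1) j x := by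
  classical
  set E := A - Polynomial.C 4 * Polynomial.X * B with hEdef
  set L : Polynomial ℂ := Polynomial.C (1 / 8) * (Polynomial.X - 1) with hL
  set g := Polynomial.expand ℂ 2 (E.comp L) + Polynomial.X * Polynomial.expand ℂ 2 (A.comp L)
    with hg
  set g' := Polynomial.expand ℂ 2 (E.comp L) - Polynomial.X * Polynomial.expand ℂ 2 (A.comp L)
    with hg'
  have hge : ∀ t, g.eval t = (1 + t) * (A.eval ((t ^ 2 - 1) / 8) +
      (1 - t) / 2 * B.eval ((t ^ 2 - 1) / 8)) := eval_expand_add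
  have hge' : ∀ t, g'.eval t = (1 - t) * (A.eval ((t ^ 2 - 1) / 8) +
      (1 + t) / 2 * B.eval ((t ^ 2 - 1) / 8)) := eval_expand_sub
  -- Zeros of `F` and `S` at `x = 1` are zeros of `g (t)` and `g (t) - 2 g (-t)` at `t = -1`.
  have hcopN : ∀ i j : ℕ, IsCoprime ((1 + Polynomial.X : Polynomial ℂ) ^ i) ((1 - Polynomial.X) ^ j) :=
    fun i j => isCoprime_one_add_one_sub.pow
  have hgd : (1 + Polynomial.X) ^ (a + 1) ∣ g := by
    have h1 : (1 + Polynomial.X) * F.comp (Polynomial.C (1 / 2) * (1 - Polynomial.X)) =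
        (1 - Polynomial.X) ^ (N - 1) * g := by
      refine Polynomial.funext fun t => ?_
      rw [Polynomial.eval_mul, Polynomial.eval_mul, Polynomial.eval_comp, hF, hge]
      simp only [Polynomial.eval_add, Polynomial.eval_mul, Polynomial.eval_C, Polynomial.eval_X,
        Polynomial.eval_one, Polynomial.eval_sub, Polynomial.eval_pow]
      rw [show (1 : ℂ) / 2 * (1 - t) * (1 / 2 * (1 - t) - 1) / 2 = (t ^ 2 - 1) / 8 by ring]
      ring
    have h2 : (1 + Polynomial.X) ^ (a + 1) ∣ (1 - Polynomial.X) ^ (N - 1) * g := by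
      rw [← h1, pow_succ']
      exact mul_dvd_mul_left _ (one_add_pow_dvd_comp hFd)
    exact (hcopN _ _).dvd_of_dvd_mul_left h2
  have hgd' : (1 + Polynomial.X) ^ b ∣ g - Polynomial.C 2 * g' := by
    have h1 : Polynomial.C 2 * S.comp (Polynomial.C (1 / 2) * (1 - Polynomial.X)) =
        (1 - Polynomial.X) ^ N * (g - Polynomial.C 2 * g') := by
      refine Polynomial.funext fun t => ?_
      simp only [Polynomial.eval_mul, Polynomial.eval_C, Polynomial.eval_X, Polynomial.eval_comp,
        hS, hge, hge', Polynomial.eval_one, Polynomial.eval_sub, Polynomial.eval_pow]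
      rw [show (1 : ℂ) / 2 * (1 - t) * (1 / 2 * (1 - t) - 1) / 2 = (t ^ 2 - 1) / 8 by ring]
      ring
    have h2 : (1 + Polynomial.X) ^ b ∣ (1 - Polynomial.X) ^ N * (g - Polynomial.C 2 * g') := by
      rw [← h1]
      exact (one_add_pow_dvd_comp hSd).mul_left _
    exact (hcopN _ _).dvd_of_dvd_mul_left h2
  have hu2 : IsUnit (Polynomial.C (2 : ℂ)) := Polynomial.isUnit_C.2 (IsUnit.mk0 _ two_ne_zero)
  -- The common zeros of `g (t)` and `g (-t)` at `t = ±1` are passed on to the even and odd parts.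
  have hea : e ≤ a + 1 := by rcases hθ with h | h <;> omega
  have heb : e ≤ b := by rcases hθ with h | h <;> omega
  have hd1 : (1 + Polynomial.X) ^ e ∣ g := (pow_dvd_pow _ hea).trans hgd
  have hd2 : (1 + Polynomial.X) ^ e ∣ g' := by
    have := dvd_sub hd1 ((pow_dvd_pow _ heb).trans hgd')
    rw [sub_sub_cancel] at this
    exact hu2.dvd_mul_left.1 this
  obtain ⟨E₁, A₁, hE₁, hA₁⟩ := exists_eq_one_sub_pow_mul hd1 hd2
  set g₁ := Polynomial.expand ℂ 2 E₁ + Polynomial.X * Polynomial.expand ℂ 2 A₁ with hg₁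
  have hgg : g = (1 + Polynomial.X) ^ e * ((1 - Polynomial.X) ^ e * g₁) := by
    rw [hg, hE₁, hA₁, map_mul, map_mul, expand_one_sub_pow, hg₁]
    ring
  have hgg' : g - Polynomial.C 2 * g' = (1 + Polynomial.X) ^ e * ((1 - Polynomial.X) ^ e *
      (Polynomial.C (-1) * Polynomial.expand ℂ 2 E₁ +
        Polynomial.C 3 * (Polynomial.X * Polynomial.expand ℂ 2 A₁))) := by
    rw [hg, hg', hE₁, hA₁, map_mul, map_mul, expand_one_sub_pow,
      show (Polynomial.C (2 : ℂ)) = 2 from rfl, show (Polynomial.C (3 : ℂ)) = 3 from rfl,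
      Polynomial.C_neg, Polynomial.C_1]
    ring
  have h1X0 : ((1 + Polynomial.X) ^ e : Polynomial ℂ) ≠ 0 := by
    refine pow_ne_zero _ fun h0 => ?_
    have := congrArg (Polynomial.eval 0) h0
    simp at this
  -- The conditions at `ξ_1` and `ξ_2` concern the extreme coefficients of `A` and `E`.
  have hAN : A.natDegree ≤ N - 1 := by
    rcases eq_or_ne A 0 with h | h
    · simp [h]
    · rw [Polynomial.degree_eq_natDegree h] at hA
      have : A.natDegree < N := by exact_mod_cast hA
      omega
  have hBN : B.natDegree ≤ N - 1 := by
    rcases eq_or_ne B 0 with h | h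
    · simp [h]
    · rw [Polynomial.degree_eq_natDegree h] at hB
      have : B.natDegree < N := by exact_mod_cast hB
      omega
  have hA0 : N = 0 → A = 0 := by
    rintro rfl
    rw [Nat.cast_zero, ← Nat.cast_zero, Polynomial.degree_lt_iff_coeff_zero] at hA
    exact Polynomial.ext fun i => hA i (Nat.zero_le _)
  have hB0 : N = 0 → B = 0 := by
    rintro rfl
    rw [Nat.cast_zero, ← Nat.cast_zero, Polynomial.degree_lt_iff_coeff_zero] at hB
    exact Polynomial.ext fun i => hB i (Nat.zero_le _)
  have hAc : ∀ i, i < c2 ∨ N ≤ i + c1 → (A.comp L).coeff i = 0 := by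
    intro i hi
    rcases Nat.eq_zero_or_pos N with h0 | h0
    · simp [hA0 h0]
    · exact coeff_comp_eq_zero_of_dvd_homog hAN hA' (by omega)
  have hEN : E.natDegree ≤ N := by
    refine (Polynomial.natDegree_sub_le _ _).trans (max_le (hAN.trans (Nat.sub_le _ _)) ?_)
    rcases Nat.eq_zero_or_pos N with h0 | h0
    · simp [hB0 h0]
    · rw [mul_assoc]
      refine (Polynomial.natDegree_C_mul_le _ _).trans (Polynomial.natDegree_mul_le.trans ?_)
      rw [Polynomial.natDegree_X]
      omega
  have hEh : homog N E (Polynomial.C (-1 / 4)) Polynomial.X =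
      Polynomial.X * homog (N - 1) A (Polynomial.C (-1 / 4)) Polynomial.X +
        homog (N - 1) B (Polynomial.C (-1 / 4)) Polynomial.X := by
    rcases Nat.eq_zero_or_pos N with h0 | h0
    · simp [hEdef, hA0 h0, hB0 h0, homog]
    · refine eq_of_eval_eq_off {0} fun v hv => ?_
      have hv' : v ≠ 0 := by simpa using hv
      have hv2 : (Polynomial.X : Polynomial ℂ).eval v ≠ 0 := by simpa using hv'
      rw [Polynomial.eval_add, Polynomial.eval_mul, eval_homog hEN hv2, eval_homog hAN hv2,
        eval_homog hBN hv2, hEdef]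
      simp only [Polynomial.eval_X, Polynomial.eval_sub, Polynomial.eval_mul, Polynomial.eval_C]
      have hN1 : v ^ N = v ^ (N - 1) * v := by rw [← pow_succ, Nat.sub_add_cancel h0]
      rw [hN1]
      field_simp
      ring
  have hEc : ∀ i, i < d2 ∨ N < i + d1 → (E.comp L).coeff i = 0 := fun i hi =>
    coeff_comp_eq_zero_of_dvd_homog hEN (hEh ▸ hE') hi
  have hE₁c : ∀ i, i < d2 ∨ N < i + d1 + e → E₁.coeff i = 0 := fun i hi =>
    coeff_eq_zero_of_one_sub_pow_mul (fun j hj => hE₁ ▸ hEc j hj) hi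
  have hA₁c : ∀ i, i < c2 ∨ N ≤ i + c1 + e → A₁.coeff i = 0 := fun i hi =>
    coeff_eq_zero_of_one_sub_pow_mul (D := N) (p := c1 + 1) (q := c2)
      (fun j hj => hA₁ ▸ hAc j (by omega)) (by omega)
  -- The coefficients of `h` are those of `g₁` divided by `θ`, which takes the values `3` and `-1` in
  -- the second case.
  have hcoeffE : ∀ i (x y : ℂ), (Polynomial.C x * Polynomial.expand ℂ 2 E₁ + Polynomial.C y *
      (Polynomial.X * Polynomial.expand ℂ 2 A₁)).coeff (2 * i) = x * E₁.coeff i := by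
    intro i x y
    rw [Polynomial.coeff_add, Polynomial.coeff_C_mul, Polynomial.coeff_C_mul,
      Polynomial.coeff_expand two_pos, if_pos (Dvd.intro _ rfl), Nat.mul_div_cancel_left _ two_pos]
    rcases i with _ | i
    · simp
    · rw [show 2 * (i + 1) = 2 * i + 1 + 1 by ring, Polynomial.coeff_X_mul,
        Polynomial.coeff_expand two_pos, if_neg (by omega), mul_zero, add_zero]
  have hcoeffO : ∀ i (x y : ℂ), (Polynomial.C x * Polynomial.expand ℂ 2 E₁ + Polynomial.C y *
      (Polynomial.X * Polynomial.expand ℂ 2 A₁)).coeff (2 * i + 1) = y * A₁.coeff i := by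
    intro i x y
    rw [Polynomial.coeff_add, Polynomial.coeff_C_mul, Polynomial.coeff_C_mul, Polynomial.coeff_X_mul,
      Polynomial.coeff_expand two_pos, if_neg (by omega), mul_zero, zero_add,
      Polynomial.coeff_expand two_pos, if_pos (Dvd.intro _ rfl), Nat.mul_div_cancel_left _ two_pos]
  obtain ⟨x₀, y₀, hhd, hh₁⟩ : ∃ x₀ y₀ : ℂ, (Polynomial.X + 1) ^ q ∣
      Polynomial.C x₀ * Polynomial.expand ℂ 2 E₁ +
        Polynomial.C y₀ * (Polynomial.X * Polynomial.expand ℂ 2 A₁) ∧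
      (∀ i, θ (2 * i) * x₀ = 1) ∧ (∀ i, θ (2 * i + 1) * y₀ = 1) := by
    rcases hθ with ⟨h1, h2, rfl⟩ | ⟨h1, h2, rfl⟩
    · refine ⟨1, 1, ?_, fun _ => one_mul _, fun _ => one_mul _⟩
      rw [h2, ← h1, pow_add, hgg] at hgd
      have := (mul_dvd_mul_iff_left h1X0).1 hgd
      have := (hcopN _ _).dvd_of_dvd_mul_left this
      rw [add_comm Polynomial.X]
      simpa using this
    · refine ⟨1 / 3, -1, ?_, fun i => ?_, fun i => ?_⟩
      · rw [h2, ← h1, pow_add, hgg'] at hgd'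
        have := (mul_dvd_mul_iff_left h1X0).1 hgd'
        have := (hcopN _ _).dvd_of_dvd_mul_left this
        rw [add_comm Polynomial.X]
        refine this.trans ⟨Polynomial.C (-1 / 3), ?_⟩
        refine Polynomial.funext fun t => ?_
        simp only [Polynomial.eval_add, Polynomial.eval_mul, Polynomial.eval_C, Polynomial.eval_X]
        ring
      · simp only [pow_mul]; norm_num
      · simp only [pow_succ, pow_mul]; norm_num
  set h := Polynomial.C x₀ * Polynomial.expand ℂ 2 E₁ +
    Polynomial.C y₀ * (Polynomial.X * Polynomial.expand ℂ 2 A₁) with hh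
  have hhdeg : h.natDegree ≤ 2 * M := by
    refine Polynomial.natDegree_le_iff_coeff_eq_zero.2 fun l hl => ?_
    rcases Nat.even_or_odd' l with ⟨i, rfl | rfl⟩
    · rw [hh, hcoeffE, hE₁c i (Or.inr (by omega)), mul_zero]
    · rw [hh, hcoeffO, hA₁c i (Or.inr (by omega)), mul_zero]
  have hJ : ∀ μ ∈ indexSetJ (2 * M) c2 c1 d2 d1, μ ≤ 2 * M ∧ h.coeff μ = 0 := by
    intro μ hμ
    rcases mem_indexSetJ.1 hμ with ⟨i, hi, rfl, hi'⟩ | ⟨i, hi, rfl, hi'⟩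
    · exact ⟨by omega, by rw [hh, hcoeffO, hA₁c i (by omega), mul_zero]⟩
    · exact ⟨by omega, by rw [hh, hcoeffE, hE₁c i (by omega), mul_zero]⟩
  have hJcard := le_card_indexSetJ (M := M) (a := c2) (b := c1) (c := d2) (d := d1) (by omega)
    (by omega)
  obtain ⟨c, hc'⟩ := exists_coeff_eq_sum_pow (m := m) hhdeg hhd _ hJ (by omega)
  refine ⟨c, fun x hx => ?_⟩
  have hx1 : 1 - x ≠ 0 := sub_ne_zero.2 (Ne.symm hx)
  have hg₁c : ∀ l, g₁.coeff l = θ l * h.coeff l := by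
    intro l
    have h1 : g₁ = Polynomial.C 1 * Polynomial.expand ℂ 2 E₁ +
        Polynomial.C 1 * (Polynomial.X * Polynomial.expand ℂ 2 A₁) := by
      rw [hg₁, Polynomial.C_1, one_mul, one_mul]
    rcases Nat.even_or_odd' l with ⟨i, rfl | rfl⟩
    · rw [h1, hh, hcoeffE, hcoeffE, ← mul_assoc, hh₁.1]
    · rw [h1, hh, hcoeffO, hcoeffO, ← mul_assoc, hh₁.2]
  have hg₁deg : g₁.natDegree < 2 * M + 1 := by
    refine Nat.lt_succ_of_le (Polynomial.natDegree_le_iff_coeff_eq_zero.2 fun l hl => ?_)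
    rw [hg₁c, Polynomial.natDegree_le_iff_coeff_eq_zero.1 hhdeg l hl, mul_zero]
  have hg₁e : g₁.eval (1 - 2 * x) = ∑ j : Fin m, c j * ∑ l ∈ Finset.range (2 * M + 1),
      (l : ℂ) ^ (j : ℕ) * (((2 * M).choose l : ℂ) * (1 - 2 * x) ^ l * θ l *
        ∏ μ ∈ indexSetJ (2 * M) c2 c1 d2 d1, ((l : ℂ) - μ)) := by
    rw [Polynomial.eval_eq_sum_range' hg₁deg]
    simp only [Finset.mul_sum]
    rw [Finset.sum_comm]
    refine Finset.sum_congr rfl fun l hl => ?_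
    rw [hg₁c, hc' l (by simpa [Nat.lt_succ_iff] using hl), Finset.sum_mul, Finset.mul_sum,
      Finset.sum_mul]
    refine Finset.sum_congr rfl fun j _ => ?_
    ring
  have hgx := hge (1 - 2 * x)
  rw [hgg, Polynomial.eval_mul, Polynomial.eval_mul, hg₁e] at hgx
  simp only [Polynomial.eval_pow, Polynomial.eval_add, Polynomial.eval_sub, Polynomial.eval_one,
    Polynomial.eval_X] at hgx
  rw [show ((1 - 2 * x) ^ 2 - 1) / 8 = x * (x - 1) / 2 by ring,
    show (1 - (1 - 2 * x)) / 2 = x by ring,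
    show (1 + (1 - 2 * x)) = 2 * (1 - x) by ring] at hgx
  have hsum : ∑ j : Fin m, c j * regimeAFun N e (2 * M) θ (indexSetJ (2 * M) c2 c1 d2 d1) j x =
      ((2 * x) ^ (N - 1) * (1 - (1 - 2 * x) ^ 2) ^ e / (2 * (1 - x))) *
        ∑ j : Fin m, c j * ∑ l ∈ Finset.range (2 * M + 1),
      (l : ℂ) ^ (j : ℕ) * (((2 * M).choose l : ℂ) * (1 - 2 * x) ^ l * θ l *
        ∏ μ ∈ indexSetJ (2 * M) c2 c1 d2 d1, ((l : ℂ) - μ)) := by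
    rw [Finset.mul_sum]
    refine Finset.sum_congr rfl fun j _ => ?_
    rw [regimeAFun]
    ring
  rw [hF, hsum]
  have h2 : (2 * (1 - x)) ≠ 0 := mul_ne_zero two_ne_zero hx1
  rw [← mul_right_inj' h2, ← mul_left_comm, ← hgx,
    show (1 - (1 - 2 * x) ^ 2) = (2 * (1 - x)) * (1 - (1 - 2 * x)) by ring]
  field_simp
  rw [mul_pow (2 * (1 - x))]
  ring

/-- The functions `A (w) + x B (w)` determine `A` and `B`. -/
lemma eq_zero_of_infinite_eval {A B : Polynomial ℂ} {s : Finset ℂ}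
    (h : ∀ x ∉ s, A.eval (x * (x - 1) / 2) + x * B.eval (x * (x - 1) / 2) = 0) :
    A = 0 ∧ B = 0 := by
  classical
  have h1 := eq_of_eval_eq_off (s.image fun x => 1 - 2 * x) (q := 0)
    (p := Polynomial.expand ℂ 2 ((A - Polynomial.C 4 * Polynomial.X * B).comp
        (Polynomial.C (1 / 8) * (Polynomial.X - 1))) +
      Polynomial.X * Polynomial.expand ℂ 2 (A.comp
        (Polynomial.C (1 / 8) * (Polynomial.X - 1)))) (by
    intro t ht
    have ht' : (1 - t) / 2 ∉ s := by
      intro h0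
      exact ht (Finset.mem_image.2 ⟨_, h0, by ring⟩)
    have h2 := h _ ht'
    rw [eval_expand_add, Polynomial.eval_zero]
    rw [show (1 - t) / 2 * ((1 - t) / 2 - 1) / 2 = (t ^ 2 - 1) / 8 by ring] at h2
    rw [h2, mul_zero])
  obtain ⟨h2, h3⟩ := expand_two_add_X_mul_eq_zero h1
  have hcomp : ∀ Q : Polynomial ℂ, Q.comp (Polynomial.C (1 / 8) * (Polynomial.X - 1)) = 0 →
      Q = 0 := by
    intro Q hQ
    refine Polynomial.funext fun v => ?_
    have := congrArg (Polynomial.eval (8 * v + 1)) hQ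
    rw [Polynomial.eval_comp] at this
    simpa using this
  have hA := hcomp A h3
  have hE := hcomp _ h2
  rw [hA, zero_sub, neg_eq_zero, mul_eq_zero, mul_eq_zero] at hE
  refine ⟨hA, hE.resolve_left ?_⟩
  simp

/-! ### The basis near `x = 1` and near `x = 0` -/

/-- `u` repeated `p` times, then `v` repeated `q` times. -/
def twoPoints (p q : ℕ) (u v : ℂ) : Fin (p + q) → ℂ :=
  Fin.append (fun _ => u) (fun _ => v)

lemma nodal_twoPoints (p q : ℕ) (u v : ℂ) :
    nodal (twoPoints p q u v) =
      (Polynomial.X - Polynomial.C u) ^ p * (Polynomial.X - Polynomial.C v) ^ q := by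
  simp [nodal, twoPoints, Fin.prod_univ_add]

lemma dvd_of_residueCoeff_eq_zero {q R : Polynomial ℂ} (hq : q.Monic)
    (h : ∀ l < q.natDegree, residueCoeff q l R = 0) : q ∣ R := by
  rw [← Polynomial.modByMonic_eq_zero_iff_dvd hq]
  by_contra h0
  have h1 := Polynomial.natDegree_lt_natDegree h0 (Polynomial.degree_modByMonic_lt R hq)
  have h2 := h _ h1
  rw [residueCoeff_apply, Polynomial.coeff_natDegree] at h2
  exact h0 (Polynomial.leadingCoeff_eq_zero.1 h2)

/-- The generating polynomial of the coefficients of the basis elements with even index. -/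
def evenPart {N : ℕ} (u : Fin (2 * N) → ℂ) : Polynomial ℂ :=
  ∑ i : Fin N, Polynomial.C (u ⟨2 * i, by omega⟩) * Polynomial.X ^ (i : ℕ)

/-- The generating polynomial of the coefficients of the basis elements with odd index. -/
def oddPart {N : ℕ} (u : Fin (2 * N) → ℂ) : Polynomial ℂ :=
  ∑ i : Fin N, Polynomial.C (u ⟨2 * i + 1, by omega⟩) * Polynomial.X ^ (i : ℕ)

lemma degree_evenPart_lt {N : ℕ} (u : Fin (2 * N) → ℂ) : (evenPart u).degree < N :=
  Polynomial.degree_sum_fin_lt _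

lemma degree_oddPart_lt {N : ℕ} (u : Fin (2 * N) → ℂ) : (oddPart u).degree < N :=
  Polynomial.degree_sum_fin_lt _

lemma coeff_evenPart {N : ℕ} (u : Fin (2 * N) → ℂ) (i : Fin N) :
    (evenPart u).coeff i = u ⟨2 * i, by omega⟩ := by
  simp [evenPart, Polynomial.finsetSum_coeff, Polynomial.coeff_X_pow, Fin.val_inj]

lemma coeff_oddPart {N : ℕ} (u : Fin (2 * N) → ℂ) (i : Fin N) :
    (oddPart u).coeff i = u ⟨2 * i + 1, by omega⟩ := by
  simp [oddPart, Polynomial.finsetSum_coeff, Polynomial.coeff_X_pow, Fin.val_inj]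

lemma sum_two_mul {M : Type*} [AddCommMonoid M] (φ : ℕ → M) (N : ℕ) :
    ∑ j ∈ Finset.range (2 * N), φ j = ∑ i ∈ Finset.range N, (φ (2 * i) + φ (2 * i + 1)) := by
  induction N with
  | zero => simp
  | succ N ih =>
    rw [show 2 * (N + 1) = 2 * N + 1 + 1 by ring, Finset.sum_range_succ, Finset.sum_range_succ, ih,
      Finset.sum_range_succ, add_assoc]

lemma sum_fin_two_mul {M : Type*} [AddCommMonoid M] {N : ℕ} (φ : Fin (2 * N) → M) :
    ∑ j, φ j = ∑ i : Fin N, (φ ⟨2 * i, by omega⟩ + φ ⟨2 * i + 1, by omega⟩) := by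
  have h := sum_two_mul (fun j => if h : j < 2 * N then φ ⟨j, h⟩ else 0) N
  rw [← Fin.sum_univ_eq_sum_range, ← Fin.sum_univ_eq_sum_range] at h
  convert h using 1
  · exact Finset.sum_congr rfl fun j _ => by simp
  · refine Finset.sum_congr rfl fun i _ => ?_
    rw [dif_pos (show 2 * (i : ℕ) < 2 * N by omega),
      dif_pos (show 2 * (i : ℕ) + 1 < 2 * N by omega)]

/-- Sums over the columns in terms of the generating polynomials. -/
lemma sum_mul_eq_parts {N : ℕ} (φ : ℕ → ℂ) (u : Fin (2 * N) → ℂ) :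
    ∑ j : Fin (2 * N), φ j * u j = ∑ i ∈ Finset.range N,
      (φ (2 * i) * (evenPart u).coeff i + φ (2 * i + 1) * (oddPart u).coeff i) := by
  rw [sum_fin_two_mul, ← Fin.sum_univ_eq_sum_range
    (fun i => φ (2 * i) * (evenPart u).coeff i + φ (2 * i + 1) * (oddPart u).coeff i)]
  refine Finset.sum_congr rfl fun i _ => ?_
  rw [coeff_evenPart, coeff_oddPart]

lemma eq_zero_of_parts {N : ℕ} {u : Fin (2 * N) → ℂ} (h : evenPart u = 0) (h' : oddPart u = 0) :
    u = 0 := by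
  funext j
  obtain ⟨j, hj⟩ := j
  rcases Nat.even_or_odd' j with ⟨i, rfl | rfl⟩
  · have := coeff_evenPart u ⟨i, by omega⟩
    rw [h, Polynomial.coeff_zero] at this
    exact this.symm
  · have := coeff_oddPart u ⟨i, by omega⟩
    rw [h', Polynomial.coeff_zero] at this
    exact this.symm

lemma tendsto_linear (a b : ℂ) : Tendsto (fun ζ : ℂ => a * ζ + b) (𝓝[≠] 0) (𝓝 b) := by
  have : Continuous fun ζ : ℂ => a * ζ + b := by fun_prop
  simpa using (this.tendsto 0).mono_left nhdsWithin_le_nhds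

lemma tendsto_div_add_two (f : ℂ → ℂ) (hf : Continuous f) :
    Tendsto (fun ζ : ℂ => f ζ / (ζ + 2)) (𝓝[≠] 0) (𝓝 (f 0 / 2)) := by
  have : ContinuousAt (fun ζ : ℂ => f ζ / (ζ + 2)) 0 :=
    hf.continuousAt.div (by fun_prop) (by simp)
  simpa using this.tendsto.mono_left nhdsWithin_le_nhds

lemma eventually_add_two_ne_zero : ∀ᶠ ζ : ℂ in 𝓝[≠] 0, ζ + 2 ≠ 0 := by
  have : ContinuousAt (fun ζ : ℂ => ζ + 2) 0 := by fun_prop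
  exact nhdsWithin_le_nhds (this.eventually_ne (by simp))

lemma tendsto_nhdsNE {f : ℂ → ℂ} (hf : Continuous f) :
    Tendsto f (𝓝[≠] 0) (𝓝 (f 0)) := (hf.tendsto 0).mono_left nhdsWithin_le_nhds

lemma polyTendsto_basisPoly (N i : ℕ) :
    PolyTendsto (fun ζ => basisPoly N ζ i) (basisPoly N 0 i) := by
  unfold basisPoly
  refine ((PolyTendsto.const _).mul ((PolyTendsto.sub (.const _) (.C ?_)).pow _)).mul
    ((PolyTendsto.sub (.mul (.C ?_) (.const _)) (.C ?_)).pow _)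
  all_goals exact tendsto_nhdsNE (by fun_prop)

lemma polyTendsto_sigmaBasisPoly (N i : ℕ) :
    PolyTendsto (fun ζ => sigmaBasisPoly N ζ i) (sigmaBasisPoly N 0 i) := by
  unfold sigmaBasisPoly e0 e1
  split_ifs
  · refine PolyTendsto.mul (.mul (.sub (.mul (.C ?_) (.const _)) (.C ?_))
      (.sub (.C ?_) (.const _))) (polyTendsto_basisPoly N i)
    all_goals exact tendsto_nhdsNE (by fun_prop)
  · refine PolyTendsto.mul (.mul (.sub (.const _) (.C ?_)) (.sub (.mul (.C ?_) (.const _)) (.C ?_)))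
      (polyTendsto_basisPoly N i)
    all_goals exact tendsto_nhdsNE (by fun_prop)

lemma PolyTendsto.comp_scale {H : ℂ → Polynomial ℂ} {H₀ : Polynomial ℂ} (h : PolyTendsto H H₀) :
    PolyTendsto (fun ζ => (H ζ).comp (Polynomial.C ζ * Polynomial.X))
      (Polynomial.C (H₀.coeff 0)) := by
  obtain ⟨d, hd, -⟩ := h.exists_natDegree_le
  refine ⟨⟨d * 1, fun ζ => ?_⟩, fun e => ?_⟩
  · exact Polynomial.natDegree_comp_le.trans
      (Nat.mul_le_mul (hd ζ) ((Polynomial.natDegree_C_mul_le _ _).trans Polynomial.natDegree_X_le))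
  · have : ∀ ζ, ((H ζ).comp (Polynomial.C ζ * Polynomial.X)).coeff e = (H ζ).coeff e * ζ ^ e :=
      fun ζ => Polynomial.comp_C_mul_X_coeff
    simp only [this]
    have h2 := (h.2 e).mul (tendsto_nhdsNE (f := fun ζ : ℂ => ζ ^ e) (by fun_prop))
    rw [Polynomial.coeff_C]
    split_ifs with he
    · subst he; simpa using h2
    · simpa [he] using h2

lemma basisPoly_even (N : ℕ) (ζ : ℂ) (i : ℕ) : basisPoly N ζ (2 * i) =
    Polynomial.X ^ (2 * i) * (Polynomial.X - Polynomial.C (2 * ζ + 1)) ^ i *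
    (Polynomial.C (ζ + 2) * Polynomial.X - Polynomial.C ζ) ^ (N - 1 - i) := by
  rw [basisPoly, Nat.mul_div_cancel_left _ two_pos]

lemma basisPoly_odd (N : ℕ) (ζ : ℂ) (i : ℕ) :
    basisPoly N ζ (2 * i + 1) = Polynomial.X * basisPoly N ζ (2 * i) := by
  rw [basisPoly_even, basisPoly, show (2 * i + 1) / 2 = i by omega]
  ring

lemma sigmaBasisPoly_even (N : ℕ) (ζ : ℂ) (i : ℕ) :
    sigmaBasisPoly N ζ (2 * i) = e0 ζ * basisPoly N ζ (2 * i) := by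
  rw [sigmaBasisPoly, if_pos (even_two_mul i)]

lemma sigmaBasisPoly_odd (N : ℕ) (ζ : ℂ) (i : ℕ) :
    sigmaBasisPoly N ζ (2 * i + 1) = e1 ζ * basisPoly N ζ (2 * i + 1) := by
  rw [sigmaBasisPoly, if_neg (by simp)]

/-- The affine coordinate `x = ζ (1 + ζ s) / (ζ + 2)` near the points `ξ_1` and `ξ_2`. -/
def cuspMap (ζ : ℂ) : Polynomial ℂ :=
  Polynomial.C (ζ / (ζ + 2)) + Polynomial.C (ζ ^ 2 / (ζ + 2)) * Polynomial.X

/-- The function `s w` near `ξ_1` and `ξ_2`, in terms of `ζ` and `ζ s`. -/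
def cuspFactor (ζ : ℂ) : Polynomial ℂ :=
  Polynomial.C (1 / (ζ + 2) ^ 2) * (1 + Polynomial.X) ^ 2 *
    (Polynomial.C (ζ / (ζ + 2)) * (1 + Polynomial.X) - Polynomial.C (2 * ζ + 1))

lemma polyTendsto_cuspFactor :
    PolyTendsto cuspFactor (Polynomial.C (-1 / 4) * (1 + Polynomial.X) ^ 2) := by
  have h1 : Tendsto (fun ζ : ℂ => 1 / (ζ + 2) ^ 2) (𝓝[≠] 0) (𝓝 (1 / 4)) := by
    have : ContinuousAt (fun ζ : ℂ => 1 / (ζ + 2) ^ 2) 0 :=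
      ContinuousAt.div (by fun_prop) (by fun_prop) (by norm_num)
    have h := this.tendsto.mono_left (nhdsWithin_le_nhds (s := {0}ᶜ))
    norm_num at h ⊢
    exact h
  have h2 := ((PolyTendsto.C h1).mul (.const ((1 + Polynomial.X) ^ 2))).mul
    (PolyTendsto.sub (.mul (.C (tendsto_div_add_two (fun ζ => ζ) (by fun_prop)))
      (.const (1 + Polynomial.X))) (.C (tendsto_linear 2 1)))
  have h3 : Polynomial.C (-1 / 4) * (1 + Polynomial.X) ^ 2 =
      Polynomial.C (1 / 4) * (1 + Polynomial.X) ^ 2 *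
        (Polynomial.C (0 / 2) * (1 + Polynomial.X) - Polynomial.C (1 : ℂ)) := by
    refine Polynomial.funext fun v => ?_
    simp only [Polynomial.eval_mul, Polynomial.eval_pow, Polynomial.eval_sub, Polynomial.eval_C,
      Polynomial.eval_X, Polynomial.eval_add, Polynomial.eval_one]
    ring
  rw [h3]
  exact h2

lemma cusp_D {ζ : ℂ} (hζ : ζ + 2 ≠ 0) :
    (Polynomial.C (ζ + 2) * Polynomial.X - Polynomial.C ζ).comp (cuspMap ζ) =
      Polynomial.C (ζ ^ 2) * Polynomial.X := by
  refine Polynomial.funext fun v => ?_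
  simp only [cuspMap, Polynomial.eval_comp, Polynomial.eval_sub, Polynomial.eval_mul,
    Polynomial.eval_add, Polynomial.eval_C, Polynomial.eval_X]
  field_simp
  ring

lemma basisPoly_even_cusp {N i : ℕ} (hi : i < N) {ζ : ℂ} (hζ : ζ + 2 ≠ 0) :
    (basisPoly N ζ (2 * i)).comp (cuspMap ζ) = Polynomial.C (ζ ^ (2 * N - 2)) *
      (Polynomial.X ^ (N - 1 - i) *
        (cuspFactor ζ ^ i).comp (Polynomial.C ζ * Polynomial.X)) := by
  rw [basisPoly_even]
  simp only [Polynomial.mul_comp, Polynomial.pow_comp, cusp_D hζ]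
  refine Polynomial.funext fun v => ?_
  simp only [Polynomial.eval_mul, Polynomial.eval_pow, Polynomial.eval_comp, Polynomial.eval_sub,
    Polynomial.eval_C, Polynomial.eval_X, Polynomial.eval_add, Polynomial.eval_one, cuspMap,
    cuspFactor]
  rw [show 2 * N - 2 = 2 * (N - 1 - i) + 2 * i by omega, pow_add]
  simp only [pow_mul, mul_pow]
  have : ζ / (ζ + 2) + ζ ^ 2 / (ζ + 2) * v = ζ / (ζ + 2) * (1 + ζ * v) := by ring
  rw [this]
  simp only [mul_pow, div_pow, one_pow, ← pow_mul]
  field_simp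

lemma basisPoly_odd_cusp {N i : ℕ} (hi : i < N) {ζ : ℂ} (hζ : ζ + 2 ≠ 0) :
    (basisPoly N ζ (2 * i + 1)).comp (cuspMap ζ) = Polynomial.C (ζ ^ (2 * N - 1)) *
      (Polynomial.X ^ (N - 1 - i) *
        (Polynomial.C (1 / (ζ + 2)) * (1 + Polynomial.X) * cuspFactor ζ ^ i).comp
          (Polynomial.C ζ * Polynomial.X)) := by
  rw [basisPoly_odd, Polynomial.mul_comp, basisPoly_even_cusp hi hζ,
    show 2 * N - 1 = (2 * N - 2) + 1 by omega]
  refine Polynomial.funext fun v => ?_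
  simp only [Polynomial.eval_mul, Polynomial.eval_pow, Polynomial.eval_comp,
    Polynomial.eval_C, Polynomial.eval_X, Polynomial.eval_add, Polynomial.eval_one, cuspMap]
  ring

lemma sigmaBasisPoly_even_cusp {N i : ℕ} (hi : i < N) {ζ : ℂ} (hζ : ζ + 2 ≠ 0) :
    (sigmaBasisPoly N ζ (2 * i)).comp (cuspMap ζ) = Polynomial.C (ζ ^ (2 * N)) *
      (Polynomial.X ^ (N - i) *
        ((Polynomial.C (2 * ζ + 1) - Polynomial.C (3 * ζ / (ζ + 2)) * (1 + Polynomial.X)) *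
          cuspFactor ζ ^ i).comp (Polynomial.C ζ * Polynomial.X)) := by
  rw [sigmaBasisPoly_even, Polynomial.mul_comp, basisPoly_even_cusp hi hζ, e0, Polynomial.mul_comp,
    cusp_D hζ, show N - i = (N - 1 - i) + 1 by omega]
  refine Polynomial.funext fun v => ?_
  have h2 : ζ ^ (2 * N) = ζ ^ (2 * N - 2) * ζ ^ 2 := by rw [← pow_add]; congr 1; omega
  simp only [Polynomial.eval_mul, Polynomial.eval_pow, Polynomial.eval_comp, Polynomial.eval_sub,
    Polynomial.eval_C, Polynomial.eval_X, Polynomial.eval_add, Polynomial.eval_one, cuspMap, h2]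
  ring

lemma sigmaBasisPoly_odd_cusp {N i : ℕ} (hi : i < N) {ζ : ℂ} (hζ : ζ + 2 ≠ 0) :
    (sigmaBasisPoly N ζ (2 * i + 1)).comp (cuspMap ζ) = Polynomial.C (ζ ^ (2 * N)) *
      (Polynomial.X ^ (N - 1 - i) *
        ((Polynomial.C (ζ / (ζ + 2)) * (1 + Polynomial.X) - Polynomial.C (2 * ζ + 1)) *
          (Polynomial.X - Polynomial.C 2) * (Polynomial.C (1 / (ζ + 2)) * (1 + Polynomial.X)) *
          cuspFactor ζ ^ i).comp (Polynomial.C ζ * Polynomial.X)) := by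
  have h1 : e1 ζ = (Polynomial.X - Polynomial.C (2 * ζ + 1)) *
      ((Polynomial.C (ζ + 2) * Polynomial.X - Polynomial.C ζ) - Polynomial.C (2 * ζ)) := by
    rw [e1, show (3 * ζ) = ζ + 2 * ζ by ring, Polynomial.C_add (a := ζ) (b := 2 * ζ), ← sub_sub]
  rw [sigmaBasisPoly_odd, Polynomial.mul_comp, basisPoly_odd, Polynomial.mul_comp,
    basisPoly_even_cusp hi hζ, h1, Polynomial.mul_comp, Polynomial.sub_comp (q := Polynomial.C (2 * ζ)),
    cusp_D hζ]
  refine Polynomial.funext fun v => ?_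
  have h2 : ζ ^ (2 * N) = ζ ^ (2 * N - 2) * ζ ^ 2 := by rw [← pow_add]; congr 1; omega
  simp only [Polynomial.eval_mul, Polynomial.eval_pow, Polynomial.eval_comp, Polynomial.eval_sub,
    Polynomial.eval_C, Polynomial.eval_X, Polynomial.eval_add, Polynomial.eval_one, cuspMap, h2]
  ring

/-- The basis at `ζ = 0`: powers of `x (x - 1) / 2` and `x` times such powers. -/
lemma eval_basisPoly_zero_even {N i : ℕ} (hi : i < N) (x : ℂ) :
    (basisPoly N 0 (2 * i)).eval x = (2 * x) ^ (N - 1) * (x * (x - 1) / 2) ^ i := by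
  rw [basisPoly_even]
  simp only [Polynomial.eval_mul, Polynomial.eval_pow, Polynomial.eval_sub,
    Polynomial.eval_C, Polynomial.eval_X]
  have h : (2 * x) ^ (N - 1) = (2 * x) ^ (N - 1 - i) * (2 * x) ^ i := by
    rw [← pow_add]; congr 1; omega
  have h2 : 2 * x * (x * (x - 1) / 2) = x ^ 2 * (x - 1) := by ring
  rw [h, mul_assoc ((2 * x) ^ (N - 1 - i)), ← mul_pow, h2, mul_pow (x ^ 2), ← pow_mul, mul_zero,
    zero_add, zero_add, sub_zero]
  ring

lemma eval_basisPoly_zero_odd {N i : ℕ} (hi : i < N) (x : ℂ) :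
    (basisPoly N 0 (2 * i + 1)).eval x = (2 * x) ^ (N - 1) * (x * (x * (x - 1) / 2) ^ i) := by
  rw [basisPoly_odd, Polynomial.eval_mul, eval_basisPoly_zero_even hi, Polynomial.eval_X]
  ring

lemma eval_eq_sum_of_degree_lt {A : Polynomial ℂ} {N : ℕ} (hA : A.degree < N) (w : ℂ) :
    A.eval w = ∑ i ∈ Finset.range N, A.coeff i * w ^ i := by
  rcases eq_or_ne A 0 with rfl | h
  · simp
  · refine Polynomial.eval_eq_sum_range' ?_ w
    rw [Polynomial.degree_eq_natDegree h] at hA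
    exact_mod_cast hA

/-! ### Asymptotics of the determinant from the limits of its entries -/

section Asymptotics

variable {N m c0 c1 c2 c3 d0 d1 d2 d3 : ℕ}

/-- The matrix of residues for the points `ξ_i` with multiplicities `c_i` in the first and `d_i` in
the second group of variables. -/
def cuspMatrix (c0 c1 c2 c3 d0 d1 d2 d3 : ℕ) (f g : Fin (2 * N) → Polynomial ℂ) (ζ : ℂ)
    (x : Fin m → ℂ) :
    Matrix (Rows m (c0 + c3) (c1 + c2) (d0 + d3) (d1 + d2)) (Fin (2 * N)) ℂ :=
  residueMatrix f g 1 ζ (ζ / (ζ + 2)) (ζ ^ 2 / (ζ + 2)) x (twoPoints c0 c3 2 0)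
    (twoPoints c1 c2 0 2) (twoPoints d0 d3 2 0) (twoPoints d1 d2 0 2)

/-- The determinant of the matrix of residues is of exact order `E` as `ζ → 0`, and its leading
coefficient is proportional to the alternant `det (φ_j(x_i))`. -/
def DetAsymptotics (c0 c1 c2 c3 d0 d1 d2 d3 : ℕ) (f g : ℂ → Fin (2 * N) → Polynomial ℂ)
    (e : Rows m (c0 + c3) (c1 + c2) (d0 + d3) (d1 + d2) ≃ Fin (2 * N)) (E : ℤ)
    (φ : Fin m → ℂ → ℂ) : Prop :=
  ∃ C : ℂ, C ≠ 0 ∧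
    (∀ x : Fin m → ℂ, (∀ i, x i ≠ 0 ∧ x i ≠ 1) →
      HasOrder (fun ζ => ((cuspMatrix c0 c1 c2 c3 d0 d1 d2 d3 (f ζ) (g ζ) ζ x).submatrix id e).det)
        E (C * (Matrix.of fun i j => φ j (x i)).det)) ∧
    ∃ x : Fin m → ℂ, (∀ i, x i ≠ 0 ∧ x i ≠ 1 ∧ x i ≠ 1 / 2) ∧
      (Matrix.of fun i j => φ j (x i)).det ≠ 0

/-- The main reduction. The rows and columns carry weights: `rx` for the rows of the free variables,
`r₁`, …, `r₄` for the rows of the clusters and `cw` for the columns. The entries have limits `ev`,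
`Y₁`, …, `Y₄` after division by the powers of `ζ` with these weights. Only the common zeros of the
constant rows `Y₁`, …, `Y₄` have to be determined. -/
theorem detAsymptotics_of_limits {f g : ℂ → Fin (2 * N) → Polynomial ℂ}
    (e : Rows m (c0 + c3) (c1 + c2) (d0 + d3) (d1 + d2) ≃ Fin (2 * N))
    (φ : Fin m → ℂ → ℂ) (rx : ℤ) (r₁ : ℕ → ℤ) (r₂ : ℕ → ℤ) (r₃ : ℕ → ℤ) (r₄ : ℕ → ℤ)
    (cw : Fin (2 * N) → ℤ) (ev : ℂ → Fin (2 * N) → ℂ) (Y₁ Y₂ Y₃ Y₄ : ℕ → Fin (2 * N) → ℂ)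
    (hx : ∀ x, x ≠ 0 → x ≠ 1 → ∀ j, HasOrder (fun ζ => (f ζ j).eval x) (rx + cw j) (ev x j))
    (h₁ : ∀ l < c0 + c3, ∀ j, HasOrder (fun ζ => residueCoeff (nodal (twoPoints c0 c3 2 0)) l
      ((f ζ j).comp (Polynomial.C 1 + Polynomial.C ζ * Polynomial.X))) (r₁ l + cw j) (Y₁ l j))
    (h₂ : ∀ l < c1 + c2, ∀ j, HasOrder (fun ζ => residueCoeff (nodal (twoPoints c1 c2 0 2)) l
      ((f ζ j).comp (cuspMap ζ))) (r₂ l + cw j) (Y₂ l j))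
    (h₃ : ∀ l < d0 + d3, ∀ j, HasOrder (fun ζ => residueCoeff (nodal (twoPoints d0 d3 2 0)) l
      ((g ζ j).comp (Polynomial.C 1 + Polynomial.C ζ * Polynomial.X))) (r₃ l + cw j) (Y₃ l j))
    (h₄ : ∀ l < d1 + d2, ∀ j, HasOrder (fun ζ => residueCoeff (nodal (twoPoints d1 d2 0 2)) l
      ((g ζ j).comp (cuspMap ζ))) (r₄ l + cw j) (Y₄ l j))
    (hker : ∀ u : Fin (2 * N) → ℂ, (∀ l < c0 + c3, Y₁ l ⬝ᵥ u = 0) → (∀ l < c1 + c2, Y₂ l ⬝ᵥ u = 0) →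
      (∀ l < d0 + d3, Y₃ l ⬝ᵥ u = 0) → (∀ l < d1 + d2, Y₄ l ⬝ᵥ u = 0) →
      (∃ c : Fin m → ℂ, ∀ x, x ≠ 0 → x ≠ 1 → ev x ⬝ᵥ u = ∑ j, c j * φ j x) ∧
      ((∀ x, x ≠ 0 → x ≠ 1 → x ≠ 1 / 2 → ev x ⬝ᵥ u = 0) → u = 0)) :
    DetAsymptotics c0 c1 c2 c3 d0 d1 d2 d3 f g e
      (m * rx + ∑ l ∈ Finset.range (c0 + c3), r₁ l + ∑ l ∈ Finset.range (c1 + c2), r₂ l +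
        ∑ l ∈ Finset.range (d0 + d3), r₃ l + ∑ l ∈ Finset.range (d1 + d2), r₄ l + ∑ j, cw j) φ := by
  classical
  let Y : Matrix ((Fin (c0 + c3) ⊕ Fin (c1 + c2)) ⊕ (Fin (d0 + d3) ⊕ Fin (d1 + d2)))
      (Fin (2 * N)) ℂ :=
    Matrix.of (Sum.elim (Sum.elim (fun l => Y₁ l) (fun l => Y₂ l))
      (Sum.elim (fun l => Y₃ l) (fun l => Y₄ l)))
  have hY : ∀ u, Y.mulVec u = 0 → (∃ c : Fin m → ℂ, ∀ x, x ≠ 0 → x ≠ 1 →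
      ev x ⬝ᵥ u = ∑ j, c j * φ j x) ∧
      ((∀ x, x ≠ 0 → x ≠ 1 → x ≠ 1 / 2 → ev x ⬝ᵥ u = 0) → u = 0) := by
    intro u hu
    refine hker u ?_ ?_ ?_ ?_
    · exact fun l hl => congrFun hu (.inl (.inl ⟨l, hl⟩))
    · exact fun l hl => congrFun hu (.inl (.inr ⟨l, hl⟩))
    · exact fun l hl => congrFun hu (.inr (.inl ⟨l, hl⟩))
    · exact fun l hl => congrFun hu (.inr (.inr ⟨l, hl⟩))
  obtain ⟨C, hC, h1, x₀, hx₀, hdet⟩ := exists_det_eq_const_mul e Y {x | x ≠ 0 ∧ x ≠ 1}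
    {x | x ≠ 0 ∧ x ≠ 1 ∧ x ≠ 1 / 2} (fun x hx => ⟨hx.1, hx.2.1⟩) ev φ
    (fun u hu => by
      obtain ⟨c, hc⟩ := (hY u hu).1
      exact ⟨c, fun x hx => hc x hx.1 hx.2⟩)
    (fun u hu h => (hY u hu).2 fun x h0 h1 h2 => h x ⟨h0, h1, h2⟩)
  refine ⟨C, hC, fun x hxS => ?_, x₀, hx₀, hdet⟩
  rw [← h1 x hxS]
  have hsum : (m * rx + ∑ l ∈ Finset.range (c0 + c3), r₁ l + ∑ l ∈ Finset.range (c1 + c2), r₂ l +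
      ∑ l ∈ Finset.range (d0 + d3), r₃ l + ∑ l ∈ Finset.range (d1 + d2), r₄ l + ∑ j, cw j) =
      ∑ t, rowFun (fun _ : Fin m => rx) (fun l : Fin (c0 + c3) => r₁ l)
        (fun l : Fin (c1 + c2) => r₂ l) (fun l : Fin (d0 + d3) => r₃ l)
        (fun l : Fin (d1 + d2) => r₄ l) t + ∑ t, cw (e t) := by
    rw [Equiv.sum_comp e cw]
    simp only [Fintype.sum_sum_type, rowFun, Sum.elim_inl, Sum.elim_inr, Finset.sum_const,
      Finset.card_univ, Fintype.card_fin, nsmul_eq_mul]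
    rw [Fin.sum_univ_eq_sum_range r₁, Fin.sum_univ_eq_sum_range r₂, Fin.sum_univ_eq_sum_range r₃,
      Fin.sum_univ_eq_sum_range r₄]
    ring
  rw [hsum]
  refine HasOrder.det _ _ fun t t' => ?_
  rcases t with i | (l | l) | (l | l)
  · exact hx _ (hxS i).1 (hxS i).2 (e t')
  · exact h₁ l l.2 (e t')
  · exact h₂ l l.2 (e t')
  · exact h₃ l l.2 (e t')
  · exact h₄ l l.2 (e t')

end Asymptotics

lemma PolyTendsto.hasOrder_residueCoeff {H : ℂ → Polynomial ℂ} {H₀ : Polynomial ℂ}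
    (h : PolyTendsto H H₀) {q : Polynomial ℂ} (hq : q.Monic) {l : ℕ} (hl : l < q.natDegree) :
    HasOrder (fun ζ => residueCoeff q l ((H ζ).comp (Polynomial.C ζ * Polynomial.X))) l
      (H₀.coeff l) := by
  have := h.residueCoeff_scaled (residueCoeff q l) 0 l (fun i hi => by
    rw [zero_add, residueCoeff_X_pow hq (hi.trans hl), if_neg hi.ne])
  rw [zero_add, residueCoeff_X_pow hq hl, if_pos rfl, mul_one] at this
  simpa [HasOrder] using this

lemma comp_one_add (F : Polynomial ℂ) (ζ : ℂ) :
    F.comp (Polynomial.C 1 + Polynomial.C ζ * Polynomial.X) =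
      (F.comp (1 + Polynomial.X)).comp (Polynomial.C ζ * Polynomial.X) := by
  rw [Polynomial.comp_assoc]
  simp

lemma X_sub_one_pow_dvd {F : Polynomial ℂ} {a : ℕ}
    (h : ∀ l < a, (F.comp (1 + Polynomial.X)).coeff l = 0) : (Polynomial.X - 1) ^ a ∣ F := by
  obtain ⟨R, hR⟩ := Polynomial.X_pow_dvd_iff.2 h
  refine ⟨R.comp (Polynomial.X - 1), ?_⟩
  have h2 := congrArg (fun p => p.comp (Polynomial.X - 1)) hR
  simp only [Polynomial.comp_assoc, Polynomial.mul_comp, Polynomial.pow_comp,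
    Polynomial.add_comp, Polynomial.one_comp, Polynomial.X_comp] at h2
  rw [add_sub_cancel, Polynomial.comp_X] at h2
  exact h2

lemma hasOrder_of_eventually {f : ℂ → ℂ} {h : ℂ → ℂ} {n : ℤ} {l : ℂ}
    (hf : ∀ᶠ ζ in 𝓝[≠] 0, f ζ = ζ ^ n * h ζ) (hh : Tendsto h (𝓝[≠] 0) (𝓝 l)) :
    HasOrder f n l := by
  refine hh.congr' ?_
  filter_upwards [hf, self_mem_nhdsWithin] with ζ h1 h2
  have := zpow_ne_zero n (show ζ ≠ 0 from h2)
  rw [h1]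
  field_simp

lemma map_C_mul (φ : Polynomial ℂ →ₗ[ℂ] ℂ) (c : ℂ) (F : Polynomial ℂ) :
    φ (Polynomial.C c * F) = c * φ F := by
  rw [← Polynomial.smul_eq_C_mul, map_smul, smul_eq_mul]

/-- The limits near `ξ_1`, `ξ_2` of the basis, after division by `ζ ^ (2 N - 2)`. -/
def cuspLimit (N i : ℕ) : Polynomial ℂ :=
  if Even i then Polynomial.X ^ (N - 1 - i / 2) * Polynomial.C ((-1 / 4) ^ (i / 2)) else 0

/-- The limits near `ξ_1`, `ξ_2` of the images of the basis under `σ̂`, after division by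
`ζ ^ (2 N)`. -/
def cuspLimitSigma (N i : ℕ) : Polynomial ℂ :=
  if Even i then Polynomial.X ^ (N - i / 2) * Polynomial.C ((-1 / 4) ^ (i / 2))
  else Polynomial.X ^ (N - 1 - i / 2) * Polynomial.C ((-1 / 4) ^ (i / 2))

lemma coeff_zero_cuspFactor_limit (i : ℕ) :
    ((Polynomial.C (-1 / 4) * (1 + Polynomial.X) ^ 2 : Polynomial ℂ) ^ i).coeff 0 =
      (-1 / 4) ^ i := by
  rw [Polynomial.coeff_zero_eq_eval_zero]
  simp

/-- Near `ξ_1` and `ξ_2` the elements with odd index `2 i + 1` have the limit `0`: they carry the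
factor `x`, which has order `ζ` there. -/
lemma hasOrder_cusp {N : ℕ} (φ : Polynomial ℂ →ₗ[ℂ] ℂ) (j : Fin (2 * N)) :
    HasOrder (fun ζ => φ ((basisPoly N ζ j).comp (cuspMap ζ))) (2 * N - 2 : ℤ)
      (φ (cuspLimit N j)) := by
  obtain ⟨j, hj⟩ := j
  have hN : ((2 * N - 2 : ℕ) : ℤ) = 2 * N - 2 := by omega
  rcases Nat.even_or_odd' j with ⟨i, rfl | rfl⟩
  · have h1 := ((PolyTendsto.const (Polynomial.X ^ (N - 1 - i))).mul
      (polyTendsto_cuspFactor.pow i).comp_scale).linear φ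
    rw [coeff_zero_cuspFactor_limit] at h1
    rw [cuspLimit, if_pos (even_two_mul i), Nat.mul_div_cancel_left _ two_pos]
    refine hasOrder_of_eventually ?_ h1
    filter_upwards [eventually_add_two_ne_zero] with ζ hζ
    rw [basisPoly_even_cusp (by omega) hζ, map_C_mul, ← hN,
      zpow_natCast]
  · have h1 := ((PolyTendsto.C (show Tendsto (fun ζ : ℂ => ζ) (𝓝[≠] 0) (𝓝 0) from
      tendsto_nhdsNE (f := fun ζ => ζ) continuous_id)).mul
      ((PolyTendsto.const (Polynomial.X ^ (N - 1 - i))).mul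
      (((PolyTendsto.C (tendsto_div_add_two (fun _ => 1) (by fun_prop))).mul
        (.const (1 + Polynomial.X))).mul (polyTendsto_cuspFactor.pow i)).comp_scale)).linear φ
    rw [cuspLimit, if_neg (by simp)]
    rw [Polynomial.C_0, zero_mul] at h1
    refine hasOrder_of_eventually ?_ h1
    filter_upwards [eventually_add_two_ne_zero] with ζ hζ
    rw [basisPoly_odd_cusp (by omega) hζ, map_C_mul, map_C_mul, ← hN, zpow_natCast, ← mul_assoc, ← pow_succ]
    congr 2
    omega

/-- After application of `σ̂` both kinds of basis elements have order `2 N` near `ξ_1` and `ξ_2`. -/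
lemma hasOrder_cusp_sigma {N : ℕ} (φ : Polynomial ℂ →ₗ[ℂ] ℂ) (j : Fin (2 * N)) :
    HasOrder (fun ζ => φ ((sigmaBasisPoly N ζ j).comp (cuspMap ζ))) (2 * N : ℤ)
      (φ (cuspLimitSigma N j)) := by
  obtain ⟨j, hj⟩ := j
  have hN : ((2 * N : ℕ) : ℤ) = 2 * N := by omega
  have t1 := PolyTendsto.C (tendsto_linear 2 1)
  have t3 : PolyTendsto (fun ζ : ℂ => Polynomial.C (3 * ζ / (ζ + 2)) * (1 + Polynomial.X)) _ :=
    (PolyTendsto.C (tendsto_div_add_two (fun ζ => 3 * ζ) (by fun_prop))).mul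
      (.const (1 + Polynomial.X))
  have t2 : PolyTendsto (fun ζ : ℂ => Polynomial.C (ζ / (ζ + 2)) * (1 + Polynomial.X)) _ :=
    (PolyTendsto.C (tendsto_div_add_two (fun ζ => ζ) (by fun_prop))).mul
      (.const (1 + Polynomial.X))
  have t4 : PolyTendsto (fun ζ : ℂ => Polynomial.C (1 / (ζ + 2)) * (1 + Polynomial.X)) _ :=
    (PolyTendsto.C (tendsto_div_add_two (fun ζ => 1) (by fun_prop))).mul
      (.const (1 + Polynomial.X))
  rcases Nat.even_or_odd' j with ⟨i, rfl | rfl⟩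
  · have h1 := ((PolyTendsto.const (Polynomial.X ^ (N - i))).mul
      ((t1.sub t3).mul (polyTendsto_cuspFactor.pow i)).comp_scale).linear φ
    rw [Polynomial.mul_coeff_zero, coeff_zero_cuspFactor_limit] at h1
    rw [cuspLimitSigma, if_pos (even_two_mul i), Nat.mul_div_cancel_left _ two_pos]
    simp only [mul_zero, zero_div, Polynomial.C_0, zero_mul, sub_zero, Polynomial.C_1,
      Polynomial.coeff_one_zero, one_mul] at h1
    refine hasOrder_of_eventually ?_ h1
    filter_upwards [eventually_add_two_ne_zero] with ζ hζ
    rw [sigmaBasisPoly_even_cusp (by omega) hζ, map_C_mul,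
      ← hN, zpow_natCast]
  · have h1 := ((PolyTendsto.const (Polynomial.X ^ (N - 1 - i))).mul
      ((((t2.sub t1).mul (.const (Polynomial.X - Polynomial.C 2))).mul t4).mul
        (polyTendsto_cuspFactor.pow i)).comp_scale).linear φ
    rw [Polynomial.mul_coeff_zero, coeff_zero_cuspFactor_limit] at h1
    rw [cuspLimitSigma, if_neg (by simp), show (2 * i + 1) / 2 = i by omega]
    have hc : ((Polynomial.C ((0 : ℂ) / 2) * (1 + Polynomial.X) - Polynomial.C 1) *
        (Polynomial.X - Polynomial.C 2) * (Polynomial.C (1 / 2) * (1 + Polynomial.X)) :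
        Polynomial ℂ).coeff 0 = 1 := by
      rw [Polynomial.coeff_zero_eq_eval_zero]
      simp
    rw [hc, one_mul] at h1
    refine hasOrder_of_eventually ?_ h1
    filter_upwards [eventually_add_two_ne_zero] with ζ hζ
    rw [sigmaBasisPoly_odd_cusp (by omega) hζ, map_C_mul,
      ← hN, zpow_natCast]

/-! ### Regime A -/

section RegimeA

variable {N : ℕ}

lemma sum_basisPoly_zero_eval (u : Fin (2 * N) → ℂ) (x : ℂ) :
    ∑ j : Fin (2 * N), (basisPoly N 0 j).eval x * u j = (2 * x) ^ (N - 1) *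
      ((evenPart u).eval (x * (x - 1) / 2) + x * (oddPart u).eval (x * (x - 1) / 2)) := by
  rw [sum_mul_eq_parts (fun j => (basisPoly N 0 j).eval x),
    eval_eq_sum_of_degree_lt (degree_evenPart_lt u), eval_eq_sum_of_degree_lt (degree_oddPart_lt u),
    Finset.mul_sum, ← Finset.sum_add_distrib, Finset.mul_sum]
  refine Finset.sum_congr rfl fun i hi => ?_
  rw [Finset.mem_range] at hi
  rw [eval_basisPoly_zero_even hi, eval_basisPoly_zero_odd hi]
  ring

lemma sum_sigmaBasisPoly_zero_eval (u : Fin (2 * N) → ℂ) (x : ℂ) :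
    ∑ j : Fin (2 * N), (sigmaBasisPoly N 0 j).eval x * u j = (2 * x) ^ N *
      ((1 - 3 * x) * (evenPart u).eval (x * (x - 1) / 2) +
        x * (x - 1) * (oddPart u).eval (x * (x - 1) / 2)) := by
  rw [sum_mul_eq_parts (fun j => (sigmaBasisPoly N 0 j).eval x),
    eval_eq_sum_of_degree_lt (degree_evenPart_lt u), eval_eq_sum_of_degree_lt (degree_oddPart_lt u),
    Finset.mul_sum, Finset.mul_sum, ← Finset.sum_add_distrib, Finset.mul_sum]
  refine Finset.sum_congr rfl fun i hi => ?_
  rw [Finset.mem_range] at hi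
  rw [sigmaBasisPoly_even, sigmaBasisPoly_odd, Polynomial.eval_mul, Polynomial.eval_mul,
    eval_basisPoly_zero_even hi, eval_basisPoly_zero_odd hi, e0, e1,
    show (2 * x) ^ N = (2 * x) ^ (N - 1) * (2 * x) by rw [← pow_succ, Nat.sub_add_cancel (by omega)]]
  simp only [Polynomial.eval_mul, Polynomial.eval_sub, Polynomial.eval_C, Polynomial.eval_X]
  ring

lemma dot_linear (φ : Polynomial ℂ →ₗ[ℂ] ℂ) {n : ℕ} (p : Fin n → Polynomial ℂ) (u : Fin n → ℂ) :
    (fun j => φ (p j)) ⬝ᵥ u = φ (∑ j, Polynomial.C (u j) * p j) := by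
  rw [map_sum, dotProduct]
  refine Finset.sum_congr rfl fun j _ => ?_
  rw [← Polynomial.smul_eq_C_mul, map_smul, smul_eq_mul, mul_comm]

lemma X_sub_one_pow_dvd_sum {n a : ℕ} {p : Fin n → Polynomial ℂ} {u : Fin n → ℂ}
    (h : ∀ l < a, (fun j => ((p j).comp (1 + Polynomial.X)).coeff l) ⬝ᵥ u = 0) :
    (Polynomial.X - 1) ^ a ∣ ∑ j, Polynomial.C (u j) * p j := by
  refine X_sub_one_pow_dvd fun l hl => ?_
  rw [← h l hl, Polynomial.comp_eq_aeval, map_sum, Polynomial.finsetSum_coeff, dotProduct]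
  refine Finset.sum_congr rfl fun j _ => ?_
  rw [← Polynomial.comp_eq_aeval, Polynomial.mul_comp, Polynomial.C_comp, Polynomial.coeff_C_mul,
    mul_comm]

lemma nodal_dvd_sum {n p q : ℕ} {r v : ℂ} {f : Fin n → Polynomial ℂ} {u : Fin n → ℂ}
    (h : ∀ l < p + q, (fun j => residueCoeff (nodal (twoPoints p q r v)) l (f j)) ⬝ᵥ u = 0) :
    (Polynomial.X - Polynomial.C r) ^ p * (Polynomial.X - Polynomial.C v) ^ q ∣
      ∑ j, Polynomial.C (u j) * f j := by
  rw [← nodal_twoPoints]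
  refine dvd_of_residueCoeff_eq_zero (nodal_monic _) fun l hl => ?_
  rw [← h l (by rwa [natDegree_nodal] at hl), dot_linear]

lemma eval_sum_C_mul {n : ℕ} (p : Fin n → Polynomial ℂ) (u : Fin n → ℂ) (x : ℂ) :
    (∑ j, Polynomial.C (u j) * p j).eval x = ∑ j, (p j).eval x * u j := by
  rw [Polynomial.eval_finsetSum]
  refine Finset.sum_congr rfl fun j _ => ?_
  rw [Polynomial.eval_mul, Polynomial.eval_C, mul_comm]

lemma sum_cuspLimit (u : Fin (2 * N) → ℂ) :
    ∑ j : Fin (2 * N), Polynomial.C (u j) * cuspLimit N j =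
      homog (N - 1) (evenPart u) (Polynomial.C (-1 / 4)) Polynomial.X := by
  refine Polynomial.funext fun v => ?_
  rw [eval_sum_C_mul, sum_mul_eq_parts (fun j => (cuspLimit N j).eval v)]
  rcases Nat.eq_zero_or_pos N with rfl | hN
  · simp [homog, evenPart]
  · rw [homog, Nat.sub_add_cancel hN, Polynomial.eval_finsetSum]
    refine Finset.sum_congr rfl fun i hi => ?_
    rw [cuspLimit, if_pos (even_two_mul i), cuspLimit, if_neg (by simp),
      Nat.mul_div_cancel_left _ two_pos]
    simp only [Polynomial.eval_mul, Polynomial.eval_pow, Polynomial.eval_C, Polynomial.eval_X,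
      Polynomial.eval_zero]
    ring

lemma sum_cuspLimitSigma (u : Fin (2 * N) → ℂ) :
    ∑ j : Fin (2 * N), Polynomial.C (u j) * cuspLimitSigma N j =
      Polynomial.X * homog (N - 1) (evenPart u) (Polynomial.C (-1 / 4)) Polynomial.X +
        homog (N - 1) (oddPart u) (Polynomial.C (-1 / 4)) Polynomial.X := by
  refine Polynomial.funext fun v => ?_
  rw [eval_sum_C_mul, sum_mul_eq_parts (fun j => (cuspLimitSigma N j).eval v)]
  rcases Nat.eq_zero_or_pos N with rfl | hN
  · simp [homog, evenPart, oddPart]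
  · rw [homog, homog, Nat.sub_add_cancel hN, Polynomial.eval_add, Polynomial.eval_mul,
      Polynomial.eval_finsetSum, Polynomial.eval_finsetSum, Finset.mul_sum,
      ← Finset.sum_add_distrib]
    refine Finset.sum_congr rfl fun i hi => ?_
    rw [Finset.mem_range] at hi
    rw [cuspLimitSigma, if_pos (even_two_mul i), cuspLimitSigma, if_neg (by simp),
      Nat.mul_div_cancel_left _ two_pos, show (2 * i + 1) / 2 = i by omega,
      show N - i = (N - 1 - i) + 1 by omega, pow_succ]
    simp only [Polynomial.eval_mul, Polynomial.eval_pow, Polynomial.eval_C, Polynomial.eval_X]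
    ring

/-- In regime A all column weights are zero, and a row for the `l`-th coefficient at `x = 1` has weight
`l`: in the limit it is the `l`-th Taylor coefficient at `x = 1`. -/
theorem detAsymptotics_regimeA {m c0 c1 c2 c3 d0 d1 d2 d3 M e₀ q : ℕ}
    (e : Rows m (c0 + c3) (c1 + c2) (d0 + d3) (d1 + d2) ≃ Fin (2 * N)) {θ : ℕ → ℂ}
    (hM : N = M + e₀) (hc : c1 + c2 ≤ M) (hd : d1 + d2 ≤ M + 1)
    (hcard : 2 * M + 1 = q + m + (c1 + c2) + (d1 + d2))
    (hθ : (e₀ = d0 + d3 ∧ c0 + c3 + 1 = d0 + d3 + q ∧ θ = fun _ => 1) ∨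
      (e₀ = c0 + c3 + 1 ∧ d0 + d3 = c0 + c3 + 1 + q ∧ θ = fun l => 1 + 2 * (-1) ^ l)) :
    DetAsymptotics c0 c1 c2 c3 d0 d1 d2 d3 (fun ζ j => basisPoly N ζ j)
      (fun ζ j => sigmaBasisPoly N ζ j) e
      ((∑ l ∈ Finset.range (c0 + c3), (l : ℤ)) + (c1 + c2) * (2 * N - 2) +
        (∑ l ∈ Finset.range (d0 + d3), (l : ℤ)) + (d1 + d2) * (2 * N))
      (fun j x => regimeAFun N e₀ (2 * M) θ (indexSetJ (2 * M) c2 c1 d2 d1) j x) := by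
  have h := detAsymptotics_of_limits (m := m) (c0 := c0) (c1 := c1) (c2 := c2) (c3 := c3)
    (d0 := d0) (d1 := d1) (d2 := d2) (d3 := d3)
    (f := fun ζ (j : Fin (2 * N)) => basisPoly N ζ j)
    (g := fun ζ (j : Fin (2 * N)) => sigmaBasisPoly N ζ j) e
    (fun j x => regimeAFun N e₀ (2 * M) θ (indexSetJ (2 * M) c2 c1 d2 d1) j x)
    0 (fun l => l) (fun _ => 2 * N - 2) (fun l => l) (fun _ => 2 * N) (fun _ => 0)
    (fun x j => (basisPoly N 0 j).eval x)
    (fun l j => ((basisPoly N 0 j).comp (1 + Polynomial.X)).coeff l)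
    (fun l j => residueCoeff (nodal (twoPoints c1 c2 0 2)) l (cuspLimit N j))
    (fun l j => ((sigmaBasisPoly N 0 j).comp (1 + Polynomial.X)).coeff l)
    (fun l j => residueCoeff (nodal (twoPoints d1 d2 0 2)) l (cuspLimitSigma N j))
    ?_ ?_ ?_ ?_ ?_ ?_
  · convert h using 1
    simp
    ring
  · intro x _ _ j
    simpa using HasOrder.of_tendsto ((polyTendsto_basisPoly N j).eval x)
  · intro l hl j
    simp only [comp_one_add, add_zero]
    exact ((polyTendsto_basisPoly N j).comp (1 + Polynomial.X)).hasOrder_residueCoeff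
      (nodal_monic _) (by rwa [natDegree_nodal])
  · intro l hl j
    simpa using hasOrder_cusp (residueCoeff (nodal (twoPoints c1 c2 0 2)) l) j
  · intro l hl j
    simp only [comp_one_add, add_zero]
    exact ((polyTendsto_sigmaBasisPoly N j).comp (1 + Polynomial.X)).hasOrder_residueCoeff
      (nodal_monic _) (by rwa [natDegree_nodal])
  · intro l hl j
    simpa using hasOrder_cusp_sigma (residueCoeff (nodal (twoPoints d1 d2 0 2)) l) j
  · intro u h1 h2 h3 h4
    have hF : ∀ x, (∑ j : Fin (2 * N), Polynomial.C (u j) * basisPoly N 0 j).eval x = _ :=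
      fun x => (eval_sum_C_mul _ u x).trans (sum_basisPoly_zero_eval u x)
    have hS : ∀ x, (∑ j : Fin (2 * N), Polynomial.C (u j) * sigmaBasisPoly N 0 j).eval x = _ :=
      fun x => (eval_sum_C_mul _ u x).trans (sum_sigmaBasisPoly_zero_eval u x)
    have hev : ∀ x, (fun j : Fin (2 * N) => (basisPoly N 0 j).eval x) ⬝ᵥ u =
        (∑ j : Fin (2 * N), Polynomial.C (u j) * basisPoly N 0 j).eval x := by
      intro x
      rw [eval_sum_C_mul]; rfl
    refine ⟨?_, fun h0 => ?_⟩
    · have hA' := nodal_dvd_sum h2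
      rw [sum_cuspLimit, Polynomial.C_0, sub_zero] at hA'
      have hE' := nodal_dvd_sum h4
      rw [sum_cuspLimitSigma, Polynomial.C_0, sub_zero] at hE'
      obtain ⟨c, hc'⟩ := exists_eq_sum_regimeAFun (m := m) (degree_evenPart_lt u)
        (degree_oddPart_lt u) hF hS (a := c0 + c3) (b := d0 + d3)
        (X_sub_one_pow_dvd_sum h1) (X_sub_one_pow_dvd_sum h3)
        (c1 := c1) (c2 := c2) (d1 := d1) (d2 := d2) hA' hE'
        hM hc hd hcard hθ
      exact ⟨c, fun x _ hx1 => (hev x).trans (hc' x hx1)⟩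
    · have h5 : ∀ x ∉ ({0, 1, 1 / 2} : Finset ℂ), (evenPart u).eval (x * (x - 1) / 2) +
          x * (oddPart u).eval (x * (x - 1) / 2) = 0 := by
        intro x hx
        simp only [Finset.mem_insert, Finset.mem_singleton, not_or] at hx
        have := h0 x hx.1 hx.2.1 hx.2.2
        rw [hev, hF] at this
        exact (mul_eq_zero.1 this).resolve_left
          (pow_ne_zero _ (mul_ne_zero two_ne_zero hx.1))
      obtain ⟨h6, h7⟩ := eq_zero_of_infinite_eval h5
      exact eq_zero_of_parts h6 h7

/-- The alternant of functions `∑_λ λ ^ j v_λ`. -/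
lemma det_sum_pow {m M : ℕ} (p : Fin m → ℂ) (v : Fin m → ℕ → ℂ) :
    (Matrix.of fun i j : Fin m => p i * ∑ l ∈ Finset.range (M + 1), (l : ℂ) ^ (j : ℕ) * v i l).det =
      (∏ i, p i) * ∑ l : Fin m → Fin (M + 1),
        delta (fun i => ((l i : ℕ) : ℂ)) * ∏ i, v i (l i) := by
  have h1 : (Matrix.of fun i j : Fin m =>
      p i * ∑ l ∈ Finset.range (M + 1), (l : ℂ) ^ (j : ℕ) * v i l) =
      Matrix.of fun i j : Fin m => p i * (Matrix.of fun i j : Fin m =>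
        ∑ l ∈ Finset.range (M + 1), (l : ℂ) ^ (j : ℕ) * v i l) i j := rfl
  rw [h1, Matrix.det_mul_column]
  congr 1
  have h2 : (Matrix.of fun i j : Fin m => ∑ l ∈ Finset.range (M + 1), (l : ℂ) ^ (j : ℕ) * v i l) =
      fun i => ∑ l : Fin (M + 1), v i l • fun j : Fin m => ((l : ℕ) : ℂ) ^ (j : ℕ) := by
    funext i j
    rw [Finset.sum_apply, Matrix.of_apply,
      ← Fin.sum_univ_eq_sum_range (fun l => (l : ℂ) ^ (j : ℕ) * v i l)]
    refine Finset.sum_congr rfl fun l _ => ?_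
    rw [Pi.smul_apply, smul_eq_mul, mul_comm]
  rw [h2]
  change (Matrix.detRowAlternating (R := ℂ) (n := Fin m)).toMultilinearMap _ = _
  rw [MultilinearMap.map_sum]
  refine Finset.sum_congr rfl fun l _ => ?_
  rw [MultilinearMap.map_smul_univ, smul_eq_mul, mul_comm]
  congr 1
  exact Matrix.det_vandermonde _

end RegimeA

/-! ### Regimes B and C: gluing the conditions near the cusps -/

lemma HasOrder.of_lt {f : ℂ → ℂ} {e e' : ℤ} {l : ℂ} (h : HasOrder f e l) (he : e' < e) :
    HasOrder f e' 0 := by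
  obtain ⟨d, hd⟩ : ∃ d : ℕ, e = e' + (d + 1 : ℕ) := ⟨(e - e' - 1).toNat, by omega⟩
  have h1 : Tendsto (fun ζ : ℂ => ζ ^ (d + 1)) (𝓝[≠] 0) (𝓝 0) := by
    have := tendsto_nhdsNE (f := fun ζ : ℂ => ζ ^ (d + 1)) (by fun_prop)
    simpa using this
  have h2 := Tendsto.mul h h1
  rw [mul_zero] at h2
  refine h2.congr' ?_
  filter_upwards [self_mem_nhdsWithin] with ζ hζ
  have hζ' : ζ ≠ 0 := hζ
  have := zpow_ne_zero e' hζ'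
  rw [hd, zpow_add₀ hζ', zpow_natCast]
  field_simp

lemma HasOrder.of_le {f : ℂ → ℂ} {e e' : ℤ} {l : ℂ} (h : HasOrder f e l) (he : e' ≤ e) :
    HasOrder f e' (if e' = e then l else 0) := by
  split_ifs with h1
  · rwa [h1]
  · exact h.of_lt (lt_of_le_of_ne he h1)

/-- The terms of degree less than `n`. -/
def lowPart (n : ℕ) (p : Polynomial ℂ) : Polynomial ℂ :=
  ∑ i ∈ Finset.range n, Polynomial.C (p.coeff i) * Polynomial.X ^ i

lemma coeff_lowPart (n : ℕ) (p : Polynomial ℂ) (i : ℕ) :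
    (lowPart n p).coeff i = if i < n then p.coeff i else 0 := by
  simp [lowPart, Polynomial.finsetSum_coeff, Polynomial.coeff_X_pow]

lemma degree_lowPart_lt (n : ℕ) (p : Polynomial ℂ) : (lowPart n p).degree < n := by
  rw [Polynomial.degree_lt_iff_coeff_zero]
  intro i hi
  rw [coeff_lowPart, if_neg (not_lt.2 hi)]

/-- The combination of `α` and `β` whose low coefficients vanish, see `pade_eq_zero`. -/
def padeComb (P : ℕ) (α β : Polynomial ℂ) : Polynomial ℂ :=
  homog P α (Polynomial.C (-1 / 4) * (1 + Polynomial.X) ^ 2) Polynomial.X +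
    Polynomial.C (1 / 2) * (1 + Polynomial.X) *
      homog P β (Polynomial.C (-1 / 4) * (1 + Polynomial.X) ^ 2) Polynomial.X

lemma coeff_padeComb (P : ℕ) (α β : Polynomial ℂ) (k : ℕ) :
    (padeComb P (lowPart (P + 1) α) (lowPart P β)).coeff k =
      ∑ i ∈ Finset.range (P + 1), (if P ≤ i + k then
        ((Polynomial.C (-1 / 4) * (1 + Polynomial.X) ^ 2 : Polynomial ℂ) ^ i).coeff (i + k - P)
          else 0) * α.coeff i +
      ∑ i ∈ Finset.range P, (if P ≤ i + k then
        (Polynomial.C (1 / 2) * (1 + Polynomial.X) *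
          (Polynomial.C (-1 / 4) * (1 + Polynomial.X) ^ 2 : Polynomial ℂ) ^ i).coeff (i + k - P)
          else 0) * β.coeff i := by
  have h2 : homog P (lowPart P β) (Polynomial.C (-1 / 4) * (1 + Polynomial.X) ^ 2) Polynomial.X =
      ∑ i ∈ Finset.range P, Polynomial.C ((lowPart P β).coeff i) *
        (Polynomial.C (-1 / 4) * (1 + Polynomial.X) ^ 2) ^ i * Polynomial.X ^ (P - i) := by
    rw [homog, Finset.sum_range_succ, coeff_lowPart P β P, if_neg (lt_irrefl P), Polynomial.C_0,
      zero_mul, zero_mul, add_zero]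
  rw [padeComb, h2, homog, Finset.mul_sum, Polynomial.coeff_add, Polynomial.finsetSum_coeff,
    Polynomial.finsetSum_coeff]
  congr 1
  · refine Finset.sum_congr rfl fun i hi => ?_
    have hi' : i < P + 1 := Finset.mem_range.1 hi
    rw [coeff_lowPart, if_pos hi', mul_assoc, Polynomial.coeff_C_mul, Polynomial.coeff_mul_X_pow',
      mul_comm]
    congr 1
    by_cases h : P ≤ i + k
    · rw [if_pos h, if_pos (by omega)]
      congr 1
      omega
    · rw [if_neg h, if_neg (by omega)]
  · refine Finset.sum_congr rfl fun i hi => ?_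
    have hi' : i < P := Finset.mem_range.1 hi
    rw [coeff_lowPart, if_pos hi', show Polynomial.C (1 / 2) * (1 + Polynomial.X) * (Polynomial.C
        (β.coeff i) * (Polynomial.C (-1 / 4) * (1 + Polynomial.X) ^ 2) ^ i *
          Polynomial.X ^ (P - i)) = Polynomial.C (β.coeff i) * ((Polynomial.C (1 / 2) *
          (1 + Polynomial.X) * (Polynomial.C (-1 / 4) * (1 + Polynomial.X) ^ 2) ^ i) *
          Polynomial.X ^ (P - i)) by ring, Polynomial.coeff_C_mul, Polynomial.coeff_mul_X_pow',
      mul_comm]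
    congr 1
    by_cases h : P ≤ i + k
    · rw [if_pos h, if_pos (by omega)]
      congr 1
      omega
    · rw [if_neg h, if_neg (by omega)]

/-- The limits of the rows of the large cluster near `x = 0`. The entries of the two kinds of columns
are the coefficients of `X ^ (nE - 1 - i) H_i (ζ X)`, with an additional factor `ζ` for the columns of
the second kind. The row `j` belongs to the exponent `l = nE - 1 - j` and has the weight
`-(min l P - 1)`, the columns have the weights `min i P - 1` and `min i (P - 1)`.

With these weights the limiting rows with `l ≤ P` state that the coefficients of `padeComb` of degree
less than `K` vanish, where the high coefficients of `α` and `β` do not enter. A row with `l > P`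
determines the coefficient of `α` with index `l` once the low coefficients vanish. -/
theorem exists_limits_saturated {P nE nB S K ab : ℕ} (hPE : P ≤ nE) (hPB : P ≤ nB) (hBE : nB ≤ nE)
    (hS : S + ab = nE + P) (hK : K + ab = 2 * P + 1) {q : Polynomial ℂ} (hq : q.Monic)
    (hqS : q.natDegree = S) {HE HB : ℕ → ℂ → Polynomial ℂ} {HE₀ HB₀ : ℕ → Polynomial ℂ}
    (hHE : ∀ i < nE, PolyTendsto (HE i) (HE₀ i)) (hHB : ∀ i < nB, PolyTendsto (HB i) (HB₀ i))
    (hE₀ : ∀ i < nE, i ≤ P →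
      HE₀ i = (Polynomial.C (-1 / 4) * (1 + Polynomial.X) ^ 2) ^ i)
    (hE₀' : ∀ i < nE, (HE₀ i).coeff 0 ≠ 0)
    (hB₀ : ∀ i < nB, i < P → HB₀ i = Polynomial.C (1 / 2) * (1 + Polynomial.X) *
      (Polynomial.C (-1 / 4) * (1 + Polynomial.X) ^ 2) ^ i) :
    ∃ YE YB : ℕ → ℕ → ℂ,
      (∀ j < S, ∀ i < nE, HasOrder (fun ζ => residueCoeff q j (Polynomial.X ^ (nE - 1 - i) *
        (HE i ζ).comp (Polynomial.C ζ * Polynomial.X)))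
        (-(min ((nE : ℤ) - 1 - j) P - 1) + (min (i : ℤ) P - 1)) (YE j i)) ∧
      (∀ j < S, ∀ i < nB, HasOrder (fun ζ => residueCoeff q j (Polynomial.C ζ *
        (Polynomial.X ^ (nE - 1 - i) * (HB i ζ).comp (Polynomial.C ζ * Polynomial.X))))
        (-(min ((nE : ℤ) - 1 - j) P - 1) + min (i : ℤ) (P - 1)) (YB j i)) ∧
      ∀ α β : Polynomial ℂ, α.degree < nE →
        (∀ j < S, ∑ i ∈ Finset.range nE, YE j i * α.coeff i +
          ∑ i ∈ Finset.range nB, YB j i * β.coeff i = 0) →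
        Polynomial.X ^ K ∣ padeComb P (lowPart (P + 1) α) (lowPart P β) ∧
        (lowPart (P + 1) α = 0 → lowPart P β = 0 → α = 0) := by
  refine ⟨fun j i => if nE ≤ i + 1 + j then
      (if min (i : ℤ) P - min ((nE : ℤ) - 1 - j) P = i - (nE - 1 - j) then
        (HE₀ i).coeff (i + 1 + j - nE) else 0)
      else (if min (i : ℤ) P = min ((nE : ℤ) - 1 - j) P then
        residueCoeff q j (Polynomial.X ^ (nE - 1 - i)) * (HE₀ i).coeff 0 else 0),
    fun j i => if nE ≤ i + 1 + j ∧ i < P ∧ nE ≤ P + 1 + j then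
      (HB₀ i).coeff (i + 1 + j - nE) else 0, ?_, ?_, ?_⟩
  · intro j hj i hi
    simp only
    by_cases h : nE ≤ i + 1 + j
    · rw [if_pos h]
      have h1 := (hHE i hi).residueCoeff_scaled (residueCoeff q j) (nE - 1 - i) (i + 1 + j - nE)
        (fun i' hi' => by rw [residueCoeff_X_pow hq (by omega), if_neg (by omega)])
      rw [residueCoeff_X_pow hq (by omega), if_pos (by omega), mul_one] at h1
      have h2 : HasOrder (fun ζ => residueCoeff q j (Polynomial.X ^ (nE - 1 - i) *
        (HE i ζ).comp (Polynomial.C ζ * Polynomial.X))) ((i + 1 + j - nE : ℕ) : ℤ)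
        ((HE₀ i).coeff (i + 1 + j - nE)) := by
        simpa [HasOrder] using h1
      have h3 := h2.of_le (e' := -(min ((nE : ℤ) - 1 - j) P - 1) + (min (i : ℤ) P - 1))
        (by omega)
      convert h3 using 1
      refine if_congr ?_ rfl rfl
      omega
    · rw [if_neg h]
      have h1 := ((PolyTendsto.const (Polynomial.X ^ (nE - 1 - i))).mul
        (hHE i hi).comp_scale).linear (residueCoeff q j)
      rw [mul_comm (Polynomial.X ^ (nE - 1 - i)) (Polynomial.C _), map_C_mul] at h1
      have h3 := (HasOrder.of_tendsto h1).of_le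
        (e' := -(min ((nE : ℤ) - 1 - j) P - 1) + (min (i : ℤ) P - 1)) (by omega)
      convert h3 using 1
      rw [mul_comm]
      refine if_congr ?_ rfl rfl
      omega
  · intro j hj i hi
    simp only [map_C_mul]
    have hz : HasOrder (fun ζ : ℂ => ζ) 1 1 := by simpa using HasOrder.zpow_self 1
    by_cases h : nE ≤ i + 1 + j
    · have h1 := (hHB i hi).residueCoeff_scaled (residueCoeff q j) (nE - 1 - i) (i + 1 + j - nE)
        (fun i' hi' => by rw [residueCoeff_X_pow hq (by omega), if_neg (by omega)])
      rw [residueCoeff_X_pow hq (by omega), if_pos (by omega), mul_one] at h1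
      have h2 : HasOrder (fun ζ => residueCoeff q j (Polynomial.X ^ (nE - 1 - i) *
        (HB i ζ).comp (Polynomial.C ζ * Polynomial.X))) ((i + 1 + j - nE : ℕ) : ℤ)
        ((HB₀ i).coeff (i + 1 + j - nE)) := by
        simpa [HasOrder] using h1
      have h3 := (hz.mul h2).of_le
        (e' := -(min ((nE : ℤ) - 1 - j) P - 1) + min (i : ℤ) (P - 1)) (by omega)
      rw [one_mul] at h3
      convert h3 using 1
      refine if_congr ?_ rfl rfl
      omega
    · rw [if_neg (by tauto)]
      have h1 := ((PolyTendsto.const (Polynomial.X ^ (nE - 1 - i))).mul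
        (hHB i hi).comp_scale).linear (residueCoeff q j)
      exact (hz.mul (HasOrder.of_tendsto h1)).of_lt (by omega)
  · intro α β hα hrow
    beta_reduce at hrow
    have hαz : ∀ i, nE ≤ i → α.coeff i = 0 := Polynomial.degree_lt_iff_coeff_zero _ _ |>.1 hα
    refine ⟨Polynomial.X_pow_dvd_iff.2 fun k hk => ?_, fun hα0 hβ0 => ?_⟩
    · rw [coeff_padeComb]
      by_cases hkE : P < nE + k
      · -- the coefficient `k` comes from the row with exponent `P - k`
        obtain ⟨j, hj⟩ : ∃ j, j + P + 1 = nE + k := ⟨nE + k - P - 1, by omega⟩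
        refine Eq.trans ?_ (hrow j (by omega))
        congr 1
        · have hs1 : ∀ φ : ℕ → ℂ, (∀ i, nE ≤ i → φ i = 0) →
              ∑ i ∈ Finset.range nE, φ i = ∑ i ∈ Finset.range (nE + 1), φ i := fun φ hφ => by
            rw [Finset.sum_range_succ, hφ nE le_rfl, add_zero]
          rw [hs1 _ (fun i hi => by rw [hαz i hi, mul_zero])]
          refine Finset.sum_subset_zero_on_sdiff (Finset.range_mono (by omega)) ?_ ?_
          · intro i hi
            simp only [Finset.mem_sdiff, Finset.mem_range, not_lt] at hi
            split_ifs
            · omega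
            · simp
            · omega
            · simp
          · intro i hi
            rw [Finset.mem_range] at hi
            by_cases hiE : i < nE
            · congr 1
              by_cases h : P ≤ i + k
              · rw [if_pos h, if_pos (show nE ≤ i + 1 + j by omega), if_pos (by omega),
                  hE₀ i hiE (by omega)]
                congr 1
                omega
              · rw [if_neg h, if_neg (show ¬ nE ≤ i + 1 + j by omega), if_neg (by omega)]
            · rw [hαz i (by omega), mul_zero, mul_zero]
        · refine Finset.sum_subset_zero_on_sdiff (Finset.range_mono hPB) ?_ ?_
          · intro i hi
            simp only [Finset.mem_sdiff, Finset.mem_range, not_lt] at hi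
            rw [if_neg (by omega), zero_mul]
          · intro i hi
            rw [Finset.mem_range] at hi
            congr 1
            by_cases h : P ≤ i + k
            · rw [if_pos h, if_pos (by omega), hB₀ i (by omega) hi]
              congr 1
              omega
            · rw [if_neg h, if_neg (by omega)]
      · -- the boundary case `P = nE`, `k = 0`
        rw [Finset.sum_eq_zero, Finset.sum_eq_zero, add_zero]
        · intro i hi
          rw [Finset.mem_range] at hi
          rw [if_neg (by omega), zero_mul]
        · intro i hi
          rw [Finset.mem_range] at hi
          by_cases h : i < nE
          · rw [if_neg (by omega), zero_mul]
          · rw [hαz i (by omega), mul_zero]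
    · have hαl : ∀ i ≤ P, α.coeff i = 0 := fun i hi => by
        have := coeff_lowPart (P + 1) α i
        rw [hα0, if_pos (by omega), Polynomial.coeff_zero] at this
        exact this.symm
      have hβl : ∀ i < P, β.coeff i = 0 := fun i hi => by
        have := coeff_lowPart P β i
        rw [hβ0, if_pos hi, Polynomial.coeff_zero] at this
        exact this.symm
      ext l
      rw [Polynomial.coeff_zero]
      rcases lt_or_ge l nE with hl | hl
      swap
      · exact hαz l hl
      rcases le_or_gt l P with hlP | hlP
      · exact hαl l hlP
      have h1 := hrow (nE - 1 - l) (by omega)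
      have h2 : ∑ i ∈ Finset.range nB, (if nE ≤ i + 1 + (nE - 1 - l) ∧ i < P ∧
          nE ≤ P + 1 + (nE - 1 - l) then (HB₀ i).coeff (i + 1 + (nE - 1 - l) - nE) else 0) *
            β.coeff i = 0 := by
        refine Finset.sum_eq_zero fun i _ => ?_
        by_cases hi : i < P
        · rw [hβl i hi, mul_zero]
        · rw [if_neg (by tauto), zero_mul]
      rw [h2, add_zero, Finset.sum_eq_single l] at h1
      · rw [if_pos (by omega), if_pos (by omega)] at h1
        refine (mul_eq_zero.1 h1).resolve_left ?_
        rw [show l + 1 + (nE - 1 - l) - nE = 0 by omega]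
        exact hE₀' l hl
      · intro i hi hil
        rw [Finset.mem_range] at hi
        by_cases hiP : i ≤ P
        · rw [hαl i hiP, mul_zero]
        · split_ifs
          · omega
          · rw [zero_mul]
          · rw [residueCoeff_X_pow hq (by omega), if_neg (by omega), zero_mul, zero_mul]
          · rw [zero_mul]
      · intro h
        exact absurd (Finset.mem_range.2 hl) h

lemma comp_two_mul_add_two (R : Polynomial ℂ) :
    (R.comp (Polynomial.C (1 / 2) * (Polynomial.X - Polynomial.C 2))).comp
      (Polynomial.C 2 * (Polynomial.X + 1)) = R := by
  rw [Polynomial.comp_assoc]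
  have : (Polynomial.C (1 / 2) * (Polynomial.X - Polynomial.C 2) : Polynomial ℂ).comp
      (Polynomial.C 2 * (Polynomial.X + 1)) = Polynomial.X := by
    refine Polynomial.funext fun v => ?_
    simp only [Polynomial.eval_comp, Polynomial.eval_mul, Polynomial.eval_C, Polynomial.eval_sub,
      Polynomial.eval_X, Polynomial.eval_add, Polynomial.eval_one]
    ring
  rw [this, Polynomial.comp_X]

lemma dvd_of_dvd_comp {p q : ℕ} {R : Polynomial ℂ}
    (h : (Polynomial.X - Polynomial.C 2) ^ p * Polynomial.X ^ q ∣
      R.comp (Polynomial.C (1 / 2) * (Polynomial.X - Polynomial.C 2))) :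
    Polynomial.X ^ p * (Polynomial.X + 1) ^ q ∣ R := by
  obtain ⟨Q, hQ⟩ := h
  have h1 := comp_two_mul_add_two R
  rw [hQ, Polynomial.mul_comp, Polynomial.mul_comp, Polynomial.pow_comp, Polynomial.pow_comp] at h1
  have h2 : (Polynomial.X - Polynomial.C 2 : Polynomial ℂ).comp
      (Polynomial.C 2 * (Polynomial.X + 1)) = Polynomial.C 2 * Polynomial.X := by
    refine Polynomial.funext fun v => ?_
    simp only [Polynomial.eval_comp, Polynomial.eval_mul, Polynomial.eval_C, Polynomial.eval_sub,
      Polynomial.eval_X, Polynomial.eval_add, Polynomial.eval_one]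
    ring
  rw [h2, Polynomial.X_comp, mul_pow, mul_pow] at h1
  refine ⟨Polynomial.C 2 ^ p * Polynomial.C 2 ^ q *
    Q.comp (Polynomial.C 2 * (Polynomial.X + 1)), ?_⟩
  rw [← h1]
  ring

lemma lowPart_comp (n : ℕ) (p L : Polynomial ℂ) : (lowPart n p).comp L =
    ∑ i ∈ Finset.range n, Polynomial.C (p.coeff i) * L ^ i := by
  rw [lowPart, Polynomial.comp_eq_aeval, map_sum]
  refine Finset.sum_congr rfl fun i _ => ?_
  rw [← Polynomial.comp_eq_aeval, Polynomial.mul_comp, Polynomial.C_comp, Polynomial.pow_comp,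
    Polynomial.X_comp]

/-- The coordinate `1 / (2 x (1 - x))`, in which the limiting functions in regimes B and C are
polynomials up to a common factor. -/
def sCoord (x : ℂ) : ℂ := 1 / (2 * x * (1 - x))

/-- The common zeros of the limiting rows in regimes B and C. By `pade_eq_zero` the conditions at
`x = 1` and those of the large cluster make `α` and the low part of `β` vanish. The remaining
conditions, of the other cluster near `x = 0`, leave `m` powers of `s` for the high part of `β`. -/
theorem glue_kernel {P nB c0 c3 d0 d3 o1 o2 m K : ℕ} {α β : Polynomial ℂ}
    (hβ : β.degree < nB)
    (hf : (Polynomial.X - Polynomial.C 2) ^ c0 * Polynomial.X ^ c3 ∣ ∑ i ∈ Finset.range P,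
      Polynomial.C (β.coeff i) * (Polynomial.C (1 / 2) * (Polynomial.X - Polynomial.C 2)) ^ i)
    (hs : (Polynomial.X - Polynomial.C 2) ^ d0 * Polynomial.X ^ d3 ∣
      ∑ i ∈ Finset.range (P + 1), Polynomial.C (α.coeff i) *
        (Polynomial.C (1 / 2) * (Polynomial.X - Polynomial.C 2)) ^ i -
      ∑ i ∈ Finset.range P, Polynomial.C (β.coeff i) *
        (Polynomial.C (1 / 2) * (Polynomial.X - Polynomial.C 2)) ^ (i + 1))
    (hc : c0 + c3 ≤ P) (hd : d0 + d3 ≤ P + 1) (hK : K + (c0 + c3) + (d0 + d3) = 2 * P + 1)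
    (hΨ : Polynomial.X ^ K ∣ padeComb P (lowPart (P + 1) α) (lowPart P β))
    (hlow : lowPart (P + 1) α = 0 → lowPart P β = 0 → α = 0)
    (hoth : α = 0 → lowPart P β = 0 → Polynomial.X ^ o1 * (Polynomial.X - Polynomial.C 2) ^ o2 ∣
      homog (nB - 1) β (Polynomial.C (-1 / 4)) Polynomial.X)
    (hnB : nB = P + m + (o1 + o2)) :
    α = 0 ∧ lowPart P β = 0 ∧ ∃ c : Fin m → ℂ, ∀ x, x ≠ 0 → x ≠ 1 →
      β.eval (x * (x - 1) / 2) = ∑ j : Fin m, c j *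
        (sCoord x ^ (1 - nB + o1 : ℤ) * (sCoord x - 2) ^ o2 * sCoord x ^ (j : ℕ)) := by
  have hpade := pade_eq_zero (P := P) (α := lowPart (P + 1) α) (β := lowPart P β) (c0 := c0)
    (c3 := c3) (d0 := d0) (d3 := d3) (K := K)
    (by
      refine Polynomial.natDegree_le_iff_coeff_eq_zero.2 fun i hi => ?_
      rw [coeff_lowPart, if_neg (by omega)])
    (degree_lowPart_lt P β)
    (dvd_of_dvd_comp (by rw [lowPart_comp]; exact hf))
    (dvd_of_dvd_comp (by
      rw [Polynomial.sub_comp, Polynomial.mul_comp, Polynomial.X_comp, lowPart_comp, lowPart_comp,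
        Finset.mul_sum]
      convert hs using 2
      refine Finset.sum_congr rfl fun i _ => ?_
      ring)) hc hd hK hΨ
  have hα := hlow hpade.1 hpade.2
  refine ⟨hα, hpade.2, ?_⟩
  have hβl : ∀ i < P, β.coeff i = 0 := fun i hi => by
    have := coeff_lowPart P β i
    rw [hpade.2, if_pos hi, Polynomial.coeff_zero] at this
    exact this.symm
  obtain ⟨R, hR⟩ := hoth hα hpade.2
  have hβn : β = 0 ∨ β.natDegree + 1 ≤ nB := by
    rcases eq_or_ne β 0 with h | h
    · exact Or.inl h
    · exact Or.inr (by rw [Polynomial.degree_eq_natDegree h] at hβ; exact_mod_cast hβ)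
  rcases hβn with h0 | hβn
  · exact ⟨0, fun x _ _ => by simp [h0]⟩
  -- The low coefficients of `β` are the high coefficients of its homogenization at `X = s`.
  have hHdeg : (homog (nB - 1) β (Polynomial.C (-1 / 4)) Polynomial.X).natDegree ≤ nB - 1 - P := by
    refine Polynomial.natDegree_sum_le_of_forall_le _ _ fun i hi => ?_
    rcases lt_or_ge i P with h | h
    · simp [hβl i h]
    · rw [← Polynomial.C_pow, ← Polynomial.C_mul]
      refine (Polynomial.natDegree_C_mul_le _ _).trans ?_
      rw [Polynomial.natDegree_X_pow]
      omega
  have hRdeg : R.degree < m := by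
    rcases eq_or_ne R 0 with h | h
    · rw [h, Polynomial.degree_zero]
      exact WithBot.bot_lt_coe m
    have hm : (Polynomial.X ^ o1 * (Polynomial.X - Polynomial.C 2) ^ o2 : Polynomial ℂ).Monic :=
      (Polynomial.monic_X_pow o1).mul ((Polynomial.monic_X_sub_C 2).pow o2)
    rw [hR, hm.natDegree_mul' h, (Polynomial.monic_X_pow o1).natDegree_mul
      ((Polynomial.monic_X_sub_C 2).pow o2), (Polynomial.monic_X_sub_C 2).natDegree_pow,
      Polynomial.natDegree_X_pow, Polynomial.natDegree_X_sub_C, mul_one] at hHdeg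
    rw [Polynomial.degree_eq_natDegree h]
    have hP : P ≤ β.natDegree := by
      by_contra h1
      have h2 := hβl β.natDegree (by omega)
      rw [Polynomial.coeff_natDegree, Polynomial.leadingCoeff_eq_zero] at h2
      rw [h2] at hR
      have : (homog (nB - 1) 0 (Polynomial.C (-1 / 4)) Polynomial.X : Polynomial ℂ) = 0 := by
        simp [homog]
      rw [this] at hR
      exact mul_ne_zero hm.ne_zero h hR.symm
    have : R.natDegree < m := by omega
    exact_mod_cast this
  refine ⟨fun j => R.coeff j, fun x hx0 hx1 => ?_⟩
  have hx1' : 1 - x ≠ 0 := sub_ne_zero.2 (Ne.symm hx1)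
  have hs0 : sCoord x ≠ 0 := one_div_ne_zero (mul_ne_zero (mul_ne_zero two_ne_zero hx0) hx1')
  have h1 := eval_homog (L₁ := Polynomial.C (-1 / 4)) (L₂ := Polynomial.X) (v := sCoord x)
    (show β.natDegree ≤ nB - 1 by omega) (by simpa using hs0)
  rw [hR, Polynomial.eval_C, Polynomial.eval_X,
    show (-1 / 4 : ℂ) / sCoord x = x * (x - 1) / 2 by rw [sCoord]; field_simp; ring] at h1
  rw [Polynomial.eval_mul, Polynomial.eval_mul, Polynomial.eval_pow, Polynomial.eval_pow,
    Polynomial.eval_sub, Polynomial.eval_X, Polynomial.eval_C,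
    eval_eq_sum_of_degree_lt hRdeg] at h1
  have h2 : (sCoord x ^ (1 - nB + o1 : ℤ)) * sCoord x ^ (nB - 1) = sCoord x ^ o1 := by
    rw [← zpow_natCast, ← zpow_natCast, ← zpow_add₀ hs0]
    congr 1
    omega
  rw [← mul_right_inj' (pow_ne_zero (nB - 1) hs0), ← h1,
    ← Fin.sum_univ_eq_sum_range (fun i => R.coeff i * sCoord x ^ i), Finset.mul_sum,
    Finset.mul_sum]
  refine Finset.sum_congr rfl fun j _ => ?_
  rw [← h2]
  ring

/-- The common prefactor of the limiting functions in regimes B and C, times powers of the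
coordinate `s`. -/
def glueFun (ρ : ℂ → ℂ) (nB o1 o2 j : ℕ) (x : ℂ) : ℂ :=
  ρ x * (sCoord x ^ (1 - nB + o1 : ℤ) * (sCoord x - 2) ^ o2 * sCoord x ^ j)

lemma eq_zero_of_eval_off {β : Polynomial ℂ} {s : Finset ℂ}
    (h : ∀ x ∉ s, β.eval (x * (x - 1) / 2) = 0) : β = 0 :=
  (eq_zero_of_infinite_eval (A := β) (B := 0) (s := s) fun x hx => by
    rw [h x hx]; simp).1

/-! ### The basis near `x = 1` -/

/-- The function `w` divided by `ζ`, at `x = 1 + ζ y`; its numerator. -/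
def hypNum (ζ : ℂ) : Polynomial ℂ :=
  (1 + Polynomial.C ζ * Polynomial.X) ^ 2 * (Polynomial.X - Polynomial.C 2)

/-- The polynomial `(ζ + 2) x - ζ` at `x = 1 + ζ y`. -/
def hypDen (ζ : ℂ) : Polynomial ℂ :=
  Polynomial.C 2 + Polynomial.C (ζ * (ζ + 2)) * Polynomial.X

lemma basisPoly_even_hyp (N i : ℕ) (ζ : ℂ) :
    (basisPoly N ζ (2 * i)).comp (Polynomial.C 1 + Polynomial.C ζ * Polynomial.X) =
      Polynomial.C (ζ ^ i) * (hypNum ζ ^ i * hypDen ζ ^ (N - 1 - i)) := by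
  rw [basisPoly_even]
  refine Polynomial.funext fun v => ?_
  simp only [Polynomial.eval_mul, Polynomial.eval_pow, Polynomial.eval_comp, Polynomial.eval_sub,
    Polynomial.eval_C, Polynomial.eval_X, Polynomial.eval_add, Polynomial.eval_one, hypNum, hypDen]
  rw [pow_mul, ← mul_pow, ← mul_assoc, ← mul_pow]
  congr 1
  · congr 1; ring
  · congr 1; ring

lemma basisPoly_odd_hyp (N i : ℕ) (ζ : ℂ) :
    (basisPoly N ζ (2 * i + 1)).comp (Polynomial.C 1 + Polynomial.C ζ * Polynomial.X) =
      Polynomial.C (ζ ^ i) * ((1 + Polynomial.C ζ * Polynomial.X) *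
        (hypNum ζ ^ i * hypDen ζ ^ (N - 1 - i))) := by
  rw [basisPoly_odd, Polynomial.mul_comp, basisPoly_even_hyp, Polynomial.X_comp, Polynomial.C_1]
  ring

lemma polyTendsto_one_add : PolyTendsto (fun ζ => 1 + Polynomial.C ζ * Polynomial.X) 1 := by
  have h := (PolyTendsto.const 1).add ((PolyTendsto.C (tendsto_nhdsNE
    (f := fun ζ : ℂ => ζ) (by fun_prop))).mul (.const Polynomial.X))
  simpa using h

lemma polyTendsto_hypNum : PolyTendsto hypNum (Polynomial.X - Polynomial.C 2) := by
  have h := (polyTendsto_one_add.pow 2).mul (.const (Polynomial.X - Polynomial.C 2))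
  rw [one_pow, one_mul] at h
  exact h

lemma polyTendsto_hypDen : PolyTendsto hypDen (Polynomial.C 2) := by
  have h := (PolyTendsto.const (Polynomial.C 2)).add ((PolyTendsto.C (tendsto_nhdsNE
    (f := fun ζ : ℂ => ζ * (ζ + 2)) (by fun_prop))).mul (.const Polynomial.X))
  beta_reduce at h
  rw [zero_mul, Polynomial.C_0, zero_mul, add_zero] at h
  exact h

/-- The limit of `w ^ i` near `x = 1`, up to the factor `2 ^ (N - 1)`. -/
lemma polyTendsto_hyp {N i : ℕ} (hi : i < N) :
    PolyTendsto (fun ζ => hypNum ζ ^ i * hypDen ζ ^ (N - 1 - i))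
      (Polynomial.C (2 ^ (N - 1)) *
        (Polynomial.C (1 / 2) * (Polynomial.X - Polynomial.C 2)) ^ i) := by
  have h := (polyTendsto_hypNum.pow i).mul (polyTendsto_hypDen.pow (N - 1 - i))
  convert h using 1
  refine Polynomial.funext fun v => ?_
  simp only [Polynomial.eval_mul, Polynomial.eval_pow, Polynomial.eval_sub,
    Polynomial.eval_C, Polynomial.eval_X]
  rw [show N - 1 = (N - 1 - i) + i by omega, Nat.add_sub_cancel, pow_add, mul_pow, one_div, inv_pow]
  have : (2 : ℂ) ^ i ≠ 0 := pow_ne_zero _ two_ne_zero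
  field_simp

lemma HasOrder.linear_of_C_mul {F H : ℂ → Polynomial ℂ} {H₀ : Polynomial ℂ} {n : ℕ}
    (hH : PolyTendsto H H₀) (hF : ∀ᶠ ζ in 𝓝[≠] 0, F ζ = Polynomial.C (ζ ^ n) * H ζ)
    (φ : Polynomial ℂ →ₗ[ℂ] ℂ) : HasOrder (fun ζ => φ (F ζ)) n (φ H₀) := by
  refine hasOrder_of_eventually ?_ (hH.linear φ)
  filter_upwards [hF] with ζ hζ
  rw [hζ, map_C_mul, zpow_natCast]

/-! ### The glued determinant -/

section Glue

variable {M : Type*} (N nB : ℕ)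

/-- The column of the `i`-th function of the first kind. If `nB = N` these are the even columns,
and if `nB = N - 1` the last column is added to them. -/
def colE (i : ℕ) : ℕ := if i < N then 2 * i else 2 * N - 1

/-- Distribution of two sequences over the columns: `a` along `colE` and `b` on the odd columns
`2 i + 1` with `i < nB`. -/
def sel (a b : ℕ → M) (j : ℕ) : M :=
  if Even j then a (j / 2) else if j / 2 < nB then b (j / 2) else a N

variable {N nB}

lemma sel_colE (hN : N ≤ nB + 1) (a b : ℕ → M) {i : ℕ} (hi : i + nB < 2 * N) :
    sel N nB a b (colE N i) = a i := by
  unfold colE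
  split_ifs with h
  · rw [sel, if_pos (even_two_mul i), Nat.mul_div_cancel_left _ two_pos]
  · rw [sel, if_neg (by rw [Nat.not_even_iff]; omega), if_neg (by omega)]
    congr 1
    omega

lemma sel_odd (a b : ℕ → M) {i : ℕ} (hi : i < nB) : sel N nB a b (2 * i + 1) = b i := by
  rw [sel, if_neg (by simp), show (2 * i + 1) / 2 = i by omega, if_pos hi]

lemma col_cases (hnB : nB ≤ N) (hN : N ≤ nB + 1) {j : ℕ} (hj : j < 2 * N) :
    (∃ i, i + nB < 2 * N ∧ j = colE N i) ∨ ∃ i < nB, j = 2 * i + 1 := by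
  rcases Nat.even_or_odd' j with ⟨i, rfl | rfl⟩
  · exact Or.inl ⟨i, by omega, by rw [colE, if_pos (by omega)]⟩
  · by_cases h : i < nB
    · exact Or.inr ⟨i, h, rfl⟩
    · exact Or.inl ⟨N, by omega, by rw [colE, if_neg (by omega)]; omega⟩

variable (nB) in
/-- The coefficients along the columns of the first kind. -/
def partE (u : Fin (2 * N) → ℂ) : Polynomial ℂ :=
  evenPart u + if nB < N then Polynomial.C ((oddPart u).coeff (N - 1)) * Polynomial.X ^ N else 0

variable (nB) in
/-- The coefficients along the columns of the second kind. -/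
def partB (u : Fin (2 * N) → ℂ) : Polynomial ℂ := lowPart nB (oddPart u)

lemma coeff_partE (u : Fin (2 * N) → ℂ) (i : ℕ) : (partE nB u).coeff i =
    (evenPart u).coeff i + if nB < N ∧ i = N then (oddPart u).coeff (N - 1) else 0 := by
  rw [partE, Polynomial.coeff_add]
  congr 1
  by_cases h : nB < N
  · rw [if_pos h, Polynomial.coeff_C_mul_X_pow]
    simp [h]
  · simp [h]

lemma degree_partE_lt (hnB : nB ≤ N) (hN : N ≤ nB + 1) (u : Fin (2 * N) → ℂ) :
    (partE nB u).degree < (2 * N - nB : ℕ) := by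
  rw [Polynomial.degree_lt_iff_coeff_zero]
  intro i hi
  have h1 := (Polynomial.degree_lt_iff_coeff_zero _ _).1 (degree_evenPart_lt u)
  rw [coeff_partE]
  by_cases h : N ≤ i
  · rw [h1 i h, zero_add, if_neg (by omega)]
  · omega

lemma eq_zero_of_partE_partB (hnB : nB ≤ N) (hN : N ≤ nB + 1) {u : Fin (2 * N) → ℂ}
    (hE : partE nB u = 0) (hB : partB nB u = 0) : u = 0 := by
  have h1 := (Polynomial.degree_lt_iff_coeff_zero _ _).1 (degree_evenPart_lt u)
  have h2 := (Polynomial.degree_lt_iff_coeff_zero _ _).1 (degree_oddPart_lt u)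
  have hE' : ∀ i, (evenPart u).coeff i + (if nB < N ∧ i = N then (oddPart u).coeff (N - 1) else 0)
      = 0 := fun i => by rw [← coeff_partE, hE, Polynomial.coeff_zero]
  have hB' : ∀ i < nB, (oddPart u).coeff i = 0 := fun i hi => by
    have := coeff_lowPart nB (oddPart u) i
    rw [if_pos hi] at this
    rw [← this, ← partB, hB, Polynomial.coeff_zero]
  refine eq_zero_of_parts (Polynomial.ext fun i => ?_) (Polynomial.ext fun i => ?_)
  · rw [Polynomial.coeff_zero]
    by_cases h : i < N
    · have := hE' i
      rwa [if_neg (by omega), add_zero] at this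
    · exact h1 i (by omega)
  · rw [Polynomial.coeff_zero]
    by_cases h : i < nB
    · exact hB' i h
    · by_cases h' : i < N
      · have := hE' N
        rw [h1 N le_rfl, zero_add, if_pos (by omega)] at this
        rwa [show i = N - 1 by omega]
      · exact h2 i (by omega)

lemma sum_sel_mul [AddCommGroup M] [Module ℂ M] (hnB : nB ≤ N) (hN : N ≤ nB + 1) (a b : ℕ → M)
    (u : Fin (2 * N) → ℂ) : ∑ j : Fin (2 * N), u j • sel N nB a b j =
      ∑ i ∈ Finset.range (2 * N - nB), (partE nB u).coeff i • a i +
        ∑ i ∈ Finset.range nB, (partB nB u).coeff i • b i := by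
  have h1 := (Polynomial.degree_lt_iff_coeff_zero _ _).1 (degree_evenPart_lt u)
  have hL : ∑ j : Fin (2 * N), u j • sel N nB a b j = ∑ i ∈ Finset.range N,
      ((evenPart u).coeff i • sel N nB a b (2 * i) +
        (oddPart u).coeff i • sel N nB a b (2 * i + 1)) := by
    rw [sum_fin_two_mul, ← Fin.sum_univ_eq_sum_range (fun i =>
      (evenPart u).coeff i • sel N nB a b (2 * i) +
        (oddPart u).coeff i • sel N nB a b (2 * i + 1))]
    refine Finset.sum_congr rfl fun i _ => ?_
    rw [coeff_evenPart, coeff_oddPart]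
  have hev : ∀ i, sel N nB a b (2 * i) = a i := fun i => by
    rw [sel, if_pos (even_two_mul i), Nat.mul_div_cancel_left _ two_pos]
  have hb : ∑ i ∈ Finset.range nB, (partB nB u).coeff i • b i =
      ∑ i ∈ Finset.range nB, (oddPart u).coeff i • sel N nB a b (2 * i + 1) := by
    refine Finset.sum_congr rfl fun i hi => ?_
    rw [Finset.mem_range] at hi
    rw [sel_odd a b hi, partB, coeff_lowPart, if_pos hi]
  have ha : ∑ i ∈ Finset.range N, (partE nB u).coeff i • a i =
      ∑ i ∈ Finset.range N, (evenPart u).coeff i • sel N nB a b (2 * i) := by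
    refine Finset.sum_congr rfl fun i hi => ?_
    rw [Finset.mem_range] at hi
    rw [hev, coeff_partE, if_neg (by omega), add_zero]
  rw [hL, hb, Finset.sum_add_distrib, ← ha]
  rcases eq_or_lt_of_le hnB with h | h
  · subst h
    rw [show 2 * nB - nB = nB by omega]
  · obtain rfl : N = nB + 1 := by omega
    rw [show 2 * (nB + 1) - nB = nB + 1 + 1 by omega, Finset.sum_range_succ _ (nB + 1),
      Finset.sum_range_succ (fun i => (oddPart u).coeff i • sel (nB + 1) nB a b (2 * i + 1)) nB,
      coeff_partE, h1 _ le_rfl, zero_add, if_pos ⟨h, rfl⟩, Nat.add_sub_cancel]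
    rw [show sel (nB + 1) nB a b (2 * nB + 1) = a (nB + 1) by
      rw [sel, if_neg (by simp), if_neg (by omega)]]
    abel

lemma dot_sel (hnB : nB ≤ N) (hN : N ≤ nB + 1) (a b : ℕ → ℂ) (u : Fin (2 * N) → ℂ) :
    (fun j : Fin (2 * N) => sel N nB a b j) ⬝ᵥ u =
      ∑ i ∈ Finset.range (2 * N - nB), a i * (partE nB u).coeff i +
        ∑ i ∈ Finset.range nB, b i * (partB nB u).coeff i := by
  have := sum_sel_mul hnB hN a b u
  simp only [smul_eq_mul] at this
  rw [dotProduct]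
  simp only [mul_comm (sel N nB a b _), this, mul_comm]

lemma sum_sel (hnB : nB ≤ N) (hN : N ≤ nB + 1) (a b : ℕ → ℤ) :
    ∑ j : Fin (2 * N), sel N nB a b j =
      ∑ i ∈ Finset.range (2 * N - nB), a i + ∑ i ∈ Finset.range nB, b i := by
  rw [sum_fin_two_mul]
  have hev : ∀ i, sel N nB a b (2 * i) = a i := fun i => by
    rw [sel, if_pos (even_two_mul i), Nat.mul_div_cancel_left _ two_pos]
  simp only [hev]
  rw [Fin.sum_univ_eq_sum_range (fun i => a i + sel N nB a b (2 * i + 1)), Finset.sum_add_distrib]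
  have hb : ∑ i ∈ Finset.range nB, b i = ∑ i ∈ Finset.range nB, sel N nB a b (2 * i + 1) :=
    Finset.sum_congr rfl fun i hi => (sel_odd a b (Finset.mem_range.1 hi)).symm
  rw [hb]
  rcases eq_or_lt_of_le hnB with h | h
  · subst h
    rw [show 2 * nB - nB = nB by omega]
  · obtain rfl : N = nB + 1 := by omega
    rw [show 2 * (nB + 1) - nB = nB + 1 + 1 by omega, Finset.sum_range_succ _ (nB + 1),
      Finset.sum_range_succ (fun i => sel (nB + 1) nB a b (2 * i + 1)) nB]
    rw [show sel (nB + 1) nB a b (2 * nB + 1) = a (nB + 1) by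
      rw [sel, if_neg (by simp), if_neg (by omega)]]
    ring

lemma sum_range_ite {M : Type*} [AddCommMonoid M] {n p : ℕ} (F : ℕ → M)
    (h : ∀ i, n ≤ i → i < p → F i = 0) :
    ∑ i ∈ Finset.range n, (if i < p then F i else 0) = ∑ i ∈ Finset.range p, F i := by
  rw [← Finset.sum_filter]
  refine Finset.sum_subset (fun i hi => ?_) fun i hi hi' => ?_
  · exact Finset.mem_range.2 (Finset.mem_filter.1 hi).2
  · rw [Finset.mem_range] at hi
    refine h i ?_ hi
    by_contra h1
    exact hi' (Finset.mem_filter.2 ⟨Finset.mem_range.2 (by omega), hi⟩)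

/-- The common part of regimes B and C, for two kinds of columns with families `FE`, `FB` in the first
group of variables and `GE`, `GB` in the second group. The columns have the weights `min i P - 1` and
`min i (P - 1)`; all rows at `x = 1` have weight `0` in the first group and `1` in the second group. As
the weights are constant for large `i`, only the low coefficients of `α` and `β` enter the conditions
at `x = 1`, and only the high coefficients enter the rows of the free variables. -/
theorem detAsymptotics_glue {m c0 c1 c2 c3 d0 d1 d2 d3 P o1 o2 K : ℕ}
    (e : Rows m (c0 + c3) (c1 + c2) (d0 + d3) (d1 + d2) ≃ Fin (2 * N))
    (hnB : nB ≤ N) (hN : N ≤ nB + 1) {FE FB GE GB : ℂ → ℕ → Polynomial ℂ} {ρ : ℂ → ℂ}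
    {EV : ℂ → ℕ → ℂ} {r₂ r₄ : ℕ → ℤ} {YE₂ YB₂ YE₄ YB₄ : ℕ → ℕ → ℂ} {cf cg : ℂ} (hcf : cf ≠ 0)
    (hcg : cg ≠ 0)
    (hxE : ∀ x, ∀ i < 2 * N - nB, HasOrder (fun ζ => (FE ζ i).eval x) 0 (EV x i))
    (hxB : ∀ x, ∀ i < nB, HasOrder (fun ζ => (FB ζ i).eval x) 0 (ρ x * (x * (x - 1) / 2) ^ i))
    (hρ : ∀ x, x ≠ 0 → x ≠ 1 → x ≠ 1 / 2 → ρ x ≠ 0)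
    (h1E : ∀ φ : Polynomial ℂ →ₗ[ℂ] ℂ, ∀ i < 2 * N - nB, HasOrder (fun ζ => φ ((FE ζ i).comp
      (Polynomial.C 1 + Polynomial.C ζ * Polynomial.X))) (min (i : ℤ) P - 1) 0)
    (h1B : ∀ φ : Polynomial ℂ →ₗ[ℂ] ℂ, ∀ i < nB, HasOrder (fun ζ => φ ((FB ζ i).comp
      (Polynomial.C 1 + Polynomial.C ζ * Polynomial.X))) i (φ (Polynomial.C cf *
        (Polynomial.C (1 / 2) * (Polynomial.X - Polynomial.C 2)) ^ i)))
    (h3E : ∀ φ : Polynomial ℂ →ₗ[ℂ] ℂ, ∀ i < 2 * N - nB, HasOrder (fun ζ => φ ((GE ζ i).comp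
      (Polynomial.C 1 + Polynomial.C ζ * Polynomial.X))) (min (i : ℤ) P)
        (φ (if i < P + 1 then Polynomial.C cg *
          (Polynomial.C (1 / 2) * (Polynomial.X - Polynomial.C 2)) ^ i else 0)))
    (h3B : ∀ φ : Polynomial ℂ →ₗ[ℂ] ℂ, ∀ i < nB, HasOrder (fun ζ => φ ((GB ζ i).comp
      (Polynomial.C 1 + Polynomial.C ζ * Polynomial.X))) (i + 1) (φ (Polynomial.C (-cg) *
        (Polynomial.C (1 / 2) * (Polynomial.X - Polynomial.C 2)) ^ (i + 1))))
    (h2E : ∀ l < c1 + c2, ∀ i < 2 * N - nB, HasOrder (fun ζ => residueCoeff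
      (nodal (twoPoints c1 c2 0 2)) l ((FE ζ i).comp (cuspMap ζ))) (r₂ l + (min (i : ℤ) P - 1))
        (YE₂ l i))
    (h2B : ∀ l < c1 + c2, ∀ i < nB, HasOrder (fun ζ => residueCoeff
      (nodal (twoPoints c1 c2 0 2)) l ((FB ζ i).comp (cuspMap ζ))) (r₂ l + min (i : ℤ) (P - 1))
        (YB₂ l i))
    (h4E : ∀ l < d1 + d2, ∀ i < 2 * N - nB, HasOrder (fun ζ => residueCoeff
      (nodal (twoPoints d1 d2 0 2)) l ((GE ζ i).comp (cuspMap ζ))) (r₄ l + (min (i : ℤ) P - 1))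
        (YE₄ l i))
    (h4B : ∀ l < d1 + d2, ∀ i < nB, HasOrder (fun ζ => residueCoeff
      (nodal (twoPoints d1 d2 0 2)) l ((GB ζ i).comp (cuspMap ζ))) (r₄ l + min (i : ℤ) (P - 1))
        (YB₄ l i))
    (hker : ∀ α β : Polynomial ℂ, α.degree < (2 * N - nB : ℕ) → β.degree < nB →
      (∀ l < c1 + c2, ∑ i ∈ Finset.range (2 * N - nB), YE₂ l i * α.coeff i +
        ∑ i ∈ Finset.range nB, YB₂ l i * β.coeff i = 0) →
      (∀ l < d1 + d2, ∑ i ∈ Finset.range (2 * N - nB), YE₄ l i * α.coeff i +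
        ∑ i ∈ Finset.range nB, YB₄ l i * β.coeff i = 0) →
      Polynomial.X ^ K ∣ padeComb P (lowPart (P + 1) α) (lowPart P β) ∧
      (lowPart (P + 1) α = 0 → lowPart P β = 0 → α = 0) ∧
      (α = 0 → lowPart P β = 0 → Polynomial.X ^ o1 * (Polynomial.X - Polynomial.C 2) ^ o2 ∣
        homog (nB - 1) β (Polynomial.C (-1 / 4)) Polynomial.X))
    (hc : c0 + c3 ≤ P) (hd : d0 + d3 ≤ P + 1) (hK : K + (c0 + c3) + (d0 + d3) = 2 * P + 1)
    (hP : nB = P + m + (o1 + o2)) :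
    DetAsymptotics c0 c1 c2 c3 d0 d1 d2 d3 (fun ζ j => sel N nB (FE ζ) (FB ζ) j)
      (fun ζ j => sel N nB (GE ζ) (GB ζ) j) e
      (m * (1 - P) + ∑ l ∈ Finset.range (c1 + c2), r₂ l + (d0 + d3) +
        ∑ l ∈ Finset.range (d1 + d2), r₄ l + (∑ i ∈ Finset.range (2 * N - nB), (min (i : ℤ) P - 1) +
          ∑ i ∈ Finset.range nB, min (i : ℤ) (P - 1)))
      (fun j x => glueFun ρ nB o1 o2 j x) := by
  set L : Polynomial ℂ := Polynomial.C (1 / 2) * (Polynomial.X - Polynomial.C 2) with hL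
  have hcase : ∀ {j : ℕ} (_ : j < 2 * N) {Q : ℕ → Prop}, (∀ i, i + nB < 2 * N → Q (colE N i)) →
      (∀ i < nB, Q (2 * i + 1)) → Q j := by
    intro j hj Q h1 h2
    rcases col_cases hnB hN hj with ⟨i, hi, rfl⟩ | ⟨i, hi, rfl⟩
    · exact h1 i hi
    · exact h2 i hi
  have hgen : ∀ (φ : ℂ → Polynomial ℂ → ℂ) (r : ℤ) (UE UB : ℂ → ℕ → Polynomial ℂ) (y z : ℕ → ℂ),
      (∀ i < 2 * N - nB, HasOrder (fun ζ => φ ζ (UE ζ i)) (r + (min (i : ℤ) P - 1)) (y i)) →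
      (∀ i < nB, HasOrder (fun ζ => φ ζ (UB ζ i)) (r + min (i : ℤ) (P - 1)) (z i)) →
      ∀ j : Fin (2 * N), HasOrder (fun ζ => φ ζ (sel N nB (UE ζ) (UB ζ) j))
        (r + sel N nB (fun i => min (i : ℤ) P - 1) (fun i => min (i : ℤ) (P - 1)) j)
        (sel N nB y z j) := by
    intro φ r UE UB y z h1 h2 j
    refine hcase j.2 (Q := fun j => HasOrder (fun ζ => φ ζ (sel N nB (UE ζ) (UB ζ) j))
        (r + sel N nB (fun i => min (i : ℤ) P - 1) (fun i => min (i : ℤ) (P - 1)) j)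
        (sel N nB y z j)) (fun i hi => ?_) (fun i hi => ?_)
    · simp only [sel_colE hN _ _ hi]
      exact h1 i (by omega)
    · simp only [sel_odd _ _ hi]
      exact h2 i hi
  have h := detAsymptotics_of_limits (f := fun ζ (j : Fin (2 * N)) => sel N nB (FE ζ) (FB ζ) j)
    (g := fun ζ (j : Fin (2 * N)) => sel N nB (GE ζ) (GB ζ) j) e
    (fun j x => glueFun ρ nB o1 o2 j x) (1 - P) (fun _ => 0) r₂ (fun _ => 1) r₄
    (fun j => sel N nB (fun i => min (i : ℤ) P - 1) (fun i => min (i : ℤ) (P - 1)) j)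
    (fun x j => sel N nB (fun i => if (1 - P + (min (i : ℤ) P - 1)) = 0 then EV x i else 0)
      (fun i => if (1 - P + min (i : ℤ) (P - 1)) = 0 then ρ x * (x * (x - 1) / 2) ^ i else 0) j)
    (fun l j => residueCoeff (nodal (twoPoints c0 c3 2 0)) l
      (sel N nB (fun _ => 0) (fun i => if i < P then Polynomial.C cf * L ^ i else 0) j))
    (fun l j => sel N nB (YE₂ l) (YB₂ l) j)
    (fun l j => residueCoeff (nodal (twoPoints d0 d3 2 0)) l
      (sel N nB (fun i => if i < P + 1 then Polynomial.C cg * L ^ i else 0)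
        (fun i => if i < P then Polynomial.C (-cg) * L ^ (i + 1) else 0) j))
    (fun l j => sel N nB (YE₄ l) (YB₄ l) j)
    ?_ ?_ ?_ ?_ ?_ ?_
  · convert h using 1
    rw [sum_sel hnB hN]
    simp
  · intro x _ _
    refine hgen (fun _ p => p.eval x) _ _ _ _ _ (fun i hi => ?_) (fun i hi => ?_)
    · exact (hxE x i hi).of_le (by omega)
    · exact (hxB x i hi).of_le (by omega)
  · intro l hl j
    have h2 : ∀ V : ℕ → Polynomial ℂ, residueCoeff (nodal (twoPoints c0 c3 2 0)) l
        (sel N nB (fun _ => 0) V j) = sel N nB (fun _ => 0)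
          (fun i => residueCoeff (nodal (twoPoints c0 c3 2 0)) l (V i)) j := by
      intro V
      unfold sel
      split_ifs <;> simp
    rw [h2]
    refine hgen (fun ζ p => residueCoeff (nodal (twoPoints c0 c3 2 0)) l (p.comp (Polynomial.C 1 +
      Polynomial.C ζ * Polynomial.X))) _ _ _ _ _ (fun i hi => ?_) (fun i hi => ?_) j
    · simpa using h1E _ i hi
    · have h3 := (h1B (residueCoeff (nodal (twoPoints c0 c3 2 0)) l) i hi).of_le
        (e' := 0 + min (i : ℤ) (P - 1)) (by omega)
      convert h3 using 1
      by_cases hiP : i < P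
      · rw [if_pos hiP, if_pos (by omega)]
      · rw [if_neg hiP, if_neg (by omega), map_zero]
  · intro l hl j
    exact hgen (fun ζ p => residueCoeff (nodal (twoPoints c1 c2 0 2)) l (p.comp (cuspMap ζ)))
      _ _ _ _ _ (h2E l hl) (h2B l hl) j
  · intro l hl j
    have h2 : ∀ V W : ℕ → Polynomial ℂ, residueCoeff (nodal (twoPoints d0 d3 2 0)) l
        (sel N nB V W j) = sel N nB (fun i => residueCoeff (nodal (twoPoints d0 d3 2 0)) l (V i))
          (fun i => residueCoeff (nodal (twoPoints d0 d3 2 0)) l (W i)) j := by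
      intro V W
      unfold sel
      split_ifs <;> rfl
    rw [h2]
    refine hgen (fun ζ p => residueCoeff (nodal (twoPoints d0 d3 2 0)) l (p.comp (Polynomial.C 1 +
      Polynomial.C ζ * Polynomial.X))) _ _ _ _ _ (fun i hi => ?_) (fun i hi => ?_) j
    · have h3 := h3E (residueCoeff (nodal (twoPoints d0 d3 2 0)) l) i hi
      rwa [show (1 : ℤ) + (min (i : ℤ) P - 1) = min (i : ℤ) P by ring]
    · have h3 := (h3B (residueCoeff (nodal (twoPoints d0 d3 2 0)) l) i hi).of_le
        (e' := 1 + min (i : ℤ) (P - 1)) (by omega)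
      convert h3 using 1
      by_cases hiP : i < P
      · rw [if_pos hiP, if_pos (by omega)]
      · rw [if_neg hiP, if_neg (by omega), map_zero]
  · intro l hl j
    exact hgen (fun ζ p => residueCoeff (nodal (twoPoints d1 d2 0 2)) l (p.comp (cuspMap ζ)))
      _ _ _ _ _ (h4E l hl) (h4B l hl) j
  · intro u h1 h2 h3 h4
    have hαdeg := degree_partE_lt hnB hN u
    have hβdeg : (partB nB u).degree < nB := degree_lowPart_lt nB _
    have hαz := (Polynomial.degree_lt_iff_coeff_zero _ _).1 hαdeg
    obtain ⟨hk1, hk2, hk3⟩ := hker _ _ hαdeg hβdeg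
      (fun l hl => by rw [← h2 l hl, dot_sel hnB hN])
      (fun l hl => by rw [← h4 l hl, dot_sel hnB hN])
    have hCf : IsUnit (Polynomial.C cf) := Polynomial.isUnit_C.2 (IsUnit.mk0 _ hcf)
    have hCg : IsUnit (Polynomial.C cg) := Polynomial.isUnit_C.2 (IsUnit.mk0 _ hcg)
    have hdf := nodal_dvd_sum h1
    have hdg := nodal_dvd_sum h3
    have hsm : ∀ V W : ℕ → Polynomial ℂ, ∑ j : Fin (2 * N), Polynomial.C (u j) * sel N nB V W j =
        ∑ i ∈ Finset.range (2 * N - nB), Polynomial.C ((partE nB u).coeff i) * V i +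
          ∑ i ∈ Finset.range nB, Polynomial.C ((partB nB u).coeff i) * W i := by
      intro V W
      have := sum_sel_mul hnB hN V W u
      simpa only [Polynomial.smul_eq_C_mul] using this
    have hE1 : ∑ j : Fin (2 * N), Polynomial.C (u j) *
        sel N nB (fun _ => 0) (fun i => if i < P then Polynomial.C cf * L ^ i else 0) j =
        Polynomial.C cf * ∑ i ∈ Finset.range P, Polynomial.C ((partB nB u).coeff i) * L ^ i := by
      rw [hsm, ← sum_range_ite (n := nB) (fun i => Polynomial.C ((partB nB u).coeff i) * L ^ i)
        (fun i h1 h2 => by omega), Finset.mul_sum]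
      simp only [mul_zero, Finset.sum_const_zero, zero_add]
      refine Finset.sum_congr rfl fun i _ => ?_
      split_ifs
      · ring
      · simp
    have hE3 : ∑ j : Fin (2 * N), Polynomial.C (u j) *
        sel N nB (fun i => if i < P + 1 then Polynomial.C cg * L ^ i else 0)
          (fun i => if i < P then Polynomial.C (-cg) * L ^ (i + 1) else 0) j =
        Polynomial.C cg * (∑ i ∈ Finset.range (P + 1),
          Polynomial.C ((partE nB u).coeff i) * L ^ i -
          ∑ i ∈ Finset.range P, Polynomial.C ((partB nB u).coeff i) * L ^ (i + 1)) := by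
      rw [hsm, ← sum_range_ite (n := nB) (fun i => Polynomial.C ((partB nB u).coeff i) * L ^ (i + 1))
        (fun i h1 h2 => by omega), ← sum_range_ite (n := 2 * N - nB)
        (fun i => Polynomial.C ((partE nB u).coeff i) * L ^ i)
        (fun i h1 h2 => by rw [hαz i h1]; simp), mul_sub, Finset.mul_sum, Finset.mul_sum,
        sub_eq_add_neg, ← Finset.sum_neg_distrib]
      congr 1
      · refine Finset.sum_congr rfl fun i _ => ?_
        split_ifs
        · ring
        · simp
      · refine Finset.sum_congr rfl fun i _ => ?_
        split_ifs
        · rw [Polynomial.C_neg]; ring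
        · simp
    rw [hE1, Polynomial.C_0, sub_zero, hCf.dvd_mul_left] at hdf
    rw [hE3, Polynomial.C_0, sub_zero, hCg.dvd_mul_left] at hdg
    obtain ⟨hα0, hβ0, c, hc'⟩ := glue_kernel (m := m) hβdeg hdf hdg hc hd hK hk1 hk2 hk3 hP
    have hβl : ∀ i < P, (partB nB u).coeff i = 0 := fun i hi => by
      have := coeff_lowPart P (partB nB u) i
      rw [hβ0, if_pos hi, Polynomial.coeff_zero] at this
      exact this.symm
    have hev : ∀ x, (fun j : Fin (2 * N) => sel N nB
        (fun i => if (1 - P + (min (i : ℤ) P - 1)) = 0 then EV x i else 0)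
        (fun i => if (1 - P + min (i : ℤ) (P - 1)) = 0 then ρ x * (x * (x - 1) / 2) ^ i else 0) j)
          ⬝ᵥ u = ρ x * (partB nB u).eval (x * (x - 1) / 2) := by
      intro x
      rw [dot_sel hnB hN, hα0, eval_eq_sum_of_degree_lt hβdeg, Finset.mul_sum]
      simp only [Polynomial.coeff_zero, mul_zero, Finset.sum_const_zero, zero_add]
      refine Finset.sum_congr rfl fun i _ => ?_
      by_cases hi : i < P
      · rw [hβl i hi]; ring
      · rw [if_pos (by omega)]; ring
    refine ⟨⟨c, fun x hx0 hx1 => ?_⟩, fun h0 => ?_⟩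
    · rw [hev, hc' x hx0 hx1, Finset.mul_sum]
      refine Finset.sum_congr rfl fun j _ => ?_
      rw [glueFun]
      ring
    · refine eq_zero_of_partE_partB hnB hN hα0 (eq_zero_of_eval_off (s := {0, 1, 1 / 2}) ?_)
      intro x hx
      simp only [Finset.mem_insert, Finset.mem_singleton, not_or] at hx
      have := h0 x hx.1 hx.2.1 hx.2.2
      rw [hev] at this
      exact (mul_eq_zero.1 this).resolve_left (hρ x hx.1 hx.2.1 hx.2.2)

end Glue

section HypLimits

variable {N : ℕ} (φ : Polynomial ℂ →ₗ[ℂ] ℂ)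

lemma hasOrder_hyp_even {i : ℕ} (hi : i < N) :
    HasOrder (fun ζ => φ ((basisPoly N ζ (2 * i)).comp
      (Polynomial.C 1 + Polynomial.C ζ * Polynomial.X))) i (φ (Polynomial.C (2 ^ (N - 1)) *
        (Polynomial.C (1 / 2) * (Polynomial.X - Polynomial.C 2)) ^ i)) :=
  HasOrder.linear_of_C_mul (polyTendsto_hyp hi) (.of_forall fun ζ => basisPoly_even_hyp N i ζ) φ

lemma hasOrder_hyp_odd {i : ℕ} (hi : i < N) :
    HasOrder (fun ζ => φ ((basisPoly N ζ (2 * i + 1)).comp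
      (Polynomial.C 1 + Polynomial.C ζ * Polynomial.X))) i (φ (Polynomial.C (2 ^ (N - 1)) *
        (Polynomial.C (1 / 2) * (Polynomial.X - Polynomial.C 2)) ^ i)) := by
  have h := HasOrder.linear_of_C_mul (polyTendsto_one_add.mul (polyTendsto_hyp hi))
    (.of_forall fun ζ => basisPoly_odd_hyp N i ζ) φ
  rwa [one_mul] at h

lemma hasOrder_hyp_sigma_even {i : ℕ} (hi : i < N) :
    HasOrder (fun ζ => φ ((sigmaBasisPoly N ζ (2 * i)).comp
      (Polynomial.C 1 + Polynomial.C ζ * Polynomial.X))) i (φ (Polynomial.C (-4 * 2 ^ (N - 1)) *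
        (Polynomial.C (1 / 2) * (Polynomial.X - Polynomial.C 2)) ^ i)) := by
  have h1 : PolyTendsto (fun ζ => Polynomial.C (2 * ζ + 1) -
      Polynomial.C 3 * (1 + Polynomial.C ζ * Polynomial.X))
      (Polynomial.C 1 - Polynomial.C 3 * 1) :=
    (PolyTendsto.C (tendsto_linear 2 1)).sub ((PolyTendsto.const _).mul polyTendsto_one_add)
  have h2 := HasOrder.linear_of_C_mul (n := i)
    (F := fun ζ => (sigmaBasisPoly N ζ (2 * i)).comp
      (Polynomial.C 1 + Polynomial.C ζ * Polynomial.X))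
    ((polyTendsto_hypDen.mul h1).mul (polyTendsto_hyp hi)) (.of_forall fun ζ => ?_) φ
  · convert h2 using 2
    rw [← mul_assoc]
    congr 1
    rw [mul_one, ← Polynomial.C_sub, ← Polynomial.C_mul, ← Polynomial.C_mul]
    norm_num
  · rw [sigmaBasisPoly_even, Polynomial.mul_comp, basisPoly_even_hyp]
    have h3 : (e0 ζ).comp (Polynomial.C 1 + Polynomial.C ζ * Polynomial.X) = hypDen ζ *
        (Polynomial.C (2 * ζ + 1) - Polynomial.C 3 * (1 + Polynomial.C ζ * Polynomial.X)) := by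
      refine Polynomial.funext fun v => ?_
      simp only [Polynomial.eval_mul, Polynomial.eval_comp, Polynomial.eval_sub,
        Polynomial.eval_C, Polynomial.eval_X, Polynomial.eval_add, Polynomial.eval_one, hypDen, e0]
      ring
    rw [h3]
    ring

lemma hasOrder_hyp_sigma_odd {i : ℕ} (hi : i < N) :
    HasOrder (fun ζ => φ ((sigmaBasisPoly N ζ (2 * i + 1)).comp
      (Polynomial.C 1 + Polynomial.C ζ * Polynomial.X))) (i + 1)
      (φ (Polynomial.C (-(-4 * 2 ^ (N - 1))) *
        (Polynomial.C (1 / 2) * (Polynomial.X - Polynomial.C 2)) ^ (i + 1))) := by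
  have h1 : PolyTendsto (fun ζ => (Polynomial.X - Polynomial.C 2) *
      (hypDen ζ - Polynomial.C (2 * ζ)))
      ((Polynomial.X - Polynomial.C 2) * (Polynomial.C 2 - Polynomial.C 0)) := by
    refine (PolyTendsto.const _).mul (polyTendsto_hypDen.sub (PolyTendsto.C ?_))
    simpa using tendsto_linear 2 0
  have h2 := HasOrder.linear_of_C_mul (n := i + 1)
    (F := fun ζ => (sigmaBasisPoly N ζ (2 * i + 1)).comp
      (Polynomial.C 1 + Polynomial.C ζ * Polynomial.X))
    (h1.mul (polyTendsto_one_add.mul (polyTendsto_hyp hi))) (.of_forall fun ζ => ?_) φ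
  · have h4 : Polynomial.C (-(-4 * 2 ^ (N - 1)) : ℂ) *
        (Polynomial.C (1 / 2 : ℂ) * (Polynomial.X - Polynomial.C 2)) ^ (i + 1) =
        (Polynomial.X - Polynomial.C (2 : ℂ)) * (Polynomial.C 2 - Polynomial.C 0) *
        (1 * (Polynomial.C (2 ^ (N - 1) : ℂ) *
          (Polynomial.C (1 / 2 : ℂ) * (Polynomial.X - Polynomial.C 2)) ^ i)) := by
      refine Polynomial.funext fun v => ?_
      simp only [Polynomial.eval_mul, Polynomial.eval_sub, Polynomial.eval_pow,
        Polynomial.eval_C, Polynomial.eval_X, Polynomial.eval_one]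
      ring
    rw [h4]
    exact_mod_cast h2
  · rw [sigmaBasisPoly_odd, Polynomial.mul_comp, basisPoly_odd_hyp]
    have h3 : (e1 ζ).comp (Polynomial.C 1 + Polynomial.C ζ * Polynomial.X) = Polynomial.C ζ *
        ((Polynomial.X - Polynomial.C 2) * (hypDen ζ - Polynomial.C (2 * ζ))) := by
      refine Polynomial.funext fun v => ?_
      simp only [Polynomial.eval_mul, Polynomial.eval_comp, Polynomial.eval_sub,
        Polynomial.eval_C, Polynomial.eval_X, Polynomial.eval_add, hypDen, e1]
      ring
    rw [h3, pow_succ ζ i, Polynomial.C_mul (a := ζ ^ i)]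
    ring

end HypLimits

lemma HasOrder.of_eventually_zpow_mul {f h : ℂ → ℂ} {n r : ℤ} {l : ℂ} (hh : HasOrder h r l)
    (hf : ∀ᶠ ζ in 𝓝[≠] 0, f ζ = ζ ^ n * h ζ) : HasOrder f (n + r) l := by
  have := (HasOrder.zpow_self n).mul hh
  rw [one_mul] at this
  exact this.congr' (hf.mono fun ζ hζ => hζ.symm)

lemma homog_of_degree_lt {n : ℕ} {β : Polynomial ℂ} (hβ : β.degree < n) (L₁ L₂ : Polynomial ℂ) :
    homog (n - 1) β L₁ L₂ =
      ∑ i ∈ Finset.range n, Polynomial.C (β.coeff i) * L₁ ^ i * L₂ ^ (n - 1 - i) := by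
  rcases Nat.eq_zero_or_pos n with rfl | hn
  · have h := (Polynomial.degree_lt_iff_coeff_zero _ _).1 hβ
    simp [homog, h 0 le_rfl]
  · rw [homog, Nat.sub_add_cancel hn]

/-- The conditions near `ξ_1` and `ξ_2` on the coefficients that survive the gluing. -/
lemma dvd_homog_of_rows {P nE nB o1 o2 : ℕ} {α β : Polynomial ℂ} {YE YB : ℕ → ℕ → ℂ} {c : ℂ}
    (hc : c ≠ 0) (hβ : β.degree < nB)
    (hYB : ∀ l < o1 + o2, ∀ i < nB, P ≤ i → YB l i = residueCoeff (nodal (twoPoints o1 o2 0 2)) l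
      (Polynomial.C c * (Polynomial.X ^ (nB - 1 - i) * Polynomial.C ((-1 / 4) ^ i))))
    (hrow : ∀ l < o1 + o2, ∑ i ∈ Finset.range nE, YE l i * α.coeff i +
        ∑ i ∈ Finset.range nB, YB l i * β.coeff i = 0)
    (hα : α = 0) (hlow : lowPart P β = 0) :
    Polynomial.X ^ o1 * (Polynomial.X - Polynomial.C 2) ^ o2 ∣
        homog (nB - 1) β (Polynomial.C (-1 / 4)) Polynomial.X := by
  have hβl : ∀ i < P, β.coeff i = 0 := fun i hi => by
    have := coeff_lowPart P β i
    rw [hlow, if_pos hi, Polynomial.coeff_zero] at this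
    exact this.symm
  have hCc : IsUnit (Polynomial.C c) := Polynomial.isUnit_C.2 (IsUnit.mk0 _ hc)
  have hn : nodal (twoPoints o1 o2 0 2) =
      Polynomial.X ^ o1 * (Polynomial.X - Polynomial.C 2) ^ o2 := by
    rw [nodal_twoPoints, Polynomial.C_0, sub_zero]
  rw [← hCc.dvd_mul_left, ← hn]
  refine dvd_of_residueCoeff_eq_zero (nodal_monic _) fun l hl => ?_
  rw [natDegree_nodal] at hl
  refine Eq.trans ?_ (hrow l hl)
  rw [hα, homog_of_degree_lt hβ, Finset.mul_sum, map_sum]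
  simp only [Polynomial.coeff_zero, mul_zero, Finset.sum_const_zero, zero_add]
  refine Finset.sum_congr rfl fun i hi => ?_
  by_cases h : i < P
  · rw [hβl i h]; simp
  · rw [hYB l hl i (Finset.mem_range.1 hi) (by omega), mul_comm _ (β.coeff i), ← map_C_mul,
      Polynomial.C_pow]
    refine congrArg (residueCoeff (nodal (twoPoints o1 o2 0 2)) l) ?_
    ring

lemma sel_self {M : Type*} {N j : ℕ} (hj : j < 2 * N) (F : ℕ → M) :
    sel N N (fun i => F (2 * i)) (fun i => F (2 * i + 1)) j = F j := by
  rcases Nat.even_or_odd' j with ⟨i, rfl | rfl⟩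
  · rw [sel, if_pos (even_two_mul i), Nat.mul_div_cancel_left _ two_pos]
  · rw [sel_odd _ _ (by omega)]

/-- In regime C the large cluster near `x = 0` belongs to the first group of variables, and the two kinds
of columns are the basis elements of even and of odd index. -/
theorem detAsymptotics_regimeC {N m c0 c1 c2 c3 d0 d1 d2 d3 P : ℕ}
    (e : Rows m (c0 + c3) (c1 + c2) (d0 + d3) (d1 + d2) ≃ Fin (2 * N))
    (hP : N = P + m + (d1 + d2)) (hc : c0 + c3 ≤ P) (hd : d0 + d3 ≤ P + 1)
    (hS : c1 + c2 + (c0 + c3 + (d0 + d3)) = N + P) :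
    DetAsymptotics c0 c1 c2 c3 d0 d1 d2 d3 (fun ζ j => basisPoly N ζ j)
      (fun ζ j => sigmaBasisPoly N ζ j) e
      (m * (1 - P) + ∑ l ∈ Finset.range (c1 + c2),
          ((2 * N - 2 : ℤ) + -(min ((N : ℤ) - 1 - l) P - 1)) + (d0 + d3) +
        ∑ _l ∈ Finset.range (d1 + d2), ((2 * N : ℤ) + (1 - P)) +
        (∑ i ∈ Finset.range N, (min (i : ℤ) P - 1) +
          ∑ i ∈ Finset.range N, min (i : ℤ) (P - 1)))
      (fun j x => glueFun (fun x => (2 * x) ^ (N - 1) * x) N d1 d2 j x) := by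
  have hNN : 2 * N - N = N := by omega
  obtain ⟨YE, YB, hYE, hYB, hY⟩ := exists_limits_saturated (P := P) (nE := N) (nB := N)
    (S := c1 + c2) (K := 2 * P + 1 - (c0 + c3 + (d0 + d3))) (ab := c0 + c3 + (d0 + d3)) (by omega)
    (by omega) le_rfl hS (by omega) (nodal_monic (twoPoints c1 c2 0 2)) (natDegree_nodal _)
    (HE := fun i ζ => cuspFactor ζ ^ i)
    (HB := fun i ζ => Polynomial.C (1 / (ζ + 2)) * (1 + Polynomial.X) * cuspFactor ζ ^ i)
    (fun i _ => polyTendsto_cuspFactor.pow i)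
    (fun i _ => ((PolyTendsto.C (tendsto_div_add_two (fun _ => 1) (by fun_prop))).mul
      (.const (1 + Polynomial.X))).mul (polyTendsto_cuspFactor.pow i))
    (fun i _ _ => rfl)
    (fun i _ => by
      rw [coeff_zero_cuspFactor_limit]
      exact pow_ne_zero _ (by norm_num))
    (fun i _ _ => rfl)
  have hfg : (fun ζ (j : Fin (2 * N)) => basisPoly N ζ j) = fun ζ (j : Fin (2 * N)) =>
      sel N N (fun i => basisPoly N ζ (2 * i)) (fun i => basisPoly N ζ (2 * i + 1)) j := by
    funext ζ j
    rw [sel_self j.2]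
  have hgg : (fun ζ (j : Fin (2 * N)) => sigmaBasisPoly N ζ j) = fun ζ (j : Fin (2 * N)) =>
      sel N N (fun i => sigmaBasisPoly N ζ (2 * i)) (fun i => sigmaBasisPoly N ζ (2 * i + 1)) j := by
    funext ζ j
    rw [sel_self j.2]
  rw [hfg, hgg]
  have h2N : ((2 * N - 2 : ℕ) : ℤ) = 2 * N - 2 ∨ N = 0 := by omega
  have h := detAsymptotics_glue (nB := N) (o1 := d1) (o2 := d2) (P := P)
    (K := 2 * P + 1 - (c0 + c3 + (d0 + d3))) e le_rfl (by omega)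
    (FE := fun ζ i => basisPoly N ζ (2 * i)) (FB := fun ζ i => basisPoly N ζ (2 * i + 1))
    (GE := fun ζ i => sigmaBasisPoly N ζ (2 * i)) (GB := fun ζ i => sigmaBasisPoly N ζ (2 * i + 1))
    (ρ := fun x => (2 * x) ^ (N - 1) * x) (EV := fun x i => (basisPoly N 0 (2 * i)).eval x)
    (r₂ := fun l => (2 * N - 2 : ℤ) + -(min ((N : ℤ) - 1 - l) P - 1))
    (r₄ := fun _ => (2 * N : ℤ) + (1 - P))
    (YE₂ := YE) (YB₂ := YB)
    (YE₄ := fun l i => if (2 * N : ℤ) + (1 - P) + (min (i : ℤ) P - 1) = 2 * N then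
      residueCoeff (nodal (twoPoints d1 d2 0 2)) l (cuspLimitSigma N (2 * i)) else 0)
    (YB₄ := fun l i => if (2 * N : ℤ) + (1 - P) + min (i : ℤ) (P - 1) = 2 * N then
      residueCoeff (nodal (twoPoints d1 d2 0 2)) l (cuspLimitSigma N (2 * i + 1)) else 0)
    (cf := 2 ^ (N - 1)) (cg := -4 * 2 ^ (N - 1)) (pow_ne_zero _ two_ne_zero)
    (mul_ne_zero (by norm_num) (pow_ne_zero _ two_ne_zero)) ?_ ?_ ?_ ?_ ?_ ?_ ?_ ?_ ?_ ?_ ?_ ?_ hc hd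
    (by omega) hP
  · rw [hNN] at h
    exact h
  · exact fun x i _ => HasOrder.of_tendsto ((polyTendsto_basisPoly N (2 * i)).eval x)
  · intro x i hi
    have h1 := HasOrder.of_tendsto ((polyTendsto_basisPoly N (2 * i + 1)).eval x)
    rwa [eval_basisPoly_zero_odd hi, ← mul_assoc] at h1
  · exact fun x h0 _ _ => mul_ne_zero (pow_ne_zero _ (mul_ne_zero two_ne_zero h0)) h0
  · exact fun φ i hi => (hasOrder_hyp_even φ (by omega)).of_lt (by omega)
  · exact fun φ i hi => hasOrder_hyp_odd φ hi
  · intro φ i hi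
    have h1 := (hasOrder_hyp_sigma_even (N := N) φ (i := i) (by omega)).of_le
      (e' := min (i : ℤ) P) (by omega)
    convert h1 using 1
    by_cases h2 : i < P + 1
    · rw [if_pos h2, if_pos (by omega)]
    · rw [if_neg h2, if_neg (by omega), map_zero]
  · exact fun φ i hi => hasOrder_hyp_sigma_odd φ hi
  · intro l hl i hi
    rw [hNN] at hi
    have h1 := (hYE l hl i hi).of_eventually_zpow_mul (n := 2 * N - 2)
      (f := fun ζ => residueCoeff (nodal (twoPoints c1 c2 0 2)) l
        ((basisPoly N ζ (2 * i)).comp (cuspMap ζ))) (by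
        filter_upwards [eventually_add_two_ne_zero] with ζ hζ
        rw [basisPoly_even_cusp hi hζ, map_C_mul, ← zpow_natCast, h2N.resolve_right (by omega)])
    rwa [← add_assoc] at h1
  · intro l hl i hi
    have h1 := (hYB l hl i hi).of_eventually_zpow_mul (n := 2 * N - 2)
      (f := fun ζ => residueCoeff (nodal (twoPoints c1 c2 0 2)) l
        ((basisPoly N ζ (2 * i + 1)).comp (cuspMap ζ))) (by
        filter_upwards [eventually_add_two_ne_zero] with ζ hζ
        rw [basisPoly_odd_cusp hi hζ, map_C_mul, map_C_mul, ← h2N.resolve_right (by omega),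
          zpow_natCast, ← mul_assoc, ← pow_succ]
        congr 2
        omega)
    rwa [← add_assoc] at h1
  · intro l hl i hi
    have h1 := hasOrder_cusp_sigma (N := N) (residueCoeff (nodal (twoPoints d1 d2 0 2)) l)
      ⟨2 * i, by omega⟩
    exact h1.of_le (by omega)
  · intro l hl i hi
    have h1 := hasOrder_cusp_sigma (N := N) (residueCoeff (nodal (twoPoints d1 d2 0 2)) l)
      ⟨2 * i + 1, by omega⟩
    exact h1.of_le (by omega)
  · intro α β hα hβ h1 h2
    rw [hNN] at hα h1 h2
    obtain ⟨h3, h4⟩ := hY α β hα h1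
    refine ⟨h3, h4, fun h5 h6 => ?_⟩
    refine dvd_homog_of_rows one_ne_zero hβ ?_ h2 h5 h6
    intro l hl i hi hPi
    rw [if_pos (by omega), cuspLimitSigma, if_neg (by simp), show (2 * i + 1) / 2 = i by omega,
      Polynomial.C_1, one_mul]

/-! ### Regime B -/

/-- The factor for which `P_{2 i + 1} + κ P_{2 i + 2}` gains an order in `ζ` near `ξ_1` and `ξ_2`
after application of `σ̂`. -/
def gluingFactor (ζ : ℂ) : ℂ := (ζ + 2) ^ 2 / (ζ ^ 2 + ζ + 1)

/-- The family with `p_j` replaced by `-(p_j + κ p_{j+1}) / 3` for odd `j < 2 N - 1`. -/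
def gluedFamily (N : ℕ) (ζ : ℂ) (p : ℕ → Polynomial ℂ) (j : ℕ) : Polynomial ℂ :=
  if ¬ Even j ∧ j / 2 < N - 1 then
    Polynomial.C (-1 / 3) * (p j + Polynomial.C (gluingFactor ζ) * p (j + 1))
  else p j

lemma eventually_gluing_ne_zero : ∀ᶠ ζ : ℂ in 𝓝[≠] 0, ζ ^ 2 + ζ + 1 ≠ 0 := by
  have : ContinuousAt (fun ζ : ℂ => ζ ^ 2 + ζ + 1) 0 := by fun_prop
  exact nhdsWithin_le_nhds (this.eventually_ne (by simp))

lemma tendsto_div_gluing (f : ℂ → ℂ) (hf : Continuous f) :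
    Tendsto (fun ζ : ℂ => f ζ / (ζ ^ 2 + ζ + 1)) (𝓝[≠] 0) (𝓝 (f 0)) := by
  have : ContinuousAt (fun ζ : ℂ => f ζ / (ζ ^ 2 + ζ + 1)) 0 :=
    hf.continuousAt.div (by fun_prop) (by simp)
  simpa using this.tendsto.mono_left nhdsWithin_le_nhds

lemma tendsto_gluingFactor : Tendsto gluingFactor (𝓝[≠] 0) (𝓝 4) := by
  have h := tendsto_div_gluing (fun ζ => (ζ + 2) ^ 2) (by fun_prop)
  norm_num at h
  exact h

lemma gluedFamily_eq_sel {N : ℕ} (ζ : ℂ) (p : ℕ → Polynomial ℂ) {j : ℕ} (hj : j < 2 * N) :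
    gluedFamily N ζ p j = sel N (N - 1) (fun i => p (colE N i)) (fun i => Polynomial.C (-1 / 3) *
      (p (2 * i + 1) + Polynomial.C (gluingFactor ζ) * p (2 * (i + 1)))) j := by
  rcases Nat.even_or_odd' j with ⟨i, rfl | rfl⟩
  · rw [gluedFamily, if_neg (by simp), sel, if_pos (even_two_mul i),
      Nat.mul_div_cancel_left _ two_pos, colE, if_pos (by omega)]
  · by_cases h : i < N - 1
    · rw [sel_odd _ _ h, gluedFamily, if_pos ⟨by simp, by omega⟩]
      rfl
    · rw [gluedFamily, if_neg (by omega), sel, if_neg (by simp), if_neg (by omega), colE,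
        if_neg (lt_irrefl N)]
      congr 1
      omega

/-- The transition from the basis to the glued family. -/
def gluingMatrix (N : ℕ) (ζ : ℂ) : Matrix (Fin (2 * N)) (Fin (2 * N)) ℂ :=
  Matrix.of fun i j => if ¬ Even (j : ℕ) ∧ (j : ℕ) / 2 < N - 1 then
    (if i = j then -1 / 3 else if (i : ℕ) = j + 1 then -1 / 3 * gluingFactor ζ else 0)
    else if i = j then 1 else 0

lemma gluedFamily_eq_sum {N : ℕ} (ζ : ℂ) (p : ℕ → Polynomial ℂ) (j : Fin (2 * N)) :
    gluedFamily N ζ p j = ∑ i : Fin (2 * N), gluingMatrix N ζ i j • p i := by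
  unfold gluedFamily gluingMatrix
  simp only [Matrix.of_apply]
  by_cases h : ¬ Even (j : ℕ) ∧ (j : ℕ) / 2 < N - 1
  · simp only [if_pos h]
    have h1 : (j : ℕ) + 1 < 2 * N := by omega
    have h2 : ∀ i : Fin (2 * N), (if i = j then (-1 / 3 : ℂ) else if (i : ℕ) = j + 1 then
        -1 / 3 * gluingFactor ζ else 0) • p i = (if i = j then (-1 / 3 : ℂ) • p j else 0) +
        (if i = ⟨j + 1, h1⟩ then (-1 / 3 * gluingFactor ζ) • p (j + 1) else 0) := by
      intro i
      by_cases hi : i = j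
      · subst hi
        rw [if_pos rfl, if_pos rfl, if_neg (by simp [Fin.ext_iff]), add_zero]
      · by_cases hi' : (i : ℕ) = j + 1
        · rw [if_neg hi, if_pos hi', if_neg hi, if_pos (Fin.ext hi'), zero_add, hi']
        · rw [if_neg hi, if_neg hi', if_neg hi, if_neg (fun h => hi' (by rw [h])), zero_smul,
            zero_add]
    simp only [h2, Finset.sum_add_distrib, Finset.sum_ite_eq', Finset.mem_univ, if_true]
    rw [Polynomial.smul_eq_C_mul, Polynomial.smul_eq_C_mul, Polynomial.C_mul]
    ring
  · simp only [if_neg h]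
    simp

/-- The transition matrix is triangular, and its diagonal is independent of `ζ`. -/
lemma exists_det_gluingMatrix (N : ℕ) : ∃ u : ℂ, u ≠ 0 ∧ ∀ ζ, (gluingMatrix N ζ).det = u := by
  refine ⟨∏ j : Fin (2 * N), if ¬ Even (j : ℕ) ∧ (j : ℕ) / 2 < N - 1 then (-1 / 3 : ℂ) else 1,
    Finset.prod_ne_zero_iff.2 fun j _ => by split_ifs <;> norm_num, fun ζ => ?_⟩
  rw [Matrix.det_of_isLowerTriangular]
  · simp [gluingMatrix]
  · intro i j hij
    have hij' : i < j := hij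
    have h1 : i ≠ j := hij'.ne
    have h2 : (i : ℕ) ≠ j + 1 := by
      have : (i : ℕ) < j := hij'
      omega
    simp [gluingMatrix, h1, h2]

lemma HasOrder.add {f g : ℂ → ℂ} {e : ℤ} {l l' : ℂ} (h : HasOrder f e l) (h' : HasOrder g e l') :
    HasOrder (fun ζ => f ζ + g ζ) e (l + l') := by
  refine (Tendsto.add h h').congr fun ζ => ?_
  rw [add_div]

lemma HasOrder.glue {f g F : ℂ → ℂ} {e : ℤ} {l l' : ℂ} (h : HasOrder f e l)
    (h' : HasOrder g e l') (hF : ∀ ζ, F ζ = -1 / 3 * (f ζ + gluingFactor ζ * g ζ)) :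
    HasOrder F e (-1 / 3 * (l + 4 * l')) := by
  have h1 := (HasOrder.of_tendsto tendsto_gluingFactor).mul h'
  rw [zero_add] at h1
  have h2 := (HasOrder.const (-1 / 3)).mul (h.add h1)
  rw [zero_add] at h2
  exact h2.congr' (.of_forall fun ζ => (hF ζ).symm)

lemma linear_comp_glue (φ : Polynomial ℂ →ₗ[ℂ] ℂ) (p q L : Polynomial ℂ) (κ : ℂ) :
    φ ((Polynomial.C (-1 / 3) * (p + Polynomial.C κ * q)).comp L) =
      -1 / 3 * (φ (p.comp L) + κ * φ (q.comp L)) := by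
  rw [Polynomial.mul_comp, Polynomial.C_comp, Polynomial.add_comp, Polynomial.mul_comp,
    Polynomial.C_comp, map_C_mul, map_add, map_C_mul]

/-- The quotient by `X` of the glued function near `ξ_1`, `ξ_2`. -/
def gluedCusp (i : ℕ) (ζ : ℂ) : Polynomial ℂ :=
  -(Polynomial.C (1 / (ζ + 2)) * (1 + Polynomial.X)) *
    (Polynomial.C (ζ / (ζ + 2)) * (1 + Polynomial.X) - Polynomial.C (2 * ζ + 1)) *
    (1 - Polynomial.C (ζ / (ζ ^ 2 + ζ + 1)) * (1 + Polynomial.X)) * cuspFactor ζ ^ i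

lemma polyTendsto_gluedCusp (i : ℕ) : PolyTendsto (gluedCusp i)
    (Polynomial.C (1 / 2) * (1 + Polynomial.X) *
      (Polynomial.C (-1 / 4) * (1 + Polynomial.X) ^ 2) ^ i) := by
  have h1 : PolyTendsto (fun ζ => Polynomial.C (1 / (ζ + 2)) * (1 + Polynomial.X)) _ :=
    (PolyTendsto.C (tendsto_div_add_two (fun _ => 1) (by fun_prop))).mul (.const (1 + Polynomial.X))
  have h2 : PolyTendsto (fun ζ : ℂ => Polynomial.C (ζ / (ζ + 2)) * (1 + Polynomial.X)) _ :=
    (PolyTendsto.C (tendsto_div_add_two (fun ζ => ζ) (by fun_prop))).mul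
      (.const (1 + Polynomial.X))
  have h3 : PolyTendsto (fun ζ : ℂ => Polynomial.C (ζ / (ζ ^ 2 + ζ + 1)) * (1 + Polynomial.X)) _ :=
    (PolyTendsto.C (tendsto_div_gluing (fun ζ => ζ) (by fun_prop))).mul (.const (1 + Polynomial.X))
  have h4 := ((((PolyTendsto.const 0).sub h1).mul
    (h2.sub (PolyTendsto.C (tendsto_linear 2 1)))).mul ((PolyTendsto.const 1).sub h3)).mul
      (polyTendsto_cuspFactor.pow i)
  rw [zero_div, Polynomial.C_0, Polynomial.C_1] at h4
  convert h4 using 1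
  · funext ζ
    rw [gluedCusp, zero_sub]
  · ring

/-- Without gluing, `σ̂ P` near `ξ_1` and `ξ_2` contains the factor `X ^ (N - 1 - i)`. The glued
combination contains `ζ X ^ (N - i)`, which is the form required in `exists_limits_saturated`. -/
lemma glued_cusp {N i : ℕ} (hi : i + 1 < N) {ζ : ℂ} (hζ : ζ + 2 ≠ 0) (hζ' : ζ ^ 2 + ζ + 1 ≠ 0) :
    (Polynomial.C (-1 / 3) * (sigmaBasisPoly N ζ (2 * i + 1) + Polynomial.C (gluingFactor ζ) *
      sigmaBasisPoly N ζ (2 * (i + 1)))).comp (cuspMap ζ) = Polynomial.C (ζ ^ (2 * N)) *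
      (Polynomial.C ζ * (Polynomial.X ^ (N - i) * (gluedCusp i ζ).comp
        (Polynomial.C ζ * Polynomial.X))) := by
  rw [Polynomial.mul_comp, Polynomial.C_comp, Polynomial.add_comp, Polynomial.mul_comp,
    Polynomial.C_comp, sigmaBasisPoly_odd_cusp (by omega) hζ, sigmaBasisPoly_even_cusp hi hζ,
    show N - (i + 1) = N - 1 - i by omega, show N - i = N - 1 - i + 1 by omega]
  refine Polynomial.funext fun v => ?_
  simp only [Polynomial.eval_mul, Polynomial.eval_pow, Polynomial.eval_comp, Polynomial.eval_sub,
    Polynomial.eval_C, Polynomial.eval_X, Polynomial.eval_add, Polynomial.eval_one, gluedCusp,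
    gluingFactor, pow_succ _ i, Polynomial.eval_neg, pow_succ v]
  have hc : (cuspFactor ζ).eval (ζ * v) = ((1 + ζ * v) / (ζ + 2)) ^ 2 *
      (ζ / (ζ + 2) * (1 + ζ * v) - (2 * ζ + 1)) := by
    simp only [cuspFactor, Polynomial.eval_mul, Polynomial.eval_pow, Polynomial.eval_sub,
      Polynomial.eval_C, Polynomial.eval_X, Polynomial.eval_add, Polynomial.eval_one]
    rw [div_pow]
    ring
  have key : -1 / 3 * ((ζ * v - 2) * (1 / (ζ + 2) * (1 + ζ * v)) + (ζ + 2) ^ 2 / (ζ ^ 2 + ζ + 1) *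
      ((2 * ζ + 1 - 3 * ζ / (ζ + 2) * (1 + ζ * v)) * ((1 + ζ * v) / (ζ + 2)) ^ 2)) =
      ζ * v * (-(1 / (ζ + 2) * (1 + ζ * v)) * (1 - ζ / (ζ ^ 2 + ζ + 1) * (1 + ζ * v))) := by
    obtain ⟨w, hw⟩ : ∃ w, w = ζ ^ 2 + ζ + 1 := ⟨_, rfl⟩
    rw [← hw] at hζ' ⊢
    field_simp
    rw [hw]
    ring
  set c := (cuspFactor ζ).eval (ζ * v) ^ i
  rw [hc]
  linear_combination ζ ^ (2 * N) * v ^ (N - 1 - i) * c *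
    (ζ / (ζ + 2) * (1 + ζ * v) - (2 * ζ + 1)) * key

/-- In regime B the large cluster near `x = 0` belongs to the second group of variables. The columns of
the second kind are the glued ones, and the last basis element is counted as a column of the first
kind, so that there are `N + 1` and `N - 1` columns of the two kinds. -/
theorem detAsymptotics_regimeB {N m c0 c1 c2 c3 d0 d1 d2 d3 P : ℕ}
    (e : Rows m (c0 + c3) (c1 + c2) (d0 + d3) (d1 + d2) ≃ Fin (2 * N))
    (hP : N = P + m + (c1 + c2) + 1) (hc : c0 + c3 ≤ P) (hd : d0 + d3 ≤ P + 1)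
    (hS : d1 + d2 + (c0 + c3 + (d0 + d3)) = N + 1 + P) :
    DetAsymptotics c0 c1 c2 c3 d0 d1 d2 d3 (fun ζ j => gluedFamily N ζ (basisPoly N ζ) j)
      (fun ζ j => gluedFamily N ζ (sigmaBasisPoly N ζ) j) e
      (m * (1 - P) + ∑ _l ∈ Finset.range (c1 + c2), ((2 * N - 2 : ℤ) + (1 - P)) + (d0 + d3) +
        ∑ l ∈ Finset.range (d1 + d2), ((2 * N : ℤ) + -(min ((N : ℤ) - l) P - 1)) +
        (∑ i ∈ Finset.range (N + 1), (min (i : ℤ) P - 1) +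
          ∑ i ∈ Finset.range (N - 1), min (i : ℤ) (P - 1)))
      (fun j x => glueFun (fun x => -1 / 3 * ((2 * x) ^ (N - 1) * (x * (2 * x - 1)))) (N - 1) c1 c2
        j x) := by
  have hNN : 2 * N - (N - 1) = N + 1 := by omega
  have hcE : ∀ {i}, i < N → colE N i = 2 * i := fun hi => if_pos hi
  have hcN : colE N N = 2 * (N - 1) + 1 := by rw [colE, if_neg (lt_irrefl N)]; omega
  obtain ⟨YE, YB, hYE, hYB, hY⟩ := exists_limits_saturated (P := P) (nE := N + 1) (nB := N - 1)
    (S := d1 + d2) (K := 2 * P + 1 - (c0 + c3 + (d0 + d3))) (ab := c0 + c3 + (d0 + d3)) (by omega)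
    (by omega) (by omega) hS (by omega) (nodal_monic (twoPoints d1 d2 0 2)) (natDegree_nodal _)
    (HE := fun i ζ => if i < N then
      (Polynomial.C (2 * ζ + 1) - Polynomial.C (3 * ζ / (ζ + 2)) * (1 + Polynomial.X)) *
        cuspFactor ζ ^ i
      else (Polynomial.C (ζ / (ζ + 2)) * (1 + Polynomial.X) - Polynomial.C (2 * ζ + 1)) *
          (Polynomial.X - Polynomial.C 2) * (Polynomial.C (1 / (ζ + 2)) * (1 + Polynomial.X)) *
          cuspFactor ζ ^ (N - 1))
    (HE₀ := fun i => if i < N then (Polynomial.C (-1 / 4) * (1 + Polynomial.X) ^ 2) ^ i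
      else (Polynomial.C ((0 : ℂ) / 2) * (1 + Polynomial.X) - Polynomial.C 1) *
        (Polynomial.X - Polynomial.C 2) * (Polynomial.C (1 / 2) * (1 + Polynomial.X)) *
        (Polynomial.C (-1 / 4) * (1 + Polynomial.X) ^ 2) ^ (N - 1))
    (HB := gluedCusp)
    (fun i _ => by
      have t1 := PolyTendsto.C (tendsto_linear 2 1)
      split_ifs with h
      · have t3 : PolyTendsto (fun ζ : ℂ => Polynomial.C (3 * ζ / (ζ + 2)) * (1 + Polynomial.X)) _ :=
          (PolyTendsto.C (tendsto_div_add_two (fun ζ => 3 * ζ) (by fun_prop))).mul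
            (.const (1 + Polynomial.X))
        have h1 := (t1.sub t3).mul (polyTendsto_cuspFactor.pow i)
        simpa only [mul_zero, zero_div, Polynomial.C_0, zero_mul, sub_zero, Polynomial.C_1,
          one_mul] using h1
      · have t2 : PolyTendsto (fun ζ : ℂ => Polynomial.C (ζ / (ζ + 2)) * (1 + Polynomial.X)) _ :=
          (PolyTendsto.C (tendsto_div_add_two (fun ζ => ζ) (by fun_prop))).mul
            (.const (1 + Polynomial.X))
        have t4 : PolyTendsto (fun ζ : ℂ => Polynomial.C (1 / (ζ + 2)) * (1 + Polynomial.X)) _ :=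
          (PolyTendsto.C (tendsto_div_add_two (fun ζ => 1) (by fun_prop))).mul
            (.const (1 + Polynomial.X))
        exact (((t2.sub t1).mul (.const (Polynomial.X - Polynomial.C 2))).mul t4).mul
          (polyTendsto_cuspFactor.pow (N - 1)))
    (fun i _ => polyTendsto_gluedCusp i)
    (fun i _ hi => if_pos (by omega))
    (fun i _ => by
      split_ifs
      · rw [coeff_zero_cuspFactor_limit]
        exact pow_ne_zero _ (by norm_num)
      · rw [Polynomial.mul_coeff_zero, coeff_zero_cuspFactor_limit,
          Polynomial.coeff_zero_eq_eval_zero]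
        exact mul_ne_zero (by simp) (pow_ne_zero _ (by norm_num)))
    (fun i _ _ => rfl)
  have hfg : ∀ p : ℂ → ℕ → Polynomial ℂ,
      (fun ζ (j : Fin (2 * N)) => gluedFamily N ζ (p ζ) j) = fun ζ (j : Fin (2 * N)) =>
      sel N (N - 1) (fun i => p ζ (colE N i)) (fun i => Polynomial.C (-1 / 3) *
        (p ζ (2 * i + 1) + Polynomial.C (gluingFactor ζ) * p ζ (2 * (i + 1)))) j := by
    intro p
    funext ζ j
    rw [gluedFamily_eq_sel ζ _ j.2]
  rw [hfg (basisPoly N), hfg (sigmaBasisPoly N)]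
  have h2N : ((2 * N - 2 : ℕ) : ℤ) = 2 * N - 2 := by omega
  have h2N' : ((2 * N : ℕ) : ℤ) = 2 * N := by omega
  have h := detAsymptotics_glue (N := N) (nB := N - 1) (o1 := c1) (o2 := c2) (P := P)
    (K := 2 * P + 1 - (c0 + c3 + (d0 + d3))) e (by omega) (by omega)
    (FE := fun ζ i => basisPoly N ζ (colE N i))
    (FB := fun ζ i => Polynomial.C (-1 / 3) *
      (basisPoly N ζ (2 * i + 1) + Polynomial.C (gluingFactor ζ) * basisPoly N ζ (2 * (i + 1))))
    (GE := fun ζ i => sigmaBasisPoly N ζ (colE N i))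
    (GB := fun ζ i => Polynomial.C (-1 / 3) * (sigmaBasisPoly N ζ (2 * i + 1) +
      Polynomial.C (gluingFactor ζ) * sigmaBasisPoly N ζ (2 * (i + 1))))
    (ρ := fun x => -1 / 3 * ((2 * x) ^ (N - 1) * (x * (2 * x - 1))))
    (EV := fun x i => (basisPoly N 0 (colE N i)).eval x)
    (r₂ := fun _ => (2 * N - 2 : ℤ) + (1 - P))
    (r₄ := fun l => (2 * N : ℤ) + -(min ((N : ℤ) - l) P - 1))
    (YE₄ := YE) (YB₄ := YB)
    (YE₂ := fun l i => if (2 * N - 2 : ℤ) + (1 - P) + (min (i : ℤ) P - 1) = 2 * N - 2 then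
      residueCoeff (nodal (twoPoints c1 c2 0 2)) l (cuspLimit N (colE N i)) else 0)
    (YB₂ := fun l i => if (2 * N - 2 : ℤ) + (1 - P) + min (i : ℤ) (P - 1) = 2 * N - 2 then
      -1 / 3 * (residueCoeff (nodal (twoPoints c1 c2 0 2)) l (cuspLimit N (2 * i + 1)) +
        4 * residueCoeff (nodal (twoPoints c1 c2 0 2)) l (cuspLimit N (2 * (i + 1)))) else 0)
    (cf := -1 / 3 * 2 ^ (N - 1)) (cg := -4 * 2 ^ (N - 1))
    (mul_ne_zero (by norm_num) (pow_ne_zero _ two_ne_zero))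
    (mul_ne_zero (by norm_num) (pow_ne_zero _ two_ne_zero)) ?_ ?_ ?_ ?_ ?_ ?_ ?_ ?_ ?_ ?_ ?_ ?_ hc hd
    (by omega) (by omega)
  · rw [hNN] at h
    exact h
  · exact fun x i _ => HasOrder.of_tendsto ((polyTendsto_basisPoly N (colE N i)).eval x)
  · intro x i hi
    have h1 := HasOrder.of_tendsto ((polyTendsto_basisPoly N (2 * i + 1)).eval x)
    have h2 := HasOrder.of_tendsto ((polyTendsto_basisPoly N (2 * (i + 1))).eval x)
    rw [eval_basisPoly_zero_odd (by omega)] at h1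
    rw [eval_basisPoly_zero_even (by omega)] at h2
    have h3 := h1.glue h2 (F := fun ζ => (Polynomial.C (-1 / 3) * (basisPoly N ζ (2 * i + 1) +
      Polynomial.C (gluingFactor ζ) * basisPoly N ζ (2 * (i + 1)))).eval x) (fun ζ => by
        rw [Polynomial.eval_mul, Polynomial.eval_C, Polynomial.eval_add, Polynomial.eval_mul,
          Polynomial.eval_C])
    convert h3 using 1
    rw [pow_succ _ i]
    ring
  · intro x h0 _ h2
    refine mul_ne_zero (by norm_num) (mul_ne_zero (pow_ne_zero _ (mul_ne_zero two_ne_zero h0))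
      (mul_ne_zero h0 fun h3 => h2 ?_))
    linear_combination h3 / 2
  · intro φ i hi
    by_cases h1 : i < N
    · simp only [hcE h1]
      exact (hasOrder_hyp_even φ h1).of_lt (by omega)
    · obtain rfl : i = N := by omega
      simp only [hcN]
      exact (hasOrder_hyp_odd φ (by omega)).of_lt (by omega)
  · intro φ i hi
    have h1 := (hasOrder_hyp_odd (N := N) φ (i := i) (by omega)).glue
      ((hasOrder_hyp_even (N := N) φ (i := i + 1) (by omega)).of_lt (e' := i) (by omega))
      (fun ζ => linear_comp_glue φ _ _ _ _)
    convert h1 using 1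
    rw [mul_zero, add_zero, ← map_C_mul, ← mul_assoc, ← Polynomial.C_mul]
  · intro φ i hi
    by_cases h1 : i < N
    · simp only [hcE h1]
      have h1 := (hasOrder_hyp_sigma_even (N := N) φ h1).of_le (e' := min (i : ℤ) P) (by omega)
      convert h1 using 1
      by_cases h2 : i < P + 1
      · rw [if_pos h2, if_pos (by omega)]
      · rw [if_neg h2, if_neg (by omega), map_zero]
    · obtain rfl : i = N := by omega
      simp only [hcN]
      rw [if_neg (by omega), map_zero]
      exact (hasOrder_hyp_sigma_odd φ (by omega)).of_lt (by omega)
  · intro φ i hi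
    have h2 := hasOrder_hyp_sigma_even (N := N) φ (i := i + 1) (by omega)
    rw [Nat.cast_add, Nat.cast_one] at h2
    have h1 := (hasOrder_hyp_sigma_odd (N := N) φ (i := i) (by omega)).glue h2
      (fun ζ => linear_comp_glue φ _ _ _ _)
    convert h1 using 1
    rw [map_C_mul, map_C_mul]
    ring
  · intro l hl i hi
    have h1 := hasOrder_cusp (N := N) (residueCoeff (nodal (twoPoints c1 c2 0 2)) l)
      ⟨colE N i, by unfold colE; split_ifs <;> omega⟩
    exact h1.of_le (by omega)
  · intro l hl i hi
    have h1 := (hasOrder_cusp (N := N) (residueCoeff (nodal (twoPoints c1 c2 0 2)) l)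
      ⟨2 * i + 1, by omega⟩).glue (hasOrder_cusp (N := N) (residueCoeff
        (nodal (twoPoints c1 c2 0 2)) l) ⟨2 * (i + 1), by omega⟩)
      (fun ζ => linear_comp_glue (residueCoeff (nodal (twoPoints c1 c2 0 2)) l) _ _ _ _)
    exact h1.of_le (by omega)
  · intro l hl i hi
    rw [hNN] at hi
    have h1 := (hYE l hl i hi).of_eventually_zpow_mul (n := 2 * N)
      (f := fun ζ => residueCoeff (nodal (twoPoints d1 d2 0 2)) l
        ((sigmaBasisPoly N ζ (colE N i)).comp (cuspMap ζ))) (by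
        filter_upwards [eventually_add_two_ne_zero] with ζ hζ
        by_cases h1 : i < N
        · rw [hcE h1, sigmaBasisPoly_even_cusp h1 hζ, map_C_mul, ← zpow_natCast, h2N', if_pos h1,
            show N + 1 - 1 - i = N - i by omega]
        · obtain rfl : i = N := by omega
          rw [hcN, sigmaBasisPoly_odd_cusp (by omega) hζ, map_C_mul, ← zpow_natCast, h2N',
            if_neg h1, show i + 1 - 1 - i = i - 1 - (i - 1) by omega])
    rw [← add_assoc] at h1
    convert h1 using 3
    push_cast
    ring_nf
  · intro l hl i hi
    have h1 := (hYB l hl i hi).of_eventually_zpow_mul (n := 2 * N)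
      (f := fun ζ => residueCoeff (nodal (twoPoints d1 d2 0 2)) l
        ((Polynomial.C (-1 / 3) * (sigmaBasisPoly N ζ (2 * i + 1) +
      Polynomial.C (gluingFactor ζ) * sigmaBasisPoly N ζ (2 * (i + 1)))).comp (cuspMap ζ))) (by
        filter_upwards [eventually_add_two_ne_zero, eventually_gluing_ne_zero] with ζ hζ hζ'
        rw [glued_cusp (by omega) hζ hζ', map_C_mul, ← zpow_natCast, h2N', Nat.add_sub_cancel])
    rw [← add_assoc] at h1
    convert h1 using 3
    push_cast
    ring_nf
  · intro α β hα hβ h1 h2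
    rw [hNN] at hα h1 h2
    obtain ⟨h3, h4⟩ := hY α β hα h2
    refine ⟨h3, h4, fun h5 h6 => ?_⟩
    refine dvd_homog_of_rows (c := 1 / 3) (by norm_num) hβ ?_ h1 h5 h6
    intro l hl i hi hPi
    rw [if_pos (by omega), cuspLimit, if_neg (by simp), cuspLimit, if_pos (even_two_mul _),
      Nat.mul_div_cancel_left _ two_pos, map_zero, zero_add, map_C_mul,
      show N - 1 - (i + 1) = N - 1 - 1 - i by omega, mul_comm (Polynomial.X ^ _),
      mul_comm (Polynomial.X ^ _), map_C_mul, map_C_mul, pow_succ]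
    ring

/-! ### The order of the variables -/

lemma twoPoints_apply (p q : ℕ) (u v : ℂ) (i : Fin (p + q)) :
    twoPoints p q u v i = if (i : ℕ) < p then u else v := by
  unfold twoPoints
  induction i using Fin.addCases with
  | left i => simp
  | right i => simp

section RowEquiv

variable (m : ℕ) (c d : Fin 4 → ℕ)

/-- The position of a row in the list `x_1, …, x_m, ξ^c, ξ^d`. -/
def rowPos : Rows m (c 0 + c 3) (c 1 + c 2) (d 0 + d 3) (d 1 + d 2) → ℕ :=
  rowFun (fun i => i)
    (fun i => if (i : ℕ) < c 0 then m + i else m + c 1 + c 2 + i)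
    (fun i => m + c 0 + i)
    (fun i => m + ∑ i, c i + if (i : ℕ) < d 0 then (i : ℕ) else d 1 + d 2 + i)
    (fun i => m + ∑ i, c i + (d 0 + i))

variable {m c d}

lemma rowPos_lt (t) : rowPos m c d t < m + ∑ i, c i + ∑ i, d i := by
  rw [Fin.sum_univ_four, Fin.sum_univ_four]
  rcases t with i | (i | i) | i | i <;> have := i.2 <;>
    simp only [rowPos, rowFun, Sum.elim_inl, Sum.elim_inr, Fin.sum_univ_four] <;>
    try split_ifs
  all_goals omega

lemma rowPos_lt_iff (t) : rowPos m c d t < m + ∑ i, c i ↔ isFirst t = true := by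
  rw [Fin.sum_univ_four]
  rcases t with i | (i | i) | i | i <;> have := i.2 <;>
    simp only [rowPos, rowFun, Sum.elim_inl, Sum.elim_inr, Fin.sum_univ_four, isFirst, iff_true,
      Bool.false_eq_true, iff_false] <;>
    try split_ifs
  all_goals omega

lemma rowPos_injective : Function.Injective (rowPos m c d) := by
  intro t t' h
  rcases t with i | (i | i) | i | i <;> rcases t' with j | (j | j) | j | j <;> have := i.2 <;>
    have := j.2 <;>
    simp only [rowPos, rowFun, Sum.elim_inl, Sum.elim_inr, Fin.sum_univ_four] at h <;>
    simp only [Sum.inl.injEq, Sum.inr.injEq, reduceCtorEq, Fin.ext_iff] <;>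
    first | omega | (split_ifs at h <;> omega)

/-- The rows in the order of the list `x_1, …, x_m, ξ^c, ξ^d`. -/
def rowEquiv {N : ℕ} (hN : m + ∑ i, c i + ∑ i, d i = 2 * N) :
    Rows m (c 0 + c 3) (c 1 + c 2) (d 0 + d 3) (d 1 + d 2) ≃ Fin (2 * N) :=
  Equiv.ofBijective (fun t => ⟨rowPos m c d t, hN ▸ rowPos_lt t⟩) <| by
    rw [Fintype.bijective_iff_injective_and_card]
    refine ⟨fun t t' h => rowPos_injective (Fin.ext_iff.1 h), ?_⟩
    simp only [Fintype.card_sum, Fintype.card_fin]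
    rw [Fin.sum_univ_four, Fin.sum_univ_four] at hN
    omega

lemma coe_rowEquiv {N : ℕ} (hN : m + ∑ i, c i + ∑ i, d i = 2 * N) (t) :
    (rowEquiv hN t : ℕ) = rowPos m c d t := rfl

end RowEquiv

lemma length_xiList (ζ : ℂ) (a : Fin 4 → ℕ) : (xiList ζ a).length = ∑ i, a i := by
  simp [xiList, Fin.sum_univ_four, add_assoc]

lemma getD_replicate {n i : ℕ} (v : ℂ) (hi : i < n) : (List.replicate n v).getD i 0 = v := by
  rw [List.getD_eq_getElem _ _ (by rwa [List.length_replicate]), List.getElem_replicate]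

lemma getD_xiList (ζ : ℂ) (a : Fin 4 → ℕ) {i : ℕ} (hi : i < ∑ i, a i) :
    (xiList ζ a).getD i 0 = if i < a 0 then xi ζ 0 else if i < a 0 + a 1 then xi ζ 1
      else if i < a 0 + a 1 + a 2 then xi ζ 2 else xi ζ 3 := by
  rw [Fin.sum_univ_four] at hi
  unfold xiList
  by_cases h1 : i < a 0
  · rw [if_pos h1, List.getD_append _ _ _ _ (by simp; omega),
      List.getD_append _ _ _ _ (by simp; omega), List.getD_append _ _ _ _ (by simp; omega),
      getD_replicate _ h1]
  rw [if_neg h1]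
  by_cases h2 : i < a 0 + a 1
  · rw [if_pos h2, List.getD_append _ _ _ _ (by simp; omega),
      List.getD_append _ _ _ _ (by simp; omega), List.getD_append_right _ _ _ _ (by simp; omega),
      getD_replicate _ (by simp; omega)]
  rw [if_neg h2]
  by_cases h3 : i < a 0 + a 1 + a 2
  · rw [if_pos h3, List.getD_append _ _ _ _ (by simp; omega),
      List.getD_append_right _ _ _ _ (by simp; omega), getD_replicate _ (by simp; omega)]
  · rw [if_neg h3, List.getD_append_right _ _ _ _ (by simp; omega),
      getD_replicate _ (by simp; omega)]

lemma xi_zero (ζ : ℂ) : xi ζ 0 = 1 + ζ * 2 := by simp [xi]; ring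

lemma xi_one (ζ : ℂ) : xi ζ 1 = ζ / (ζ + 2) + ζ ^ 2 / (ζ + 2) * 0 := by simp [xi]

lemma xi_two (ζ : ℂ) : xi ζ 2 = ζ / (ζ + 2) + ζ ^ 2 / (ζ + 2) * 2 := by simp [xi]; ring

lemma xi_three (ζ : ℂ) : xi ζ 3 = 1 + ζ * 0 := by simp [xi]

/-- The arguments of `T` in the definition of `tnk`, in terms of the rows. -/
lemma getD_rowEquiv {m N : ℕ} {c d : Fin 4 → ℕ} (hN : m + ∑ i, c i + ∑ i, d i = 2 * N) (ζ : ℂ)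
    (x : Fin m → ℂ) (i : Fin (2 * N)) :
    (List.ofFn x ++ xiList ζ c ++ xiList ζ d).getD (i : ℕ) 0 =
      rowFun x (fun i => 1 + ζ * twoPoints (c 0) (c 3) 2 0 i)
        (fun i => ζ / (ζ + 2) + ζ ^ 2 / (ζ + 2) * twoPoints (c 1) (c 2) 0 2 i)
        (fun i => 1 + ζ * twoPoints (d 0) (d 3) 2 0 i)
        (fun i => ζ / (ζ + 2) + ζ ^ 2 / (ζ + 2) * twoPoints (d 1) (d 2) 0 2 i)
        ((rowEquiv hN).symm i) := by
  obtain ⟨t, rfl⟩ := (rowEquiv hN).surjective i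
  rw [Equiv.symm_apply_apply, coe_rowEquiv]
  have hl := rowPos_lt t
  have hf := rowPos_lt_iff t
  have hlen : (List.ofFn x ++ xiList ζ c).length = m + ∑ i, c i := by
    rw [List.length_append, List.length_ofFn, length_xiList]
  rcases t with i | (i | i) | i | i
  · have := i.2
    rw [List.getD_append _ _ _ _ (by rw [hlen]; exact hf.2 rfl),
      List.getD_append _ _ _ _ (by rw [List.length_ofFn]; exact i.2)]
    simp [rowPos, rowFun, List.getD_eq_getElem?_getD]
  · have hi := i.2
    have h0 := hf.2 rfl
    rw [List.getD_append _ _ _ _ (by rw [hlen]; exact h0)]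
    simp only [rowPos, rowFun, Sum.elim_inl, Sum.elim_inr, twoPoints_apply] at h0 ⊢
    rw [Fin.sum_univ_four] at h0
    by_cases h : (i : ℕ) < c 0
    · rw [if_pos h, if_pos h, List.getD_append_right _ _ _ _ (by rw [List.length_ofFn]; omega),
        List.length_ofFn, getD_xiList _ _ (by rw [Fin.sum_univ_four]; omega), if_pos (by omega),
        xi_zero]
    · rw [if_neg h] at h0
      rw [if_neg h, if_neg h, List.getD_append_right _ _ _ _ (by rw [List.length_ofFn]; omega),
        List.length_ofFn, getD_xiList _ _ (by rw [Fin.sum_univ_four]; omega), if_neg (by omega),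
        if_neg (by omega), if_neg (by omega), xi_three]
  · have hi := i.2
    have h0 := hf.2 rfl
    rw [List.getD_append _ _ _ _ (by rw [hlen]; exact h0)]
    simp only [rowPos, rowFun, Sum.elim_inl, Sum.elim_inr, twoPoints_apply] at h0 ⊢
    rw [Fin.sum_univ_four] at h0
    rw [List.getD_append_right _ _ _ _ (by rw [List.length_ofFn]; omega),
        List.length_ofFn, getD_xiList _ _ (by rw [Fin.sum_univ_four]; omega), if_neg (by omega)]
    by_cases h : (i : ℕ) < c 1
    · rw [if_pos h, if_pos (by omega), xi_one]
    · rw [if_neg h, if_neg (by omega), if_pos (by omega), xi_two]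
  · have hi := i.2
    simp only [rowPos, rowFun, Sum.elim_inl, Sum.elim_inr, twoPoints_apply]
    rw [List.getD_append_right _ _ _ _ (by rw [hlen]; omega), hlen, Nat.add_sub_cancel_left]
    by_cases h : (i : ℕ) < d 0
    · rw [if_pos h, if_pos h, getD_xiList _ _ (by rw [Fin.sum_univ_four]; omega), if_pos (by omega),
        xi_zero]
    · rw [if_neg h, if_neg h, getD_xiList _ _ (by rw [Fin.sum_univ_four]; omega),
        if_neg (by omega), if_neg (by omega), if_neg (by omega), xi_three]
  · have hi := i.2
    simp only [rowPos, rowFun, Sum.elim_inr, twoPoints_apply]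
    rw [List.getD_append_right _ _ _ _ (by rw [hlen]; omega), hlen, Nat.add_sub_cancel_left,
      getD_xiList _ _ (by rw [Fin.sum_univ_four]; omega), if_neg (by omega)]
    by_cases h : (i : ℕ) < d 1
    · rw [if_pos h, if_pos (by omega), xi_one]
    · rw [if_neg h, if_neg (by omega), if_pos (by omega), xi_two]

/-! ### The factors `G` -/

section GFactors

lemma G_xi_zero (ζ x : ℂ) : G ζ x (xi ζ 0) = 2 * (ζ + 1) ^ 2 * x ^ 2 := by
  simp only [xi, G, Matrix.cons_val_zero]
  ring

lemma G_xi_one {ζ : ℂ} (hζ : ζ + 2 ≠ 0) (x : ℂ) :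
    G ζ x (xi ζ 1) = ζ ^ 2 * (2 * ((ζ + 1) / (ζ + 2)) ^ 2) := by
  simp only [xi, G, Matrix.cons_val]
  field_simp
  ring

lemma G_xi_two {ζ : ℂ} (hζ : ζ + 2 ≠ 0) (x : ℂ) :
    G ζ x (xi ζ 2) = ζ ^ 2 * (2 * (x - (2 * ζ + 1) / (ζ + 2)) ^ 2) := by
  simp only [xi, G, Matrix.cons_val]
  field_simp
  ring

lemma G_xi_three (ζ x : ℂ) : G ζ x (xi ζ 3) = 2 * (x - ζ) ^ 2 := by
  simp only [xi, G, Matrix.cons_val]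
  ring

end GFactors

/-! ### The orders of numerator and denominator of `T_n^{(k)}` -/

lemma HasOrder.of_eventually_pow_mul {f h : ℂ → ℂ} (n : ℕ) (hh : ContinuousAt h 0)
    (hf : ∀ᶠ ζ in 𝓝[≠] 0, f ζ = ζ ^ n * h ζ) : HasOrder f n (h 0) := by
  have h1 := (HasOrder.of_continuousAt hh).of_eventually_zpow_mul (n := n) (f := f)
    (hf.mono fun ζ hζ => by rw [hζ, zpow_natCast])
  rwa [add_zero] at h1

/-- The orders of `G(ξ_i, ξ_j)` for `i ≠ j`. -/
def orderG : Fin 4 → Fin 4 → ℕ := ![![0, 2, 2, 0], ![2, 0, 2, 2], ![2, 2, 0, 2], ![0, 2, 2, 0]]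

lemma exists_hasOrder_G {i j : Fin 4} (hij : i ≠ j) :
    ∃ v ≠ 0, HasOrder (fun ζ => G ζ (xi ζ i) (xi ζ j)) (orderG i j) v := by
  have h2 : (0 : ℂ) + 2 ≠ 0 := by norm_num
  fin_cases j
  · fin_cases i
    · exact absurd rfl hij
    · refine ⟨_, ?_, HasOrder.of_eventually_pow_mul 2
        (h := fun ζ => 2 * (ζ + 1) ^ 2 * (1 / (ζ + 2)) ^ 2) (by fun_prop (disch := simp))
        (.of_forall fun ζ => ?_)⟩
      · norm_num
      · simp only [Fin.mk_one, Fin.zero_eta]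
        rw [G_xi_zero]
        simp only [xi, Matrix.cons_val]
        ring
    · refine ⟨_, ?_, HasOrder.of_eventually_pow_mul 2
        (h := fun ζ => 2 * (ζ + 1) ^ 2 * ((2 * ζ + 1) / (ζ + 2)) ^ 2) (by fun_prop (disch := simp))
        (.of_forall fun ζ => ?_)⟩
      · norm_num
      · simp only [Fin.reduceFinMk, Fin.zero_eta]
        rw [G_xi_zero]
        simp only [xi, Matrix.cons_val]
        ring
    · refine ⟨_, ?_, HasOrder.of_eventually_pow_mul 0
        (h := fun ζ => 2 * (ζ + 1) ^ 2) (by fun_prop) (.of_forall fun ζ => ?_)⟩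
      · norm_num
      · simp only [Fin.reduceFinMk, Fin.zero_eta]
        rw [G_xi_zero]
        simp only [xi, Matrix.cons_val]
        ring
  · have h : orderG i 1 = 2 := by fin_cases i <;> first | rfl | exact absurd rfl hij
    simp only [Fin.mk_one]
    rw [h]
    refine ⟨_, ?_, HasOrder.of_eventually_pow_mul 2
        (h := fun ζ => 2 * ((ζ + 1) / (ζ + 2)) ^ 2) (by fun_prop (disch := simp)) ?_⟩
    · norm_num
    · filter_upwards [eventually_add_two_ne_zero] with ζ hζ
      rw [G_xi_one hζ]
  · have h : orderG i 2 = 2 := by fin_cases i <;> first | rfl | exact absurd rfl hij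
    simp only [Fin.reduceFinMk]
    rw [h]
    refine ⟨_, ?_, HasOrder.of_eventually_pow_mul 2
        (h := fun ζ => 2 * (xi ζ i - (2 * ζ + 1) / (ζ + 2)) ^ 2) ?_ ?_⟩
    · fin_cases i
      · simp [xi]; norm_num
      · simp [xi]
      · exact absurd rfl hij
      · simp [xi]; norm_num
    · fin_cases i <;> simp only [xi, Fin.zero_eta, Fin.mk_one, Fin.reduceFinMk, Matrix.cons_val] <;>
        fun_prop (disch := simp)
    · filter_upwards [eventually_add_two_ne_zero] with ζ hζ
      rw [G_xi_two hζ]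
  · fin_cases i
    · refine ⟨_, ?_, HasOrder.of_eventually_pow_mul 0
        (h := fun ζ => 2 * (ζ + 1) ^ 2) (by fun_prop) (.of_forall fun ζ => ?_)⟩
      · norm_num
      · simp only [Fin.reduceFinMk, Fin.zero_eta]
        rw [G_xi_three]
        simp only [xi, Matrix.cons_val]
        ring
    · refine ⟨_, ?_, HasOrder.of_eventually_pow_mul 2
        (h := fun ζ => 2 * (1 / (ζ + 2) - 1) ^ 2) (by fun_prop (disch := simp))
        (.of_forall fun ζ => ?_)⟩
      · norm_num
      · simp only [Fin.reduceFinMk, Fin.mk_one]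
        rw [G_xi_three]
        simp only [xi, Matrix.cons_val]
        ring
    · refine ⟨_, ?_, HasOrder.of_eventually_pow_mul 2
        (h := fun ζ => 2 * ((2 * ζ + 1) / (ζ + 2) - 1) ^ 2) (by fun_prop (disch := simp))
        (.of_forall fun ζ => ?_)⟩
      · norm_num
      · simp only [Fin.reduceFinMk]
        rw [G_xi_three]
        simp only [xi, Matrix.cons_val]
        ring
    · exact absurd rfl hij

lemma hasOrder_G_point (x : ℂ) (i : Fin 4) :
    HasOrder (fun ζ => G ζ x (xi ζ i)) (![0, 2, 2, 0] i : ℤ)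
      (![2 * x ^ 2, 1 / 2, 1 / 2 * (1 - 2 * x) ^ 2, 2 * x ^ 2] i) := by
  have h2 : (0 : ℂ) + 2 ≠ 0 := by norm_num
  fin_cases i
  · simp only [Fin.zero_eta, G_xi_zero, Matrix.cons_val]
    have h := HasOrder.of_continuousAt (f := fun ζ : ℂ => 2 * (ζ + 1) ^ 2 * x ^ 2) (by fun_prop)
    simpa using h
  · have h := HasOrder.of_eventually_pow_mul (f := fun ζ => G ζ x (xi ζ 1)) 2
        (h := fun ζ => 2 * ((ζ + 1) / (ζ + 2)) ^ 2) (by fun_prop (disch := simp)) (by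
        filter_upwards [eventually_add_two_ne_zero] with ζ hζ
        rw [G_xi_one hζ])
    convert h using 1
    · rfl
    · rfl
    · change (1 / 2 : ℂ) = _
      norm_num
  · have h := HasOrder.of_eventually_pow_mul (f := fun ζ => G ζ x (xi ζ 2)) 2
        (h := fun ζ => 2 * (x - (2 * ζ + 1) / (ζ + 2)) ^ 2) (by fun_prop (disch := simp)) (by
        filter_upwards [eventually_add_two_ne_zero] with ζ hζ
        rw [G_xi_two hζ])
    convert h using 1
    · rfl
    · rfl
    · change 1 / 2 * (1 - 2 * x) ^ 2 = _
      ring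
  · simp only [Fin.reduceFinMk, G_xi_three]
    have h := HasOrder.of_continuousAt (f := fun ζ : ℂ => 2 * (x - ζ) ^ 2) (by fun_prop)
    simpa using h

/-- The denominator in the definition of `tnk`. -/
def tnkDenom (k : Fin 4 → ℤ) {m : ℕ} (ζ : ℂ) (x : Fin m → ℂ) : ℂ :=
  2 ^ (∑ i, negPart k i) *
      (∏ i, ∏ j, G ζ (xi ζ i) (xi ζ j) ^ (negPart k i * posPart k j)) *
      ∏ j, ∏ i, G ζ (x j) (xi ζ i) ^ negPart k i

/-- The exponent of `ζ` in `tnkDenom`. -/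
def denomOrder (m : ℕ) (c d : Fin 4 → ℕ) : ℕ :=
  2 * ((d 0 + d 3) * (c 1 + c 2) + (d 1 + d 2) * (c 0 + c 3) + (d 1 + d 2) * (c 1 + c 2)) +
    m * (2 * (d 1 + d 2))

lemma negPart_mul_posPart (k : Fin 4 → ℤ) (i : Fin 4) : negPart k i * posPart k i = 0 := by
  unfold negPart posPart
  rcases le_total (k i) 0 with h | h
  · rw [Int.toNat_of_nonpos h, mul_zero]
  · rw [Int.toNat_of_nonpos (by omega), zero_mul]

lemma exists_hasOrder_tnkDenom (k : Fin 4 → ℤ) (m : ℕ) : ∃ v : ℂ, v ≠ 0 ∧ ∀ x : Fin m → ℂ,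
    HasOrder (fun ζ => tnkDenom k ζ x) (denomOrder m (posPart k) (negPart k))
      (v * ∏ j, (x j ^ (2 * (negPart k 0 + negPart k 3)) * (1 - 2 * x j) ^ (2 * negPart k 2))) := by
  have h1 : ∀ i j, ∃ v : ℂ, v ≠ 0 ∧ HasOrder (fun ζ => G ζ (xi ζ i) (xi ζ j) ^
      (negPart k i * posPart k j)) ((negPart k i * posPart k j : ℕ) * orderG i j) v := by
    intro i j
    by_cases hij : i = j
    · subst hij
      refine ⟨1, one_ne_zero, ?_⟩
      rw [negPart_mul_posPart]
      simpa using HasOrder.const 1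
    · obtain ⟨v, hv, h⟩ := exists_hasOrder_G hij
      exact ⟨_, pow_ne_zero _ hv, h.pow _⟩
  choose v hv h1 using h1
  have h2 := HasOrder.prod Finset.univ fun i _ => HasOrder.prod Finset.univ fun j _ => h1 i j
  refine ⟨2 ^ (∑ i, negPart k i) * (∏ i, ∏ j, v i j) *
    ∏ _j : Fin m, (2 ^ (negPart k 0 + negPart k 3) * (1 / 2) ^ (negPart k 1 + negPart k 2)),
    ?_, fun x => ?_⟩
  · refine mul_ne_zero (mul_ne_zero (pow_ne_zero _ two_ne_zero) ?_) ?_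
    · exact Finset.prod_ne_zero_iff.2 fun i _ => Finset.prod_ne_zero_iff.2 fun j _ => hv i j
    · exact Finset.prod_ne_zero_iff.2 fun i _ =>
        mul_ne_zero (pow_ne_zero _ two_ne_zero) (pow_ne_zero _ (by norm_num))
  · have h3 := HasOrder.prod Finset.univ fun j (_ : j ∈ (Finset.univ : Finset (Fin m))) =>
      HasOrder.prod Finset.univ fun i (_ : i ∈ Finset.univ) =>
        (hasOrder_G_point (x j) i).pow (negPart k i)
    have h := ((HasOrder.const (2 ^ (∑ i, negPart k i))).mul h2).mul h3
    unfold tnkDenom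
    convert h using 1
    · have h0 := negPart_mul_posPart k 0
      have h1' := negPart_mul_posPart k 1
      have h2' := negPart_mul_posPart k 2
      have h3' := negPart_mul_posPart k 3
      zify at h0 h1' h2' h3'
      simp only [denomOrder, Fin.sum_univ_four, orderG, Matrix.cons_val, Finset.sum_const,
        Finset.card_univ, Fintype.card_fin, nsmul_eq_mul]
      push_cast
      linear_combination 2 * h1' + 2 * h2'
    · rw [mul_assoc (2 ^ (∑ i, negPart k i) * ∏ i, ∏ j, v i j), ← Finset.prod_mul_distrib]
      congr 1
      refine Finset.prod_congr rfl fun j _ => ?_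
      simp only [Fin.prod_univ_four, Matrix.cons_val]
      rw [mul_pow (1 / 2) ((1 - 2 * x j) ^ 2), ← pow_mul (1 - 2 * x j)]
      ring

/-- The numerator `T(x, ξ^c; ξ^d)`. -/
def tnkNum (N : ℕ) (c d : Fin 4 → ℕ) {m : ℕ} (ζ : ℂ) (x : Fin m → ℂ) : ℂ :=
  MvPolynomial.eval (fun i : Fin (2 * N) => (List.ofFn x ++ xiList ζ c ++ xiList ζ d).getD (i : ℕ) 0)
    (polyT N (m + ∑ i, c i) ζ)

lemma HasOrder.eventually_ne {f : ℂ → ℂ} {e : ℤ} {l : ℂ} (h : HasOrder f e l) (hl : l ≠ 0) :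
    ∀ᶠ ζ in 𝓝[≠] 0, f ζ ≠ 0 := by
  filter_upwards [Tendsto.eventually_ne h hl] with ζ hζ h0
  exact hζ (by rw [h0, zero_div])

lemma HasOrder.crossProd {p q : ℕ} {x : ℂ → Fin p → ℂ} {y : ℂ → Fin q → ℂ} {x₀ : Fin p → ℂ} {v : ℂ}
    (hx : ∀ i, HasOrder (fun ζ => x ζ i) 0 (x₀ i)) (hy : ∀ j, HasOrder (fun ζ => y ζ j) 0 v) :
    HasOrder (fun ζ => crossProd (x ζ) (y ζ)) 0 (∏ i, (v - x₀ i) ^ q) := by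
  have h0 : ∀ i j, HasOrder (fun ζ => y ζ j - x ζ i) 0 (v - x₀ i) := fun i j => by
    have h1 := (HasOrder.const (-1)).mul (hx i)
    rw [zero_add] at h1
    have h2 := (hy j).add h1
    simpa only [neg_one_mul, ← sub_eq_add_neg] using h2
  have h1 : ∀ i, HasOrder (fun ζ => ∏ j, (y ζ j - x ζ i)) 0 ((v - x₀ i) ^ q) := fun i => by
    simpa using HasOrder.prod Finset.univ fun j _ => h0 i j
  have h2 := HasOrder.prod Finset.univ fun i _ => h1 i
  rw [Finset.sum_const_zero] at h2
  exact h2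

/-- The exponent of `ζ` in the Vandermonde determinants of the repeated variables. -/
def vandermondeOrder (c d : Fin 4 → ℕ) : ℕ :=
  (c 0 + c 3).choose 2 + 2 * (c 1 + c 2).choose 2 + (d 0 + d 3).choose 2 +
    2 * (d 1 + d 2).choose 2

/-- From the determinant of residues to `T`: one divides by the Vandermonde determinants within and
between the clusters. The transition matrix `U ζ` accounts for the gluing of columns. -/
theorem exists_hasOrder_tnkNum {m N : ℕ} {c d : Fin 4 → ℕ}
    (hN : m + ∑ i, c i + ∑ i, d i = 2 * N) {f g : ℂ → Fin (2 * N) → Polynomial ℂ}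
    {U : ℂ → Matrix (Fin (2 * N)) (Fin (2 * N)) ℂ} {u : ℂ} (hu : u ≠ 0) (hU : ∀ ζ, (U ζ).det = u)
    (hf : ∀ ζ j, f ζ j = ∑ j', U ζ j' j • basisPoly N ζ j')
    (hg : ∀ ζ j, g ζ j = ∑ j', U ζ j' j • sigmaBasisPoly N ζ j') {E : ℤ} {φ : Fin m → ℂ → ℂ}
    (h : DetAsymptotics (c 0) (c 1) (c 2) (c 3) (d 0) (d 1) (d 2) (d 3) f g (rowEquiv hN) E φ) :
    ∃ C : ℂ, C ≠ 0 ∧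
      (∀ x : Fin m → ℂ, Function.Injective x → (∀ i, x i ≠ 0 ∧ x i ≠ 1) →
        HasOrder (fun ζ => tnkNum N c d ζ x) (E - vandermondeOrder c d)
          (C * ((Matrix.of fun i j => φ j (x i)).det / ((Matrix.vandermonde x).det *
            ∏ i, ((1 - x i) ^ (c 0 + c 3) * x i ^ (c 1 + c 2)))))) ∧
      ∃ x : Fin m → ℂ, Function.Injective x ∧ (∀ i, x i ≠ 0 ∧ x i ≠ 1 ∧ x i ≠ 1 / 2) ∧
        (Matrix.of fun i j => φ j (x i)).det ≠ 0 := by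
  obtain ⟨ε, hε, hT⟩ := exists_polyT_eval_eq_det N (m + ∑ i, c i) (rowEquiv hN)
    (fun t => rowPos_lt_iff t)
  obtain ⟨C, hC, h1, x₀, hx₀, hx₀'⟩ := h
  refine ⟨C / (ε * u * ((1 / 2) ^ ((c 1 + c 2).choose 2) * (1 / 2) ^ ((d 1 + d 2).choose 2)) *
    ((-1) ^ (m * (c 1 + c 2)) * (-1) ^ ((c 1 + c 2) * (c 0 + c 3)) *
      (-1) ^ ((d 1 + d 2) * (d 0 + d 3)))), ?_, fun x hx hx' => ?_, x₀, ?_, hx₀, hx₀'⟩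
  · refine div_ne_zero hC (mul_ne_zero (mul_ne_zero (mul_ne_zero hε hu) ?_) ?_)
    · exact mul_ne_zero (pow_ne_zero _ (by norm_num)) (pow_ne_zero _ (by norm_num))
    · exact mul_ne_zero (mul_ne_zero (pow_ne_zero _ (by norm_num)) (pow_ne_zero _ (by norm_num)))
        (pow_ne_zero _ (by norm_num))
  · have hV : (Matrix.vandermonde x).det ≠ 0 := Matrix.det_vandermonde_ne_zero_iff.2 hx
    have hl : HasOrder (fun ζ : ℂ => ζ ^ 2 / (ζ + 2)) 2 (1 / 2) := by
      have := HasOrder.of_eventually_pow_mul (f := fun ζ : ℂ => ζ ^ 2 / (ζ + 2)) 2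
        (h := fun ζ => 1 / (ζ + 2)) (by fun_prop (disch := simp)) (.of_forall fun ζ => by ring)
      simpa using this
    have hz : HasOrder (fun ζ : ℂ => ζ) 1 1 := by simpa using HasOrder.zpow_self 1
    have hp : ∀ v : ℂ, HasOrder (fun ζ => 1 + ζ * v) 0 1 := fun v => by
      simpa using HasOrder.of_continuousAt (f := fun ζ : ℂ => 1 + ζ * v) (by fun_prop)
    have hq : ∀ v : ℂ, HasOrder (fun ζ => ζ / (ζ + 2) + ζ ^ 2 / (ζ + 2) * v) 0 0 := fun v => by
      have h2 : (0 : ℂ) + 2 ≠ 0 := by norm_num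
      have h := HasOrder.of_continuousAt (f := fun ζ : ℂ => ζ / (ζ + 2) + ζ ^ 2 / (ζ + 2) * v)
        (by fun_prop (disch := simp))
      convert h using 1
      simp
    have hden := ((HasOrder.const (ε * u)).mul ((((HasOrder.const (Matrix.vandermonde x).det).mul
      (hz.pow ((c 0 + c 3).choose 2))).mul (hl.pow ((c 1 + c 2).choose 2))).mul
      (hz.pow ((d 0 + d 3).choose 2)) |>.mul (hl.pow ((d 1 + d 2).choose 2)))).mul
      ((((HasOrder.crossProd (fun i => .const (x i)) (fun j => hp (twoPoints (c 0) (c 3) 2 0 j))).mul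
        (HasOrder.crossProd (fun i => .const (x i)) (fun j => hq (twoPoints (c 1) (c 2) 0 2 j)))).mul
        (HasOrder.crossProd (fun j => hp (twoPoints (c 0) (c 3) 2 0 j))
          (fun j => hq (twoPoints (c 1) (c 2) 0 2 j)))).mul
        (HasOrder.crossProd (fun j => hp (twoPoints (d 0) (d 3) 2 0 j))
          (fun j => hq (twoPoints (d 1) (d 2) 0 2 j))))
    have hne : ∀ n : ℕ, (-1 : ℂ) ^ n ≠ 0 := fun n => pow_ne_zero _ (by norm_num)
    have hne2 : ∀ n : ℕ, (1 / 2 : ℂ) ^ n ≠ 0 := fun n => pow_ne_zero _ (by norm_num)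
    have h01 : (0 : ℂ) - 1 ≠ 0 := by norm_num
    obtain ⟨l, hl, hden, hden0⟩ : ∃ l : ℂ, l = _ ∧ HasOrder _ _ l ∧ l ≠ 0 := by
      refine ⟨_, rfl, hden, ?_⟩
      refine mul_ne_zero (mul_ne_zero (mul_ne_zero hε hu)
        (mul_ne_zero (mul_ne_zero (mul_ne_zero (mul_ne_zero hV (pow_ne_zero _ one_ne_zero))
        (hne2 _)) (pow_ne_zero _ one_ne_zero)) (hne2 _)))
        (mul_ne_zero (mul_ne_zero (mul_ne_zero ?_ ?_) ?_) ?_)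
      · exact Finset.prod_ne_zero_iff.2 fun i _ => pow_ne_zero _ (sub_ne_zero.2 (hx' i).2.symm)
      · exact Finset.prod_ne_zero_iff.2 fun i _ => pow_ne_zero _ (sub_ne_zero.2 (hx' i).1.symm)
      all_goals exact Finset.prod_ne_zero_iff.2 fun i _ => pow_ne_zero _ h01
    have hdiv := (h1 x hx').div hden hden0
    have hsign : ∏ i, (0 - x i) ^ (c 1 + c 2) =
        (-1) ^ (m * (c 1 + c 2)) * ∏ i, x i ^ (c 1 + c 2) := by
      have : ∀ i, (0 - x i) ^ (c 1 + c 2) = (-1) ^ (c 1 + c 2) * x i ^ (c 1 + c 2) := fun i => by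
        rw [← mul_pow]; congr 1; ring
      simp only [this, Finset.prod_mul_distrib, Finset.prod_const, Finset.card_univ,
        Fintype.card_fin]
      rw [← pow_mul, mul_comm m]
    convert (hdiv.congr' (g := fun ζ => tnkNum N c d ζ x) ?_) using 1
    · simp only [vandermondeOrder]
      push_cast
      ring
    · rw [hl, hsign, Finset.prod_mul_distrib (f := fun i => (1 - x i) ^ (c 0 + c 3))]
      simp only [one_pow, mul_one, zero_sub, Finset.prod_const, Finset.card_univ,
        Fintype.card_fin, ← pow_mul]
      rw [div_mul_div_comm]
      congr 1
      ring
    · filter_upwards [hden.eventually_ne hden0] with ζ hζ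
      rw [div_eq_iff hζ]
      have h2 := hT ζ (U ζ) (f ζ) (g ζ) (hf ζ) (hg ζ) 1 ζ (ζ / (ζ + 2)) (ζ ^ 2 / (ζ + 2)) x
        (twoPoints (c 0) (c 3) 2 0) (twoPoints (c 1) (c 2) 0 2) (twoPoints (d 0) (d 3) 2 0)
        (twoPoints (d 1) (d 2) 0 2)
      rw [cuspMatrix, ← h2, hU, tnkNum]
      simp only [getD_rowEquiv hN]
      ring
  · intro i j hij
    by_contra hne
    exact hx₀' (Matrix.det_zero_of_row_eq hne (by funext l; simp [hij]))

/-! ### Extension to the special points -/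

lemma totalDegree_aeval_X_le {σ : Type*} (i : σ) (p : Polynomial ℂ) :
    (Polynomial.aeval (MvPolynomial.X i : MvPolynomial σ ℂ) p).totalDegree ≤ p.natDegree := by
  rw [Polynomial.aeval_eq_sum_range]
  refine MvPolynomial.totalDegree_finsetSum_le fun e he => ?_
  refine (MvPolynomial.totalDegree_smul_le _ _).trans ?_
  rw [MvPolynomial.totalDegree_X_pow]
  exact Nat.lt_succ_iff.1 (Finset.mem_range.1 he)

/-- The degree of `T` is bounded uniformly in `ζ`. -/
lemma exists_totalDegree_polyT_le (N K : ℕ) : ∃ B, ∀ ζ, (polyT N K ζ).totalDegree ≤ B := by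
  have h : ∀ j : Fin (2 * N), ∃ D, ∀ ζ (i : Fin (2 * N)), (Polynomial.aeval (MvPolynomial.X i)
      (if (i : ℕ) < K then basisPoly N ζ j else sigmaBasisPoly N ζ j) :
        MvPolynomial (Fin (2 * N)) ℂ).totalDegree ≤ D := by
    intro j
    obtain ⟨D₁, h₁⟩ := (polyTendsto_basisPoly N j).1
    obtain ⟨D₂, h₂⟩ := (polyTendsto_sigmaBasisPoly N j).1
    refine ⟨max D₁ D₂, fun ζ i => (totalDegree_aeval_X_le i _).trans ?_⟩
    split_ifs
    · exact (h₁ ζ).trans (le_max_left _ _)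
    · exact (h₂ ζ).trans (le_max_right _ _)
  choose D hD using h
  refine ⟨∑ j, D j, fun ζ => ?_⟩
  have hdet : (alternantMatrix N K ζ).det.totalDegree ≤ ∑ j, D j := by
    rw [Matrix.det_apply]
    refine MvPolynomial.totalDegree_finsetSum_le fun s _ => ?_
    rw [Units.smul_def, ← Int.cast_smul_eq_zsmul ℂ]
    refine (MvPolynomial.totalDegree_smul_le _ _).trans ?_
    refine (MvPolynomial.totalDegree_finsetProd _ _).trans (Finset.sum_le_sum fun j _ => ?_)
    exact hD j ζ (s j)
  rw [← groupDelta_mul_polyT] at hdet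
  rcases eq_or_ne (polyT N K ζ) 0 with h0 | h0
  · rw [h0, MvPolynomial.totalDegree_zero]
    exact Nat.zero_le _
  · have h1 : groupDelta N K ≠ 0 := by
      refine Finset.prod_ne_zero_iff.2 fun q hq => (prime_X_sub_X ?_).ne_zero
      simp only [groupPairs, Finset.mem_filter, Finset.mem_univ, true_and] at hq
      exact hq.1.ne
    rw [MvPolynomial.totalDegree_mul_of_isDomain h1 h0] at hdet
    omega

lemma eval_eq_sum_basis {p : Polynomial ℂ} {s : Finset ℂ} (hp : p.natDegree < s.card) (t : ℂ) :
    p.eval t = ∑ i ∈ s, p.eval i * (Lagrange.basis s id i).eval t := by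
  have h1 : p.degree < s.card := lt_of_le_of_lt Polynomial.degree_le_natDegree (by exact_mod_cast hp)
  conv_lhs => rw [Lagrange.eq_interpolate (v := id) (s := s) Function.injective_id.injOn h1]
  rw [Lagrange.interpolate_apply, Polynomial.eval_finsetSum]
  refine Finset.sum_congr rfl fun i _ => ?_
  rw [Polynomial.eval_mul, Polynomial.eval_C, id]

/-- The line through `x` on which almost all points have distinct coordinates. -/
def shift {m : ℕ} (x : Fin m → ℂ) (t : ℂ) (j : Fin m) : ℂ := x j + t * ((j : ℕ) + 1)

lemma shift_zero {m : ℕ} (x : Fin m → ℂ) : shift x 0 = x := by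
  funext j
  rw [shift, zero_mul, add_zero]

/-- On the line `t ↦ shift x t` the numerator is a polynomial in `t` of degree bounded uniformly in
`ζ`. -/
lemma exists_interpolation {m N : ℕ} {c d : Fin 4 → ℕ} (hN : m + ∑ i, c i + ∑ i, d i = 2 * N) :
    ∃ B : ℕ, ∀ (x : Fin m → ℂ) (s : Finset ℂ), B < s.card → ∀ ζ t,
      tnkNum N c d ζ (shift x t) =
        ∑ i ∈ s, tnkNum N c d ζ (shift x i) * (Lagrange.basis s id i).eval t := by
  obtain ⟨B, hB⟩ := exists_totalDegree_polyT_le N (m + ∑ i, c i)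
  refine ⟨B, fun x s hs ζ t => ?_⟩
  set q : Polynomial ℂ := MvPolynomial.aeval (fun i : Fin (2 * N) =>
    Polynomial.C ((List.ofFn x ++ xiList ζ c ++ xiList ζ d).getD (i : ℕ) 0) +
    Polynomial.C (rowFun (fun j : Fin m => ((j : ℕ) + 1 : ℂ)) (fun _ => 0) (fun _ => 0) (fun _ => 0)
      (fun _ => 0) ((rowEquiv hN).symm i)) * Polynomial.X) (polyT N (m + ∑ i, c i) ζ) with hq
  have hdeg : q.natDegree ≤ B * 1 := by
    refine MvPolynomial.aeval_natDegree_le _ (hB ζ) _ fun i => ?_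
    refine (Polynomial.natDegree_add_le _ _).trans (max_le (by simp) ?_)
    exact (Polynomial.natDegree_C_mul_le _ _).trans Polynomial.natDegree_X_le
  have hev : ∀ t, q.eval t = tnkNum N c d ζ (shift x t) := by
    intro t
    rw [hq, tnkNum, ← Polynomial.coe_evalRingHom, MvPolynomial.aeval_def,
      MvPolynomial.hom_eval₂, MvPolynomial.eval, MvPolynomial.coe_eval₂Hom]
    congr 1
    · ext a; simp
    · funext i
      rw [getD_rowEquiv hN, getD_rowEquiv hN]
      rcases (rowEquiv hN).symm i with j | (j | j) | j | j <;> simp [rowFun, shift]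
      ring
  simp only [← hev]
  exact eval_eq_sum_basis (by omega) t

lemma eventually_add_mul_ne {a b c : ℂ} (hb : b ≠ 0) : ∀ᶠ t : ℂ in 𝓝[≠] 0, a + t * b ≠ c := by
  by_cases h : a = c
  · filter_upwards [self_mem_nhdsWithin] with t ht h1
    rw [h, add_eq_left, mul_eq_zero] at h1
    exact h1.elim ht hb
  · have : ContinuousAt (fun t : ℂ => a + t * b) 0 := by fun_prop
    exact nhdsWithin_le_nhds (this.eventually_ne (by simpa using h))

lemma eventually_shift {m : ℕ} (x : Fin m → ℂ) : ∀ᶠ t : ℂ in 𝓝[≠] 0,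
    Function.Injective (shift x t) ∧
      ∀ j, shift x t j ≠ 0 ∧ shift x t j ≠ 1 ∧ shift x t j ≠ 1 / 2 := by
  have h1 : ∀ i j : Fin m, ∀ᶠ t : ℂ in 𝓝[≠] 0, i ≠ j → shift x t i ≠ shift x t j := by
    intro i j
    by_cases hij : i = j
    · exact .of_forall fun t h => absurd hij h
    · have hne : ((i : ℕ) : ℂ) - (j : ℕ) ≠ 0 := by
        rw [sub_ne_zero]
        exact fun h => hij (Fin.ext (Nat.cast_injective h))
      filter_upwards [eventually_add_mul_ne (a := x i) (c := x j) hne] with t ht _ h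
      refine ht ?_
      simp only [shift] at h
      linear_combination h
  have h2 : ∀ c : ℂ, ∀ j : Fin m, ∀ᶠ t : ℂ in 𝓝[≠] 0, shift x t j ≠ c := fun c j =>
    eventually_add_mul_ne (by exact_mod_cast Nat.succ_ne_zero j)
  filter_upwards [eventually_all.2 fun i => eventually_all.2 fun j => h1 i j,
    eventually_all.2 (h2 0), eventually_all.2 (h2 1), eventually_all.2 (h2 (1 / 2))]
    with t ha hb hc hd
  exact ⟨fun i j h => by_contra fun hij => ha i j hij h, fun j => ⟨hb j, hc j, hd j⟩⟩

lemma exists_finset_of_eventually {p : ℂ → Prop} (h : ∀ᶠ t in 𝓝[≠] 0, p t) (n : ℕ) :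
    ∃ s : Finset ℂ, s.card = n ∧ ∀ t ∈ s, p t := by
  have h1 : {t | t ∈ ({0} : Set ℂ)ᶜ → p t} ∈ 𝓝 (0 : ℂ) := eventually_nhdsWithin_iff.1 h
  have h2 := (infinite_of_mem_nhds 0 h1).sdiff (Set.finite_singleton 0)
  obtain ⟨s, hs, hn⟩ := h2.exists_subset_card_eq n
  exact ⟨s, hn, fun t ht => (hs ht).1 (hs ht).2⟩

/-- Interpolation in a generic direction gives the limit at all points from the limit at generic
points. -/
theorem exists_tnkNum_limit {m N : ℕ} {c d : Fin 4 → ℕ} (hN : m + ∑ i, c i + ∑ i, d i = 2 * N)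
    {E : ℤ} {A : (Fin m → ℂ) → ℂ} (h : ∀ x : Fin m → ℂ, Function.Injective x →
      (∀ i, x i ≠ 0 ∧ x i ≠ 1) → HasOrder (fun ζ => tnkNum N c d ζ x) E (A x)) :
    ∃ A' : (Fin m → ℂ) → ℂ, (∀ x, HasOrder (fun ζ => tnkNum N c d ζ x) E (A' x)) ∧
      ∀ x, Continuous fun t => A' (shift x t) := by
  obtain ⟨B, hB⟩ := exists_interpolation hN
  have hs : ∀ x : Fin m → ℂ, ∃ s : Finset ℂ, s.card = B + 1 ∧ ∀ t ∈ s,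
      Function.Injective (shift x t) ∧ ∀ j, shift x t j ≠ 0 ∧ shift x t j ≠ 1 ∧
        shift x t j ≠ 1 / 2 := fun x => exists_finset_of_eventually (eventually_shift x) _
  choose s hs hs' using hs
  have hlim : ∀ x t, HasOrder (fun ζ => tnkNum N c d ζ (shift x t)) E
      (∑ i ∈ s x, A (shift x i) * (Lagrange.basis (s x) id i).eval t) := by
    intro x t
    have h1 : ∀ i ∈ s x, Tendsto (fun ζ => tnkNum N c d ζ (shift x i) *
        (Lagrange.basis (s x) id i).eval t / ζ ^ E) (𝓝[≠] 0)
        (𝓝 (A (shift x i) * (Lagrange.basis (s x) id i).eval t)) := by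
      intro i hi
      obtain ⟨h2, h3⟩ := hs' x i hi
      have h4 : Tendsto _ _ _ := h _ h2 fun j => ⟨(h3 j).1, (h3 j).2.1⟩
      refine (h4.mul_const _).congr fun ζ => ?_
      ring
    refine (tendsto_finsetSum _ h1).congr fun ζ => ?_
    change _ = tnkNum N c d ζ (shift x t) / ζ ^ E
    rw [hB x (s x) (by rw [hs]; omega) ζ t, Finset.sum_div]
  have hlim' : ∀ x, HasOrder (fun ζ => tnkNum N c d ζ x) E
      (∑ i ∈ s x, A (shift x i) * (Lagrange.basis (s x) id i).eval 0) := fun x => by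
    have := hlim x 0
    rwa [shift_zero] at this
  refine ⟨_, hlim', fun x => ?_⟩
  have h1 := fun t => tendsto_nhds_unique (hlim' (shift x t)) (hlim x t)
  simp only [h1]
  exact continuous_finsetSum _ fun i _ => continuous_const.mul (Polynomial.continuous _)

/-! ### The leading coefficient of `T_n^{(k)}` -/

lemma tnk_eq {n : ℤ} {k : Fin 4 → ℤ} {m N : ℕ} (hN : (N : ℤ) = n + ∑ i, (negPart k i : ℤ)) (ζ : ℂ)
    (x : Fin m → ℂ) : tnk n k ζ x = (-1) ^ (Nat.choose (∑ i, negPart k i) 2) *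
      tnkNum N (posPart k) (negPart k) ζ x / tnkDenom k ζ x := by
  obtain rfl : N = (n + ∑ i, (negPart k i : ℤ)).toNat := by omega
  rfl

/-- The factor of the limit of the denominator that depends on `x`. -/
def poleFactor (k : Fin 4 → ℤ) {m : ℕ} (x : Fin m → ℂ) : ℂ :=
  ∏ j, (x j ^ (2 * (negPart k 0 + negPart k 3)) * (1 - 2 * x j) ^ (2 * negPart k 2))

lemma poleFactor_ne_zero {k : Fin 4 → ℤ} {m : ℕ} {x : Fin m → ℂ} (hx : x ∈ regularPoints k m) :
    poleFactor k x ≠ 0 := by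
  refine Finset.prod_ne_zero_iff.2 fun j _ => mul_ne_zero ?_ ?_
  · by_cases h : k 0 < 0 ∨ k 3 < 0
    · exact pow_ne_zero _ ((hx j).1 h)
    · have : negPart k 0 + negPart k 3 = 0 := by unfold negPart; omega
      rw [this, mul_zero, pow_zero]
      exact one_ne_zero
  · by_cases h : k 2 < 0
    · refine pow_ne_zero _ fun h0 => (hx j).2 h ?_
      linear_combination -h0 / 2
    · have : negPart k 2 = 0 := by unfold negPart; omega
      rw [this, mul_zero, pow_zero]
      exact one_ne_zero

lemma continuous_poleFactor_shift (k : Fin 4 → ℤ) {m : ℕ} (x : Fin m → ℂ) :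
    Continuous fun t => poleFactor k (shift x t) := by
  unfold poleFactor shift
  fun_prop

/-- From the asymptotics of the determinant to those of `T_n^{(k)}`, at all regular points. -/
theorem exists_leadingCoeff {n : ℤ} {k : Fin 4 → ℤ} {m N : ℕ}
    (hN : m + ∑ i, posPart k i + ∑ i, negPart k i = 2 * N)
    (hN' : (N : ℤ) = n + ∑ i, (negPart k i : ℤ)) {f g : ℂ → Fin (2 * N) → Polynomial ℂ}
    {U : ℂ → Matrix (Fin (2 * N)) (Fin (2 * N)) ℂ} {u : ℂ} (hu : u ≠ 0) (hU : ∀ ζ, (U ζ).det = u)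
    (hf : ∀ ζ j, f ζ j = ∑ j', U ζ j' j • basisPoly N ζ j')
    (hg : ∀ ζ j, g ζ j = ∑ j', U ζ j' j • sigmaBasisPoly N ζ j') {E L : ℤ} {φ : Fin m → ℂ → ℂ}
    (h : DetAsymptotics (posPart k 0) (posPart k 1) (posPart k 2) (posPart k 3) (negPart k 0)
      (negPart k 1) (negPart k 2) (negPart k 3) f g (rowEquiv hN) E φ)
    (hL : E - vandermondeOrder (posPart k) (negPart k) - denomOrder m (posPart k) (negPart k) = L)
    {F : (Fin m → ℂ) → ℂ} {c : ℂ} (hc : c ≠ 0)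
    (hF : ∀ x ∈ regularPoints k m, Function.Injective x → (∀ j, x j ≠ 0 ∧ x j ≠ 1) →
      (Matrix.of fun i j => φ j (x i)).det / ((Matrix.vandermonde x).det *
        ∏ i, ((1 - x i) ^ (posPart k 0 + posPart k 3) * x i ^ (posPart k 1 + posPart k 2))) /
          poleFactor k x = c * F x) :
    ∃ C : (Fin m → ℂ) → ℂ,
      (∀ x ∈ regularPoints k m, HasOrder (fun ζ => tnk n k ζ x) L (C x)) ∧
      (∃ x ∈ regularPoints k m, C x ≠ 0) ∧
      ∃ c : ℂ, c ≠ 0 ∧ (∀ x ∈ regularPoints k m, Function.Injective x →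
          (∀ j, x j ≠ 0 ∧ x j ≠ 1) → C x = c * F x) ∧
        ((∀ x ∈ regularPoints k m, ContinuousAt (fun t => F (shift x t)) 0) →
          ∀ x ∈ regularPoints k m, C x = c * F x) := by
  obtain ⟨c₁, hc₁, h1, x₀, hx₀, hx₀', hdet⟩ := exists_hasOrder_tnkNum hN hu hU hf hg h
  obtain ⟨A, hA, hAc⟩ := exists_tnkNum_limit hN h1
  obtain ⟨v, hv, hden⟩ := exists_hasOrder_tnkDenom k m
  set σ : ℂ := (-1) ^ (Nat.choose (∑ i, negPart k i) 2) with hσ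
  have hσ0 : σ ≠ 0 := pow_ne_zero _ (by norm_num)
  have hreg : x₀ ∈ regularPoints k m :=
    fun j => ⟨fun _ => (hx₀' j).1, fun _ => (hx₀' j).2.2⟩
  have hformula : ∀ x ∈ regularPoints k m, Function.Injective x →
      (∀ j, x j ≠ 0 ∧ x j ≠ 1) → σ * A x / (v * poleFactor k x) = σ * c₁ * c / v * F x := by
    intro x hx hxi hx01
    rw [tendsto_nhds_unique (hA x) (h1 x hxi hx01)]
    have := hF x hx hxi hx01
    rw [show σ * c₁ * c / v * F x = σ * c₁ / v * (c * F x) by ring, ← this]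
    ring
  refine ⟨fun x => σ * A x / (v * poleFactor k x), fun x hx => ?_, ⟨x₀, hreg, ?_⟩,
    σ * c₁ * c / v, div_ne_zero (mul_ne_zero (mul_ne_zero hσ0 hc₁) hc) hv, hformula,
    fun hcont x hx => ?_⟩
  · have h2 := ((HasOrder.const σ).mul (hA x)).div (hden x) (mul_ne_zero hv (poleFactor_ne_zero hx))
    rw [zero_add, hL] at h2
    exact h2.congr' (.of_forall fun ζ => (tnk_eq hN' ζ x).symm)
  · refine div_ne_zero (mul_ne_zero hσ0 ?_) (mul_ne_zero hv (poleFactor_ne_zero hreg))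
    rw [tendsto_nhds_unique (hA x₀) (h1 x₀ hx₀ fun j => ⟨(hx₀' j).1, (hx₀' j).2.1⟩)]
    refine mul_ne_zero hc₁ (div_ne_zero hdet (mul_ne_zero
      (Matrix.det_vandermonde_ne_zero_iff.2 hx₀) (Finset.prod_ne_zero_iff.2 fun i _ =>
        mul_ne_zero (pow_ne_zero _ (sub_ne_zero.2 (hx₀' i).2.1.symm)) (pow_ne_zero _ (hx₀' i).1))))
  · -- Both sides are continuous along the generic line through `x`.
    have hl : ContinuousAt (fun t => σ * A (shift x t) / (v * poleFactor k (shift x t))) 0 := by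
      refine ((continuous_const.mul (hAc x)).continuousAt).div
        ((continuous_const.mul (continuous_poleFactor_shift k x)).continuousAt) ?_
      rw [shift_zero]
      exact mul_ne_zero hv (poleFactor_ne_zero hx)
    have hr : ContinuousAt (fun t => σ * c₁ * c / v * F (shift x t)) 0 :=
      continuousAt_const.mul (hcont x hx)
    have h2 := hl.tendsto.mono_left (nhdsWithin_le_nhds (s := {0}ᶜ))
    have h3 := hr.tendsto.mono_left (nhdsWithin_le_nhds (s := {0}ᶜ))
    rw [shift_zero] at h2 h3
    refine tendsto_nhds_unique h2 (h3.congr' ?_)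
    filter_upwards [eventually_shift x] with t ht
    exact (hformula _ (fun j => ⟨fun _ => (ht.2 j).1, fun _ => (ht.2 j).2.2⟩) ht.1
      fun j => ⟨(ht.2 j).1, (ht.2 j).2.1⟩).symm

/-! ### The leading coefficient in regime A -/

lemma two_mul_choose_two (n : ℕ) : (2 * n.choose 2 : ℤ) = n * (n - 1) := by
  induction n with
  | zero => simp
  | succ n ih =>
    rw [Nat.choose_succ_succ' n 1, Nat.choose_one_right]
    push_cast
    linear_combination ih

lemma sum_range_eq_choose_two (n : ℕ) : ∑ l ∈ Finset.range n, (l : ℤ) = n.choose 2 := by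
  induction n with
  | zero => simp
  | succ n ih =>
    rw [Finset.sum_range_succ, ih, Nat.choose_succ_succ' n 1, Nat.choose_one_right]
    push_cast
    ring

lemma eq_posPart_sub_negPart (k : Fin 4 → ℤ) (i : Fin 4) : k i = posPart k i - negPart k i := by
  unfold posPart negPart
  omega

lemma exists_card {n : ℤ} {k : Fin 4 → ℤ} {m : ℕ} (hm : (m : ℤ) = 2 * n - ∑ i, k i) :
    ∃ N : ℕ, m + ∑ i, posPart k i + ∑ i, negPart k i = 2 * N ∧
      (N : ℤ) = n + ∑ i, (negPart k i : ℤ) := by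
  have h : ∑ i, k i = ∑ i, (posPart k i : ℤ) - ∑ i, (negPart k i : ℤ) := by
    rw [← Finset.sum_sub_distrib]
    exact Finset.sum_congr rfl fun i _ => eq_posPart_sub_negPart k i
  have h1 : 0 ≤ ∑ i, (posPart k i : ℤ) := Finset.sum_nonneg fun i _ => Int.natCast_nonneg _
  have h2 : 0 ≤ ∑ i, (negPart k i : ℤ) := Finset.sum_nonneg fun i _ => Int.natCast_nonneg _
  refine ⟨(n + ∑ i, (negPart k i : ℤ)).toNat, ?_, by omega⟩
  zify
  omega

lemma prod_quotient {m : ℕ} {p q r w : Fin m → ℂ} {K : ℂ} (S V : ℂ)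
    (h : ∀ i, p i / q i / r i = K * w i) :
    (∏ i, p i) * S / (V * ∏ i, q i) / ∏ i, r i = K ^ m * (1 / V * (∏ i, w i) * S) := by
  have h1 : (∏ i, p i) / (∏ i, q i) / ∏ i, r i = K ^ m * ∏ i, w i := by
    rw [← Finset.prod_div_distrib, ← Finset.prod_div_distrib, Finset.prod_congr rfl fun i _ => h i,
      Finset.prod_mul_distrib, Finset.prod_const, Finset.card_univ, Fintype.card_fin]
  rw [show K ^ m * (1 / V * (∏ i, w i) * S) = K ^ m * (∏ i, w i) * (S / V) by ring, ← h1]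
  ring

lemma zpow_eq_div {x : ℂ} (hx : x ≠ 0) {z : ℤ} {p q : ℕ} (h : z = p - q) : x ^ z = x ^ p / x ^ q := by
  rw [h, zpow_sub₀ hx, zpow_natCast, zpow_natCast]

section RegimeA

variable {n : ℤ} {k : Fin 4 → ℤ} {m N : ℕ}

/-- The sum of the row weights, less the orders of the Vandermonde factors and of the denominator, is
the exponent `L` in regime A. -/
lemma exponent_regimeA (hN : m + ∑ i, posPart k i + ∑ i, negPart k i = 2 * N)
    (hN' : (N : ℤ) = n + ∑ i, (negPart k i : ℤ)) (hA : RegimeA k m) :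
    (∑ l ∈ Finset.range (posPart k 0 + posPart k 3), (l : ℤ)) +
        (posPart k 1 + posPart k 2) * (2 * N - 2) +
        (∑ l ∈ Finset.range (negPart k 0 + negPart k 3), (l : ℤ)) +
        (negPart k 1 + negPart k 2) * (2 * N) - vandermondeOrder (posPart k) (negPart k) -
        denomOrder m (posPart k) (negPart k) = leadingExponent n k m := by
  rw [leadingExponent_of_regimeA hA, sum_range_eq_choose_two, sum_range_eq_choose_two,
    eq_posPart_sub_negPart k 1, eq_posPart_sub_negPart k 2]
  zify at hN
  rw [Fin.sum_univ_four, Fin.sum_univ_four] at hN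
  rw [Fin.sum_univ_four] at hN'
  have h1 := two_mul_choose_two (posPart k 1 + posPart k 2)
  have h2 := two_mul_choose_two (negPart k 1 + negPart k 2)
  simp only [vandermondeOrder, denomOrder]
  push_cast at h1 h2 ⊢
  obtain rfl : n = N - (negPart k 0 + negPart k 1 + negPart k 2 + negPart k 3) := by
    linear_combination -hN'
  linear_combination -h1 - h2 - 2 * (negPart k 1 + negPart k 2 : ℤ) * hN

/-- The common form of the two cases of regime A, which differ in the sign of `k_0 + k_3 + 1`. -/
theorem exists_leadingCoeff_regimeA {e₀ q M : ℕ} {θ : ℕ → ℂ}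
    (hN : m + ∑ i, posPart k i + ∑ i, negPart k i = 2 * N)
    (hN' : (N : ℤ) = n + ∑ i, (negPart k i : ℤ)) (hA : RegimeA k m) (hM : N = M + e₀)
    (hc : posPart k 1 + posPart k 2 ≤ M) (hd : negPart k 1 + negPart k 2 ≤ M + 1)
    (hcard : 2 * M + 1 = q + m + (posPart k 1 + posPart k 2) + (negPart k 1 + negPart k 2))
    (hθ : (e₀ = negPart k 0 + negPart k 3 ∧
        posPart k 0 + posPart k 3 + 1 = negPart k 0 + negPart k 3 + q ∧ θ = fun _ => 1) ∨
      (e₀ = posPart k 0 + posPart k 3 + 1 ∧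
        negPart k 0 + negPart k 3 = posPart k 0 + posPart k 3 + 1 + q ∧
          θ = fun l => 1 + 2 * (-1) ^ l)) :
    ∃ C : (Fin m → ℂ) → ℂ,
      (∀ x ∈ regularPoints k m, HasOrder (fun ζ => tnk n k ζ x) (leadingExponent n k m) (C x)) ∧
      (∃ x ∈ regularPoints k m, C x ≠ 0) ∧
      ∃ c : ℂ, c ≠ 0 ∧ ∀ x ∈ regularPoints k m, Function.Injective x →
          (∀ j, x j ≠ 0 ∧ x j ≠ 1) → C x = c * (1 / delta x *
        (∏ j, x j ^ (N - 1 + e₀ - (posPart k 1 + posPart k 2) - 2 * (negPart k 0 + negPart k 3) : ℤ) /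
          ((1 - x j) ^ (posPart k 0 + posPart k 3 + 1 - e₀ : ℤ) * (1 - 2 * x j) ^ (2 * negPart k 2))) *
        ∑ l : Fin m → Fin (2 * M + 1),
      delta (fun j => ((l j : ℕ) : ℂ)) *
        ∏ j, (((2 * M).choose (l j) : ℂ) * (1 - 2 * x j) ^ (l j : ℕ) * θ (l j) *
          ∏ μ ∈ indexSetJ (2 * M) (posPart k 2) (posPart k 1) (negPart k 2) (negPart k 1),
            (((l j : ℕ) : ℂ) - (μ : ℂ)))) := by
  have h := detAsymptotics_regimeA (rowEquiv hN) hM hc hd hcard hθ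
  have h2 := exists_leadingCoeff (F := fun x => 1 / delta x *
        (∏ j, x j ^ (N - 1 + e₀ - (posPart k 1 + posPart k 2) - 2 * (negPart k 0 + negPart k 3) : ℤ) /
          ((1 - x j) ^ (posPart k 0 + posPart k 3 + 1 - e₀ : ℤ) * (1 - 2 * x j) ^ (2 * negPart k 2))) *
        ∑ l : Fin m → Fin (2 * M + 1),
      delta (fun j => ((l j : ℕ) : ℂ)) *
        ∏ j, (((2 * M).choose (l j) : ℂ) * (1 - 2 * x j) ^ (l j : ℕ) * θ (l j) *
          ∏ μ ∈ indexSetJ (2 * M) (posPart k 2) (posPart k 1) (negPart k 2) (negPart k 1),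
            (((l j : ℕ) : ℂ) - (μ : ℂ)))) (c := (2 ^ (N - 1) * 4 ^ e₀ / 2) ^ m) hN hN' one_ne_zero
    (U := fun _ => 1) (fun _ => Matrix.det_one) (by simp [Matrix.one_apply])
    (by simp [Matrix.one_apply]) h (exponent_regimeA hN hN' hA)
    (pow_ne_zero _ (div_ne_zero (mul_ne_zero (pow_ne_zero _ two_ne_zero)
      (pow_ne_zero _ (by norm_num))) two_ne_zero)) (fun x _ _ hx => ?_)
  · obtain ⟨C, hC, hC', c, hc0, hCF, -⟩ := h2
    exact ⟨C, hC, hC', c, hc0, hCF⟩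
  simp only [regimeAFun]
  rw [det_sum_pow (M := 2 * M) (fun i => (2 * x i) ^ (N - 1) * (1 - (1 - 2 * x i) ^ 2) ^ e₀ /
    (2 * (1 - x i))) (fun i l => ((2 * M).choose l : ℂ) * (1 - 2 * x i) ^ l * θ l *
      ∏ μ ∈ indexSetJ (2 * M) (posPart k 2) (posPart k 1) (negPart k 2) (negPart k 1),
        ((l : ℂ) - μ)), Matrix.det_vandermonde, poleFactor]
  refine prod_quotient _ _ fun i => ?_
  have hNpos : 1 ≤ N := by
    have := i.2
    omega
  have h0 := (hx i).1
  have h1 : 1 - x i ≠ 0 := sub_ne_zero.2 (hx i).2.symm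
  rw [zpow_eq_div h0 (p := N - 1 + e₀)
    (q := posPart k 1 + posPart k 2 + 2 * (negPart k 0 + negPart k 3)) (by push_cast [hNpos]; ring),
    zpow_eq_div h1 (p := posPart k 0 + posPart k 3 + 1) (q := e₀) (by push_cast; ring),
    show 1 - (1 - 2 * x i) ^ 2 = 4 * (x i * (1 - x i)) by ring]
  simp only [mul_pow, pow_add, pow_one]
  generalize (1 - 2 * x i) ^ (2 * negPart k 2) = Q
  field_simp

end RegimeA

section

variable {n : ℤ} {k : Fin 4 → ℤ} {m : ℕ}

theorem exists_leadingCoeff_formA₁ (hm : (m : ℤ) = 2 * n - ∑ i, k i) (hA : RegimeA k m)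
    (h03 : 0 ≤ k 0 + k 3 + 1) :
    ∃ C : (Fin m → ℂ) → ℂ,
      (∀ x ∈ regularPoints k m, HasOrder (fun ζ => tnk n k ζ x) (leadingExponent n k m) (C x)) ∧
      (∃ x ∈ regularPoints k m, C x ≠ 0) ∧
      ∃ c : ℂ, c ≠ 0 ∧ ∀ x ∈ regularPoints k m, Function.Injective x →
          (∀ j, x j ≠ 0 ∧ x j ≠ 1) → C x = c * formA₁ n k x := by
  obtain ⟨N, hN, hN'⟩ := exists_card hm
  have hN₁ := hN
  have hN₂ := hN'
  rw [Fin.sum_univ_four] at hN₂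
  rw [Fin.sum_univ_four, Fin.sum_univ_four] at hN₁
  have e0 := eq_posPart_sub_negPart k 0
  have e1 := eq_posPart_sub_negPart k 1
  have e2 := eq_posPart_sub_negPart k 2
  have e3 := eq_posPart_sub_negPart k 3
  have hA' := hA
  unfold RegimeA at hA'
  rw [abs_of_nonneg h03, abs_le] at hA'
  obtain ⟨C, hC, hC', c, hc, hF⟩ := exists_leadingCoeff_regimeA
    (q := posPart k 0 + posPart k 3 + 1 - (negPart k 0 + negPart k 3))
    (M := N - (negPart k 0 + negPart k 3)) hN hN' hA (by omega) (by omega) (by omega) (by omega)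
    (Or.inl ⟨rfl, by omega, rfl⟩)
  refine ⟨C, hC, hC', c, hc, fun x hx hxi hx01 => ?_⟩
  have hM : upperA₁ n k = 2 * (N - (negPart k 0 + negPart k 3)) := by
    unfold upperA₁
    omega
  rw [hF x hx hxi hx01, formA₁, hM]
  simp only [mul_one]
  congr 5 with j
  rw [show (N - 1 + (negPart k 0 + negPart k 3 : ℕ) - (posPart k 1 + posPart k 2) -
      2 * (negPart k 0 + negPart k 3) : ℤ) = n - k 1 - k 2 - 1 by push_cast; omega,
    show (posPart k 0 + posPart k 3 + 1 - (negPart k 0 + negPart k 3 : ℕ) : ℤ) = k 0 + k 3 + 1 by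
      push_cast; omega]

theorem exists_leadingCoeff_formA₂ (hm : (m : ℤ) = 2 * n - ∑ i, k i) (hA : RegimeA k m)
    (h03 : k 0 + k 3 + 1 ≤ 0) :
    ∃ C : (Fin m → ℂ) → ℂ,
      (∀ x ∈ regularPoints k m, HasOrder (fun ζ => tnk n k ζ x) (leadingExponent n k m) (C x)) ∧
      (∃ x ∈ regularPoints k m, C x ≠ 0) ∧
      ∃ c : ℂ, c ≠ 0 ∧ ∀ x ∈ regularPoints k m, Function.Injective x →
          (∀ j, x j ≠ 0 ∧ x j ≠ 1) → C x = c * formA₂ n k x := by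
  obtain ⟨N, hN, hN'⟩ := exists_card hm
  have hN₁ := hN
  have hN₂ := hN'
  rw [Fin.sum_univ_four] at hN₂
  rw [Fin.sum_univ_four, Fin.sum_univ_four] at hN₁
  have e0 := eq_posPart_sub_negPart k 0
  have e1 := eq_posPart_sub_negPart k 1
  have e2 := eq_posPart_sub_negPart k 2
  have e3 := eq_posPart_sub_negPart k 3
  have hA' := hA
  unfold RegimeA at hA'
  rw [abs_of_nonpos h03, abs_le] at hA'
  obtain ⟨C, hC, hC', c, hc, hF⟩ := exists_leadingCoeff_regimeA
    (q := negPart k 0 + negPart k 3 - (posPart k 0 + posPart k 3 + 1))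
    (M := N - (posPart k 0 + posPart k 3 + 1)) hN hN' hA (by omega) (by omega) (by omega)
    (by omega) (Or.inr ⟨rfl, by omega, rfl⟩)
  refine ⟨C, hC, hC', c, hc, fun x hx hxi hx01 => ?_⟩
  have hM : upperA₂ n k = 2 * (N - (posPart k 0 + posPart k 3 + 1)) := by
    unfold upperA₂
    omega
  rw [hF x hx hxi hx01, formA₂, hM]
  congr 5 with j
  congr 1
  · congr 1
    push_cast
    omega
  · rw [show (posPart k 0 + posPart k 3 + 1 - (posPart k 0 + posPart k 3 + 1 : ℕ) : ℤ) = 0 by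
      push_cast; ring, zpow_zero, one_mul]

end

/-! ### The leading coefficient in regimes B and C -/

lemma two_mul_sum_min (n : ℕ) {q : ℤ} (h0 : -1 ≤ q) (h : q ≤ n) :
    2 * ∑ i ∈ Finset.range n, min (i : ℤ) q = q * (q - 1) + 2 * q * (n - q) := by
  induction n with
  | zero =>
    have : q = -1 ∨ q = 0 := by push_cast at h; omega
    rcases this with rfl | rfl <;> simp
  | succ n ih =>
    push_cast at h
    rcases h.lt_or_eq with h | h
    · rw [Finset.sum_range_succ, mul_add, ih (by omega), min_eq_right (by omega)]
      push_cast
      ring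
    · have h2 : ∀ i ∈ Finset.range (n + 1), min (i : ℤ) q = i := fun i hi =>
        min_eq_left (by have := Finset.mem_range.1 hi; omega)
      rw [Finset.sum_congr rfl h2, sum_range_eq_choose_two, two_mul_choose_two, h]
      push_cast
      ring

lemma two_mul_sum_min_sub (S : ℕ) {r q : ℤ} (h : q ≤ r) (hT : -1 ≤ S - r + q) :
    2 * ∑ l ∈ Finset.range S, min (r - 1 - l) q =
      2 * (r - q) * q + 2 * (S - r + q) * (q - 1) - (S - r + q) * (S - r + q - 1) := by
  induction S with
  | zero =>
    have : r = q ∨ r = q + 1 := by push_cast at hT; omega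
    rcases this with rfl | rfl
    · simp
    · push_cast
      simp
      ring
  | succ S ih =>
    push_cast at hT
    by_cases h1 : -1 ≤ S - r + q
    · rw [Finset.sum_range_succ, mul_add, ih h1]
      rcases h1.lt_or_eq with h2 | h2
      · rw [min_eq_left (by omega)]
        push_cast
        ring
      · rw [min_eq_right (by omega)]
        obtain rfl : r = S + q + 1 := by omega
        push_cast
        ring
    · obtain rfl : r = S + q + 2 := by omega
      have h2 : ∀ l ∈ Finset.range (S + 1), min ((S : ℤ) + q + 2 - 1 - l) q = q := fun l hl =>
        min_eq_right (by have := Finset.mem_range.1 hl; omega)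
      rw [Finset.sum_congr rfl h2, Finset.sum_const, Finset.card_range, nsmul_eq_mul]
      push_cast
      ring

/-- The sum of the row and column weights, less the orders of the Vandermonde factors and of the
denominator, is the exponent `L` in regime C. -/
lemma exponent_regimeC {n : ℤ} {k : Fin 4 → ℤ} {m N P : ℕ}
    (hm : (m : ℤ) = 2 * n - ∑ i, k i)
    (hN' : (N : ℤ) = n + ∑ i, (negPart k i : ℤ)) (hC : RegimeC k m)
    (hP : N = P + m + (negPart k 1 + negPart k 2)) (hc : posPart k 0 + posPart k 3 ≤ P)
    (hd : negPart k 0 + negPart k 3 ≤ P + 1)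
    (hS : posPart k 1 + posPart k 2 + (posPart k 0 + posPart k 3 + (negPart k 0 + negPart k 3)) =
      N + P) :
    (m * (1 - P) + ∑ l ∈ Finset.range (posPart k 1 + posPart k 2),
          ((2 * N - 2 : ℤ) + -(min ((N : ℤ) - 1 - l) P - 1)) + (negPart k 0 + negPart k 3) +
        ∑ _l ∈ Finset.range (negPart k 1 + negPart k 2), ((2 * N : ℤ) + (1 - P)) +
        (∑ i ∈ Finset.range N, (min (i : ℤ) P - 1) +
          ∑ i ∈ Finset.range N, min (i : ℤ) (P - 1)) : ℤ) -
      vandermondeOrder (posPart k) (negPart k) - denomOrder m (posPart k) (negPart k) =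
    leadingExponent n k m := by
  rw [leadingExponent_of_regimeC hm hC, eq_posPart_sub_negPart k 1, eq_posPart_sub_negPart k 2]
  have h1 := two_mul_choose_two (posPart k 1 + posPart k 2)
  have h2 := two_mul_choose_two (negPart k 1 + negPart k 2)
  have h3 := two_mul_choose_two (posPart k 0 + posPart k 3)
  have h4 := two_mul_choose_two (negPart k 0 + negPart k 3)
  have h5 := two_mul_sum_min N (q := P) (by omega) (by omega)
  have h6 := two_mul_sum_min N (q := P - 1) (by omega) (by omega)
  have h7 := two_mul_sum_min_sub (posPart k 1 + posPart k 2) (r := N) (q := P) (by omega)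
    (by omega)
  rw [Fin.sum_univ_four] at hN'
  simp only [vandermondeOrder, denomOrder, Finset.sum_add_distrib, Finset.sum_sub_distrib,
    Finset.sum_neg_distrib, Finset.sum_const, Finset.card_range, nsmul_eq_mul]
  zify at hS hP
  push_cast at h1 h2 h3 h4 h7 ⊢
  refine mul_left_cancel₀ (two_ne_zero (α := ℤ)) ?_
  generalize (posPart k 0 : ℤ) = c0 at *
  generalize (posPart k 1 : ℤ) = c1 at *
  generalize (negPart k 0 : ℤ) = d0 at *
  generalize (N : ℤ) = N' at *
  generalize (m : ℤ) = m' at *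
  obtain rfl : m' = N' - P - (negPart k 1 + negPart k 2) := by linear_combination -hP
  obtain rfl : c1 = N' + P - (c0 + posPart k 3 + (d0 + negPart k 3)) - posPart k 2 := by
    linear_combination hS
  obtain rfl : n = N' - (d0 + negPart k 1 + negPart k 2 + negPart k 3) := by
    linear_combination -hN'
  linear_combination h5 + h6 - h7 - 2 * h1 - 2 * h2 - h3 - h4

/-- The sum of the row and column weights, less the orders of the Vandermonde factors and of the
denominator, is the exponent `L` in regime B. -/
lemma exponent_regimeB {n : ℤ} {k : Fin 4 → ℤ} {m N P : ℕ}
    (hm : (m : ℤ) = 2 * n - ∑ i, k i)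
    (hN' : (N : ℤ) = n + ∑ i, (negPart k i : ℤ)) (hB : RegimeB k m)
    (hP : N = P + m + (posPart k 1 + posPart k 2) + 1) (hc : posPart k 0 + posPart k 3 ≤ P)
    (hd : negPart k 0 + negPart k 3 ≤ P + 1)
    (hS : negPart k 1 + negPart k 2 + (posPart k 0 + posPart k 3 + (negPart k 0 + negPart k 3)) =
      N + 1 + P) :
    (m * (1 - P) + ∑ _l ∈ Finset.range (posPart k 1 + posPart k 2), ((2 * N - 2 : ℤ) + (1 - P)) +
        (negPart k 0 + negPart k 3) +
        ∑ l ∈ Finset.range (negPart k 1 + negPart k 2),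
          ((2 * N : ℤ) + -(min ((N : ℤ) - l) P - 1)) +
        (∑ i ∈ Finset.range (N + 1), (min (i : ℤ) P - 1) +
          ∑ i ∈ Finset.range (N - 1), min (i : ℤ) (P - 1)) : ℤ) -
      vandermondeOrder (posPart k) (negPart k) - denomOrder m (posPart k) (negPart k) =
    leadingExponent n k m := by
  rw [leadingExponent_of_regimeB hm hB, eq_posPart_sub_negPart k 0, eq_posPart_sub_negPart k 1,
    eq_posPart_sub_negPart k 2, eq_posPart_sub_negPart k 3]
  have h1 := two_mul_choose_two (posPart k 1 + posPart k 2)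
  have h2 := two_mul_choose_two (negPart k 1 + negPart k 2)
  have h3 := two_mul_choose_two (posPart k 0 + posPart k 3)
  have h4 := two_mul_choose_two (negPart k 0 + negPart k 3)
  have h5 := two_mul_sum_min (N + 1) (q := P) (by omega) (by omega)
  have h6 := two_mul_sum_min (N - 1) (q := P - 1) (by omega) (by omega)
  have h7 := two_mul_sum_min_sub (negPart k 1 + negPart k 2) (r := N + 1) (q := P) (by omega)
    (by omega)
  rw [Fin.sum_univ_four] at hN'
  simp only [vandermondeOrder, denomOrder, Finset.sum_add_distrib, Finset.sum_sub_distrib,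
    Finset.sum_neg_distrib, Finset.sum_const, Finset.card_range, nsmul_eq_mul]
  rw [Nat.cast_sub (by omega : 1 ≤ N)] at h6
  simp only [add_sub_cancel_right] at h7
  zify at hS hP
  push_cast at h1 h2 h3 h4 h5 h6 h7 ⊢
  refine mul_left_cancel₀ (two_ne_zero (α := ℤ)) ?_
  generalize (posPart k 0 : ℤ) = c0 at *
  generalize (posPart k 1 : ℤ) = c1 at *
  generalize (negPart k 0 : ℤ) = d0 at *
  generalize (negPart k 1 : ℤ) = d1 at *
  generalize (m : ℤ) = m' at *
  obtain rfl : m' = N - P - 1 - (c1 + posPart k 2) := by linear_combination -hP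
  obtain rfl : d1 = N + 1 + P - (c0 + posPart k 3 + (d0 + negPart k 3)) - negPart k 2 := by
    linear_combination hS
  obtain rfl : n = N - (d0 + (N + 1 + P - (c0 + posPart k 3 + (d0 + negPart k 3)) - negPart k 2)
    + negPart k 2 + negPart k 3) := by
    linear_combination -hN'
  linear_combination h5 + h6 - h7 - 2 * h1 - 2 * h2 - h3 - h4

lemma sCoord_ne_zero {x : ℂ} (h0 : x ≠ 0) (h1 : x ≠ 1) : sCoord x ≠ 0 :=
  one_div_ne_zero (mul_ne_zero (mul_ne_zero two_ne_zero h0) (sub_ne_zero.2 h1.symm))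

lemma sCoord_sub_two {x : ℂ} (h0 : x ≠ 0) (h1 : x ≠ 1) :
    sCoord x - 2 = (1 - 2 * x) ^ 2 * sCoord x := by
  have h1' : 1 - x ≠ 0 := sub_ne_zero.2 h1.symm
  rw [sCoord]
  field_simp
  ring

lemma sCoord_sub_sCoord {x y : ℂ} (hx0 : x ≠ 0) (hx1 : x ≠ 1) (hy0 : y ≠ 0) (hy1 : y ≠ 1) :
    sCoord y - sCoord x = 2 * (y - x) * (x + y - 1) * (sCoord x * sCoord y) := by
  have hx1' : 1 - x ≠ 0 := sub_ne_zero.2 hx1.symm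
  have hy1' : 1 - y ≠ 0 := sub_ne_zero.2 hy1.symm
  rw [sCoord, sCoord]
  field_simp
  ring

lemma det_vandermonde_sCoord {m : ℕ} {x : Fin m → ℂ} (hx : ∀ j, x j ≠ 0 ∧ x j ≠ 1) :
    (Matrix.vandermonde fun i => sCoord (x i)).det =
      (∏ i : Fin m, ∏ _j ∈ Finset.Ioi i, (2 : ℂ)) * (Matrix.vandermonde x).det *
        (∏ i, ∏ j ∈ Finset.Ioi i, (x i + x j - 1)) * ∏ i, sCoord (x i) ^ (m - 1) := by
  have h : ∏ i, ∏ j ∈ Finset.Ioi i, sCoord (x i) * sCoord (x j) = ∏ i, sCoord (x i) ^ (m - 1) := by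
    rw [Finset.prod_prod_Ioi_mul_eq_prod_prod_off_diag (fun _ i => sCoord (x i))]
    refine Finset.prod_congr rfl fun i _ => ?_
    rw [Finset.prod_const, Finset.card_compl, Fintype.card_fin, Finset.card_singleton]
  rw [← h, Matrix.det_vandermonde, Matrix.det_vandermonde]
  simp only [← Finset.prod_mul_distrib]
  exact Finset.prod_congr rfl fun i _ => Finset.prod_congr rfl fun j _ =>
    sCoord_sub_sCoord (hx i).1 (hx i).2 (hx j).1 (hx j).2

/-- The determinant of the limiting functions in regimes B and C: in the coordinate `s` it is a
Vandermonde determinant. -/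
lemma det_glueFun {m nB o1 o2 P : ℕ} {ρ : ℂ → ℂ} {x : Fin m → ℂ} (hP : nB = P + m + (o1 + o2))
    (hx : ∀ j, x j ≠ 0 ∧ x j ≠ 1) :
    (Matrix.of fun i j : Fin m => glueFun ρ nB o1 o2 j (x i)).det =
      (∏ i, ρ (x i) * (2 * x i * (1 - x i)) ^ P * (1 - 2 * x i) ^ (2 * o2)) *
        ((∏ i : Fin m, ∏ _j ∈ Finset.Ioi i, (2 : ℂ)) * (Matrix.vandermonde x).det *
        ∏ i, ∏ j ∈ Finset.Ioi i, (x i + x j - 1)) := by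
  have h1 : (Matrix.of fun i j : Fin m => glueFun ρ nB o1 o2 j (x i)) =
      Matrix.of fun i j => (ρ (x i) * (sCoord (x i) ^ (1 - nB + o1 : ℤ) * (sCoord (x i) - 2) ^ o2)) *
        (Matrix.vandermonde fun i => sCoord (x i)) i j := by
    ext i j
    simp only [Matrix.of_apply, glueFun, Matrix.vandermonde_apply]
    ring
  have h2 : ∀ i, ρ (x i) * (2 * x i * (1 - x i)) ^ P * (1 - 2 * x i) ^ (2 * o2) =
      ρ (x i) * (sCoord (x i) ^ (1 - nB + o1 : ℤ) * (sCoord (x i) - 2) ^ o2) *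
        sCoord (x i) ^ (m - 1) := by
    intro i
    have hs := sCoord_ne_zero (hx i).1 (hx i).2
    have hm : 1 ≤ m := by have := i.2; omega
    have h3 : (2 * x i * (1 - x i)) = (sCoord (x i))⁻¹ := by rw [sCoord, one_div, inv_inv]
    have h4 : (sCoord (x i))⁻¹ ^ P =
        sCoord (x i) ^ (1 - nB + o1 : ℤ) * sCoord (x i) ^ o2 * sCoord (x i) ^ (m - 1) := by
      rw [← zpow_natCast, ← zpow_natCast, ← zpow_natCast, inv_zpow', ← zpow_add₀ hs,
        ← zpow_add₀ hs]
      congr 1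
      push_cast [hP, hm]
      ring
    rw [sCoord_sub_two (hx i).1 (hx i).2, h3, h4, mul_pow, pow_mul]
    ring
  rw [h1, Matrix.det_mul_column, det_vandermonde_sCoord hx, Finset.prod_congr rfl fun i _ => h2 i,
    Finset.prod_mul_distrib (g := fun i => sCoord (x i) ^ (m - 1))]
  ring

section

variable {n : ℤ} {k : Fin 4 → ℤ} {m : ℕ}

lemma continuous_shift (x : Fin m → ℂ) (j : Fin m) : Continuous fun t => shift x t j := by
  unfold shift
  fun_prop

lemma continuousAt_prod_add_sub_one (x : Fin m → ℂ) :
    ContinuousAt (fun t => ∏ i, ∏ j ∈ Finset.Ioi i, (shift x t i + shift x t j - 1)) 0 := by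
  unfold shift
  fun_prop

lemma one_sub_two_mul_ne_zero {y : ℂ} (h : y ≠ 1 / 2) : 1 - 2 * y ≠ 0 :=
  fun h0 => h (by linear_combination -h0 / 2)

lemma continuousAt_formC_shift (hm : (m : ℤ) = 2 * n - ∑ i, k i) (hC : RegimeC k m)
    {x : Fin m → ℂ} (hx : x ∈ regularPoints k m) :
    ContinuousAt (fun t => formC n k (shift x t)) 0 := by
  unfold formC
  rw [Fin.sum_univ_four] at hm
  unfold RegimeC at hC
  have h1 := le_abs_self (k 0 + k 3 + 1)
  refine ContinuousAt.mul (tendsto_finsetProd _ fun j _ => ContinuousAt.mul ?_ ?_)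
    (continuousAt_prod_add_sub_one x)
  · refine (continuous_shift x j).continuousAt.zpow₀ _ ?_
    rw [shift_zero]
    by_cases h : k 0 < 0 ∨ k 3 < 0
    · exact Or.inl ((hx j).1 h)
    · exact Or.inr (by omega)
  · exact (continuous_const.sub (continuous_shift x j)).continuousAt.zpow₀ _ (Or.inr (by omega))

lemma continuousAt_formB_shift (hm : (m : ℤ) = 2 * n - ∑ i, k i) (hB : RegimeB k m)
    {x : Fin m → ℂ} (hx : x ∈ regularPoints k m) :
    ContinuousAt (fun t => formB n k (shift x t)) 0 := by
  unfold formB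
  rw [Fin.sum_univ_four] at hm
  unfold RegimeB at hB
  have h1 := le_abs_self (k 0 + k 3 + 1)
  simp only [div_eq_mul_inv, ← zpow_neg]
  refine ContinuousAt.mul (tendsto_finsetProd _ fun j _ => ContinuousAt.mul
    (ContinuousAt.mul ?_ ?_) ?_) (continuousAt_prod_add_sub_one x)
  · refine (continuous_shift x j).continuousAt.zpow₀ _ ?_
    rw [shift_zero]
    by_cases h : k 0 < 0 ∨ k 3 < 0
    · exact Or.inl ((hx j).1 h)
    · exact Or.inr (by omega)
  · refine (continuous_const.sub (continuous_const.mul (continuous_shift x j))).continuousAt.zpow₀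
      _ ?_
    simp only [Pi.sub_apply, Pi.mul_apply, shift_zero]
    by_cases h : k 2 < 0
    · exact Or.inl (one_sub_two_mul_ne_zero ((hx j).2 h))
    · exact Or.inr (by omega)
  · exact (continuous_const.sub (continuous_shift x j)).continuousAt.zpow₀ _ (Or.inr (by omega))

/-- In regime C the number `P` is `N` less the number of free variables and of the variables of the
small cluster near `x = 0`. -/
theorem exists_leadingCoeff_formC (hm : (m : ℤ) = 2 * n - ∑ i, k i) (hC : RegimeC k m) :
    ∃ C : (Fin m → ℂ) → ℂ,
      (∀ x ∈ regularPoints k m, HasOrder (fun ζ => tnk n k ζ x) (leadingExponent n k m) (C x)) ∧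
      (∃ x ∈ regularPoints k m, C x ≠ 0) ∧
      ∃ c : ℂ, c ≠ 0 ∧ ∀ x ∈ regularPoints k m, C x = c * formC n k x := by
  obtain ⟨N, hN, hN'⟩ := exists_card hm
  have hN₁ := hN
  have hN₂ := hN'
  rw [Fin.sum_univ_four] at hN₂
  rw [Fin.sum_univ_four, Fin.sum_univ_four] at hN₁
  have e0 := eq_posPart_sub_negPart k 0
  have e1 := eq_posPart_sub_negPart k 1
  have e2 := eq_posPart_sub_negPart k 2
  have e3 := eq_posPart_sub_negPart k 3
  have hC' := hC
  unfold RegimeC at hC'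
  have a1 := le_abs_self (k 0 + k 3 + 1)
  have a2 := neg_le_abs (k 0 + k 3 + 1)
  obtain ⟨P, hP⟩ : ∃ P, N = P + m + (negPart k 1 + negPart k 2) :=
    ⟨N - m - (negPart k 1 + negPart k 2), by omega⟩
  have hc : posPart k 0 + posPart k 3 ≤ P := by omega
  have hd : negPart k 0 + negPart k 3 ≤ P + 1 := by omega
  have hS : posPart k 1 + posPart k 2 + (posPart k 0 + posPart k 3 +
    (negPart k 0 + negPart k 3)) = N + P := by omega
  have h2 := exists_leadingCoeff (F := formC n k) (c := (2 ^ (N - 1 + P)) ^ m *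
    ∏ i : Fin m, ∏ _j ∈ Finset.Ioi i, (2 : ℂ)) hN hN' one_ne_zero
    (U := fun _ => 1) (fun _ => Matrix.det_one) (by simp [Matrix.one_apply])
    (by simp [Matrix.one_apply]) (detAsymptotics_regimeC (rowEquiv hN) hP hc hd hS)
    (exponent_regimeC hm hN' hC hP hc hd hS)
    (mul_ne_zero (pow_ne_zero _ (pow_ne_zero _ two_ne_zero)) (Finset.prod_ne_zero_iff.2 fun _ _ =>
      Finset.prod_ne_zero_iff.2 fun _ _ => two_ne_zero)) (fun x hx hxi hx01 => ?_)
  · obtain ⟨C, hC₁, hC₂, c, hc0, -, hF⟩ := h2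
    exact ⟨C, hC₁, hC₂, c, hc0, hF fun x hx => continuousAt_formC_shift hm hC hx⟩
  have hV := Matrix.det_vandermonde_ne_zero_iff.2 hxi
  rw [det_glueFun hP hx01, poleFactor, prod_quotient (K := 2 ^ (N - 1 + P))
    (w := fun j => x j ^ (k 0 + k 3) * (1 - x j) ^ (k 1 + k 2 - n)), formC]
  · field_simp
  intro i
  have h0 := (hx01 i).1
  have h1 : 1 - x i ≠ 0 := sub_ne_zero.2 (hx01 i).2.symm
  have hQ : (1 - 2 * x i) ^ (2 * negPart k 2) ≠ 0 := by
    by_cases h : k 2 < 0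
    · exact pow_ne_zero _ (one_sub_two_mul_ne_zero ((hx i).2 h))
    · rw [show negPart k 2 = 0 by unfold negPart; omega, mul_zero, pow_zero]
      exact one_ne_zero
  have hNpos : N = N - 1 + 1 := by
    have := i.2
    omega
  rw [zpow_eq_div h0 (z := k 0 + k 3) (p := N - 1 + 1 + P)
    (q := posPart k 1 + posPart k 2 + 2 * (negPart k 0 + negPart k 3)) (by omega),
    zpow_eq_div h1 (z := k 1 + k 2 - n) (p := P) (q := posPart k 0 + posPart k 3) (by omega)]
  simp only [mul_pow, pow_add, pow_one]
  generalize (1 - 2 * x i) ^ (2 * negPart k 2) = Q at *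
  field_simp

/-- As in regime C, with the glued columns; `exists_det_gluingMatrix` shows that the gluing does not
change the order of the determinant. -/
theorem exists_leadingCoeff_formB (hm : (m : ℤ) = 2 * n - ∑ i, k i) (hB : RegimeB k m) :
    ∃ C : (Fin m → ℂ) → ℂ,
      (∀ x ∈ regularPoints k m, HasOrder (fun ζ => tnk n k ζ x) (leadingExponent n k m) (C x)) ∧
      (∃ x ∈ regularPoints k m, C x ≠ 0) ∧
      ∃ c : ℂ, c ≠ 0 ∧ ∀ x ∈ regularPoints k m, C x = c * formB n k x := by
  obtain ⟨N, hN, hN'⟩ := exists_card hm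
  have hN₁ := hN
  have hN₂ := hN'
  rw [Fin.sum_univ_four] at hN₂
  rw [Fin.sum_univ_four, Fin.sum_univ_four] at hN₁
  have e0 := eq_posPart_sub_negPart k 0
  have e1 := eq_posPart_sub_negPart k 1
  have e2 := eq_posPart_sub_negPart k 2
  have e3 := eq_posPart_sub_negPart k 3
  have hB' := hB
  unfold RegimeB at hB'
  have a1 := le_abs_self (k 0 + k 3 + 1)
  have a2 := neg_le_abs (k 0 + k 3 + 1)
  obtain ⟨P, hP⟩ : ∃ P, N = P + m + (posPart k 1 + posPart k 2) + 1 :=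
    ⟨N - m - (posPart k 1 + posPart k 2) - 1, by omega⟩
  have hc : posPart k 0 + posPart k 3 ≤ P := by omega
  have hd : negPart k 0 + negPart k 3 ≤ P + 1 := by omega
  have hS : negPart k 1 + negPart k 2 + (posPart k 0 + posPart k 3 +
    (negPart k 0 + negPart k 3)) = N + 1 + P := by omega
  obtain ⟨u, hu, hU⟩ := exists_det_gluingMatrix N
  have h2 := exists_leadingCoeff (F := formB n k) (c := (1 / 3 * 2 ^ (N - 1 + P)) ^ m *
    ∏ i : Fin m, ∏ _j ∈ Finset.Ioi i, (2 : ℂ)) hN hN' hu hU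
    (fun ζ j => gluedFamily_eq_sum ζ (basisPoly N ζ) j)
    (fun ζ j => gluedFamily_eq_sum ζ (sigmaBasisPoly N ζ) j)
    (detAsymptotics_regimeB (rowEquiv hN) hP hc hd hS)
    (exponent_regimeB hm hN' hB hP hc hd hS)
    (mul_ne_zero (pow_ne_zero _ (mul_ne_zero (by norm_num) (pow_ne_zero _ two_ne_zero)))
      (Finset.prod_ne_zero_iff.2 fun _ _ =>
      Finset.prod_ne_zero_iff.2 fun _ _ => two_ne_zero)) (fun x hx hxi hx01 => ?_)
  · obtain ⟨C, hC₁, hC₂, c, hc0, -, hF⟩ := h2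
    exact ⟨C, hC₁, hC₂, c, hc0, hF fun x hx => continuousAt_formB_shift hm hB hx⟩
  have hV := Matrix.det_vandermonde_ne_zero_iff.2 hxi
  rw [det_glueFun (P := P) (by omega) hx01, poleFactor,
    prod_quotient (K := 1 / 3 * 2 ^ (N - 1 + P)) (w := fun j => x j ^ (k 0 + k 3 - k 1 - k 2 - 1) *
      (1 - 2 * x j) ^ (2 * k 2 + 1) / (1 - x j) ^ (n + 1)), formB]
  · field_simp
  intro i
  have h0 := (hx01 i).1
  have h1 : 1 - x i ≠ 0 := sub_ne_zero.2 (hx01 i).2.symm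
  -- The exponent `2 k_2 + 1` is negative only where `x_i ≠ 1/2`.
  have hQ : (1 - 2 * x i) ^ (2 * k 2 + 1) =
      (1 - 2 * x i) ^ (2 * posPart k 2) * (1 - 2 * x i) / (1 - 2 * x i) ^ (2 * negPart k 2) := by
    rw [← pow_succ]
    by_cases h : k 2 < 0
    · exact zpow_eq_div (one_sub_two_mul_ne_zero ((hx i).2 h)) (by push_cast; omega)
    · rw [show negPart k 2 = 0 by unfold negPart; omega, mul_zero, pow_zero, div_one,
        ← zpow_natCast]
      congr 1
      push_cast
      unfold posPart
      omega
  have hNpos : N = N - 1 + 1 := by omega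
  rw [hQ, zpow_eq_div h0 (z := k 0 + k 3 - k 1 - k 2 - 1) (p := N - 1 + 1 + P)
    (q := posPart k 1 + posPart k 2 + 2 * (negPart k 0 + negPart k 3)) (by omega),
    zpow_eq_div h1 (z := n + 1) (p := posPart k 0 + posPart k 3) (q := P) (by omega)]
  simp only [mul_pow, pow_add, pow_one]
  generalize (1 - 2 * x i) ^ (2 * negPart k 2) = Q
  generalize (1 - 2 * x i) ^ (2 * posPart k 2) = R
  by_cases hQ0 : Q = 0
  · simp [hQ0]
  field_simp
  ring

end

end HyperbolicCusp

end

theorem theorem4 (n : ℤ) (k : Fin 4 → ℤ) (m : ℕ) (hm : (m : ℤ) = 2 * n - ∑ i, k i) :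
    ∃ C : (Fin m → ℂ) → ℂ,
      (∀ x ∈ regularPoints k m,
        Tendsto (fun ζ : ℂ => tnk n k ζ x / ζ ^ leadingExponent n k m) (𝓝[≠] 0) (𝓝 (C x))) ∧
      (∃ x ∈ regularPoints k m, C x ≠ 0) ∧
      (RegimeA k m → 0 ≤ k 0 + k 3 + 1 →
        ∃ c : ℂ, c ≠ 0 ∧ ∀ x ∈ regularPoints k m, Function.Injective x →
          (∀ j, x j ≠ 0 ∧ x j ≠ 1) → C x = c * formA₁ n k x) ∧
      (RegimeA k m → k 0 + k 3 + 1 ≤ 0 →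
        ∃ c : ℂ, c ≠ 0 ∧ ∀ x ∈ regularPoints k m, Function.Injective x →
          (∀ j, x j ≠ 0 ∧ x j ≠ 1) → C x = c * formA₂ n k x) ∧
      (RegimeB k m → ∃ c : ℂ, c ≠ 0 ∧ ∀ x ∈ regularPoints k m, C x = c * formB n k x) ∧
      (RegimeC k m → ∃ c : ℂ, c ≠ 0 ∧ ∀ x ∈ regularPoints k m, C x = c * formC n k x) := by
  -- The limit at each regular point is unique, so that the limits found in different regimes agree.
  have key : ∀ {C D : (Fin m → ℂ) → ℂ},
      (∀ x ∈ regularPoints k m,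
        HasOrder (fun ζ => tnk n k ζ x) (leadingExponent n k m) (C x)) →
      (∀ x ∈ regularPoints k m,
        HasOrder (fun ζ => tnk n k ζ x) (leadingExponent n k m) (D x)) →
      ∀ x ∈ regularPoints k m, C x = D x :=
    fun hC hD x hx => tendsto_nhds_unique (hC x hx) (hD x hx)
  have hex : ∃ C : (Fin m → ℂ) → ℂ,
      (∀ x ∈ regularPoints k m,
        HasOrder (fun ζ => tnk n k ζ x) (leadingExponent n k m) (C x)) ∧
      ∃ x ∈ regularPoints k m, C x ≠ 0 := by
    by_cases hA : RegimeA k m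
    · rcases le_total 0 (k 0 + k 3 + 1) with h | h
      · obtain ⟨C, h1, h2, -⟩ := exists_leadingCoeff_formA₁ hm hA h
        exact ⟨C, h1, h2⟩
      · obtain ⟨C, h1, h2, -⟩ := exists_leadingCoeff_formA₂ hm hA h
        exact ⟨C, h1, h2⟩
    · rcases lt_abs.1 (not_le.1 hA) with h | h
      · obtain ⟨C, h1, h2, -⟩ := exists_leadingCoeff_formC hm h.le
        exact ⟨C, h1, h2⟩
      · obtain ⟨C, h1, h2, -⟩ := exists_leadingCoeff_formB hm (le_neg_of_le_neg h.le)
        exact ⟨C, h1, h2⟩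
  obtain ⟨C, hC, hne⟩ := hex
  refine ⟨C, hC, hne, fun hA h => ?_, fun hA h => ?_, fun hB => ?_, fun hC' => ?_⟩
  · obtain ⟨D, hD, -, c, hc, hF⟩ := exists_leadingCoeff_formA₁ hm hA h
    exact ⟨c, hc, fun x hx hxi hx01 => (key hC hD x hx).trans (hF x hx hxi hx01)⟩
  · obtain ⟨D, hD, -, c, hc, hF⟩ := exists_leadingCoeff_formA₂ hm hA h
    exact ⟨c, hc, fun x hx hxi hx01 => (key hC hD x hx).trans (hF x hx hxi hx01)⟩
  · obtain ⟨D, hD, -, c, hc, hF⟩ := exists_leadingCoeff_formB hm hB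
    exact ⟨c, hc, fun x hx => (key hC hD x hx).trans (hF x hx)⟩
  · obtain ⟨D, hD, -, c, hc, hF⟩ := exists_leadingCoeff_formC hm hC'
    exact ⟨c, hc, fun x hx => (key hC hD x hx).trans (hF x hx)⟩
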